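/- **Setting.** Let $d,m\ge 1$. Let $P=\{p_1,\dots,p_n\}\subset\mathbb R^d$ be points with weights $w_i\ge 0$, and let $S=\{s_1,\dots,s_m\}$ be nondegenerate, possibly overlapping, $d$-simplices in $\mathbb R^d$ with $\sum_i w_i=V:=\sum_j \mathrm{vol}(s_j)$. A transport plan $\tau$ consists of measurable densities $\tau_{i,j}:s_j\to[0,1]$ with $\sum_j\int_{s_j}\tau_{i,j}=w_i$ for all $i$ and $\sum_i\tau_{i,j}=1$ almost everywhere on $s_j$ for all $j$. Its cost is $\|\tau\|=\sum_{i,j}\int_{s_j}\tau_{i,j}(x)\,|p_i-x|\,dx$ with the Euclidean norm, and $\mathrm{EMD}$ is the infimum of $\|\tau\|$ over all transport plans. Let $\ell$ be the longest edge length of $S$, and let $\Delta=\ell/V^{1/d}$ be the longest edge length after scaling the total volume to one. A $(1+\delta)$-approximate plan between two finite weighted point sets of equal total weight is a transport plan between them of cost at most $1+\delta$ times the minimum. **Theorem.** (1) *(Approximation.)* Let $0<\delta\le\frac15$. Overlay a grid of half-open cubes of edge length $\ell$ (with any origin) and take the cubes that meet a simplex. Repeatedly divide a cell into its $2^d$ half-size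 cells, unless the cell lies wholly within distance $\delta V^{1/d}/(nm)^{1/d}$ of some point of $P$, or for every point of $P$ the ratio between the longest and shortest distance to the cell is at most $1+\delta$. Then the set $Q$ of final cells that meet a simplex is finite. Choose any point $t_q$ in each $q\in Q$, and give it as weight the total volume of the parts of simplices inside $q$. Let $\nu$ be any $(1+\delta)$-approximate (for example, an optimal) plan between $P$ and these points, and let $\tau$ spread the mass that $\nu$ sends to $t_q$ evenly over the parts of simplices inside $q$. Then $\tau$ is a transport plan between $P$ and $S$ and $\|\tau\|\le(1+21\delta)\,\mathrm{EMD}$. (2) *(Algorithm.)* There are a real-RAM program and an absolute constant $C>0$ such that the following holds for all $d,n,m,P,S$ as above and all $\delta>0$. Suppose we are given an algorithm that, for weighted point sets in $\mathbb R^d$ of equal total weight, with $k$ points in total, lists the transfers of a $(1+\delta)$-approximate plan in $f_\delta(k)$ time, where $f_\delta$ is nondecreasing and $f_\delta(k)\ge k$. Using it as a subroutine, the program, given $\delta$, $P$ and $S$, constructs a transport plan between $P$ and $S$ of cost at most $(1+21\delta)\,\mathrm{EMD}$ in time at most $$C\Big(6^d d^2 d^d m+f_\delta\big(\lceil C\,X\rceil\big)\Big),\qquad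 X=\frac{5^d\,d\,d^{d/2}\,nm}{\delta_0^{\,d}}\,\log\frac{(nm)^{1/d}\Delta}{\delta_0},\qquad \delta_0=\min(\delta,\tfrac15).$$ The real RAM takes unit time for each memory access, comparison, addition, subtraction, multiplication (on naturals and reals) and division (on reals); it has no roots, no rounding of reals and no division of naturals. The plan is output as a table of pieces (the part of a simplex inside a cube) and a list of transfers (point, piece, density), each giving a constant density from a point to a piece. -/

import Mathlib

open MeasureTheory

noncomputable section

namespace PointSimplex

/-- Euclidean `d`-space. -/
abbrev E (d : ℕ) : Type := EuclideanSpace ℝ (Fin d)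

/-- The half-open axis-parallel cube with lower corner `a` and edge length `s`. -/
def cube {d : ℕ} (a : E d) (s : ℝ) : Set (E d) := {x | ∀ c, a c ≤ x c ∧ x c < a c + s}

/-! ## Continuous transport problem: weighted points to simplices -/

/-- The solid simplex spanned by the vertices of `s`. -/
def solid {d : ℕ} (s : Affine.Simplex ℝ (E d) d) : Set (E d) := convexHull ℝ (Set.range s.points)

/-- `n` weighted points and `m` (possibly overlapping) nondegenerate `d`-simplices in `ℝ^d`, where
the total weight of the points equals the total volume of the simplices. -/
structure Input (d n m : ℕ) where
  pt : Fin n → E d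
  wt : Fin n → ℝ
  sx : Fin m → Affine.Simplex ℝ (E d) d
  wt_nonneg : ∀ i, 0 ≤ wt i
  balanced : ∑ i, wt i = ∑ j, volume.real (solid (sx j))

namespace Input

variable {d n m : ℕ} (I : Input d n m)

/-- Total volume of the simplices (the total mass). -/
def mass : ℝ := ∑ j, volume.real (solid (I.sx j))

/-- Longest edge of any simplex. -/
def longestEdge : ℝ :=
  ⨆ e : Fin m × Fin (d + 1) × Fin (d + 1), dist ((I.sx e.1).points e.2.1) ((I.sx e.1).points e.2.2)

/-- Longest edge after scaling space so that the total volume becomes one. -/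
def normEdge : ℝ := I.longestEdge / I.mass ^ (1 / (d : ℝ))

/-- `τ i j` is the density, on the `j`-th simplex, of the mass sent there by the `i`-th point. -/
structure IsPlan (τ : Fin n → Fin m → E d → ℝ) : Prop where
  measurable : ∀ i j, AEStronglyMeasurable (τ i j) (volume.restrict (solid (I.sx j)))
  mem_Icc : ∀ i j, ∀ᵐ x ∂volume.restrict (solid (I.sx j)), 0 ≤ τ i j x ∧ τ i j x ≤ 1
  point : ∀ i, ∑ j, ∫ x in solid (I.sx j), τ i j x = I.wt i
  simplex : ∀ j, ∀ᵐ x ∂volume.restrict (solid (I.sx j)), ∑ i, τ i j x = 1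

/-- Cost of a transport plan under the Euclidean metric. -/
def cost (τ : Fin n → Fin m → E d → ℝ) : ℝ :=
  ∑ i, ∑ j, ∫ x in solid (I.sx j), τ i j x * dist (I.pt i) x

/-- The earth mover's distance. -/
def emd : ℝ := sInf (I.cost '' {τ | I.IsPlan τ})

end Input

/-! ## Discrete transport problem -/

/-- Two weighted point sets, of `a` and `b` points. -/
structure Discrete (d a b : ℕ) where
  src : Fin a → E d
  srcWt : Fin a → ℝ
  tgt : Fin b → E d
  tgtWt : Fin b → ℝ

namespace Discrete

variable {d a b : ℕ} (D : Discrete d a b)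

/-- The weights are nonnegative and have equal totals. -/
def Valid : Prop :=
  (∀ i, 0 ≤ D.srcWt i) ∧ (∀ j, 0 ≤ D.tgtWt j) ∧ ∑ i, D.srcWt i = ∑ j, D.tgtWt j

/-- `ν i j` is the mass moved from source `i` to target `j`. -/
def IsPlan (ν : Fin a → Fin b → ℝ) : Prop :=
  (∀ i j, 0 ≤ ν i j) ∧ (∀ i, ∑ j, ν i j = D.srcWt i) ∧ (∀ j, ∑ i, ν i j = D.tgtWt j)

def cost (ν : Fin a → Fin b → ℝ) : ℝ := ∑ i, ∑ j, ν i j * dist (D.src i) (D.tgt j)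

/-- `ν` is a transport plan of cost at most `1 + δ` times the minimum cost. -/
def IsApprox (δ : ℝ) (ν : Fin a → Fin b → ℝ) : Prop :=
  D.IsPlan ν ∧ ∀ ν', D.IsPlan ν' → D.cost ν ≤ (1 + δ) * D.cost ν'

end Discrete

/-- The plan described by a list of transfers `(source, target, mass)`. -/
def listPlan {a b : ℕ} (L : List (Fin a × Fin b × ℝ)) (i : Fin a) (j : Fin b) : ℝ :=
  (L.map fun e => if e.1 = i ∧ e.2.1 = j then e.2.2 else 0).sum

/-- A procedure for discrete transport problems in `ℝ^d` that outputs a list of transfers. -/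
abbrev Solver (d : ℕ) : Type := ∀ a b : ℕ, Discrete d a b → List (Fin a × Fin b × ℝ)

/-- On every valid instance the solver returns a `(1 + δ)`-approximate plan. Within its time
bound `f k`, for `k` points in total, it can write at most `f k` transfers. -/
def Solver.Solves {d : ℕ} (A : Solver d) (δ : ℝ) (f : ℕ → ℕ) : Prop :=
  ∀ (a b : ℕ) (D : Discrete d a b), D.Valid →
    D.IsApprox δ (listPlan (A a b D)) ∧ (A a b D).length ≤ f (a + b)

/-! ## The subdivision and the transport plan built on it -/

namespace Input

variable {d n m : ℕ} (I : Input d n m)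

/-- The cell of index `z`, after `l` halvings, of the grid of size `longestEdge` with origin `o`. -/
def cell (o : E d) (q : ℕ × (Fin d → ℤ)) : Set (E d) :=
  cube (WithLp.toLp 2 fun c => o c + I.longestEdge / 2 ^ q.1 * q.2 c) (I.longestEdge / 2 ^ q.1)

/-- The cell meets some simplex. -/
def Meets (o : E d) (q : ℕ × (Fin d → ℤ)) : Prop := ∃ j, (I.cell o q ∩ solid (I.sx j)).Nonempty

/-- The radius `δ / (nm)^{1/d}`, for total volume scaled to one. -/
def radius (δ : ℝ) : ℝ := δ / ((n : ℝ) * m) ^ (1 / (d : ℝ)) * I.mass ^ (1 / (d : ℝ))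

/-- No further subdivision: the cell is wholly within distance `radius` of some point, or for every
point the ratio of longest to shortest distance is at most `1 + δ`. -/
def Stop (δ : ℝ) (o : E d) (q : ℕ × (Fin d → ℤ)) : Prop :=
  (∃ i, ∀ x ∈ I.cell o q, dist (I.pt i) x ≤ I.radius δ) ∨
  (∀ i, ∀ x ∈ I.cell o q, ∀ y ∈ I.cell o q, dist (I.pt i) x ≤ (1 + δ) * dist (I.pt i) y)

/-- The cells generated: grid cells meeting a simplex, and the `2^d` halves of every generated cell
that has to be subdivided. -/
inductive Generated (δ : ℝ) (o : E d) : ℕ × (Fin d → ℤ) → Prop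
  | root (z : Fin d → ℤ) : I.Meets o (0, z) → Generated δ o (0, z)
  | child (l : ℕ) (z : Fin d → ℤ) (h : Fin d → Fin 2) : Generated δ o (l, z) →
      ¬ I.Stop δ o (l, z) → Generated δ o (l + 1, fun c => 2 * z c + ((h c : ℕ) : ℤ))

/-- The resulting subdivision: the final nonempty cells. -/
def cells (δ : ℝ) (o : E d) : Set (ℕ × (Fin d → ℤ)) :=
  {q | I.Generated δ o q ∧ I.Stop δ o q ∧ I.Meets o q}

/-- Total volume of the parts of simplices inside a cell. -/
def cellWt (o : E d) (q : ℕ × (Fin d → ℤ)) : ℝ :=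
  ∑ j, volume.real (I.cell o q ∩ solid (I.sx j))

/-- The discrete problem between the given points and one representative `t c` per cell `q c`. -/
def discretize (o : E d) {k : ℕ} (q : Fin k → ℕ × (Fin d → ℤ)) (t : Fin k → E d) :
    Discrete d n k where
  src := I.pt
  srcWt := I.wt
  tgt := t
  tgtWt := fun c => I.cellWt o (q c)

open Classical in
/-- Spread the mass sent to each representative evenly over the parts of simplices in its cell. -/
def spread (o : E d) {k : ℕ} (q : Fin k → ℕ × (Fin d → ℤ)) (ν : Fin n → Fin k → ℝ) :
    Fin n → Fin m → E d → ℝ :=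
  fun i _ x => ∑ c, if x ∈ I.cell o (q c) then ν i c / I.cellWt o (q c) else 0

end Input

/-! ## Real RAM

Programs over two memories of arrays, one holding natural numbers (used for indices) and one holding
real numbers. Reals can be compared and combined by the four field operations; there is no
conversion from reals to naturals, no division of naturals and no root. Every operation, memory
access and test takes one unit of time. -/

/-- `nat A i` and `real A i` are the `i`-th entries of the arrays named `A`. -/
structure Mem where
  nat : ℕ → ℕ → ℕ
  real : ℕ → ℕ → ℝ

def Mem.setNat (σ : Mem) (A i v : ℕ) : Mem :=
  { σ with nat := Function.update σ.nat A (Function.update (σ.nat A) i v) }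

def Mem.setReal (σ : Mem) (A i : ℕ) (v : ℝ) : Mem :=
  { σ with real := Function.update σ.real A (Function.update (σ.real A) i v) }

inductive NExp where
  | lit (c : ℕ)
  | get (A : ℕ) (i : NExp)
  | add (x y : NExp)
  | sub (x y : NExp)
  | mul (x y : NExp)

def NExp.val (σ : Mem) : NExp → ℕ
  | lit c => c
  | get A i => σ.nat A (i.val σ)
  | add x y => x.val σ + y.val σ
  | sub x y => x.val σ - y.val σ
  | mul x y => x.val σ * y.val σ

/-- Evaluation time. -/
def NExp.time : NExp → ℕ
  | lit _ => 1
  | get _ i => i.time + 1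
  | add x y => x.time + y.time + 1
  | sub x y => x.time + y.time + 1
  | mul x y => x.time + y.time + 1

inductive RExp where
  | lit (c : ℕ)
  | get (A : ℕ) (i : NExp)
  | ofNat (i : NExp)
  | add (x y : RExp)
  | sub (x y : RExp)
  | mul (x y : RExp)
  | div (x y : RExp)

def RExp.val (σ : Mem) : RExp → ℝ
  | lit c => c
  | get A i => σ.real A (i.val σ)
  | ofNat i => (i.val σ : ℝ)
  | add x y => x.val σ + y.val σ
  | sub x y => x.val σ - y.val σ
  | mul x y => x.val σ * y.val σ
  | div x y => x.val σ / y.val σ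

/-- Evaluation time. -/
def RExp.time : RExp → ℕ
  | lit _ => 1
  | get _ i => i.time + 1
  | ofNat i => i.time + 1
  | add x y => x.time + y.time + 1
  | sub x y => x.time + y.time + 1
  | mul x y => x.time + y.time + 1
  | div x y => x.time + y.time + 1

inductive Test where
  | natLt (x y : NExp)
  | realLe (x y : RExp)
  | neg (b : Test)
  | and (b c : Test)

def Test.Holds (σ : Mem) : Test → Prop
  | natLt x y => x.val σ < y.val σ
  | realLe x y => x.val σ ≤ y.val σ
  | neg b => ¬ b.Holds σ
  | and b c => b.Holds σ ∧ c.Holds σ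

/-- Evaluation time. -/
def Test.time : Test → ℕ
  | natLt x y => x.time + y.time + 1
  | realLe x y => x.time + y.time + 1
  | neg b => b.time + 1
  | and b c => b.time + c.time + 1

inductive Cmd where
  | skip
  | setNat (A : ℕ) (i e : NExp)
  | setReal (A : ℕ) (i : NExp) (e : RExp)
  | seq (p q : Cmd)
  | ite (b : Test) (p q : Cmd)
  | loop (b : Test) (p : Cmd)
  /-- Solve a discrete transport problem with `a` sources and `b` targets. Coordinate `c` of source
  `i` is entry `i * d + c` of the real array `X`, its weight is entry `i` of `U`, and likewise `Y`
  and `V` for the targets. The number of transfers is put into entry `0` of the natural array `K`;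
  the source, target and mass of the `l`-th transfer into entry `l` of `S`, `T` and `M`. -/
  | solve (a b : NExp) (X U Y V : ℕ) (K S T M : ℕ)

/-- The discrete instance stored in memory. -/
def Mem.instanceAt (σ : Mem) (d a b X U Y V : ℕ) : Discrete d a b where
  src := fun i => WithLp.toLp 2 fun c => σ.real X (i * d + c)
  srcWt := fun i => σ.real U i
  tgt := fun j => WithLp.toLp 2 fun c => σ.real Y (j * d + c)
  tgtWt := fun j => σ.real V j

/-- Store the list `L` of transfers. -/
def Mem.storePlan {a b : ℕ} (σ : Mem) (L : List (Fin a × Fin b × ℝ)) (K S T M : ℕ) : Mem :=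
  ⟨fun A l =>
      if A = K ∧ l = 0 then L.length
      else if h : l < L.length then
        if A = S then (L[l]).1 else if A = T then (L[l]).2.1 else σ.nat A l
      else σ.nat A l,
    fun A l => if h : l < L.length then if A = M then (L[l]).2.2 else σ.real A l else σ.real A l⟩

/-- `Exec A f p σ t σ'`: program `p`, started in memory `σ`, halts after `t` time units in `σ'`.
Solving a discrete problem is done by `A`, and takes time `f k` for `k` points in total. -/
inductive Exec {d : ℕ} (A : Solver d) (f : ℕ → ℕ) : Cmd → Mem → ℕ → Mem → Prop
  | skip (σ : Mem) : Exec A f .skip σ 1 σ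
  | setNat (σ : Mem) (B : ℕ) (i e : NExp) :
      Exec A f (.setNat B i e) σ (i.time + e.time + 1) (σ.setNat B (i.val σ) (e.val σ))
  | setReal (σ : Mem) (B : ℕ) (i : NExp) (e : RExp) :
      Exec A f (.setReal B i e) σ (i.time + e.time + 1) (σ.setReal B (i.val σ) (e.val σ))
  | seq {p q : Cmd} {σ σ₁ σ₂ : Mem} {t u : ℕ} :
      Exec A f p σ t σ₁ → Exec A f q σ₁ u σ₂ → Exec A f (.seq p q) σ (t + u) σ₂
  | iteTrue {b : Test} {p q : Cmd} {σ σ₁ : Mem} {t : ℕ} :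
      b.Holds σ → Exec A f p σ t σ₁ → Exec A f (.ite b p q) σ (b.time + t + 1) σ₁
  | iteFalse {b : Test} {p q : Cmd} {σ σ₁ : Mem} {t : ℕ} :
      ¬ b.Holds σ → Exec A f q σ t σ₁ → Exec A f (.ite b p q) σ (b.time + t + 1) σ₁
  | loopDone {b : Test} {p : Cmd} {σ : Mem} :
      ¬ b.Holds σ → Exec A f (.loop b p) σ (b.time + 1) σ
  | loopStep {b : Test} {p : Cmd} {σ σ₁ σ₂ : Mem} {t u : ℕ} :
      b.Holds σ → Exec A f p σ t σ₁ → Exec A f (.loop b p) σ₁ u σ₂ →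
      Exec A f (.loop b p) σ (b.time + t + 1 + u) σ₂
  | solve (σ : Mem) (a b : NExp) (X U Y V K S T M : ℕ) :
      Exec A f (.solve a b X U Y V K S T M) σ (a.time + b.time + f (a.val σ + b.val σ) + 1)
        (σ.storePlan (A (a.val σ) (b.val σ) (σ.instanceAt d (a.val σ) (b.val σ) X U Y V)) K S T M)

/-- The memory contains the parameter `δ` and the input; all other entries are arbitrary. -/
structure Mem.HasInput {d n m : ℕ} (σ : Mem) (δ : ℝ) (I : Input d n m) : Prop where
  points : σ.nat 0 0 = n
  simplices : σ.nat 0 1 = m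
  dim : σ.nat 0 2 = d
  param : σ.real 0 0 = δ
  pt : ∀ (i : Fin n) (c : Fin d), σ.real 1 (i * d + c) = I.pt i c
  wt : ∀ i : Fin n, σ.real 2 i = I.wt i
  sx : ∀ (j : Fin m) (a : Fin (d + 1)) (c : Fin d),
    σ.real 3 ((j * (d + 1) + a) * d + c) = (I.sx j).points a c

open Classical in
/-- The transport plan described by a final memory. It has a table of pieces: the `q`-th piece is
the part of simplex `nat 2 q` inside the cube with corner `real 4 (q * d + ·)` and edge length
`real 5 q`. And it has `nat 1 0` transfers: the `l`-th gives density `real 6 l` from point `nat 3 l`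
to all of piece `nat 4 l`. -/
def Mem.plan (σ : Mem) (d n m : ℕ) : Fin n → Fin m → E d → ℝ := fun i j x =>
  ∑ l ∈ Finset.range (σ.nat 1 0),
    if σ.nat 3 l = i ∧ σ.nat 2 (σ.nat 4 l) = j ∧
        x ∈ cube (WithLp.toLp 2 fun c : Fin d => σ.real 4 (σ.nat 4 l * d + c)) (σ.real 5 (σ.nat 4 l))
    then σ.real 6 l else 0

/-- `5^d · d · d^{d/2} · nm / δ^d · log ((nm)^{1/d} Δ / δ)`. -/
def cellBound (d n m : ℕ) (Δ δ : ℝ) : ℝ :=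
  5 ^ d * d * (d : ℝ) ^ ((d : ℝ) / 2) * (n * m) / δ ^ d *
    Real.log (((n : ℝ) * m) ^ (1 / (d : ℝ)) * Δ / δ)

end PointSimplex

end

noncomputable section

namespace PointSimplex

open Matrix Filter Topology

/-! **Approximation.** Replace every piece of a simplex by one weighted point. If this changes each
distance by a factor of at most $1+\delta$ plus an additive error, then a continuous plan collapses
to a discrete one and a discrete plan spreads to a continuous one. The factors multiply, and the
additive errors are weighted by the masses of the pieces (`Input.cost_spreadOn_le`). The additive
part is absorbed by a lower bound on the cost. Put $\lambda=(V/nm)^{1/d}$. Since densities are at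
most one, a point and a simplex exchange at most $(\lambda/2)^d$ of mass within distance $\lambda/4$
of the point. Over all $nm$ pairs this is at most half of $V$, so every plan costs at least $\lambda
V/8$ (`Input.IsPlan.le_cost`). In the subdivision of part (1), cells near a point have error
$2\delta\lambda$ and total mass at most $(2\delta)^dV\le 2\delta V$, so they lose only $O(\delta^2)$
times the optimum. All other cells lose only factors $1+\delta$ (`Input.approximation`).

**Algorithm.** The program need not build the subdivision of part (1). It only needs a table of
pieces to which the same discretization bound applies (`Table.cost_le`). Each simplex gets its own
root cube, which is halved until the edge length is $O(\delta\lambda/\sqrt d)$ or no point is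
relevant. Here a point is relevant if its squared distance to the centre of the cube is below
$4ds^2/\delta^2$, a test without roots. Every cube carries the list of its relevant points, and a
child filters the list of its parent.

**Counting.** A cube of edge $t$ at which $p$ is relevant is charged to the integral over it of a
Gaussian of width $t/\delta$ around $p$. On such a cube the Gaussian is at least $e^{-9d}$, and its
total integral is $(\sqrt\pi\,t/\delta)^d$. So each level has at most $(e^9\sqrt\pi/\delta)^d$ such
cubes per point and simplex (`treeCount_le_mul`). The number of levels is
$O(d\log((nm)^{1/d}\Delta/\delta))$ (`exists_depth`).

**Volumes.** The weight of a piece is the volume of a polytope with $3d+1$ constraints in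
barycentric coordinates. It is computed by Lawrence's formula $$\mathrm{vol}=\sum_v \frac{(c\cdot
v)^d}{d!\,|\det A_v|\prod_i\gamma_i},\qquad c=\sum_i\gamma_i a_i,$$ summed over the vertices $v$,
where the rows $a_i$ of $A_v$ are the constraints tight at $v$ (`integral_polytope`). The formula
requires that no vertex is degenerate and no $\gamma_i$ vanishes. Degenerate polytopes are handled
by a symbolic perturbation of the right-hand side. The perturbation and the vector $c$ are both
taken from the moment curve at an integer $t$. Bad values of $t$ are roots of few polynomials of low
degree, so a trial loop of known length meets a good one (`volume_polytope`, `card_bad_le`).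
Determinants and inverses come from the Faddeev–LeVerrier recursion, which needs no pivoting
(`flX_last`).

**Time.** Everything spent on a single cell, including the enumeration of all subsets of
constraints, is at most exponential in $d$. An exponential in $d$ is dominated by a constant times
$d^{d/2}$ (`exists_pow_le`), a factor that $X$ contains. Hence the whole running time is already
$O(f_\delta(\lceil CX\rceil))$, because $f_\delta(k)\ge k$ (`exists_transport_time`). -/

/-! ## Volume of a polytope as a sum over vertices -/

/-- The polytope `{x | ∀ r, A r ⬝ᵥ x ≤ b r}`. -/
def polytope {ι : Type} {d : ℕ} (A : ι → Fin d → ℝ) (b : ι → ℝ) : Set (Fin d → ℝ) :=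
  {x | ∀ r, A r ⬝ᵥ x ≤ b r}

/-- The square system formed by the constraints `β`. -/
def rows {ι : Type} {d : ℕ} (A : ι → Fin d → ℝ) (β : Fin d → ι) : Matrix (Fin d) (Fin d) ℝ :=
  Matrix.of fun p => A (β p)

open Classical in
/-- Contribution of the vertex determined by `β` to the integral of `(c ⬝ᵥ x + e) ^ k / k!`. -/
def vertexTerm {ι : Type} {d : ℕ} (A : ι → Fin d → ℝ) (b : ι → ℝ) (c : Fin d → ℝ) (e : ℝ) (k : ℕ)
    (β : Fin d → ι) : ℝ :=
  if (rows A β).det ≠ 0 ∧ (rows A β)⁻¹ *ᵥ (b ∘ β) ∈ polytope A b then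
    (c ⬝ᵥ ((rows A β)⁻¹ *ᵥ (b ∘ β)) + e) ^ (d + k) /
      ((d + k).factorial * |(rows A β).det| * ∏ p, (c ᵥ* (rows A β)⁻¹) p)
  else 0

theorem isClosed_polytope {ι : Type} {d : ℕ} (A : ι → Fin d → ℝ) (b : ι → ℝ) :
    IsClosed (polytope A b) := by
  have : polytope A b = ⋂ r, {x | A r ⬝ᵥ x ≤ b r} := by ext; simp [polytope]
  rw [this]
  refine isClosed_iInter fun r => isClosed_le ?_ continuous_const
  unfold dotProduct; fun_prop

-- The feasible set is a compact interval, so the sum has to reduce to `h hi - h lo`. Some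
-- constraint is tight at each end, and `hd` forbids a second one there. Every other constraint
-- becomes tight only outside of the interval.
open Classical in
theorem integral_constraints {ι : Type} [Fintype ι] (α β : ι → ℝ)
    (hb : Bornology.IsBounded {t : ℝ | ∀ r, α r * t ≤ β r})
    (hd : ∀ r s, r ≠ s → α r ≠ 0 → α s * (β r / α r) ≠ β s) (h h' : ℝ → ℝ)
    (hh : ∀ t, HasDerivAt h (h' t) t) (hc : Continuous h') :
    ∫ t in {t : ℝ | ∀ r, α r * t ≤ β r}, h' t =
      ∑ r, if α r ≠ 0 ∧ ∀ s, α s * (β r / α r) ≤ β s then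
        (SignType.sign (α r) : ℝ) * h (β r / α r) else 0 := by
  set I := {t : ℝ | ∀ r, α r * t ≤ β r} with hI
  rcases Set.eq_empty_or_nonempty I with he | hne
  · rw [he, Measure.restrict_empty, integral_zero_measure]
    refine (Finset.sum_eq_zero fun r _ => ?_).symm
    rw [if_neg]
    rintro ⟨-, h2⟩
    have : β r / α r ∈ I := h2
    simp [he] at this
  have hcl : IsClosed I := by
    have : I = ⋂ r, {t | α r * t ≤ β r} := by ext; simp [hI]
    rw [this]
    exact isClosed_iInter fun r => isClosed_le (by fun_prop) continuous_const
  have hcp : IsCompact I := Metric.isCompact_of_isClosed_isBounded hcl hb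
  have hcx : Convex ℝ I := by
    have : I = ⋂ r, {t | α r * t ≤ β r} := by ext; simp [hI]
    rw [this]
    refine convex_iInter fun r => ?_
    exact convex_halfSpace_le ⟨fun x y => by ring, fun c x => by simp; ring⟩ _
  have hIcc : I = Set.Icc (sInf I) (sSup I) :=
    eq_Icc_of_connected_compact ⟨hne, hcx.isPreconnected⟩ hcp
  set lo := sInf I
  set hi := sSup I
  have hlo : lo ∈ I := hcp.sInf_mem hne
  have hhi : hi ∈ I := hcp.sSup_mem hne
  have hle : lo ≤ hi := (hIcc ▸ hlo : lo ∈ Set.Icc lo hi).2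
  -- Otherwise all constraints would still hold slightly to the right of `hi`.
  have top : ∃ r, 0 < α r ∧ α r * hi = β r := by
    by_contra! hno
    have : ∀ᶠ t in 𝓝[>] hi, ∀ r, α r * t ≤ β r := by
      rw [eventually_all]
      intro r
      rcases lt_or_ge 0 (α r) with hp | hp
      · have h1 : α r * hi < β r := lt_of_le_of_ne (hhi r) (hno r hp)
        have h2 : ∀ᶠ t in 𝓝 hi, α r * t < β r :=
          (by fun_prop : Continuous fun t => α r * t).continuousAt.eventually_lt_const h1
        exact (h2.filter_mono nhdsWithin_le_nhds).mono fun t ht => ht.le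
      · filter_upwards [self_mem_nhdsWithin] with t ht
        have : hi < t := ht
        have := hhi r
        nlinarith
    obtain ⟨t, ht, ht'⟩ := (this.and self_mem_nhdsWithin).exists
    have h3 : t ∈ I := ht
    rw [hIcc] at h3
    exact absurd h3.2 (not_le.2 ht')
  have bot : ∃ r, α r < 0 ∧ α r * lo = β r := by
    by_contra! hno
    have : ∀ᶠ t in 𝓝[<] lo, ∀ r, α r * t ≤ β r := by
      rw [eventually_all]
      intro r
      rcases lt_or_ge (α r) 0 with hp | hp
      · have h1 : α r * lo < β r := lt_of_le_of_ne (hlo r) (hno r hp)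
        have h2 : ∀ᶠ t in 𝓝 lo, α r * t < β r :=
          (by fun_prop : Continuous fun t => α r * t).continuousAt.eventually_lt_const h1
        exact (h2.filter_mono nhdsWithin_le_nhds).mono fun t ht => ht.le
      · filter_upwards [self_mem_nhdsWithin] with t ht
        have : t < lo := ht
        have := hlo r
        nlinarith
    obtain ⟨t, ht, ht'⟩ := (this.and self_mem_nhdsWithin).exists
    have h3 : t ∈ I := ht
    rw [hIcc] at h3
    exact absurd h3.1 (not_le.2 ht')
  obtain ⟨rt, hrt, hrt'⟩ := top
  obtain ⟨rb, hrb, hrb'⟩ := bot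
  have hterm : ∀ r, (if α r ≠ 0 ∧ ∀ s, α s * (β r / α r) ≤ β s then
        (SignType.sign (α r) : ℝ) * h (β r / α r) else 0) =
      (if r = rt then h hi else 0) + (if r = rb then - h lo else 0) := by
    intro r
    rcases lt_trichotomy (α r) 0 with hn | hz | hp
    · have hne1 : r ≠ rt := by rintro rfl; linarith
      rw [if_neg hne1, zero_add]
      by_cases hr : r = rb
      · subst hr
        have : β r / α r = lo := by rw [← hrb', mul_div_cancel_left₀ _ hn.ne]
        rw [if_pos ⟨hn.ne, by rw [this]; exact hlo⟩, if_pos rfl, this, sign_neg hn]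
        simp
      · rw [if_neg hr, if_neg]
        rintro ⟨-, h2⟩
        have h3 : β r / α r ∈ I := h2
        rw [hIcc] at h3
        have h4 : β r / α r ≤ lo := by rw [div_le_iff_of_neg hn]; linarith [hlo r]
        have h5 : β r / α r = lo := le_antisymm h4 h3.1
        exact hd r rb hr hn.ne (by rw [h5, hrb'])
    · have hne1 : r ≠ rt := by rintro rfl; linarith
      have hne2 : r ≠ rb := by rintro rfl; linarith
      simp [hz, hne1, hne2]
    · have hne1 : r ≠ rb := by rintro rfl; linarith
      rw [if_neg hne1, add_zero]
      by_cases hr : r = rt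
      · subst hr
        have : β r / α r = hi := by rw [← hrt', mul_div_cancel_left₀ _ hp.ne']
        rw [if_pos ⟨hp.ne', by rw [this]; exact hhi⟩, if_pos rfl, this, sign_pos hp]
        simp
      · rw [if_neg hr, if_neg]
        rintro ⟨-, h2⟩
        have h3 : β r / α r ∈ I := h2
        rw [hIcc] at h3
        have h4 : hi ≤ β r / α r := by rw [le_div_iff₀ hp]; linarith [hhi r]
        have h5 : β r / α r = hi := le_antisymm h3.2 h4
        exact hd r rt hr hp.ne' (by rw [h5, hrt'])
  rw [Finset.sum_congr rfl fun r _ => hterm r, Finset.sum_add_distrib, Finset.sum_ite_eq',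
    Finset.sum_ite_eq', if_pos (Finset.mem_univ _), if_pos (Finset.mem_univ _)]
  rw [hIcc, integral_Icc_eq_integral_Ioc, ← intervalIntegral.integral_of_le hle,
    intervalIntegral.integral_eq_sub_of_hasDerivAt (fun x _ => hh x) (hc.intervalIntegrable _ _)]
  ring

theorem volume_hyperplane {d : ℕ} (w : Fin d → ℝ) (β : ℝ) (h : ¬ (w = 0 ∧ β = 0)) :
    volume {x : Fin d → ℝ | w ⬝ᵥ x = β} = 0 := by
  by_cases hw : w = 0
  · have : {x : Fin d → ℝ | w ⬝ᵥ x = β} = ∅ := by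
      ext x
      simp only [hw, zero_dotProduct, Set.mem_ofPred_eq, Set.mem_empty_iff_false, iff_false]
      intro h0; exact h ⟨hw, h0.symm⟩
    simp [this]
  · let S : AffineSubspace ℝ (Fin d → ℝ) :=
      { carrier := {x | w ⬝ᵥ x = β}
        smul_vsub_vadd_mem' := by
          intro c p1 p2 p3 h1 h2 h3
          simp only [Set.mem_ofPred_eq] at *
          simp [dotProduct_add, dotProduct_sub, h1, h2, h3] }
    have hS : S ≠ ⊤ := by
      intro hS
      have hall : ∀ x, w ⬝ᵥ x = β := fun x => by
        have : x ∈ S := by rw [hS]; trivial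
        exact this
      have h0 := hall 0
      rw [dotProduct_zero] at h0
      have h1 := hall w
      rw [← h0, dotProduct_self_eq_zero] at h1
      exact hw h1
    exact Measure.addHaar_affineSubspace volume S hS

/-- Constraints after substituting coordinate `0` by means of constraint `r`. -/
def elimA {ι : Type} {d : ℕ} (A : ι → Fin (d + 1) → ℝ) (r : ι) (s : {s // s ≠ r}) : Fin d → ℝ :=
  fun j => A s j.succ - A s 0 / A r 0 * A r j.succ

def elimB {ι : Type} {d : ℕ} (A : ι → Fin (d + 1) → ℝ) (b : ι → ℝ) (r : ι) (s : {s // s ≠ r}) : ℝ :=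
  b s - A s 0 / A r 0 * b r

def elimC {ι : Type} {d : ℕ} (A : ι → Fin (d + 1) → ℝ) (c : Fin (d + 1) → ℝ) (r : ι) : Fin d → ℝ :=
  fun j => c j.succ - c 0 / A r 0 * A r j.succ

/-- The point above `x` on the hyperplane of constraint `r`. -/
def liftPt {ι : Type} {d : ℕ} (A : ι → Fin (d + 1) → ℝ) (b : ι → ℝ) (r : ι) (x : Fin d → ℝ) :
    Fin (d + 1) → ℝ :=
  Fin.cons ((b r - (fun j => A r j.succ) ⬝ᵥ x) / A r 0) x

theorem dotProduct_cons' {d : ℕ} (w : Fin (d + 1) → ℝ) (t : ℝ) (x : Fin d → ℝ) :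
    w ⬝ᵥ (Fin.cons t x : Fin (d + 1) → ℝ) = w 0 * t + (fun j => w j.succ) ⬝ᵥ x := by
  simp [dotProduct, Fin.sum_univ_succ]

theorem elim_dotProduct {d : ℕ} (w : Fin (d + 1) → ℝ) (z : Fin d → ℝ) (α : ℝ) (x : Fin d → ℝ) :
    (fun j => w j.succ - α * z j) ⬝ᵥ x = (fun j => w j.succ) ⬝ᵥ x - α * (z ⬝ᵥ x) := by
  simp [dotProduct, Finset.mul_sum, ← Finset.sum_sub_distrib, sub_mul, mul_assoc]

section elim
variable {ι : Type} {d : ℕ} (A : ι → Fin (d + 1) → ℝ) (b : ι → ℝ) (c : Fin (d + 1) → ℝ) (r : ι)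

theorem liftPt_self (hr : A r 0 ≠ 0) (x : Fin d → ℝ) : A r ⬝ᵥ liftPt A b r x = b r := by
  rw [liftPt, dotProduct_cons']; field_simp; ring

theorem dotProduct_liftPt (hr : A r 0 ≠ 0) (s : {s // s ≠ r}) (x : Fin d → ℝ) :
    A s ⬝ᵥ liftPt A b r x - b s = elimA A r s ⬝ᵥ x - elimB A b r s := by
  unfold elimA
  rw [elim_dotProduct, liftPt, dotProduct_cons', elimB]; field_simp; ring

theorem elimC_dotProduct (hr : A r 0 ≠ 0) (e : ℝ) (x : Fin d → ℝ) :
    elimC A c r ⬝ᵥ x + (e + c 0 / A r 0 * b r) = c ⬝ᵥ liftPt A b r x + e := by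
  unfold elimC
  rw [elim_dotProduct, liftPt, dotProduct_cons']; field_simp; ring

theorem liftPt_mem (hr : A r 0 ≠ 0) (x : Fin d → ℝ) :
    liftPt A b r x ∈ polytope A b ↔ x ∈ polytope (elimA A r) (elimB A b r) := by
  constructor
  · intro h s
    have := h s
    linarith [dotProduct_liftPt A b r hr s x]
  · intro h s
    by_cases hs : s = r
    · rw [hs, liftPt_self A b r hr]
    · linarith [dotProduct_liftPt A b r hr ⟨s, hs⟩ x, h ⟨s, hs⟩]

/-- Put constraint `r` in front. -/
def consRow (r : ι) (β : Fin d → {s // s ≠ r}) : Fin (d + 1) → ι := Fin.cons r fun p => (β p : ι)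

/-- Clearing column `0` with row `r` leaves the rows of `elimA` below it; then expand along that
column. -/
theorem det_consRow (hr : A r 0 ≠ 0) (β : Fin d → {s // s ≠ r}) :
    (rows A (consRow r β)).det = A r 0 * (rows (elimA A r) β).det := by
  set M := rows A (consRow r β)
  let N : Matrix (Fin (d + 1)) (Fin (d + 1)) ℝ :=
    Matrix.of (Fin.cons (A r) fun p => fun j => A (β p) j - A (β p) 0 / A r 0 * A r j)
  have h1 : M.det = N.det := by
    refine Matrix.det_eq_of_forall_row_eq_smul_add_const
      (Fin.cons 0 fun p => A (β p) 0 / A r 0) 0 (by simp) ?_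
    intro i j
    refine Fin.cases ?_ (fun p => ?_) i
    · simp [M, N, rows, consRow]
    · simp [M, N, rows, consRow]
  rw [h1, Matrix.det_succ_column_zero, Fin.sum_univ_succ, Finset.sum_eq_zero]
  · have : N.submatrix (Fin.succAbove 0) Fin.succ = rows (elimA A r) β := by
      ext i j; simp [N, rows, elimA]
    rw [this]; simp [N]
  · intro i _
    have : N i.succ 0 = 0 := by simp [N, hr]
    simp [this]

theorem mulVec_consRow (hr : A r 0 ≠ 0) (β : Fin d → {s // s ≠ r}) (x : Fin d → ℝ)
    (hx : rows (elimA A r) β *ᵥ x = elimB A b r ∘ β) :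
    rows A (consRow r β) *ᵥ liftPt A b r x = b ∘ consRow r β := by
  ext i
  refine Fin.cases ?_ (fun p => ?_) i
  · exact liftPt_self A b r hr x
  · have h1 := congrFun hx p
    have h2 := dotProduct_liftPt A b r hr (β p) x
    have h3 : elimA A r (β p) ⬝ᵥ x = elimB A b r (β p) := h1
    have : A (β p) ⬝ᵥ liftPt A b r x = b (β p) := by linarith
    exact this

/-- Elimination keeps the coefficients of `c` at the remaining constraints. Only the coefficient of
row `r` is new, and column `0` determines it. -/
theorem vecMul_consRow (hr : A r 0 ≠ 0) (β : Fin d → {s // s ≠ r}) (y : Fin d → ℝ)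
    (hy : y ᵥ* rows (elimA A r) β = elimC A c r) :
    (Fin.cons ((c 0 - ∑ p, y p * A (β p) 0) / A r 0) y : Fin (d + 1) → ℝ) ᵥ* rows A (consRow r β) =
      c := by
  ext j
  simp only [vecMul, dotProduct, Fin.sum_univ_succ, Fin.cons_zero, Fin.cons_succ, rows, consRow,
    Matrix.of_apply]
  refine Fin.cases ?_ (fun j => ?_) j
  · field_simp; ring
  · have h1 := congrFun hy j
    simp only [vecMul, dotProduct, rows, Matrix.of_apply, elimA, elimC] at h1
    have h2 : ∑ p, y p * (A (β p) j.succ - A (β p) 0 / A r 0 * A r j.succ) =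
        ∑ p, y p * A (β p) j.succ - (∑ p, y p * A (β p) 0) / A r 0 * A r j.succ := by
      rw [Finset.sum_div, Finset.sum_mul, ← Finset.sum_sub_distrib]
      refine Finset.sum_congr rfl fun p _ => by ring
    rw [h2] at h1
    have : ∑ p, y p * A (β p) j.succ =
        c j.succ - c 0 / A r 0 * A r j.succ + (∑ p, y p * A (β p) 0) / A r 0 * A r j.succ := by
      linarith
    rw [this]; field_simp; ring

theorem eq_inv_mulVec {d : ℕ} {M : Matrix (Fin d) (Fin d) ℝ} (hM : M.det ≠ 0) {x v : Fin d → ℝ}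
    (h : M *ᵥ x = v) : x = M⁻¹ *ᵥ v := by
  rw [← h, mulVec_mulVec, nonsing_inv_mul _ (isUnit_iff_ne_zero.2 hM), one_mulVec]

theorem eq_vecMul_inv {d : ℕ} {M : Matrix (Fin d) (Fin d) ℝ} (hM : M.det ≠ 0) {x v : Fin d → ℝ}
    (h : x ᵥ* M = v) : x = v ᵥ* M⁻¹ := by
  rw [← h, vecMul_vecMul, mul_nonsing_inv _ (isUnit_iff_ne_zero.2 hM), vecMul_one]

/-- Passing from a facet back to the polytope keeps the vertex, the later coefficients and the total
exponent. The determinant gains the factor `A r 0` and the product of coefficients gains its first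
entry; these two make up the factor on the right. -/
theorem vertexTerm_elim (hr : A r 0 ≠ 0) (e : ℝ) (k : ℕ) (β : Fin d → {s // s ≠ r})
    (hne : (rows A (consRow r β)).det ≠ 0 → (c ᵥ* (rows A (consRow r β))⁻¹) 0 ≠ 0) :
    vertexTerm (elimA A r) (elimB A b r) (elimC A c r) (e + c 0 / A r 0 * b r) (k + 1) β =
      |A r 0| * (c ᵥ* (rows A (consRow r β))⁻¹) 0 * vertexTerm A b c e k (consRow r β) := by
  by_cases hdet : (rows (elimA A r) β).det = 0
  · have h2 : (rows A (consRow r β)).det = 0 := by rw [det_consRow A r hr, hdet, mul_zero]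
    simp [vertexTerm, hdet, h2]
  have hdet' : (rows A (consRow r β)).det ≠ 0 := by
    rw [det_consRow A r hr]; exact mul_ne_zero hr hdet
  set v' := (rows (elimA A r) β)⁻¹ *ᵥ (elimB A b r ∘ β) with hv'
  set y' := elimC A c r ᵥ* (rows (elimA A r) β)⁻¹ with hy'
  have hv : rows (elimA A r) β *ᵥ v' = elimB A b r ∘ β := by
    rw [hv', mulVec_mulVec, mul_nonsing_inv _ (isUnit_iff_ne_zero.2 hdet), one_mulVec]
  have hy : y' ᵥ* rows (elimA A r) β = elimC A c r := by
    rw [hy', vecMul_vecMul, nonsing_inv_mul _ (isUnit_iff_ne_zero.2 hdet), vecMul_one]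
  have e1 := eq_inv_mulVec hdet' (mulVec_consRow A b r hr β v' hv)
  have e2 := eq_vecMul_inv hdet' (vecMul_consRow A c r hr β y' hy)
  have e3 : ∏ p, (c ᵥ* (rows A (consRow r β))⁻¹) p =
      (c ᵥ* (rows A (consRow r β))⁻¹) 0 * ∏ p, y' p := by
    rw [Fin.prod_univ_succ]; congr 1
    refine Finset.prod_congr rfl fun p _ => ?_
    rw [← e2]; simp
  have h0 := hne hdet'
  rw [vertexTerm, vertexTerm, ← hv', ← hy', ← e1, e3, elimC_dotProduct A b c r hr]
  by_cases hm : v' ∈ polytope (elimA A r) (elimB A b r)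
  · rw [if_pos ⟨hdet, hm⟩, if_pos ⟨hdet', (liftPt_mem A b r hr v').2 hm⟩, det_consRow A r hr, abs_mul,
      show d + 1 + k = d + (k + 1) by ring]
    have : |A r 0| ≠ 0 := abs_ne_zero.2 hr
    rw [mul_div_assoc']
    rw [show ((d + (k + 1)).factorial : ℝ) * (|A r 0| * |(rows (elimA A r) β).det|) *
      ((c ᵥ* (rows A (consRow r β))⁻¹) 0 * ∏ p, y' p) = (|A r 0| * (c ᵥ* (rows A (consRow r β))⁻¹) 0) *
        (((d + (k + 1)).factorial : ℝ) * |(rows (elimA A r) β).det| * ∏ p, y' p) by ring,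
      mul_div_mul_left _ _ (mul_ne_zero this h0)]
  · rw [if_neg fun h => hm h.2, if_neg fun h => hm ((liftPt_mem A b r hr v').1 h.2), mul_zero]

end elim

end PointSimplex

/-! ### The vertex formula, by induction on the dimension -/

namespace PointSimplex

open Matrix Filter Topology

/-- Used twice: to average over which constraint is eliminated first, and to pass from ordered
tuples of constraints to subsets. -/
theorem vertexTerm_perm {ι : Type} {d : ℕ} (A : ι → Fin d → ℝ) (b : ι → ℝ) (c : Fin d → ℝ) (e : ℝ)
    (k : ℕ) (β : Fin d → ι) (σ : Equiv.Perm (Fin d)) :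
    vertexTerm A b c e k (β ∘ σ) = vertexTerm A b c e k β := by
  have h0 : rows A (β ∘ σ) = (rows A β).submatrix σ (Equiv.refl _) := rfl
  have h1 : (rows A (β ∘ σ))⁻¹ = (rows A β)⁻¹.submatrix (Equiv.refl _) σ := by
    rw [h0, inv_submatrix_equiv]
  have h2 : (rows A (β ∘ σ))⁻¹ *ᵥ (b ∘ β ∘ σ) = (rows A β)⁻¹ *ᵥ (b ∘ β) := by
    rw [h1]; ext i
    simp only [mulVec, dotProduct, submatrix_apply, Function.comp_apply, Equiv.refl_apply]
    exact Equiv.sum_comp σ fun j => (rows A β)⁻¹ i j * b (β j)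
  have h3 : |(rows A (β ∘ σ)).det| = |(rows A β).det| := by
    have : (rows A (β ∘ σ)).det = _ := Matrix.det_permute σ (rows A β)
    rw [this, abs_mul]
    rcases Int.units_eq_one_or (Equiv.Perm.sign σ) with h | h <;> simp [h]
  have h4 : ∏ p, (c ᵥ* (rows A (β ∘ σ))⁻¹) p = ∏ p, (c ᵥ* (rows A β)⁻¹) p := by
    rw [h1]
    exact Equiv.prod_comp σ fun p => (c ᵥ* (rows A β)⁻¹) p
  have h5 : (rows A (β ∘ σ)).det ≠ 0 ↔ (rows A β).det ≠ 0 := by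
    rw [← abs_ne_zero, h3, abs_ne_zero]
  unfold vertexTerm
  rw [h2, h3, h4]
  by_cases hd : (rows A β).det ≠ 0 ∧ (rows A β)⁻¹ *ᵥ (b ∘ β) ∈ polytope A b
  · rw [if_pos hd, if_pos ⟨h5.2 hd.1, hd.2⟩]
  · rw [if_neg hd, if_neg fun h => hd ⟨h5.1 h.1, h.2⟩]

theorem vecMul_inv_perm {ι : Type} {d : ℕ} (A : ι → Fin d → ℝ) (c : Fin d → ℝ) (β : Fin d → ι)
    (σ : Equiv.Perm (Fin d)) (p : Fin d) :
    (c ᵥ* (rows A (β ∘ σ))⁻¹) p = (c ᵥ* (rows A β)⁻¹) (σ p) := by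
  have h0 : rows A (β ∘ σ) = (rows A β).submatrix σ (Equiv.refl _) := rfl
  rw [h0, inv_submatrix_equiv]; rfl

/-- No coefficient of `c` in terms of `d` independent constraint normals vanishes. -/
def GenericDir {ι : Type} {d : ℕ} (A : ι → Fin d → ℝ) (c : Fin d → ℝ) : Prop :=
  ∀ (β : Fin d → ι) (y : Fin d → ℝ), (rows A β).det ≠ 0 → y ᵥ* rows A β = c → ∀ p, y p ≠ 0

/-- A vertex lies on no further constraint hyperplane. -/
def Simple {ι : Type} {d : ℕ} (A : ι → Fin d → ℝ) (b : ι → ℝ) : Prop :=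
  ∀ (β : Fin d → ι) (x : Fin d → ℝ), (rows A β).det ≠ 0 → rows A β *ᵥ x = b ∘ β →
    ∀ r, r ∉ Set.range β → A r ⬝ᵥ x ≠ b r

/-- Every coordinate is bounded by some constraint alone. -/
def HasAxes {ι : Type} {d : ℕ} (A : ι → Fin d → ℝ) : Prop :=
  ∀ k, ∃ r, ∃ a : ℝ, a ≠ 0 ∧ A r = Pi.single k a

theorem HasAxes.exists_rows {ι : Type} {d : ℕ} {A : ι → Fin d → ℝ} (h : HasAxes A) :
    ∃ (ρ : Fin d → ι) (a : Fin d → ℝ), (∀ k, a k ≠ 0) ∧ (∀ k, A (ρ k) = Pi.single k (a k)) ∧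
      (rows A ρ).det ≠ 0 := by
  choose ρ a ha h using h
  refine ⟨ρ, a, ha, h, ?_⟩
  have : rows A ρ = diagonal a := by
    ext i j
    rw [rows, of_apply, h, diagonal_apply, Pi.single_apply]
    simp only [eq_comm]
  rw [this, det_diagonal]
  exact Finset.prod_ne_zero_iff.2 fun k _ => ha k

theorem isBounded_elim {ι : Type} {d : ℕ} {A : ι → Fin (d + 1) → ℝ} {b : ι → ℝ}
    (h : Bornology.IsBounded (polytope A b)) (r : ι) (hr : A r 0 ≠ 0) :
    Bornology.IsBounded (polytope (elimA A r) (elimB A b r)) := by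
  obtain ⟨C, hC⟩ := isBounded_iff_forall_norm_le.1 h
  refine isBounded_iff_forall_norm_le.2 ⟨C, fun x hx => ?_⟩
  have h1 := hC _ ((liftPt_mem A b r hr x).2 hx)
  have hC0 : 0 ≤ C := (norm_nonneg _).trans h1
  rw [pi_norm_le_iff_of_nonneg hC0] at h1 ⊢
  intro i
  simpa [liftPt] using h1 i.succ

theorem integrableOn_polytope {ι : Type} {d : ℕ} {A : ι → Fin d → ℝ} {b : ι → ℝ}
    (h : Bornology.IsBounded (polytope A b)) {f : (Fin d → ℝ) → ℝ} (hf : Continuous f) :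
    IntegrableOn f (polytope A b) :=
  hf.continuousOn.integrableOn_compact
    (Metric.isCompact_of_isClosed_isBounded (isClosed_polytope A b) h)

/-- If constraint `s` became trivial, it would be a multiple of constraint `r`, right-hand side
included. Then `s` would also be tight at the vertex cut out by `r` and the axis constraints of the
coordinates `k.succ`, which simplicity excludes. If `s` is itself one of these axis constraints, its
normal would be zero. -/
theorem Simple.elim_ne_zero {ι : Type} {d : ℕ} {A : ι → Fin (d + 1) → ℝ} {b : ι → ℝ}
    (h2 : Simple A b) (h3 : HasAxes A) (r : ι) (hr : A r 0 ≠ 0) (s : {s // s ≠ r}) :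
    ¬ (elimA A r s = 0 ∧ elimB A b r s = 0) := by
  rintro ⟨e1, e2⟩
  obtain ⟨ρ, a, ha, hρ, -⟩ := h3.exists_rows
  have hρ0 : ∀ k : Fin d, A (ρ k.succ) 0 = 0 := fun k => by rw [hρ]; simp
  have hne : ∀ k : Fin d, ρ k.succ ≠ r := fun k hk => hr (hk ▸ hρ0 k)
  let β : Fin d → {s // s ≠ r} := fun k => ⟨ρ k.succ, hne k⟩
  have hdet : (rows A (consRow r β)).det ≠ 0 := by
    rw [det_consRow A r hr]
    refine mul_ne_zero hr ?_
    have : rows (elimA A r) β = diagonal fun k => a k.succ := by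
      ext i j
      simp only [rows, of_apply, elimA, β, hρ, diagonal_apply, Pi.single_apply]
      simp [Fin.succ_ne_zero, eq_comm]
    rw [this, det_diagonal]
    exact Finset.prod_ne_zero_iff.2 fun k _ => ha _
  set v := (rows A (consRow r β))⁻¹ *ᵥ (b ∘ consRow r β)
  have hv : rows A (consRow r β) *ᵥ v = b ∘ consRow r β := by
    rw [mulVec_mulVec, mul_nonsing_inv _ (isUnit_iff_ne_zero.2 hdet), one_mulVec]
  have hvr : A r ⬝ᵥ v = b r := congrFun hv 0
  have hAs : A s = (A s 0 / A r 0) • A r := by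
    ext j
    refine Fin.cases ?_ (fun j => ?_) j
    · simp [hr]
    · have := congrFun e1 j
      simp only [elimA, Pi.zero_apply] at this
      simp; linarith
  refine h2 (consRow r β) v hdet hv s ?_ ?_
  · rintro ⟨i, hi⟩
    revert hi
    refine Fin.cases ?_ (fun k => ?_) i
    · intro hi; exact s.2 hi.symm
    · intro hi
      have hi' : ρ k.succ = s := hi
      have h0 : A s 0 = 0 := hi' ▸ hρ0 k
      have h4 : A s = 0 := by rw [hAs, h0]; simp
      have h5 := hρ k.succ
      rw [hi', h4] at h5
      have := congrFun h5 k.succ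
      simp at this
      exact ha _ this.symm
  · rw [hAs, smul_dotProduct, hvr]
    simp only [elimB] at e2
    simp; linarith

-- Fubini along coordinate `0`. On almost every line the integral is the difference of a primitive
-- at the two ends. The end on facet `r` contributes exactly for lines through the projection of
-- that facet, which is the polytope with constraints `elimA A r` and `elimB A b r`.
open Classical in
theorem integral_polytope_succ {ι : Type} [Fintype ι] {d : ℕ} (A : ι → Fin (d + 1) → ℝ) (b : ι → ℝ)
    (c : Fin (d + 1) → ℝ) (e : ℝ) (k : ℕ) (hc : c 0 ≠ 0)
    (hb : Bornology.IsBounded (polytope A b)) (h2 : Simple A b) (h3 : HasAxes A) :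
    ∫ x in polytope A b, (c ⬝ᵥ x + e) ^ k / k.factorial =
      ∑ r, if A r 0 ≠ 0 then (SignType.sign (A r 0) : ℝ) / c 0 *
        ∫ x in polytope (elimA A r) (elimB A b r),
          (elimC A c r ⬝ᵥ x + (e + c 0 / A r 0 * b r)) ^ (k + 1) / (k + 1).factorial else 0 := by
  set F : (Fin (d + 1) → ℝ) → ℝ := fun x => (c ⬝ᵥ x + e) ^ k / k.factorial with hF
  have hFc : Continuous F := by rw [hF]; unfold dotProduct; fun_prop
  have hint := integrableOn_polytope hb hFc
  have hmeas := (isClosed_polytope A b).measurableSet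
  rw [← integral_indicator hmeas]
  have hmp := (volume_preserving_piFinSuccAbove (fun _ : Fin (d + 1) => ℝ) 0).symm
  rw [← hmp.integral_comp', Measure.volume_eq_prod, integral_prod_symm]
  swap
  · have := (hint.integrable_indicator hmeas)
    exact (hmp.integrable_comp_emb (MeasurableEquiv.measurableEmbedding _)).2 this
  have hcons : ∀ (t : ℝ) (x : Fin d → ℝ),
      (MeasurableEquiv.piFinSuccAbove (fun _ : Fin (d + 1) => ℝ) 0).symm (t, x) =
        (Fin.cons t x : Fin (d + 1) → ℝ) := by
    intro t x
    ext i
    refine Fin.cases ?_ (fun i => ?_) i <;> simp [MeasurableEquiv.piFinSuccAbove]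
  have hslice : ∀ᵐ x : Fin d → ℝ, ∫ t : ℝ, (polytope A b).indicator F
      ((MeasurableEquiv.piFinSuccAbove (fun _ : Fin (d + 1) => ℝ) 0).symm (t, x)) =
      ∑ r, if A r 0 ≠ 0 then (SignType.sign (A r 0) : ℝ) / c 0 *
        (polytope (elimA A r) (elimB A b r)).indicator (fun x =>
          (elimC A c r ⬝ᵥ x + (e + c 0 / A r 0 * b r)) ^ (k + 1) / (k + 1).factorial) x else 0 := by
    -- Two constraints become tight at the same point only on a null set of lines; this gives
    -- hypothesis `hd` of `integral_constraints`.
    have hae : ∀ᵐ x : Fin d → ℝ, ∀ r, A r 0 ≠ 0 → ∀ s : {s // s ≠ r},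
        elimA A r s ⬝ᵥ x ≠ elimB A b r s := by
      rw [ae_all_iff]; intro r
      by_cases hr : A r 0 = 0
      · exact Eventually.of_forall fun x h => absurd hr h
      simp only [hr, ne_eq, not_false_eq_true, forall_true_left]
      rw [ae_all_iff]; intro s
      rw [ae_iff]
      simpa using volume_hyperplane _ _ (h2.elim_ne_zero h3 r hr s)
    filter_upwards [hae] with x hx
    set β : ι → ℝ := fun r => b r - (fun j => A r j.succ) ⬝ᵥ x with hβ
    set γ := (fun j => c j.succ) ⬝ᵥ x + e with hγ
    have hmem : ∀ t, (Fin.cons t x : Fin (d + 1) → ℝ) ∈ polytope A b ↔ ∀ r, A r 0 * t ≤ β r := by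
      intro t
      refine forall_congr' fun r => ?_
      rw [dotProduct_cons', hβ]; constructor <;> intro h <;> linarith
    have hbd : Bornology.IsBounded {t : ℝ | ∀ r, A r 0 * t ≤ β r} := by
      obtain ⟨C, hC⟩ := isBounded_iff_forall_norm_le.1 hb
      refine isBounded_iff_forall_norm_le.2 ⟨C, fun t ht => ?_⟩
      have h1 := hC _ ((hmem t).2 ht)
      exact (norm_le_pi_norm (Fin.cons t x : Fin (d + 1) → ℝ) 0).trans h1
    have hlift : ∀ r, liftPt A b r x = Fin.cons (β r / A r 0) x := fun r => rfl
    have hd : ∀ r s, r ≠ s → A r 0 ≠ 0 → A s 0 * (β r / A r 0) ≠ β s := by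
      intro r s hrs hr h
      refine hx r hr ⟨s, hrs.symm⟩ ?_
      have := dotProduct_liftPt A b r hr ⟨s, hrs.symm⟩ x
      rw [hlift, dotProduct_cons'] at this
      have h' : A s 0 * (β r / A r 0) = b s - (fun j => A s j.succ) ⬝ᵥ x := h
      simp only at this
      linarith
    have key := integral_constraints (fun r => A r 0) β hbd hd
      (fun t => (c 0 * t + γ) ^ (k + 1) / (k + 1).factorial / c 0)
      (fun t => (c 0 * t + γ) ^ k / k.factorial) (fun t => by
        have h1 : HasDerivAt (fun t => c 0 * t + γ) (c 0) t := by
          simpa using ((hasDerivAt_id t).const_mul (c 0)).add_const γ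
        have h2 := ((h1.pow (k + 1)).div_const ((k + 1).factorial : ℝ)).div_const (c 0)
        refine h2.congr_deriv ?_
        rw [Nat.factorial_succ]; push_cast
        have : (k.factorial : ℝ) ≠ 0 := by positivity
        have : (k : ℝ) + 1 ≠ 0 := by positivity
        field_simp) (by fun_prop)
    have hml : MeasurableSet {t : ℝ | ∀ r, A r 0 * t ≤ β r} := by
      have : {t : ℝ | ∀ r, A r 0 * t ≤ β r} = ⋂ r, {t | A r 0 * t ≤ β r} := by ext; simp
      rw [this]
      exact (isClosed_iInter fun r => isClosed_le (by fun_prop) continuous_const).measurableSet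
    rw [← integral_indicator hml] at key
    have e1 : ∀ t : ℝ, (polytope A b).indicator F
        ((MeasurableEquiv.piFinSuccAbove (fun _ : Fin (d + 1) => ℝ) 0).symm (t, x)) =
        {t : ℝ | ∀ r, A r 0 * t ≤ β r}.indicator (fun t => (c 0 * t + γ) ^ k / k.factorial) t := by
      intro t
      rw [hcons]
      by_cases ht : ∀ r, A r 0 * t ≤ β r
      · rw [Set.indicator_of_mem ((hmem t).2 ht), Set.indicator_of_mem (by exact ht), hF]
        simp only [dotProduct_cons', hγ, add_assoc]
      · rw [Set.indicator_of_notMem (fun h => ht ((hmem t).1 h)),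
          Set.indicator_of_notMem (by exact ht)]
    rw [integral_congr_ae (Eventually.of_forall e1), key]
    refine Finset.sum_congr rfl fun r _ => ?_
    by_cases hr : A r 0 = 0
    · simp [hr]
    have e2 : (∀ s, A s 0 * (β r / A r 0) ≤ β s) ↔ x ∈ polytope (elimA A r) (elimB A b r) := by
      rw [← hmem, ← liftPt_mem A b r hr x, hlift]
    rw [if_pos hr]
    by_cases hm : x ∈ polytope (elimA A r) (elimB A b r)
    · rw [if_pos ⟨hr, e2.2 hm⟩, Set.indicator_of_mem hm, elimC_dotProduct A b c r hr, hlift,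
        dotProduct_cons', hγ, add_assoc]
      ring
    · rw [if_neg fun h => hm (e2.1 h.2), Set.indicator_of_notMem hm, mul_zero]
  rw [integral_congr_ae hslice, integral_finsetSum]
  · refine Finset.sum_congr rfl fun r _ => ?_
    by_cases hr : A r 0 = 0
    · simp [hr]
    simp only [hr, ne_eq, not_false_eq_true, if_true]
    rw [integral_const_mul, integral_indicator (isClosed_polytope _ _).measurableSet]
  · intro r _
    by_cases hr : A r 0 = 0
    · simp [hr]
    simp only [hr, ne_eq, not_false_eq_true, if_true]
    refine Integrable.const_mul ?_ _
    refine IntegrableOn.integrable_indicator (integrableOn_polytope (isBounded_elim hb r hr) ?_)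
      (isClosed_polytope _ _).measurableSet
    unfold dotProduct; fun_prop

/-- The inductive hypothesis on the facets gives a sum over tuples with a distinguished first
constraint, weighted by `A r 0` times its coefficient in `c`, divided by `c 0`. By symmetry the
distinguished place may be any of the `d + 1` places. The weights over all places add up to one,
because coordinate `0` of `c` is the same combination of the coordinates `0` of the normals.
Averaging therefore turns `1 / d!` into `1 / (d + 1)!`. -/
theorem integral_polytope {d : ℕ} : ∀ {ι : Type} [Fintype ι] (A : ι → Fin d → ℝ)
    (b : ι → ℝ) (c : Fin d → ℝ) (e : ℝ) (k : ℕ), Bornology.IsBounded (polytope A b) →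
    GenericDir A c → Simple A b → HasAxes A →
    ∫ x in polytope A b, (c ⬝ᵥ x + e) ^ k / k.factorial =
      (∑ β : Fin d → ι, vertexTerm A b c e k β) / d.factorial := by
  classical
  induction d with
  | zero =>
    intro ι _ A b c e k _ _ _ _
    have hu : (volume : Measure (Fin 0 → ℝ)).real Set.univ = 1 := by
      simp [Measure.real, volume_pi]
    rw [Fintype.sum_unique]
    by_cases h : ∀ r, 0 ≤ b r
    · have : polytope A b = Set.univ := by ext x; simp [polytope, dotProduct, h]
      simp [vertexTerm, this, hu, dotProduct]
    · have : polytope A b = ∅ := by ext x; simpa [polytope, dotProduct] using h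
      simp [vertexTerm, this]
  | succ d ih =>
    intro ι _ A b c e k hb h1 h2 h3
    obtain ⟨ρ, a, ha, hρ, hρd⟩ := h3.exists_rows
    -- In terms of the axis rows `c` has the coefficients `c p / a p`, so genericity makes its
    -- coordinates nonzero.
    have hc : c 0 ≠ 0 := by
      have hy : (fun p => c p / a p) ᵥ* rows A ρ = c := by
        ext j
        simp only [vecMul, dotProduct, rows, of_apply, hρ, Pi.single_apply, mul_ite, mul_zero]
        rw [Finset.sum_ite_eq Finset.univ j, if_pos (Finset.mem_univ _), div_mul_cancel₀ _ (ha j)]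
      have := h1 ρ _ hρd hy 0
      intro h0; simp [h0] at this
    rw [integral_polytope_succ A b c e k hc hb h2 h3]
    have hstep : ∀ r, (if A r 0 ≠ 0 then (SignType.sign (A r 0) : ℝ) / c 0 *
        ∫ x in polytope (elimA A r) (elimB A b r),
          (elimC A c r ⬝ᵥ x + (e + c 0 / A r 0 * b r)) ^ (k + 1) / (k + 1).factorial else 0) =
        ∑ β : Fin d → ι, A r 0 * (c ᵥ* (rows A (Fin.cons r β))⁻¹) 0 *
          vertexTerm A b c e k (Fin.cons r β) / (c 0 * d.factorial) := by
      intro r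
      by_cases hr : A r 0 = 0
      · simp [hr]
      rw [if_pos hr, ih (elimA A r) (elimB A b r) (elimC A c r) (e + c 0 / A r 0 * b r) (k + 1)
        (isBounded_elim hb r hr)]
      -- Tuples that repeat `r` have determinant zero, so the sum may run over all tuples instead of
      -- those avoiding `r`.
      · have hz : ∀ β : Fin d → ι, β ∉ Set.range (fun (β : Fin d → {s // s ≠ r}) p => (β p : ι)) →
            A r 0 * (c ᵥ* (rows A (Fin.cons r β))⁻¹) 0 *
              vertexTerm A b c e k (Fin.cons r β) / (c 0 * d.factorial) = 0 := by
          intro β hβ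
          have : ∃ p, β p = r := by
            by_contra! hno
            exact hβ ⟨fun p => ⟨β p, hno p⟩, rfl⟩
          obtain ⟨p, hp⟩ := this
          have : (rows A (Fin.cons r β)).det = 0 := by
            refine det_zero_of_row_eq (i := 0) (j := p.succ) (Fin.succ_ne_zero p).symm ?_
            ext j; simp [rows, hp]
          simp [vertexTerm, this]
        rw [← Fintype.sum_of_injective (fun (β : Fin d → {s // s ≠ r}) p => (β p : ι)) _
          (fun β => A r 0 * (c ᵥ* (rows A (consRow r β))⁻¹) 0 *
              vertexTerm A b c e k (consRow r β) / (c 0 * d.factorial)) _ hz (fun β => rfl)]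
        · rw [Finset.sum_div, Finset.mul_sum]
          refine Finset.sum_congr rfl fun β _ => ?_
          rw [vertexTerm_elim A b c r hr e k β]
          · have : (SignType.sign (A r 0) : ℝ) * |A r 0| = A r 0 := by
              rcases lt_or_gt_of_ne hr with h | h
              · rw [sign_neg h, abs_of_neg h]; simp
              · rw [sign_pos h, abs_of_pos h]; simp
            conv_rhs => rw [← this]
            field_simp
          · intro hdet
            refine h1 (consRow r β) _ hdet ?_ 0
            rw [vecMul_vecMul, nonsing_inv_mul _ (isUnit_iff_ne_zero.2 hdet), vecMul_one]
        · intro β β' h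
          ext p
          exact congrFun h p
      · intro β y hdet hy p
        have h5 := h1 (consRow r β) _ (by rw [det_consRow A r hr]; exact mul_ne_zero hr hdet)
          (vecMul_consRow A c r hr β y hy) p.succ
        simpa using h5
      · intro β x hdet hx s hs hcon
        refine h2 (consRow r β) (liftPt A b r x)
          (by rw [det_consRow A r hr]; exact mul_ne_zero hr hdet)
          (mulVec_consRow A b r hr β x hx) s ?_ ?_
        · rintro ⟨i, hi⟩
          revert hi
          refine Fin.cases ?_ (fun p => ?_) i
          · intro hi; exact s.2 hi.symm
          · intro hi; exact hs ⟨p, Subtype.ext hi⟩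
        · linarith [dotProduct_liftPt A b r hr s x]
      · intro j
        have hρ0 : A (ρ j.succ) 0 = 0 := by rw [hρ]; simp
        refine ⟨⟨ρ j.succ, fun h => hr (h ▸ hρ0)⟩, a j.succ, ha _, ?_⟩
        ext i
        simp only [elimA, hρ]
        simp [Pi.single_apply]
    rw [Finset.sum_congr rfl fun r _ => hstep r]
    set G : (Fin (d + 1) → ι) → Fin (d + 1) → ℝ := fun β i =>
      A (β i) 0 * (c ᵥ* (rows A β)⁻¹) i * vertexTerm A b c e k β / (c 0 * d.factorial) with hG
    have e1 : ∑ r, ∑ β : Fin d → ι, A r 0 * (c ᵥ* (rows A (Fin.cons r β))⁻¹) 0 *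
          vertexTerm A b c e k (Fin.cons r β) / (c 0 * d.factorial) = ∑ β, G β 0 := by
      rw [← Fintype.sum_prod_type']
      exact Fintype.sum_equiv (Fin.consEquiv fun _ => ι) _ _ fun x => by
        simp [hG, Fin.consEquiv]
    have e2 : ∀ i, ∑ β, G β i = ∑ β, G β 0 := by
      intro i
      let s : Equiv.Perm (Fin (d + 1)) := Equiv.swap 0 i
      refine Fintype.sum_equiv (Equiv.arrowCongr s (Equiv.refl ι)) _ _ fun β => ?_
      have hβ : (Equiv.arrowCongr s (Equiv.refl ι)) β = β ∘ s := by
        ext p; simp [Equiv.arrowCongr, s]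
      simp only [hG, hβ, vertexTerm_perm, vecMul_inv_perm]
      simp [s]
    have e3 : ∀ β, ∑ i, G β i = vertexTerm A b c e k β / d.factorial := by
      intro β
      by_cases hdet : (rows A β).det = 0
      · simp [hG, vertexTerm, hdet]
      have hy : (c ᵥ* (rows A β)⁻¹) ᵥ* rows A β = c := by
        rw [vecMul_vecMul, nonsing_inv_mul _ (isUnit_iff_ne_zero.2 hdet), vecMul_one]
      have h0 : ∑ i, A (β i) 0 * (c ᵥ* (rows A β)⁻¹) i = c 0 := by
        conv_rhs => rw [← hy]
        simp [vecMul, dotProduct, rows, mul_comm]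
      simp only [hG]
      rw [← Finset.sum_div, ← Finset.sum_mul, h0]
      have : (d.factorial : ℝ) ≠ 0 := by positivity
      field_simp
    rw [e1]
    have e4 : (d + 1 : ℝ) * ∑ β, G β 0 = ∑ β, vertexTerm A b c e k β / d.factorial := by
      rw [← Finset.sum_congr rfl fun β _ => e3 β, Finset.sum_comm,
        Finset.sum_congr rfl fun i _ => e2 i]
      simp
    rw [← Finset.sum_div Finset.univ (fun β => vertexTerm A b c e k β)] at e4
    rw [Nat.factorial_succ]; push_cast
    have h7 : (d + 1 : ℝ) ≠ 0 := by positivity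
    rw [mul_comm ((d : ℝ) + 1), ← div_div, ← e4, mul_div_cancel_left₀ _ h7]

end PointSimplex

/-! ### Sums over subsets of constraints, and degenerate polytopes by perturbation -/

namespace PointSimplex

open Matrix Filter Topology

theorem det_rows_of_not_injective {ι : Type} {d : ℕ} (A : ι → Fin d → ℝ) (β : Fin d → ι)
    (h : ¬ Function.Injective β) : (rows A β).det = 0 := by
  simp only [Function.Injective, not_forall] at h
  obtain ⟨i, j, hij, hne⟩ := h
  exact det_zero_of_row_eq hne (by ext k; simp [rows, hij])

theorem exists_perm_of_range_eq {ι : Type} {d : ℕ} {β γ : Fin d → ι} (hβ : Function.Injective β)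
    (h : Set.range β ⊆ Set.range γ) : ∃ σ : Equiv.Perm (Fin d), β = γ ∘ σ := by
  have : ∀ p, ∃ q, γ q = β p := fun p => h ⟨p, rfl⟩
  choose f hf using this
  have hinj : Function.Injective f := fun a b hab => hβ (by rw [← hf, ← hf, hab])
  exact ⟨Equiv.ofBijective f (Finite.injective_iff_bijective.1 hinj), by
    ext p; simp [hf]⟩

/-- An injective tuple is one of the `d!` orderings of its image. This factor cancels the `d!` in
`integral_polytope`. -/
theorem sum_eq_sum_powersetCard {ι : Type} [Fintype ι] [DecidableEq ι] {d : ℕ}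
    (f : (Fin d → ι) → ℝ) (h0 : ∀ β, ¬ Function.Injective β → f β = 0)
    (hp : ∀ β (σ : Equiv.Perm (Fin d)), f (β ∘ σ) = f β) (E : Finset ι → Fin d → ι)
    (hE : ∀ B, B.card = d → Function.Injective (E B) ∧ Finset.univ.image (E B) = B) :
    ∑ β, f β = d.factorial * ∑ B ∈ Finset.univ.powersetCard d, f (E B) := by
  classical
  rw [← Finset.sum_filter_add_sum_filter_not Finset.univ fun β => Function.Injective β,
    Finset.sum_eq_zero (s := Finset.univ.filter fun β => ¬ Function.Injective β)
      (fun β hβ => h0 β (Finset.mem_filter.1 hβ).2), add_zero,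
    ← Finset.sum_fiberwise_of_maps_to (g := fun β : Fin d → ι => Finset.univ.image β)
      (t := Finset.univ.powersetCard d)]
  · rw [Finset.mul_sum]
    refine Finset.sum_congr rfl fun B hB => ?_
    have hBc := (Finset.mem_powersetCard.1 hB).2
    obtain ⟨hi, him⟩ := hE B hBc
    have : ∑ σ : Equiv.Perm (Fin d), f (E B ∘ σ) = d.factorial * f (E B) := by
      simp [hp, Fintype.card_perm]
    rw [← this]
    symm
    refine Finset.sum_bij (fun σ _ => E B ∘ σ) ?_ ?_ ?_ (fun _ _ => rfl)
    · intro σ _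
      simp only [Finset.mem_filter, Finset.mem_univ, true_and]
      refine ⟨hi.comp σ.injective, ?_⟩
      rw [← Finset.image_image, Finset.image_univ_equiv σ, him]
    · intro σ _ τ _ hst
      refine Equiv.ext fun p => hi ?_
      exact congrFun hst p
    · intro β hβ
      simp only [Finset.mem_filter, Finset.mem_univ, true_and] at hβ
      obtain ⟨σ, hσ⟩ := exists_perm_of_range_eq (γ := E B) hβ.1 (by
        have h1 : (Finset.univ.image β : Set ι) = (Finset.univ.image (E B) : Set ι) := by
          rw [hβ.2, him]
        simpa using h1.subset)
      exact ⟨σ, Finset.mem_univ _, hσ.symm⟩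
  · intro β hβ
    simp only [Finset.mem_filter, Finset.mem_univ, true_and] at hβ
    rw [Finset.mem_powersetCard]
    exact ⟨Finset.subset_univ _, by rw [Finset.card_image_of_injective _ hβ]; simp⟩

section perturbed
variable {ι : Type} {d : ℕ} (A : ι → Fin d → ℝ) (b : ι → ℝ) (c : Fin d → ℝ) (g : ι → ℝ)

/-- Slack of constraint `r` at the vertex of `β`. -/
def slack (β : Fin d → ι) (r : ι) : ℝ := b r - A r ⬝ᵥ ((rows A β)⁻¹ *ᵥ (b ∘ β))

/-- `β` causes no degeneracy when `b` is perturbed in direction `g`. -/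
def Good (β : Fin d → ι) : Prop :=
  (∀ p, (c ᵥ* (rows A β)⁻¹) p ≠ 0) ∧
    ∀ r, r ∉ Set.range β → slack A b β r ≠ 0 ∨ slack A g β r ≠ 0

/-- The vertex of `β` is feasible for small perturbations of `b` in direction `g`. -/
def Feasible (β : Fin d → ι) : Prop :=
  ∀ r, r ∉ Set.range β → 0 < slack A b β r ∨ (slack A b β r = 0 ∧ 0 < slack A g β r)

-- The limit of `vertexTerm` with `e = k = 0` as `b + ε • g` tends to `b` from `ε > 0`. Values are
-- taken at `ε = 0`, but which tuples count is still decided by the perturbed system.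
open Classical in
def subsetTerm (β : Fin d → ι) : ℝ :=
  if (rows A β).det ≠ 0 ∧ Feasible A b g β then
    (c ⬝ᵥ ((rows A β)⁻¹ *ᵥ (b ∘ β))) ^ d /
      (d.factorial * |(rows A β).det| * ∏ p, (c ᵥ* (rows A β)⁻¹) p)
  else 0

theorem slack_add_smul (β : Fin d → ι) (ε : ℝ) (r : ι) :
    slack A (b + ε • g) β r = slack A b β r + ε * slack A g β r := by
  have : (b + ε • g) ∘ β = b ∘ β + ε • (g ∘ β) := rfl
  simp only [slack, this, mulVec_add, mulVec_smul, dotProduct_add, dotProduct_smul, Pi.add_apply,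
    Pi.smul_apply, smul_eq_mul]
  ring

theorem slack_self (β : Fin d → ι) (hdet : (rows A β).det ≠ 0) (r : ι) (hr : r ∈ Set.range β) :
    slack A b β r = 0 := by
  obtain ⟨p, rfl⟩ := hr
  have : rows A β *ᵥ ((rows A β)⁻¹ *ᵥ (b ∘ β)) = b ∘ β := by
    rw [mulVec_mulVec, mul_nonsing_inv _ (isUnit_iff_ne_zero.2 hdet), one_mulVec]
  have h2 := congrFun this p
  have h3 : A (β p) ⬝ᵥ ((rows A β)⁻¹ *ᵥ (b ∘ β)) = b (β p) := h2
  rw [slack, h3, sub_self]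

theorem vertex_mem_iff (β : Fin d → ι) :
    (rows A β)⁻¹ *ᵥ (b ∘ β) ∈ polytope A b ↔ ∀ r, 0 ≤ slack A b β r :=
  forall_congr' fun r => by rw [slack, sub_nonneg]

/-- For small `ε > 0` the polytope with right-hand side `b + ε • g` is simple, so the vertex formula
applies to it. As `ε` decreases to `0` these polytopes shrink to the given one, since `0 ≤ g`, and
their volumes converge. In the formula the contributing subsets no longer change and every term is
continuous, even when several of them merge into one degenerate vertex. -/
theorem volume_polytope [Fintype ι] [DecidableEq ι] (hb : ∀ b, Bornology.IsBounded (polytope A b))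
    (hA : HasAxes A) (hg : ∀ r, 0 ≤ g r) (E : Finset ι → Fin d → ι)
    (hE : ∀ B, B.card = d → Function.Injective (E B) ∧ Finset.univ.image (E B) = B)
    (hgood : ∀ B, B.card = d → (rows A (E B)).det ≠ 0 → Good A b c g (E B)) :
    volume.real (polytope A b) = ∑ B ∈ Finset.univ.powersetCard d, subsetTerm A b c g (E B) := by
  classical
  have hperm : ∀ β : Fin d → ι, (rows A β).det ≠ 0 → ∃ B, ∃ σ : Equiv.Perm (Fin d), B.card = d ∧
      E B = β ∘ σ ∧ Set.range (E B) = Set.range β ∧ (rows A (E B)).det ≠ 0 := by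
    intro β hdet
    have hinj : Function.Injective β := by
      by_contra h; exact hdet (det_rows_of_not_injective A β h)
    have hc : (Finset.univ.image β).card = d := by
      rw [Finset.card_image_of_injective _ hinj]; simp
    obtain ⟨h1, h2⟩ := hE _ hc
    have hr : Set.range (E (Finset.univ.image β)) = Set.range β := by
      have h3 : (Finset.univ.image (E (Finset.univ.image β)) : Set ι) = (Finset.univ.image β : Set ι) := by
        rw [h2]
      simpa using h3
    obtain ⟨σ, hσ⟩ := exists_perm_of_range_eq h1 hr.subset
    refine ⟨_, σ, hc, hσ, hr, ?_⟩
    rw [hσ]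
    have : (rows A (β ∘ σ)).det = _ := Matrix.det_permute σ (rows A β)
    rw [this]
    refine mul_ne_zero ?_ hdet
    rcases Int.units_eq_one_or (Equiv.Perm.sign σ) with h | h <;> simp [h]
  have hdir : GenericDir A c := by
    intro β y hdet hy p
    obtain ⟨B, σ, hBc, hσ, -, hd⟩ := hperm β hdet
    have h1 := (hgood B hBc hd).1 (σ.symm p)
    rw [hσ, vecMul_inv_perm] at h1
    rw [eq_vecMul_inv hdet hy]
    simpa using h1
  -- A slack is affine in `ε`, so near `0` its sign is that of its value at `0`, or of its slope if
  -- this value vanishes.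
  have hsimple : ∀ᶠ ε : ℝ in 𝓝[>] 0, ∀ B r, B.card = d → (rows A (E B)).det ≠ 0 →
      r ∉ Set.range (E B) → (slack A (b + ε • g) (E B) r ≠ 0 ∧
      (0 < slack A (b + ε • g) (E B) r ↔
        (0 < slack A b (E B) r ∨ (slack A b (E B) r = 0 ∧ 0 < slack A g (E B) r)))) := by
    rw [eventually_all]; intro B
    rw [eventually_all]; intro r
    by_cases hBc : B.card = d
    swap
    · exact Eventually.of_forall fun _ h => absurd h hBc
    by_cases hd : (rows A (E B)).det = 0
    · exact Eventually.of_forall fun _ _ h => absurd hd h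
    by_cases hr : r ∈ Set.range (E B)
    · exact Eventually.of_forall fun _ _ _ h => absurd hr h
    have hor := (hgood B hBc hd).2 r hr
    set s0 := slack A b (E B) r
    set s1 := slack A g (E B) r
    have hlim : Tendsto (fun ε : ℝ => s0 + ε * s1) (𝓝[>] 0) (𝓝 s0) := by
      have : Tendsto (fun ε : ℝ => s0 + ε * s1) (𝓝 0) (𝓝 (s0 + 0 * s1)) :=
        (by fun_prop : Continuous fun ε : ℝ => s0 + ε * s1).tendsto 0
      simpa using this.mono_left nhdsWithin_le_nhds
    rcases lt_trichotomy s0 0 with h | h | h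
    · filter_upwards [hlim.eventually_lt_const h] with ε hε _ _ _
      rw [slack_add_smul]
      exact ⟨hε.ne, ⟨fun h' => absurd h' hε.not_gt, fun h' => by
        rcases h' with h' | h'
        · exact absurd h' h.not_gt
        · exact absurd h'.1 h.ne⟩⟩
    · have h1 : s1 ≠ 0 := hor.resolve_left fun h' => h' h
      filter_upwards [self_mem_nhdsWithin] with ε hε _ _ _
      have hε' : 0 < ε := hε
      rw [slack_add_smul]
      change s0 + ε * s1 ≠ 0 ∧ (0 < s0 + ε * s1 ↔ _)
      rw [h, zero_add]
      exact ⟨mul_ne_zero hε'.ne' h1, by simp [hε']⟩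
    · filter_upwards [hlim.eventually_const_lt h] with ε hε _ _ _
      rw [slack_add_smul]
      exact ⟨hε.ne', ⟨fun _ => Or.inl h, fun _ => hε⟩⟩
  have hvol : ∀ᶠ ε : ℝ in 𝓝[>] 0, volume.real (polytope A (b + ε • g)) =
      ∑ B ∈ Finset.univ.powersetCard d, if (rows A (E B)).det ≠ 0 ∧ Feasible A b g (E B) then
        (c ⬝ᵥ ((rows A (E B))⁻¹ *ᵥ ((b + ε • g) ∘ E B))) ^ d /
          (d.factorial * |(rows A (E B)).det| * ∏ p, (c ᵥ* (rows A (E B))⁻¹) p) else 0 := by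
    filter_upwards [hsimple] with ε hε
    have hs : Simple A (b + ε • g) := by
      intro β x hdet hx r hr
      obtain ⟨B, σ, hBc, hσ, hran, hd⟩ := hperm β hdet
      have h1 := (hε B r hBc hd (by rwa [hran])).1
      have h2 : x = (rows A (E B))⁻¹ *ᵥ ((b + ε • g) ∘ E B) := by
        refine eq_inv_mulVec hd ?_
        ext p
        rw [hσ]
        exact congrFun hx (σ p)
      rw [slack, ← h2] at h1
      intro h; exact h1 (by rw [h, sub_self])
    have h1 := integral_polytope A (b + ε • g) c 0 0 (hb _) hdir hs hA
    rw [sum_eq_sum_powersetCard (fun β => vertexTerm A (b + ε • g) c 0 0 β)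
      (fun β hβ => by simp [vertexTerm, det_rows_of_not_injective A β hβ])
      (fun β σ => vertexTerm_perm A _ c 0 0 β σ) E hE] at h1
    have hf : (d.factorial : ℝ) ≠ 0 := by positivity
    rw [mul_div_cancel_left₀ _ hf] at h1
    have h2 : ∫ x in polytope A (b + ε • g), (c ⬝ᵥ x + 0) ^ 0 / (Nat.factorial 0 : ℝ) =
        volume.real (polytope A (b + ε • g)) := by simp
    rw [← h2, h1]
    refine Finset.sum_congr rfl fun B hB => ?_
    have hBc := (Finset.mem_powersetCard.1 hB).2
    by_cases hd : (rows A (E B)).det = 0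
    · simp [vertexTerm, hd]
    have hfe : (rows A (E B))⁻¹ *ᵥ ((b + ε • g) ∘ E B) ∈ polytope A (b + ε • g) ↔
        Feasible A b g (E B) := by
      rw [vertex_mem_iff]
      constructor
      · intro h r hr
        have h3 := hε B r hBc hd hr
        exact h3.2.1 (lt_of_le_of_ne (h r) h3.1.symm)
      · intro h r
        by_cases hr : r ∈ Set.range (E B)
        · rw [slack_self A _ _ hd r hr]
        · exact ((hε B r hBc hd hr).2.2 (h r hr)).le
    by_cases hF : Feasible A b g (E B)
    · rw [vertexTerm, if_pos ⟨hd, hfe.2 hF⟩, if_pos ⟨hd, hF⟩]; simp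
    · rw [vertexTerm, if_neg fun h => hF (hfe.1 h.2), if_neg fun h => hF h.2]
  have hlim1 : Tendsto (fun ε : ℝ => volume.real (polytope A (b + ε • g))) (𝓝[>] 0)
      (𝓝 (volume.real (polytope A b))) := by
    have h1 := tendsto_measure_biInter_gt (μ := (volume : Measure (Fin d → ℝ)))
      (s := fun ε : ℝ => polytope A (b + ε • g)) (a := 0)
      (fun r _ => (isClosed_polytope _ _).measurableSet.nullMeasurableSet)
      (fun i j _ hij x hx r => (hx r).trans (by
        have := mul_le_mul_of_nonneg_right hij (hg r)
        simpa using this))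
      ⟨1, one_pos, (hb _).measure_lt_top.ne⟩
    have h2 : ⋂ r : ℝ, ⋂ (_ : r > 0), polytope A (b + r • g) = polytope A b := by
      ext x
      simp only [Set.mem_iInter]
      constructor
      · intro h r
        refine le_of_forall_pos_le_add fun η hη => ?_
        have hpos : 0 < g r + 1 := by linarith [hg r]
        have h3 := h (η / (g r + 1)) (by positivity) r
        have h4 : η / (g r + 1) * g r ≤ η := by
          rw [div_mul_eq_mul_div, div_le_iff₀ hpos]; nlinarith
        simp only [Pi.add_apply, Pi.smul_apply, smul_eq_mul] at h3
        linarith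
      · intro h ε hε r
        refine (h r).trans ?_
        have := mul_nonneg hε.le (hg r)
        simpa using this
    rw [h2] at h1
    exact (ENNReal.tendsto_toReal (hb b).measure_lt_top.ne).comp h1
  refine tendsto_nhds_unique hlim1 (Tendsto.congr' (hvol.mono fun ε h => h.symm) ?_)
  refine tendsto_finsetSum _ fun B _ => ?_
  unfold subsetTerm
  by_cases h : (rows A (E B)).det ≠ 0 ∧ Feasible A b g (E B)
  · simp only [if_pos h]
    refine Tendsto.div_const (Tendsto.pow ?_ _) _
    have hcont : Continuous fun ε : ℝ => c ⬝ᵥ ((rows A (E B))⁻¹ *ᵥ ((b + ε • g) ∘ E B)) := by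
      simp only [dotProduct, mulVec, Function.comp_apply, Pi.add_apply, Pi.smul_apply, smul_eq_mul]
      fun_prop
    have := hcont.tendsto 0
    simp only [zero_smul, add_zero] at this
    exact this.mono_left nhdsWithin_le_nhds
  · simp only [if_neg h]
    exact tendsto_const_nhds

end perturbed

/-! ### Codes of subsets, and the number of degenerate parameters on the moment curve -/

/-- The subset of `Fin R` coded by the binary digits of `code`. -/
def codeSet (R code : ℕ) : Finset (Fin R) := Finset.univ.filter fun r => code.testBit r

theorem codeSet_injOn (R : ℕ) {a b : ℕ} (ha : a < 2 ^ R) (hb : b < 2 ^ R)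
    (hab : codeSet R a = codeSet R b) : a = b := by
  refine Nat.eq_of_testBit_eq fun i => ?_
  by_cases hi : i < R
  · have := Finset.ext_iff.1 hab ⟨i, hi⟩
    simp only [codeSet, Finset.mem_filter, Finset.mem_univ, true_and] at this
    exact Bool.eq_iff_iff.2 this
  · have h2 : 2 ^ R ≤ 2 ^ i := Nat.pow_le_pow_right two_pos (not_lt.1 hi)
    rw [Nat.testBit_lt_two_pow (ha.trans_le h2), Nat.testBit_lt_two_pow (hb.trans_le h2)]

theorem sum_codeSet (R : ℕ) (f : Finset (Fin R) → ℝ) :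
    ∑ code ∈ Finset.range (2 ^ R), f (codeSet R code) = ∑ B : Finset (Fin R), f B := by
  rw [Finset.sum_range fun code => f (codeSet R code)]
  have hbij : Function.Bijective fun code : Fin (2 ^ R) => codeSet R code := by
    rw [Fintype.bijective_iff_injective_and_card]
    exact ⟨fun a b hab => Fin.ext (codeSet_injOn R a.2 b.2 hab), by simp⟩
  exact Fintype.sum_bijective _ hbij _ _ fun _ => rfl

theorem volume_polytope_code {R d : ℕ} (A : Fin R → Fin d → ℝ) (b : Fin R → ℝ) (c : Fin d → ℝ)
    (g : Fin R → ℝ) (hb : ∀ b, Bornology.IsBounded (polytope A b))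
    (hA : HasAxes A) (hg : ∀ r, 0 ≤ g r) (E : ℕ → Fin d → Fin R)
    (hE : ∀ code, (codeSet R code).card = d →
      Function.Injective (E code) ∧ Finset.univ.image (E code) = codeSet R code)
    (hgood : ∀ code < 2 ^ R, (codeSet R code).card = d → (rows A (E code)).det ≠ 0 →
      Good A b c g (E code)) :
    volume.real (polytope A b) = ∑ code ∈ Finset.range (2 ^ R),
      if (codeSet R code).card = d then subsetTerm A b c g (E code) else 0 := by
  classical
  have hsurj : ∀ B : Finset (Fin R), ∃ code < 2 ^ R, codeSet R code = B := by
    intro B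
    by_contra! hno
    have := sum_codeSet R fun B' => if B' = B then 1 else 0
    rw [Finset.sum_eq_zero] at this
    · simp at this
    · intro code hc
      exact if_neg (hno code (Finset.mem_range.1 hc))
  choose κ hκ hκ' using hsurj
  have hκκ : ∀ code < 2 ^ R, κ (codeSet R code) = code :=
    fun code h => codeSet_injOn R (hκ _) h (hκ' _)
  rw [volume_polytope A b c g hb hA hg (fun B => E (κ B))
    (fun B hB => by
      have := hE (κ B) (by rw [hκ', hB])
      rwa [hκ'] at this)
    (fun B hB => hgood (κ B) (hκ B) (by rw [hκ', hB]))]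
  rw [← Finset.univ_filter_card_eq, Finset.sum_filter,
    ← sum_codeSet R fun B => if B.card = d then subsetTerm A b c g (E (κ B)) else 0]
  refine Finset.sum_congr rfl fun code h => ?_
  rw [hκκ code (Finset.mem_range.1 h)]

theorem card_roots_le {q : Polynomial ℝ} (hq : q ≠ 0) {N : ℕ} (hN : q.natDegree ≤ N) (T : Finset ℕ)
    (hT : ∀ t ∈ T, q.eval (t : ℝ) = 0) : T.card ≤ N := by
  have h1 : T.image (fun t : ℕ => (t : ℝ)) ⊆ q.roots.toFinset := by
    intro x hx
    obtain ⟨t, ht, rfl⟩ := Finset.mem_image.1 hx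
    rw [Multiset.mem_toFinset, Polynomial.mem_roots hq]
    exact hT t ht
  calc T.card = (T.image (fun t : ℕ => (t : ℝ))).card :=
        (Finset.card_image_of_injective _ Nat.cast_injective).symm
    _ ≤ q.roots.toFinset.card := Finset.card_le_card h1
    _ ≤ q.roots.card := Multiset.toFinset_card_le _
    _ ≤ N := q.card_roots'.trans hN

/-- Few members of the moment curve are degenerate. -/
theorem card_not_good_le {R d : ℕ} (A : Fin R → Fin d → ℝ) (b : Fin R → ℝ) (β : Fin d → Fin R)
    (hdet : (rows A β).det ≠ 0) (T : Finset ℕ)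
    (hT : ∀ t ∈ T, ¬ Good A b (fun k => (t : ℝ) ^ (k : ℕ)) (fun r => (t : ℝ) ^ (r : ℕ)) β) :
    T.card ≤ d * d + R * R := by
  classical
  set M := (rows A β)⁻¹ with hM
  -- With `c` and `g` on the moment curve, coefficients and slacks are polynomials in `t`. `q1 p` is
  -- nonzero because its coefficients form a column of an invertible matrix. `q2 r` is nonzero
  -- because `r ∉ Set.range β` leaves coefficient `1` at `X ^ r`. Degrees at most `d` and `R` give
  -- the two summands of the bound.
  let q1 : Fin d → Polynomial ℝ := fun p => ∑ k : Fin d, Polynomial.C (M k p) * Polynomial.X ^ (k : ℕ)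
  let q2 : Fin R → Polynomial ℝ := fun r => Polynomial.X ^ (r : ℕ) -
    ∑ p : Fin d, Polynomial.C ((A r ᵥ* M) p) * Polynomial.X ^ (β p : ℕ)
  have hsub : T ⊆ (Finset.univ.biUnion fun p => T.filter fun t : ℕ => (q1 p).eval (t : ℝ) = 0) ∪
      (Finset.univ.biUnion fun r => T.filter fun t : ℕ => r ∉ Set.range β ∧ (q2 r).eval (t : ℝ) = 0) := by
    intro t ht
    have := hT t ht
    rw [Good, not_and_or] at this
    push Not at this
    rcases this with ⟨p, hp⟩ | ⟨r, hr, -, hs⟩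
    · refine Finset.mem_union_left _ (Finset.mem_biUnion.2 ⟨p, Finset.mem_univ _,
        Finset.mem_filter.2 ⟨ht, ?_⟩⟩)
      rw [← hp]
      simp only [q1, Polynomial.eval_finsetSum, Polynomial.eval_mul, Polynomial.eval_C,
        Polynomial.eval_pow, Polynomial.eval_X, vecMul, dotProduct]
      exact Finset.sum_congr rfl fun k _ => mul_comm _ _
    · refine Finset.mem_union_right _ (Finset.mem_biUnion.2 ⟨r, Finset.mem_univ _,
        Finset.mem_filter.2 ⟨ht, hr, ?_⟩⟩)
      rw [← hs, slack, dotProduct_mulVec]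
      simp [q2, Polynomial.eval_finsetSum, hM, dotProduct]
  refine (Finset.card_le_card hsub).trans ((Finset.card_union_le _ _).trans (add_le_add ?_ ?_))
  · refine (Finset.card_biUnion_le_card_mul _ _ d fun p _ => ?_).trans (by simp)
    refine card_roots_le (q := q1 p) ?_ ?_ _ fun t ht => (Finset.mem_filter.1 ht).2
    · intro h0
      have hcol : ∀ k : Fin d, M k p = 0 := by
        intro k
        have := congrArg (fun q => Polynomial.coeff q (k : ℕ)) h0
        simpa [q1, Polynomial.finsetSum_coeff, Polynomial.coeff_C_mul, Polynomial.coeff_X_pow,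
          Fin.val_inj] using this
      have h1 : (rows A β * M) p p = 1 := by
        rw [hM, mul_nonsing_inv _ (isUnit_iff_ne_zero.2 hdet)]; simp
      simp [Matrix.mul_apply, hcol] at h1
    · refine Polynomial.natDegree_sum_le_of_forall_le _ _ fun k _ => ?_
      exact (Polynomial.natDegree_C_mul_X_pow_le _ _).trans k.2.le
  · refine (Finset.card_biUnion_le_card_mul _ _ R fun r _ => ?_).trans (by simp)
    by_cases hr : r ∈ Set.range β
    · rw [Finset.filter_eq_empty_iff.2 fun t _ h => h.1 hr]; simp
    refine card_roots_le (q := q2 r) ?_ ?_ _ fun t ht => (Finset.mem_filter.1 ht).2.2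
    · intro h0
      have := congrArg (fun q => Polynomial.coeff q (r : ℕ)) h0
      have h2 : ∀ p, (r : ℕ) ≠ β p := fun p h => hr ⟨p, (Fin.ext h).symm⟩
      simp [q2, Polynomial.coeff_C_mul, Polynomial.coeff_X_pow, h2] at this
    · refine (Polynomial.natDegree_sub_le _ _).trans (max_le ?_ ?_)
      · simp [r.2.le]
      · refine Polynomial.natDegree_sum_le_of_forall_le _ _ fun k _ => ?_
        exact (Polynomial.natDegree_C_mul_X_pow_le _ _).trans (β k).2.le

/-- Among any larger number of parameters one is good for all subsets at once, so the program can
search by a loop of known length. -/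
theorem card_bad_le {R d : ℕ} (A : Fin R → Fin d → ℝ) (b : Fin R → ℝ) (E : ℕ → Fin d → Fin R)
    (T : Finset ℕ) (hT : ∀ t ∈ T, ∃ code < 2 ^ R, (rows A (E code)).det ≠ 0 ∧
      ¬ Good A b (fun k => (t : ℝ) ^ (k : ℕ)) (fun r => (t : ℝ) ^ (r : ℕ)) (E code)) :
    T.card ≤ 2 ^ R * (d * d + R * R) := by
  classical
  have hsub : T ⊆ (Finset.range (2 ^ R)).biUnion fun code => T.filter fun t =>
      (rows A (E code)).det ≠ 0 ∧
      ¬ Good A b (fun k => (t : ℝ) ^ (k : ℕ)) (fun r => (t : ℝ) ^ (r : ℕ)) (E code) := by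
    intro t ht
    obtain ⟨code, h1, h2⟩ := hT t ht
    exact Finset.mem_biUnion.2 ⟨code, Finset.mem_range.2 h1, Finset.mem_filter.2 ⟨ht, h2⟩⟩
  refine (Finset.card_le_card hsub).trans
    ((Finset.card_biUnion_le_card_mul _ _ (d * d + R * R) fun code _ => ?_).trans (by simp))
  by_cases hdet : (rows A (E code)).det = 0
  · simp [hdet]
  · exact card_not_good_le A b (E code) hdet _ fun t ht => (Finset.mem_filter.1 ht).2.2

end PointSimplex

namespace PointSimplex

open Matrix Filter Topology

/-! ## The Faddeev–LeVerrier algorithm -/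

/-- Jacobi's formula. Differentiating the Leibniz expansion gives determinants with one column
replaced, which Cramer's rule expresses by the adjugate. -/
theorem derivative_det {n : Type*} [Fintype n] [DecidableEq n] {R : Type*} [CommRing R]
    (M : Matrix n n (Polynomial R)) :
    Polynomial.derivative M.det = (M.adjugate * M.map Polynomial.derivative).trace := by
  have h1 : ∀ i, (M.adjugate * M.map Polynomial.derivative) i i =
      (M.updateCol i fun k => Polynomial.derivative (M k i)).det := by
    intro i
    rw [← cramer_apply, cramer_eq_adjugate_mulVec]
    simp [Matrix.mul_apply, mulVec, dotProduct]
  simp only [trace, diag_apply, h1, det_apply]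
  rw [Polynomial.derivative_sum, Finset.sum_comm]
  refine Finset.sum_congr rfl fun σ _ => ?_
  rw [Units.smul_def, Polynomial.derivative_smul, Polynomial.derivative_prod_finset, Finset.smul_sum]
  refine Finset.sum_congr rfl fun i _ => ?_
  rw [Units.smul_def]
  congr 1
  rw [← Finset.prod_erase_mul _ _ (Finset.mem_univ i)]
  congr 1
  · refine Finset.prod_congr rfl fun j hj => ?_
    rw [updateCol_ne (Finset.ne_of_mem_erase hj)]
  · simp

/-- The matrices of the Faddeev–LeVerrier algorithm. -/
def flX {d : ℕ} (A : Matrix (Fin d) (Fin d) ℝ) : ℕ → Matrix (Fin d) (Fin d) ℝ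
  | 0 => 1
  | k + 1 => A * flX A k + (-(A * flX A k).trace / (k + 1)) • (1 : Matrix (Fin d) (Fin d) ℝ)

def flq {d : ℕ} (A : Matrix (Fin d) (Fin d) ℝ) (k : ℕ) : ℝ := -(A * flX A k).trace / (k + 1)

/-- Let `N j` be the coefficient matrices of the adjugate of `X - A`, and `p` the characteristic
polynomial. Comparing coefficients in the product of `X - A` with its adjugate gives `N j = A * N (j
+ 1) + p.coeff (j + 1) • 1`. Jacobi's formula gives the trace of `N j` as `(j + 1) * p.coeff (j +
1)`. Together these are the recursion of `flX`, so `flX A k = N (d - k)`. The coefficients at `0`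
then give `A * N 0 = -p.coeff 0 • 1`, and `p.coeff 0` is the determinant up to sign. -/
theorem flX_last {d : ℕ} (A : Matrix (Fin (d + 1)) (Fin (d + 1)) ℝ) :
    A * flX A d = (-flq A d) • (1 : Matrix (Fin (d + 1)) (Fin (d + 1)) ℝ) ∧
      |flq A d| = |A.det| := by
  set adj := (charmatrix A).adjugate with hadj
  let N : ℕ → Matrix (Fin (d + 1)) (Fin (d + 1)) ℝ := fun j => of fun a b => (adj a b).coeff j
  set p := A.charpoly with hp
  have hmul : charmatrix A * adj = p • (1 : Matrix _ _ (Polynomial ℝ)) := by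
    rw [hadj, mul_adjugate]; rfl
  have hent : ∀ a b, (Polynomial.X * adj a b - ∑ k, Polynomial.C (A a k) * adj k b) =
      p * (1 : Matrix (Fin (d + 1)) (Fin (d + 1)) (Polynomial ℝ)) a b := by
    intro a b
    have := congrFun (congrFun hmul a) b
    rw [Matrix.smul_apply, smul_eq_mul] at this
    rw [← this, charmatrix, sub_mul, Matrix.sub_apply]
    congr 1
    · simp [Matrix.mul_apply, scalar_apply, diagonal_apply]
  have hrec : ∀ j, N j = A * N (j + 1) + p.coeff (j + 1) • (1 : Matrix _ _ ℝ) := by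
    intro j
    ext a b
    have := congrArg (fun q => Polynomial.coeff q (j + 1)) (hent a b)
    simp only [Polynomial.coeff_sub, Polynomial.coeff_X_mul, Polynomial.finsetSum_coeff,
      Polynomial.coeff_C_mul] at this
    have h1 : (p * (1 : Matrix (Fin (d + 1)) (Fin (d + 1)) (Polynomial ℝ)) a b).coeff (j + 1) =
        p.coeff (j + 1) * (1 : Matrix (Fin (d + 1)) (Fin (d + 1)) ℝ) a b := by
      by_cases hab : a = b <;> simp [hab, Matrix.one_apply]
    rw [h1] at this
    simp only [N, of_apply, Matrix.add_apply, Matrix.mul_apply, Matrix.smul_apply, smul_eq_mul]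
    linarith
  have hzero : A * N 0 = (-p.coeff 0) • (1 : Matrix _ _ ℝ) := by
    ext a b
    have := congrArg (fun q => Polynomial.coeff q 0) (hent a b)
    simp only [Polynomial.coeff_sub, Polynomial.finsetSum_coeff, Polynomial.mul_coeff_zero,
      Polynomial.coeff_X_zero, zero_mul, Polynomial.coeff_C_zero] at this
    have h1 : ((1 : Matrix (Fin (d + 1)) (Fin (d + 1)) (Polynomial ℝ)) a b).coeff 0 =
        (1 : Matrix (Fin (d + 1)) (Fin (d + 1)) ℝ) a b := by
      by_cases hab : a = b <;> simp [hab, Matrix.one_apply]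
    rw [h1] at this
    simp only [N, of_apply, Matrix.mul_apply, Matrix.smul_apply, smul_eq_mul]
    linarith
  have hdeg : p.natDegree = d + 1 := by rw [hp, charpoly_natDegree_eq_dim]; simp
  -- The recursion runs downwards. It is started beyond all degrees in the adjugate, and above its
  -- own degree `p` contributes nothing.
  have hvan : ∀ j, d + 1 ≤ j → N j = 0 := by
    obtain ⟨J, hJ⟩ : ∃ J, ∀ j, J ≤ j → N j = 0 := by
      let D : Fin (d + 1) → Fin (d + 1) → ℕ := fun a b => (adj a b).natDegree
      refine ⟨(∑ a, ∑ b, D a b) + 1, fun j hj => ?_⟩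
      ext a b
      suffices (adj a b).natDegree < j from Polynomial.coeff_eq_zero_of_natDegree_lt this
      have h1 : D a b ≤ ∑ b, D a b := Finset.single_le_sum
        (fun _ _ => Nat.zero_le _) (Finset.mem_univ b)
      have h2 : ∑ b, D a b ≤ ∑ a, ∑ b, D a b := Finset.single_le_sum (f := fun a => ∑ b, D a b)
        (fun _ _ => Nat.zero_le _) (Finset.mem_univ a)
      have h3 : (adj a b).natDegree = D a b := rfl
      omega
    have : ∀ i j, d + 1 ≤ j → J ≤ i + j → N j = 0 := by
      intro i
      induction i with
      | zero => intro j _ h; exact hJ j (by omega)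
      | succ i ih =>
        intro j hj h
        rw [hrec, ih (j + 1) (by omega) (by omega),
          Polynomial.coeff_eq_zero_of_natDegree_lt (by omega)]
        simp
    intro j hj
    exact this J j hj (by omega)
  have htr : ∀ j, (N j).trace = p.coeff (j + 1) * (j + 1) := by
    intro j
    have h1 := derivative_det (charmatrix A)
    have h2 : (charmatrix A).map Polynomial.derivative = 1 := by
      ext a b
      by_cases hab : a = b
      · subst hab; simp [charmatrix_apply_eq]
      · simp [hab]
    rw [h2, mul_one] at h1
    have h3 := congrArg (fun q => Polynomial.coeff q j) h1
    have h4 : (charmatrix A).det = p := rfl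
    simp only [h4, Polynomial.coeff_derivative] at h3
    rw [h3]
    simp [trace, N, Polynomial.finsetSum_coeff, hadj]
  have htr' : ∀ j, (A * N (j + 1)).trace = -((d : ℝ) - j) * p.coeff (j + 1) := by
    intro j
    have h1 := htr j
    rw [hrec, trace_add, trace_smul, trace_one] at h1
    simp only [Fintype.card_fin, smul_eq_mul] at h1
    push_cast at h1
    linarith
  have hmain : ∀ k, k ≤ d → flX A k = N (d - k) := by
    intro k
    induction k with
    | zero =>
      intro _
      rw [flX, hrec, Nat.sub_zero, hvan (d + 1) le_rfl]
      have : p.coeff (d + 1) = 1 := by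
        rw [← hdeg]; exact (charpoly_monic A)
      simp [this]
    | succ k ih =>
      intro hk
      obtain ⟨j, rfl⟩ : ∃ j, d = j + (k + 1) := ⟨d - (k + 1), by omega⟩
      have e1 : j + (k + 1) - k = j + 1 := by omega
      have e2 : j + (k + 1) - (k + 1) = j := by omega
      rw [flX, ih (by omega), e1, e2, htr', hrec j]
      congr 2
      push_cast
      have : (k : ℝ) + 1 ≠ 0 := by positivity
      field_simp
      ring
  have hq : flq A d = p.coeff 0 := by
    have hd1 : (d : ℝ) + 1 ≠ 0 := by positivity
    rw [flq, hmain d le_rfl, Nat.sub_self, hzero, trace_smul, trace_one]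
    simp only [Fintype.card_fin, smul_eq_mul]
    push_cast
    field_simp
  refine ⟨by rw [hmain d le_rfl, Nat.sub_self, hzero, hq], ?_⟩
  rw [hq, det_eq_sign_charpoly_coeff, abs_mul]
  simp [hp]

theorem flX_inv {d : ℕ} (A : Matrix (Fin (d + 1)) (Fin (d + 1)) ℝ) (h : flq A d ≠ 0) :
    A⁻¹ = (-(flq A d)⁻¹) • flX A d := by
  refine inv_eq_right_inv ?_
  rw [Matrix.mul_smul, (flX_last A).1, smul_smul]
  simp [h]

theorem flq_eq_zero_iff {d : ℕ} (A : Matrix (Fin (d + 1)) (Fin (d + 1)) ℝ) :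
    flq A d = 0 ↔ A.det = 0 := by
  rw [← abs_eq_zero, (flX_last A).2, abs_eq_zero]

end PointSimplex

namespace PointSimplex

/-! ## Simplices and cubes -/

theorem isCompact_solid {d : ℕ} (s : Affine.Simplex ℝ (E d) d) : IsCompact (solid s) :=
  (Set.finite_range s.points).isCompact_convexHull (𝕜 := ℝ)

theorem measurableSet_solid {d : ℕ} (s : Affine.Simplex ℝ (E d) d) : MeasurableSet (solid s) :=
  (isCompact_solid s).isClosed.measurableSet

theorem volume_solid_pos {d : ℕ} (s : Affine.Simplex ℝ (E d) d) : 0 < volume.real (solid s) := by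
  have h1 : affineSpan ℝ (Set.range s.points) = ⊤ := by
    rw [s.independent.affineSpan_eq_top_iff_card_eq_finrank_add_one]; simp
  have h2 : (interior (solid s)).Nonempty := interior_convexHull_nonempty_iff_affineSpan_eq_top.2 h1
  have h3 : 0 < volume (solid s) :=
    (isOpen_interior.measure_pos _ h2).trans_le (measure_mono interior_subset)
  exact ENNReal.toReal_pos h3.ne' (isCompact_solid s).measure_lt_top.ne

theorem volume_ofLp_preimage {d : ℕ} {s : Set (Fin d → ℝ)} (hs : MeasurableSet s) :
    volume {x : E d | (fun c => x c) ∈ s} = volume s :=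
  (EuclideanSpace.volume_preserving_symm_measurableEquiv_toLp (Fin d)).measure_preimage
    hs.nullMeasurableSet

theorem measurableSet_cube {d : ℕ} (a : E d) (s : ℝ) : MeasurableSet (cube a s) := by
  have : cube a s = ⋂ c, {x : E d | a c ≤ x c} ∩ {x : E d | x c < a c + s} := by
    ext x; simp [cube]
  rw [this]
  refine MeasurableSet.iInter fun c => ?_
  exact (isClosed_le (by fun_prop) (by fun_prop)).measurableSet.inter
    (isOpen_lt (by fun_prop) (by fun_prop)).measurableSet

theorem volume_cube {d : ℕ} (a : E d) {s : ℝ} (hs : 0 ≤ s) : volume.real (cube a s) = s ^ d := by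
  have h1 : cube a s = {x : E d | (fun c => x c) ∈ Set.univ.pi fun c => Set.Ico (a c) (a c + s)} := by
    ext x; simp [cube]
  rw [Measure.real, h1, volume_ofLp_preimage (MeasurableSet.univ_pi fun c => measurableSet_Ico),
    Real.volume_pi_Ico]
  simp [hs]

/-- The bound by the circumscribed cube suffices throughout and avoids the volume constant of balls.
-/
theorem volume_closedBall_le {d : ℕ} (p : E d) {r : ℝ} (hr : 0 ≤ r) :
    volume (Metric.closedBall p r) ≤ ENNReal.ofReal ((2 * r) ^ d) := by
  have h1 : Metric.closedBall p r ⊆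
      {x : E d | (fun c => x c) ∈ Set.univ.pi fun c => Set.Icc (p c - r) (p c + r)} := by
    intro x hx c _
    have h2 : |x c - p c| ≤ r := by
      have := PiLp.norm_apply_le (x - p) c
      rw [← dist_eq_norm] at this
      exact this.trans hx
    rw [abs_le] at h2
    constructor <;> linarith
  refine (measure_mono h1).trans ?_
  rw [volume_ofLp_preimage (MeasurableSet.univ_pi fun c => measurableSet_Icc), Set.pi_univ_Icc,
    Real.volume_Icc_pi, ENNReal.ofReal_pow (by positivity)]
  simp [two_mul]

/-- Distances within a cube are at most `√d` times the edge length. -/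
theorem dist_le_of_mem_cube {d : ℕ} {a x y : E d} {s : ℝ} (hx : x ∈ cube a s) (hy : y ∈ cube a s)
    (hs : 0 ≤ s) : dist x y ≤ √d * s := by
  rw [EuclideanSpace.dist_eq, ← Real.sqrt_sq hs, ← Real.sqrt_mul (by positivity)]
  refine Real.sqrt_le_sqrt ?_
  calc ∑ c, dist (x c) (y c) ^ 2 ≤ ∑ _c : Fin d, s ^ 2 := by
        refine Finset.sum_le_sum fun c _ => ?_
        have h1 := hx c
        have h2 := hy c
        refine pow_le_pow_left₀ dist_nonneg ?_ 2
        rw [Real.dist_eq, abs_le]; constructor <;> linarith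
    _ = d * s ^ 2 := by simp

/-! ## Discretizing a transport problem -/

namespace Input
variable {d n m : ℕ} (I : Input d n m)

/-- Volume on the `j`-th simplex. -/
abbrev vol (j : Fin m) : Measure (E d) := volume.restrict (solid (I.sx j))

instance (j : Fin m) : IsFiniteMeasure (I.vol j) :=
  ⟨by simpa using (isCompact_solid (I.sx j)).measure_lt_top⟩

variable {k : ℕ} (Y : Fin k → Fin m → Set (E d))

/-- Mass of a piece, that is of a measurable subset of each simplex. -/
def pieceWt (c : Fin k) : ℝ := ∑ j, (I.vol j).real (Y c j)

open Classical in
/-- Spread the mass sent to each piece evenly. -/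
def spreadOn (ν : Fin n → Fin k → ℝ) : Fin n → Fin m → E d → ℝ :=
  fun i j x => ∑ c, if x ∈ Y c j then ν i c / I.pieceWt Y c else 0

def pieceProblem (t : Fin k → E d) : Discrete d n k where
  src := I.pt
  srcWt := I.wt
  tgt := t
  tgtWt := I.pieceWt Y

/-- The pieces partition the simplices up to null sets. -/
structure IsPartition : Prop where
  meas : ∀ c j, MeasurableSet (Y c j)
  ae_sum : ∀ j, ∀ᵐ x ∂I.vol j, ∑ c, (Y c j).indicator (fun _ => (1 : ℝ)) x = 1

variable {I Y}

theorem pieceWt_nonneg (c : Fin k) : 0 ≤ I.pieceWt Y c :=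
  Finset.sum_nonneg fun _ _ => measureReal_nonneg

theorem IsPartition.sum_integral (h : I.IsPartition Y) (j : Fin m) {f : E d → ℝ}
    (hf : Integrable f (I.vol j)) : ∑ c, ∫ x in Y c j, f x ∂I.vol j = ∫ x, f x ∂I.vol j := by
  simp_rw [← integral_indicator (h.meas _ j)]
  rw [← integral_finsetSum _ fun c _ => hf.indicator (h.meas c j)]
  refine integral_congr_ae ?_
  filter_upwards [h.ae_sum j] with x hx
  have : ∀ c, (Y c j).indicator f x = (Y c j).indicator (fun _ => (1 : ℝ)) x * f x := by
    intro c
    by_cases hc : x ∈ Y c j <;> simp [hc]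
  simp_rw [this]
  rw [← Finset.sum_mul, hx, one_mul]

theorem IsPartition.sum_pieceWt (h : I.IsPartition Y) : ∑ c, I.pieceWt Y c = I.mass := by
  unfold pieceWt mass
  rw [Finset.sum_comm]
  refine Finset.sum_congr rfl fun j _ => ?_
  have := h.sum_integral j (f := fun _ => 1) (integrable_const 1)
  simp at this
  simpa using this

theorem ae_notMem_of_pieceWt {c : Fin k} (hc : I.pieceWt Y c = 0) (j : Fin m) :
    ∀ᵐ x ∂I.vol j, x ∉ Y c j := by
  have := (Finset.sum_eq_zero_iff_of_nonneg fun j _ => measureReal_nonneg).1 hc j (Finset.mem_univ _)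
  rw [measureReal_eq_zero_iff] at this
  rw [ae_iff]; simpa using this

theorem integrable_dist (p : E d) (j : Fin m) : Integrable (fun x => dist p x) (I.vol j) :=
  (by fun_prop : Continuous fun x => dist p x).continuousOn.integrableOn_compact
    (isCompact_solid _)

theorem IsPlan.integrable {τ : Fin n → Fin m → E d → ℝ} (h : I.IsPlan τ) (i : Fin n) (j : Fin m) :
    Integrable (τ i j) (I.vol j) := by
  refine Integrable.of_bound (h.measurable i j) 1 ?_
  filter_upwards [h.mem_Icc i j] with x hx
  rw [Real.norm_eq_abs, abs_of_nonneg hx.1]; exact hx.2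

theorem IsPlan.integrable_mul {τ : Fin n → Fin m → E d → ℝ} (h : I.IsPlan τ) (i : Fin n) (j : Fin m)
    {f : E d → ℝ} (hf : Integrable f (I.vol j)) : Integrable (fun x => τ i j x * f x) (I.vol j) := by
  refine hf.bdd_mul (c := 1) (h.measurable i j) ?_
  filter_upwards [h.mem_Icc i j] with x hx
  rw [Real.norm_eq_abs, abs_of_nonneg hx.1]; exact hx.2

theorem IsPlan.cost_nonneg {τ : Fin n → Fin m → E d → ℝ} (h : I.IsPlan τ) : 0 ≤ I.cost τ := by
  refine Finset.sum_nonneg fun i _ => Finset.sum_nonneg fun j _ => integral_nonneg_of_ae ?_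
  filter_upwards [h.mem_Icc i j] with x hx
  exact mul_nonneg hx.1 dist_nonneg

theorem plan_eq_zero {t : Fin k → E d} {ν : Fin n → Fin k → ℝ} (hν : (I.pieceProblem Y t).IsPlan ν)
    {c : Fin k} (hc : I.pieceWt Y c = 0) (i : Fin n) : ν i c = 0 := by
  have h1 : ∑ i, ν i c = 0 := (hν.2.2 c).trans hc
  exact (Finset.sum_eq_zero_iff_of_nonneg fun i _ => hν.1 i c).1 h1 i (Finset.mem_univ _)

theorem integral_spreadOn (h : I.IsPartition Y) (ν : Fin n → Fin k → ℝ) (i : Fin n)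
    (j : Fin m) {f : E d → ℝ} (hf : Integrable f (I.vol j)) :
    ∫ x, I.spreadOn Y ν i j x * f x ∂I.vol j =
      ∑ c, ν i c / I.pieceWt Y c * ∫ x in Y c j, f x ∂I.vol j := by
  have : ∀ x, I.spreadOn Y ν i j x * f x =
      ∑ c, (Y c j).indicator (fun x => ν i c / I.pieceWt Y c * f x) x := by
    intro x
    rw [spreadOn, Finset.sum_mul]
    refine Finset.sum_congr rfl fun c _ => ?_
    by_cases hc : x ∈ Y c j <;> simp [hc]
  simp_rw [this]
  rw [integral_finsetSum _ fun c _ => (hf.const_mul _).indicator (h.meas c j)]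
  refine Finset.sum_congr rfl fun c _ => ?_
  rw [integral_indicator (h.meas c j), integral_const_mul]

/-- Pieces of weight zero need care: their density is the default value of a division by zero. This
does no harm, because such pieces are null sets and receive no mass. -/
theorem isPlan_spreadOn (h : I.IsPartition Y) {t : Fin k → E d} {ν : Fin n → Fin k → ℝ}
    (hν : (I.pieceProblem Y t).IsPlan ν) : I.IsPlan (I.spreadOn Y ν) := by
  classical
  have hsum : ∀ j, ∀ᵐ x ∂I.vol j, ∑ i, I.spreadOn Y ν i j x = 1 := by
    intro j
    have h0 : ∀ᵐ x ∂I.vol j, ∀ c, I.pieceWt Y c = 0 → x ∉ Y c j := by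
      rw [ae_all_iff]; intro c
      by_cases hc : I.pieceWt Y c = 0
      · filter_upwards [ae_notMem_of_pieceWt hc j] with x hx _ using hx
      · exact Filter.Eventually.of_forall fun x h => absurd h hc
    filter_upwards [h.ae_sum j, h0] with x hx hx0
    rw [← hx]
    unfold spreadOn
    rw [Finset.sum_comm]
    refine Finset.sum_congr rfl fun c _ => ?_
    by_cases hc : x ∈ Y c j
    · have hne : I.pieceWt Y c ≠ 0 := fun h' => hx0 c h' hc
      simp only [hc, if_true, Set.indicator_of_mem]
      rw [← Finset.sum_div, hν.2.2 c]
      exact div_self hne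
    · simp [hc]
  have hnn : ∀ i j x, 0 ≤ I.spreadOn Y ν i j x := by
    intro i j x
    refine Finset.sum_nonneg fun c _ => ?_
    split_ifs
    · exact div_nonneg (hν.1 i c) (pieceWt_nonneg c)
    · exact le_rfl
  refine ⟨fun i j => ?_, fun i j => ?_, fun i => ?_, hsum⟩
  · refine Measurable.aestronglyMeasurable ?_
    refine Finset.measurable_sum _ fun c _ => ?_
    exact Measurable.ite (h.meas c j) measurable_const measurable_const
  · filter_upwards [hsum j] with x hx
    refine ⟨hnn i j x, ?_⟩
    rw [← hx]
    exact Finset.single_le_sum (f := fun i => I.spreadOn Y ν i j x) (fun i _ => hnn i j x)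
      (Finset.mem_univ i)
  · have h1 := fun j => integral_spreadOn h ν i j (f := fun _ => 1) (integrable_const 1)
    simp only [mul_one, integral_const, smul_eq_mul, measureReal_restrict_apply_univ] at h1
    rw [Finset.sum_congr rfl fun j _ => h1 j, Finset.sum_comm]
    have h2 : ∑ c, ν i c = I.wt i := hν.2.1 i
    rw [← h2]
    refine Finset.sum_congr rfl fun c _ => ?_
    rw [← Finset.mul_sum]
    by_cases hc : I.pieceWt Y c = 0
    · simp [hc, plan_eq_zero hν hc i]
    · exact div_mul_cancel₀ _ hc

/-- Cost of spreading an approximate plan for the discretized problem, where replacing points of a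
piece by its representative changes distances by a factor `1 + δ` and an error `err`. -/
theorem cost_spreadOn_le (h : I.IsPartition Y) {t : Fin k → E d} {ν : Fin n → Fin k → ℝ} {ε δ : ℝ}
    (hε : 0 ≤ ε) (hδ : 0 ≤ δ) (hν : (I.pieceProblem Y t).IsApprox ε ν) {err : Fin k → ℝ}
    (herr : ∀ c i j, ∀ x ∈ Y c j, dist (I.pt i) x ≤ (1 + δ) * dist (I.pt i) (t c) + err c ∧
      dist (I.pt i) (t c) ≤ (1 + δ) * dist (I.pt i) x + err c)
    {τ : Fin n → Fin m → E d → ℝ} (hτ : I.IsPlan τ) :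
    I.cost (I.spreadOn Y ν) ≤ (1 + ε) * (1 + δ) ^ 2 * I.cost τ +
      ((1 + ε) * (1 + δ) + 1) * ∑ c, err c * I.pieceWt Y c := by
  obtain ⟨hνp, hνo⟩ := hν
  have hw : ∀ c j (r : ℝ), ∫ _ in Y c j, r ∂I.vol j = (I.vol j).real (Y c j) * r := by
    intro c j r; simp
  -- From discrete to continuous: spreading `ν` costs one factor `1 + δ` and the errors.
  have h1 : I.cost (I.spreadOn Y ν) ≤ (1 + δ) * (I.pieceProblem Y t).cost ν +
      ∑ c, err c * I.pieceWt Y c := by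
    have e1 : ∀ i, ∑ j, ∫ x in solid (I.sx j), I.spreadOn Y ν i j x * dist (I.pt i) x ≤
        ∑ c, ν i c * ((1 + δ) * dist (I.pt i) (t c) + err c) := by
      intro i
      rw [Finset.sum_congr rfl fun j _ => integral_spreadOn h ν i j (integrable_dist (I.pt i) j),
        Finset.sum_comm]
      refine Finset.sum_le_sum fun c _ => ?_
      rw [← Finset.mul_sum]
      by_cases hc : I.pieceWt Y c = 0
      · simp [hc, plan_eq_zero hνp hc i]
      have hpos : 0 < I.pieceWt Y c := lt_of_le_of_ne (pieceWt_nonneg c) (Ne.symm hc)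
      have : ∑ j, ∫ x in Y c j, dist (I.pt i) x ∂I.vol j ≤
          I.pieceWt Y c * ((1 + δ) * dist (I.pt i) (t c) + err c) := by
        rw [pieceWt, Finset.sum_mul]
        refine Finset.sum_le_sum fun j _ => ?_
        rw [← hw]
        exact setIntegral_mono_on (integrable_dist _ j).integrableOn (integrable_const _).integrableOn
          (h.meas c j) fun x hx => (herr c i j x hx).1
      calc ν i c / I.pieceWt Y c * ∑ j, ∫ x in Y c j, dist (I.pt i) x ∂I.vol j
          ≤ ν i c / I.pieceWt Y c * (I.pieceWt Y c * ((1 + δ) * dist (I.pt i) (t c) + err c)) :=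
            mul_le_mul_of_nonneg_left this (div_nonneg (hνp.1 i c) hpos.le)
        _ = _ := by field_simp
    refine (Finset.sum_le_sum fun i _ => e1 i).trans (le_of_eq ?_)
    rw [Discrete.cost, Finset.mul_sum]
    have e2 : ∑ c, err c * I.pieceWt Y c = ∑ i, ∑ c, ν i c * err c := by
      rw [Finset.sum_comm]
      refine Finset.sum_congr rfl fun c _ => ?_
      have : ∑ i, ν i c = I.pieceWt Y c := hνp.2.2 c
      rw [← this, Finset.mul_sum]
      exact Finset.sum_congr rfl fun i _ => mul_comm _ _
    rw [e2, ← Finset.sum_add_distrib]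
    refine Finset.sum_congr rfl fun i _ => ?_
    rw [Finset.mul_sum, ← Finset.sum_add_distrib]
    refine Finset.sum_congr rfl fun c _ => ?_
    simp only [pieceProblem]; ring
  -- From continuous to discrete: collapsing `τ` onto the pieces gives a plan that `ν` competes
  -- with.
  set ν' : Fin n → Fin k → ℝ := fun i c => ∑ j, ∫ x in Y c j, τ i j x ∂I.vol j with hν'
  have hplan : (I.pieceProblem Y t).IsPlan ν' := by
    refine ⟨fun i c => Finset.sum_nonneg fun j _ => ?_, fun i => ?_, fun c => ?_⟩
    · exact integral_nonneg_of_ae (ae_restrict_of_ae ((hτ.mem_Icc i j).mono fun x hx => hx.1))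
    · rw [Finset.sum_comm, Finset.sum_congr rfl fun j _ => h.sum_integral j (hτ.integrable i j)]
      exact hτ.point i
    · rw [Finset.sum_comm]
      refine Finset.sum_congr rfl fun j _ => ?_
      rw [← integral_finsetSum _ fun i _ => (hτ.integrable i j).integrableOn]
      have := hw c j 1
      rw [mul_one] at this
      rw [← this]
      exact integral_congr_ae (ae_restrict_of_ae (hτ.simplex j))
  have h2 : (I.pieceProblem Y t).cost ν' ≤ (1 + δ) * I.cost τ + ∑ c, err c * I.pieceWt Y c := by
    have e1 : ∀ i c, ν' i c * dist (I.pt i) (t c) ≤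
        (1 + δ) * (∑ j, ∫ x in Y c j, τ i j x * dist (I.pt i) x ∂I.vol j) + ν' i c * err c := by
      intro i c
      rw [hν', Finset.sum_mul, Finset.sum_mul, Finset.mul_sum, ← Finset.sum_add_distrib]
      refine Finset.sum_le_sum fun j _ => ?_
      rw [← integral_mul_const, ← integral_const_mul, ← integral_mul_const, ← integral_add]
      · refine setIntegral_mono_ae_restrict ?_ ?_ ?_
        · exact ((hτ.integrable i j).mul_const _).integrableOn
        · exact (((hτ.integrable_mul i j (integrable_dist _ j)).const_mul _).add
            ((hτ.integrable i j).mul_const _)).integrableOn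
        · filter_upwards [ae_restrict_of_ae (hτ.mem_Icc i j), ae_restrict_mem (h.meas c j)] with x hx hm
          have := mul_le_mul_of_nonneg_left (herr c i j x hm).2 hx.1
          calc _ ≤ _ := this
            _ = _ := by ring
      · exact ((hτ.integrable_mul i j (integrable_dist _ j)).const_mul _).integrableOn
      · exact ((hτ.integrable i j).mul_const _).integrableOn
    have e2 : ∑ i, ∑ c, ν' i c * err c = ∑ c, err c * I.pieceWt Y c := by
      rw [Finset.sum_comm]
      refine Finset.sum_congr rfl fun c _ => ?_
      have : ∑ i, ν' i c = I.pieceWt Y c := hplan.2.2 c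
      rw [← this, Finset.mul_sum]
      exact Finset.sum_congr rfl fun i _ => mul_comm _ _
    refine (Finset.sum_le_sum fun i _ => Finset.sum_le_sum fun c _ => e1 i c).trans (le_of_eq ?_)
    simp_rw [Finset.sum_add_distrib]
    rw [e2, cost, Finset.mul_sum]
    congr 1
    refine Finset.sum_congr rfl fun i _ => ?_
    rw [← Finset.mul_sum, Finset.sum_comm]
    congr 1
    refine Finset.sum_congr rfl fun j _ => ?_
    exact h.sum_integral j (hτ.integrable_mul i j (integrable_dist _ j))
  have h3 := hνo ν' hplan
  have h4 : (I.pieceProblem Y t).cost ν ≤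
      (1 + ε) * ((1 + δ) * I.cost τ + ∑ c, err c * I.pieceWt Y c) :=
    h3.trans (mul_le_mul_of_nonneg_left h2 (by linarith))
  have h5 := mul_le_mul_of_nonneg_left h4 (by linarith : 0 ≤ 1 + δ)
  linarith

theorem mass_pos (hm : 0 < m) : 0 < I.mass :=
  Finset.sum_pos (fun _ _ => volume_solid_pos _) ⟨⟨0, hm⟩, Finset.mem_univ _⟩

theorem n_pos (I : Input d n m) (hm : 0 < m) : 0 < n := by
  rcases Nat.eq_zero_or_pos n with h | h
  · subst h
    have := I.balanced
    have h2 : 0 < I.mass := mass_pos hm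
    rw [mass, ← this] at h2
    simp at h2
  · exact h

/-- Length scale `(V / (n m)) ^ (1 / d)` of the problem. -/
def scale (I : Input d n m) : ℝ := (I.mass / (n * m)) ^ (1 / (d : ℝ))

theorem scale_pos (hm : 0 < m) : 0 < I.scale := by
  have := I.n_pos hm
  have := mass_pos (I := I) hm
  unfold scale; positivity

theorem scale_pow (hd : 0 < d) (hm : 0 < m) : I.scale ^ d = I.mass / (n * m) := by
  have := I.n_pos hm
  have := mass_pos (I := I) hm
  unfold scale
  rw [one_div, Real.rpow_inv_natCast_pow (by positivity) hd.ne']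

/-- Mass that a point sends beyond distance `R = scale / 4` costs at least `R` per unit. What it
sends to one simplex within this distance is at most `(2 * R) ^ d`, since densities are at most one.
Over all pairs of a point and a simplex at least half of the mass travels further than `R`, whence
`8 = 4 * 2`. -/
theorem IsPlan.le_cost (hd : 0 < d) (hm : 0 < m) {τ : Fin n → Fin m → E d → ℝ} (hτ : I.IsPlan τ) :
    I.scale * I.mass ≤ 8 * I.cost τ := by
  set R := I.scale / 4 with hR
  have hs := scale_pos (I := I) hm
  have hR0 : 0 < R := by positivity
  have hn := I.n_pos hm
  have e1 : ∀ i j, R * (∫ x, τ i j x ∂I.vol j - (2 * R) ^ d) ≤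
      ∫ x in solid (I.sx j), τ i j x * dist (I.pt i) x := by
    intro i j
    have hB : (I.vol j).real (Metric.closedBall (I.pt i) R) ≤ (2 * R) ^ d := by
      refine ENNReal.toReal_le_of_le_ofReal (by positivity) ?_
      exact (Measure.restrict_le_self _).trans (volume_closedBall_le _ hR0.le)
    have h1 : ∫ x, τ i j x - (Metric.closedBall (I.pt i) R).indicator (fun _ => (1 : ℝ)) x ∂I.vol j =
        ∫ x, τ i j x ∂I.vol j - (I.vol j).real (Metric.closedBall (I.pt i) R) := by
      rw [integral_sub (hτ.integrable i j)
        ((integrable_const 1).indicator Metric.isClosed_closedBall.measurableSet),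
        integral_indicator Metric.isClosed_closedBall.measurableSet]
      simp
    calc R * (∫ x, τ i j x ∂I.vol j - (2 * R) ^ d)
        ≤ R * ∫ x, τ i j x - (Metric.closedBall (I.pt i) R).indicator (fun _ => (1 : ℝ)) x ∂I.vol j := by
          rw [h1]; exact mul_le_mul_of_nonneg_left (by linarith) hR0.le
      _ ≤ _ := by
          rw [← integral_const_mul]
          refine integral_mono_ae ?_ (hτ.integrable_mul i j (integrable_dist _ j)) ?_
          · exact ((hτ.integrable i j).sub
              ((integrable_const 1).indicator Metric.isClosed_closedBall.measurableSet)).const_mul _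
          · filter_upwards [hτ.mem_Icc i j] with x hx
            by_cases hxB : x ∈ Metric.closedBall (I.pt i) R
            · have : τ i j x * dist (I.pt i) x ≥ 0 := mul_nonneg hx.1 dist_nonneg
              simp only [hxB, Set.indicator_of_mem]
              nlinarith [hx.2]
            · have : R < dist (I.pt i) x := by
                rw [dist_comm]; simpa using hxB
              simp only [hxB, not_false_eq_true, Set.indicator_of_notMem, sub_zero]
              nlinarith [hx.1]
  have e2 : ∑ i, ∑ j, R * (∫ x, τ i j x ∂I.vol j - (2 * R) ^ d) ≤ I.cost τ :=
    Finset.sum_le_sum fun i _ => Finset.sum_le_sum fun j _ => e1 i j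
  have e3 : ∑ i, ∑ j, R * (∫ x, τ i j x ∂I.vol j - (2 * R) ^ d) =
      R * (I.mass - n * m * (2 * R) ^ d) := by
    simp_rw [← Finset.mul_sum, Finset.sum_sub_distrib]
    rw [Finset.sum_congr rfl fun i _ => hτ.point i, I.balanced]
    simp [mass]; ring_nf; tauto
  have e4 : (n : ℝ) * m * (2 * R) ^ d ≤ I.mass / 2 := by
    have h1 : 2 * R = I.scale / 2 := by rw [hR]; ring
    rw [h1, div_pow, scale_pow hd hm]
    have h2 : (2 : ℝ) ≤ 2 ^ d := by
      simpa using pow_le_pow_right₀ (by norm_num : (1 : ℝ) ≤ 2) hd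
    have h3 := mass_pos (I := I) hm
    have : (n : ℝ) * m * (I.mass / (n * m) / 2 ^ d) = I.mass / 2 ^ d := by
      have : (n : ℝ) ≠ 0 := by positivity
      have : (m : ℝ) ≠ 0 := by positivity
      field_simp
    rw [this]
    exact div_le_div_of_nonneg_left h3.le (by norm_num) h2
  rw [e3] at e2
  have e5 := mul_le_mul_of_nonneg_left (by linarith : I.mass / 2 ≤ I.mass - n * m * (2 * R) ^ d) hR0.le
  rw [hR] at e5 e2
  linarith

end Input

end PointSimplex

namespace PointSimplex

namespace Input
variable {d n m : ℕ} {I : Input d n m}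

/-! ## The subdivision into cells -/

theorem le_longestEdge (I : Input d n m) (j : Fin m) (a b : Fin (d + 1)) :
    dist ((I.sx j).points a) ((I.sx j).points b) ≤ I.longestEdge :=
  le_ciSup (f := fun e : Fin m × Fin (d + 1) × Fin (d + 1) =>
    dist ((I.sx e.1).points e.2.1) ((I.sx e.1).points e.2.2)) (Set.finite_range _).bddAbove (j, a, b)

theorem longestEdge_pos (hd : 0 < d) (hm : 0 < m) : 0 < I.longestEdge := by
  have h1 := I.le_longestEdge ⟨0, hm⟩ 0 ⟨1, by omega⟩
  refine lt_of_lt_of_le (dist_pos.2 fun h => ?_) h1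
  have := (I.sx ⟨0, hm⟩).independent.injective h
  simp [Fin.ext_iff] at this

theorem mem_cell_iff (hd : 0 < d) (hm : 0 < m) (o x : E d) (l : ℕ) (z : Fin d → ℤ) :
    x ∈ I.cell o (l, z) ↔ ∀ c, z c = ⌊(x c - o c) / (I.longestEdge / 2 ^ l)⌋ := by
  have hs : 0 < I.longestEdge / 2 ^ l := div_pos (longestEdge_pos hd hm) (by positivity)
  refine forall_congr' fun c => ?_
  rw [eq_comm, Int.floor_eq_iff, le_div_iff₀ hs, div_lt_iff₀ hs]
  dsimp only
  constructor <;> rintro ⟨h1, h2⟩ <;> constructor <;> nlinarith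

theorem mem_child_iff (hd : 0 < d) (hm : 0 < m) (o x : E d) (l : ℕ) (z : Fin d → ℤ) :
    x ∈ I.cell o (l, z) ↔
      ∃ h : Fin d → Fin 2, x ∈ I.cell o (l + 1, fun c => 2 * z c + ((h c : ℕ) : ℤ)) := by
  have hs : 0 < I.longestEdge / 2 ^ l := div_pos (longestEdge_pos hd hm) (by positivity)
  have he : ∀ c, (x c - o c) / (I.longestEdge / 2 ^ (l + 1)) =
      2 * ((x c - o c) / (I.longestEdge / 2 ^ l)) := fun c => by
    rw [pow_succ]; field_simp
  have h1 : ∀ u : ℝ, ∃ b : Fin 2, 2 * ⌊u⌋ + ((b : ℕ) : ℤ) = ⌊2 * u⌋ := by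
    intro u
    have h1 := Int.floor_le u
    have h2 := Int.lt_floor_add_one u
    by_cases hu : u < ⌊u⌋ + 1 / 2
    · refine ⟨0, ?_⟩
      rw [eq_comm, Int.floor_eq_iff]; push_cast; constructor <;> simp <;> linarith
    · refine ⟨1, ?_⟩
      rw [eq_comm, Int.floor_eq_iff]; push_cast; constructor <;> simp <;> linarith
  have h2 : ∀ (u : ℝ) (z : ℤ) (b : Fin 2), 2 * z + ((b : ℕ) : ℤ) = ⌊2 * u⌋ → z = ⌊u⌋ := by
    intro u z b hb
    have h1 := (Int.floor_eq_iff.1 hb.symm)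
    push_cast at h1
    rw [eq_comm, Int.floor_eq_iff]
    have h2 : ((b : ℕ) : ℝ) ≤ 1 := by
      have := b.2; exact_mod_cast (by omega : (b : ℕ) ≤ 1)
    have h3 : (0 : ℝ) ≤ ((b : ℕ) : ℝ) := by positivity
    constructor <;> linarith [h1.1, h1.2]
  simp only [mem_cell_iff hd hm, he]
  constructor
  · intro h
    choose b hb using fun c => h1 ((x c - o c) / (I.longestEdge / 2 ^ l))
    exact ⟨b, fun c => by rw [h c, hb c]⟩
  · rintro ⟨b, hb⟩ c
    exact h2 _ _ _ (hb c)

theorem dist_le_of_mem_cell {o x y : E d} {q : ℕ × (Fin d → ℤ)} (hx : x ∈ I.cell o q)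
    (hy : y ∈ I.cell o q) : dist x y ≤ √d * (I.longestEdge / 2 ^ q.1) := by
  refine dist_le_of_mem_cube hx hy ?_
  have : 0 ≤ I.longestEdge := Real.iSup_nonneg fun _ => dist_nonneg
  positivity

theorem radius_eq (δ : ℝ) (hm : 0 < m) : I.radius δ = δ * I.scale := by
  have := mass_pos (I := I) hm
  rw [radius, scale, Real.div_rpow this.le (by positivity)]
  ring

/-- If the cell is not near any point, some `w` in it has distance above `r = radius δ` from the
point in question. With diameter `D`, every `y` in the cell then has distance at least `r - D`, and
`D ≤ δ * (r - D)` is the assumption. -/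
theorem stop_of_small {δ : ℝ} {o : E d} {q : ℕ × (Fin d → ℤ)} (hδ : 0 < δ)
    (h : √d * (I.longestEdge / 2 ^ q.1) * (1 + δ) ≤ δ * I.radius δ) : I.Stop δ o q := by
  set D := √d * (I.longestEdge / 2 ^ q.1)
  by_cases hA : ∃ i, ∀ x ∈ I.cell o q, dist (I.pt i) x ≤ I.radius δ
  · exact Or.inl hA
  push Not at hA
  refine Or.inr fun i x hx y hy => ?_
  obtain ⟨w, hw, hwr⟩ := hA i
  have h1 := dist_triangle (I.pt i) y w
  have h2 := dist_triangle (I.pt i) y x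
  have h3 : dist y w ≤ D := dist_le_of_mem_cell hy hw
  have h4 : dist y x ≤ D := dist_le_of_mem_cell hy hx
  have h5 : δ * (I.radius δ - D) ≤ δ * dist (I.pt i) y :=
    mul_le_mul_of_nonneg_left (by linarith) hδ.le
  linarith

theorem exists_level (hm : 0 < m) {δ : ℝ} (hδ : 0 < δ) (o : E d) :
    ∃ l₀, ∀ l z, I.Generated δ o (l, z) → l ≤ l₀ := by
  have hr : 0 < δ * I.radius δ := by
    rw [radius_eq δ hm]
    have := scale_pos (I := I) hm
    positivity
  have hlim : Filter.Tendsto (fun l : ℕ => √d * (I.longestEdge / 2 ^ l) * (1 + δ)) Filter.atTop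
      (nhds (√d * 0 * (1 + δ))) := by
    refine Filter.Tendsto.mul_const _ (Filter.Tendsto.const_mul _ ?_)
    exact tendsto_const_nhds.div_atTop (tendsto_pow_atTop_atTop_of_one_lt (by norm_num))
  rw [mul_zero, zero_mul] at hlim
  obtain ⟨l₀, h₀⟩ := Filter.eventually_atTop.1 (hlim.eventually_lt_const hr)
  -- Cells of level `l₀` and beyond are stopped, but a cell is generated when its parent is not;
  -- hence one more level.
  refine ⟨l₀ + 1, fun l z hg => ?_⟩
  cases hg with
  | root => omega
  | child l z h hg hs =>
    by_contra hl
    exact hs (stop_of_small hδ (h₀ l (by omega)).le)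

theorem finite_level (hd : 0 < d) (hm : 0 < m) (δ : ℝ) (o : E d) (l : ℕ) :
    {z | I.Generated δ o (l, z)}.Finite := by
  induction l with
  | zero =>
    have hb : Bornology.IsBounded (⋃ j, solid (I.sx j)) :=
      (Bornology.isBounded_iUnion).2 fun j => (isCompact_solid _).isBounded
    obtain ⟨C, hC⟩ := hb.subset_closedBall o
    have hℓ := longestEdge_pos (I := I) hd hm
    refine (Set.Finite.pi' (t := fun _ : Fin d =>
      Set.Icc ⌊-C / I.longestEdge⌋ ⌊C / I.longestEdge⌋) fun _ => Set.finite_Icc _ _).subset ?_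
    intro z hz c
    have hM : I.Meets o (0, z) := by
      cases hz with
      | root _ h => exact h
    obtain ⟨j, x, hx, hxs⟩ := hM
    have h1 := (mem_cell_iff hd hm o x 0 z).1 hx c
    have h2 : |x c - o c| ≤ C := by
      have := PiLp.norm_apply_le (x - o) c
      rw [← dist_eq_norm] at this
      exact this.trans (hC (Set.mem_iUnion.2 ⟨j, hxs⟩))
    rw [abs_le] at h2
    rw [h1, pow_zero, div_one]
    exact ⟨Int.floor_le_floor (div_le_div_of_nonneg_right h2.1 hℓ.le),
      Int.floor_le_floor (div_le_div_of_nonneg_right h2.2 hℓ.le)⟩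
  | succ l ih =>
    refine (Set.Finite.image2 (fun (z : Fin d → ℤ) (h : Fin d → Fin 2) c =>
      2 * z c + ((h c : ℕ) : ℤ)) ih Set.finite_univ).subset ?_
    intro z hz
    cases hz with
    | child l z h hg _ => exact ⟨z, hg, h, Set.mem_univ _, rfl⟩

theorem finite_cells (hd : 0 < d) (hm : 0 < m) {δ : ℝ} (hδ : 0 < δ) (o : E d) :
    (I.cells δ o).Finite := by
  obtain ⟨l₀, h₀⟩ := exists_level (I := I) hm hδ o
  refine ((Set.finite_Iic l₀).biUnion fun l _ =>
    (finite_level (I := I) hd hm δ o l).image (Prod.mk l)).subset ?_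
  rintro ⟨l, z⟩ ⟨hg, -, -⟩
  exact Set.mem_biUnion (h₀ l z hg) ⟨z, hg, rfl⟩

/-- Descend from the root cell of `x` through the children containing `x`. The bound on the level
forces a stop, and the final cell meets the simplex in `x` itself. -/
theorem exists_cell (hd : 0 < d) (hm : 0 < m) {δ : ℝ} (hδ : 0 < δ) (o : E d) {j : Fin m} {x : E d}
    (hx : x ∈ solid (I.sx j)) : ∃ q ∈ I.cells δ o, x ∈ I.cell o q := by
  obtain ⟨l₀, h₀⟩ := exists_level (I := I) hm hδ o
  have key : ∀ k l z, l₀ < l + k → I.Generated δ o (l, z) → x ∈ I.cell o (l, z) →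
      ∃ q ∈ I.cells δ o, x ∈ I.cell o q := by
    intro k
    induction k with
    | zero => intro l z hl hg _; exact absurd (h₀ l z hg) (by omega)
    | succ k ih =>
      intro l z hl hg hxc
      by_cases hs : I.Stop δ o (l, z)
      · exact ⟨(l, z), ⟨hg, hs, j, x, hxc, hx⟩, hxc⟩
      · obtain ⟨h, hh⟩ := (mem_child_iff hd hm o x l z).1 hxc
        exact ih (l + 1) _ (by omega) (.child l z h hg hs) hh
  have h1 : x ∈ I.cell o (0, fun c => ⌊(x c - o c) / (I.longestEdge / 2 ^ 0)⌋) :=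
    (mem_cell_iff hd hm o x 0 _).2 fun _ => rfl
  exact key (l₀ + 1) 0 _ (by omega) (.root _ ⟨j, x, h1, hx⟩) h1

theorem Generated.ancestor (hd : 0 < d) (hm : 0 < m) {δ : ℝ} {o x : E d} {q : ℕ × (Fin d → ℤ)}
    (hg : I.Generated δ o q) (hx : x ∈ I.cell o q) (l : ℕ) (hl : l < q.1) :
    ∃ z, ¬ I.Stop δ o (l, z) ∧ x ∈ I.cell o (l, z) := by
  induction hg with
  | root z h => exact absurd hl (Nat.not_lt_zero _)
  | child l' z h hg hs ih =>
    have h1 : x ∈ I.cell o (l', z) := (mem_child_iff hd hm o x l' z).2 ⟨h, hx⟩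
    rcases Nat.lt_succ_iff_lt_or_eq.1 hl with h2 | h2
    · exact ih h1 h2
    · subst h2; exact ⟨z, hs, h1⟩

/-- If one of two final cells containing `x` were deeper, its ancestor on the level of the other
would be that other cell, since the cells of one level are disjoint. But proper ancestors are not
stopped. -/
theorem cells_disjoint (hd : 0 < d) (hm : 0 < m) {δ : ℝ} {o x : E d} {q q' : ℕ × (Fin d → ℤ)}
    (hq : q ∈ I.cells δ o) (hq' : q' ∈ I.cells δ o) (hx : x ∈ I.cell o q) (hx' : x ∈ I.cell o q') :
    q = q' := by
  have hz : ∀ {l z z'}, x ∈ I.cell o (l, z) → x ∈ I.cell o (l, z') → z = z' := by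
    intro l z z' h h'
    rw [mem_cell_iff hd hm] at h h'
    ext c; rw [h, h']
  have hno : ∀ {q q' : ℕ × (Fin d → ℤ)}, q ∈ I.cells δ o → q' ∈ I.cells δ o → x ∈ I.cell o q →
      x ∈ I.cell o q' → ¬ q.1 < q'.1 := by
    intro q q' hq hq' hx hx' hlt
    obtain ⟨z, hz1, hz2⟩ := hq'.1.ancestor hd hm hx' q.1 hlt
    have := hz hx hz2
    exact hz1 (by rw [← this]; exact hq.2.1)
  have hl : q.1 = q'.1 := le_antisymm (not_lt.1 (hno hq' hq hx' hx)) (not_lt.1 (hno hq hq' hx hx'))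
  obtain ⟨l, z⟩ := q
  obtain ⟨l', z'⟩ := q'
  dsimp only at hl
  subst hl
  rw [hz hx hx']

theorem measurableSet_cell (o : E d) (q : ℕ × (Fin d → ℤ)) : MeasurableSet (I.cell o q) :=
  measurableSet_cube _ _

theorem le_mul_emd {x C : ℝ} (hC : 0 < C) (hne : ∃ τ, I.IsPlan τ)
    (h : ∀ τ, I.IsPlan τ → x ≤ C * I.cost τ) : x ≤ C * I.emd := by
  rw [← div_le_iff₀' hC]
  obtain ⟨τ, hτ⟩ := hne
  refine le_csInf ⟨_, τ, hτ, rfl⟩ ?_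
  rintro _ ⟨τ', hτ', rfl⟩
  rw [div_le_iff₀' hC]
  exact h τ' hτ'

/-- The final cells partition the simplices, so `cost_spreadOn_le` applies. The additive error is
zero except on cells near a point, and there it is controlled by the small total mass of such cells
together with `IsPlan.le_cost`. -/
theorem approximation (hd : 0 < d) (hm : 0 < m) {δ : ℝ} (hδ : 0 < δ) (hδ5 : δ ≤ 1 / 5) (o : E d)
    {k : ℕ} (q : Fin k → ℕ × (Fin d → ℤ)) (hinj : Function.Injective q)
    (hq : Set.range q = I.cells δ o) (t : Fin k → E d) (ht : ∀ c, t c ∈ I.cell o (q c))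
    (ν : Fin n → Fin k → ℝ) (hν : (I.discretize o q t).IsApprox δ ν) :
    I.IsPlan (I.spread o q ν) ∧ I.cost (I.spread o q ν) ≤ (1 + 21 * δ) * I.emd := by
  classical
  set Y : Fin k → Fin m → Set (E d) := fun c _ => I.cell o (q c) with hY
  have hmemq : ∀ c, q c ∈ I.cells δ o := fun c => hq ▸ Set.mem_range_self c
  have hwt : ∀ c, I.pieceWt Y c = I.cellWt o (q c) := fun c =>
    Finset.sum_congr rfl fun j _ => measureReal_restrict_apply (measurableSet_cell o (q c))
  have hspread : I.spread o q ν = I.spreadOn Y ν := by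
    ext i j x
    exact Finset.sum_congr rfl fun c _ => by rw [hwt]
  have hprob : I.discretize o q t = I.pieceProblem Y t := by
    simp only [discretize, pieceProblem, ← hwt]
  have hpart : I.IsPartition Y := by
    refine ⟨fun c j => measurableSet_cell o (q c), fun j => ?_⟩
    filter_upwards [ae_restrict_mem (measurableSet_solid (I.sx j))] with x hx
    obtain ⟨p, hp, hxp⟩ := exists_cell hd hm hδ o hx
    obtain ⟨c, rfl⟩ : p ∈ Set.range q := hq ▸ hp
    rw [Finset.sum_eq_single c]
    · simp [hY, hxp]
    · intro c' _ hne
      refine Set.indicator_of_notMem (fun hx' => hne (hinj ?_)) _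
      exact cells_disjoint hd hm (hmemq c') (hmemq c) hx' hxp
    · simp
  rw [hprob] at hν
  rw [hspread]
  have hplan := isPlan_spreadOn hpart hν.1
  refine ⟨hplan, le_mul_emd (by positivity) ⟨_, hplan⟩ fun τ hτ => ?_⟩
  set r := I.radius δ with hr
  have hr0 : 0 < r := by
    rw [hr, radius_eq δ hm]
    have := scale_pos (I := I) hm
    positivity
  let P : Fin k → Prop := fun c => ∃ i, ∀ x ∈ I.cell o (q c), dist (I.pt i) x ≤ r
  -- All of a near cell lies within `r` of a single point, so any two of its points are at distance
  -- at most `2 * r`.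
  set err : Fin k → ℝ := fun c => if P c then 2 * r else 0 with herr
  have key := cost_spreadOn_le hpart hδ.le hδ.le hν (err := err) (by
    intro c i j x hx
    have hx' : x ∈ I.cell o (q c) := hx
    by_cases hc : P c
    · obtain ⟨i', hi'⟩ := hc
      have h1 : dist (t c) x ≤ 2 * r := by
        have := dist_triangle (t c) (I.pt i') x
        rw [dist_comm (t c) (I.pt i')] at this
        linarith [hi' x hx', hi' _ (ht c)]
      have h2 := dist_triangle (I.pt i) (t c) x
      have h3 := dist_triangle (I.pt i) x (t c)
      rw [dist_comm x] at h3
      have h4 := mul_nonneg hδ.le (dist_nonneg (x := I.pt i) (y := x))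
      have h5 := mul_nonneg hδ.le (dist_nonneg (x := I.pt i) (y := t c))
      simp only [herr, show P c from ⟨i', hi'⟩, if_true]
      constructor <;> linarith
    · have hs : ∀ i, ∀ x ∈ I.cell o (q c), ∀ y ∈ I.cell o (q c),
          dist (I.pt i) x ≤ (1 + δ) * dist (I.pt i) y := by
        rcases (hmemq c).2.1 with h | h
        · exact absurd h hc
        · exact h
      simp only [herr, hc, if_false, add_zero]
      exact ⟨hs i x hx' _ (ht c), hs i _ (ht c) x hx'⟩) hτ
  -- Near cells are disjoint and covered by `n` balls of radius `r`. Counted once for each simplex,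
  -- their mass is at most `n m (2r)^d = (2δ)^d V`, which is at most `2δV` because `2δ ≤ 1`.
  have hsum : ∑ c, err c * I.pieceWt Y c ≤ 2 * r * (2 * δ * I.mass) := by
    have e1 : ∑ c, err c * I.pieceWt Y c = 2 * r * ∑ c ∈ Finset.univ.filter P, I.pieceWt Y c := by
      rw [Finset.mul_sum, Finset.sum_filter]
      refine Finset.sum_congr rfl fun c _ => ?_
      by_cases hc : P c
      · simp only [herr, if_pos hc]; exact (if_pos hc).symm
      · simp only [herr, if_neg hc, zero_mul]; exact (if_neg hc).symm
    rw [e1]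
    refine mul_le_mul_of_nonneg_left ?_ (by positivity)
    simp only [pieceWt]
    rw [Finset.sum_comm]
    have e2 : ∀ j, ∑ c ∈ Finset.univ.filter P, (I.vol j).real (Y c j) ≤ n * (2 * r) ^ d := by
      intro j
      rw [← measureReal_biUnion_finset]
      · have hsub : (⋃ c ∈ Finset.univ.filter P, Y c j) ⊆ ⋃ i, Metric.closedBall (I.pt i) r := by
          refine Set.iUnion₂_subset fun c hc x hx => ?_
          obtain ⟨i, hi⟩ := (Finset.mem_filter.1 hc).2
          exact Set.mem_iUnion.2 ⟨i, by rw [Metric.mem_closedBall, dist_comm]; exact hi x hx⟩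
        refine (measureReal_mono hsub).trans ?_
        refine (measureReal_iUnion_fintype_le _).trans ?_
        have : ∀ i, (I.vol j).real (Metric.closedBall (I.pt i) r) ≤ (2 * r) ^ d := fun i =>
          ENNReal.toReal_le_of_le_ofReal (by positivity)
            ((Measure.restrict_le_self _).trans (volume_closedBall_le _ hr0.le))
        exact (Finset.sum_le_sum fun i _ => this i).trans (by simp)
      · intro c _ c' _ hne
        refine Set.disjoint_left.2 fun x hx hx' => hne (hinj ?_)
        exact cells_disjoint hd hm (hmemq c) (hmemq c') hx hx'
      · exact fun c _ => measurableSet_cell o (q c)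
    refine (Finset.sum_le_sum fun j _ => e2 j).trans ?_
    have hn := I.n_pos hm
    have hV := mass_pos (I := I) hm
    have e3 : ∑ _j : Fin m, (n : ℝ) * (2 * r) ^ d = (2 * δ) ^ d * I.mass := by
      rw [hr, radius_eq δ hm, ← mul_assoc, mul_pow, scale_pow hd hm]
      have : (n : ℝ) ≠ 0 := by positivity
      have : (m : ℝ) ≠ 0 := by positivity
      simp; field_simp
    rw [e3]
    refine mul_le_mul_of_nonneg_right ?_ hV.le
    exact pow_le_of_le_one (by positivity) (by linarith) hd.ne'
  have hlow := hτ.le_cost hd hm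
  have hc0 := hτ.cost_nonneg
  have hr' : 2 * r * (2 * δ * I.mass) ≤ 32 * δ ^ 2 * I.cost τ := by
    rw [hr, radius_eq δ hm]
    nlinarith [sq_nonneg δ]
  have h6 : ((1 + δ) * (1 + δ) + 1) * ∑ c, err c * I.pieceWt Y c ≤
      ((1 + δ) * (1 + δ) + 1) * (32 * δ ^ 2 * I.cost τ) :=
    mul_le_mul_of_nonneg_left (hsum.trans hr') (by positivity)
  -- With `δ ≤ 1 / 5` each higher power of `δ` is bounded by a multiple of `δ`. At `δ = 1 / 5` the
  -- sides are `4.8512` and `5.2`.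
  have h7 : (1 + δ) * (1 + δ) ^ 2 + ((1 + δ) * (1 + δ) + 1) * (32 * δ ^ 2) ≤ 1 + 21 * δ := by
    nlinarith [mul_nonneg hδ.le (sub_nonneg.2 hδ5), mul_nonneg (sq_nonneg δ) (sub_nonneg.2 hδ5),
      mul_nonneg (mul_nonneg (sq_nonneg δ) hδ.le) (sub_nonneg.2 hδ5), hδ]
  have h8 := mul_le_mul_of_nonneg_right h7 hc0
  linarith

end Input

end PointSimplex

namespace PointSimplex

/-! ## Reasoning about RAM programs -/

section memory
variable (σ : Mem) (A i B j v : ℕ) (r : ℝ)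

@[simp] theorem Mem.setNat_nat : (σ.setNat A i v).nat B j =
    if B = A ∧ j = i then v else σ.nat B j := by
  by_cases h : B = A
  · subst h; by_cases h2 : j = i
    · subst h2; simp [Mem.setNat]
    · simp [Mem.setNat, h2]
  · simp [Mem.setNat, h]

@[simp] theorem Mem.setReal_real : (σ.setReal A i r).real B j =
    if B = A ∧ j = i then r else σ.real B j := by
  by_cases h : B = A
  · subst h; by_cases h2 : j = i
    · subst h2; simp [Mem.setReal]
    · simp [Mem.setReal, h2]
  · simp [Mem.setReal, h]

@[simp] theorem Mem.setNat_real : (σ.setNat A i v).real = σ.real := rfl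

@[simp] theorem Mem.setReal_nat : (σ.setReal A i r).nat = σ.nat := rfl

theorem Mem.setNat_nat_of_ne {A B : ℕ} (h : B ≠ A) : (σ.setNat A i v).nat B = σ.nat B := by
  simp [Mem.setNat, h]

theorem Mem.setReal_real_of_ne {A B : ℕ} (h : B ≠ A) : (σ.setReal A i r).real B = σ.real B := by
  simp [Mem.setReal, h]

end memory

/-- Natural arrays a program may write to. -/
def Cmd.wn : Cmd → List ℕ
  | .skip => []
  | .setNat A _ _ => [A]
  | .setReal _ _ _ => []
  | .seq p q => p.wn ++ q.wn
  | .ite _ p q => p.wn ++ q.wn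
  | .loop _ p => p.wn
  | .solve _ _ _ _ _ _ K S T _ => [K, S, T]

/-- Real arrays a program may write to. -/
def Cmd.wr : Cmd → List ℕ
  | .skip => []
  | .setNat _ _ _ => []
  | .setReal A _ _ => [A]
  | .seq p q => p.wr ++ q.wr
  | .ite _ p q => p.wr ++ q.wr
  | .loop _ p => p.wr
  | .solve _ _ _ _ _ _ _ _ _ M => [M]

/-- The memories agree except on the natural arrays `ln` and the real arrays `lr`. -/
def Eqv (ln lr : List ℕ) (σ σ' : Mem) : Prop :=
  (∀ B, B ∉ ln → σ'.nat B = σ.nat B) ∧ (∀ B, B ∉ lr → σ'.real B = σ.real B)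

theorem Eqv.refl (ln lr : List ℕ) (σ : Mem) : Eqv ln lr σ σ := ⟨fun _ _ => rfl, fun _ _ => rfl⟩

theorem Eqv.trans {ln lr : List ℕ} {σ σ' σ'' : Mem} (h : Eqv ln lr σ σ') (h' : Eqv ln lr σ' σ'') :
    Eqv ln lr σ σ'' :=
  ⟨fun B hB => (h'.1 B hB).trans (h.1 B hB), fun B hB => (h'.2 B hB).trans (h.2 B hB)⟩

theorem Eqv.mono {ln lr ln' lr' : List ℕ} {σ σ' : Mem} (h : Eqv ln lr σ σ') (h1 : ln ⊆ ln')
    (h2 : lr ⊆ lr') : Eqv ln' lr' σ σ' :=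
  ⟨fun B hB => h.1 B fun h => hB (h1 h), fun B hB => h.2 B fun h => hB (h2 h)⟩

variable {d : ℕ} {A : Solver d} {f : ℕ → ℕ}

/-- The frame rule: arrays that do not occur as targets in the text of a program survive its run.
All later reasoning about separate arrays rests on this, with membership settled by `decide`. -/
theorem Exec.eqv {p : Cmd} {σ σ' : Mem} {t : ℕ} (h : Exec A f p σ t σ') : Eqv p.wn p.wr σ σ' := by
  induction h with
  | skip => exact Eqv.refl _ _ _
  | setNat σ B i e =>
    refine ⟨fun C hC => Mem.setNat_nat_of_ne _ _ _ (by simpa [Cmd.wn] using hC), fun C _ => rfl⟩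
  | setReal σ B i e =>
    refine ⟨fun C _ => rfl, fun C hC => Mem.setReal_real_of_ne _ _ _ (by simpa [Cmd.wr] using hC)⟩
  | seq _ _ ih1 ih2 =>
    exact (ih1.mono (List.subset_append_left _ _) (List.subset_append_left _ _)).trans
      (ih2.mono (List.subset_append_right _ _) (List.subset_append_right _ _))
  | iteTrue _ _ ih => exact ih.mono (List.subset_append_left _ _) (List.subset_append_left _ _)
  | iteFalse _ _ ih => exact ih.mono (List.subset_append_right _ _) (List.subset_append_right _ _)
  | loopDone => exact Eqv.refl _ _ _
  | loopStep _ _ _ ih1 ih2 => exact ih1.trans ih2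
  | solve σ a b X U Y V K S T M =>
    constructor
    · intro B hB
      simp only [Cmd.wn, List.mem_cons, List.not_mem_nil, or_false, not_or] at hB
      ext l
      simp [Mem.storePlan, hB]
    · intro B hB
      simp only [Cmd.wr, List.mem_cons, List.not_mem_nil, or_false] at hB
      ext l
      simp [Mem.storePlan, hB]

theorem eqv_setNat (σ : Mem) (B i v : ℕ) : Eqv [B] [] σ (σ.setNat B i v) :=
  ⟨fun _ hB => Mem.setNat_nat_of_ne _ _ _ (by simpa using hB), fun _ _ => rfl⟩

theorem eqv_setReal (σ : Mem) (B i : ℕ) (v : ℝ) : Eqv [] [B] σ (σ.setReal B i v) :=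
  ⟨fun _ _ => rfl, fun _ hB => Mem.setReal_real_of_ne _ _ _ (by simpa using hB)⟩

theorem Eqv.n {ln lr : List ℕ} {σ σ' : Mem} (h : Eqv ln lr σ σ') (B : ℕ)
    (hB : B ∉ ln := by decide) : σ'.nat B = σ.nat B := h.1 B hB

theorem Eqv.r {ln lr : List ℕ} {σ σ' : Mem} (h : Eqv ln lr σ σ') (B : ℕ)
    (hB : B ∉ lr := by decide) : σ'.real B = σ.real B := h.2 B hB

/-- Started in `σ`, the program halts within time `T` in a memory satisfying `Q`. -/
def Runs (A : Solver d) (f : ℕ → ℕ) (p : Cmd) (σ : Mem) (T : ℕ) (Q : Mem → Prop) : Prop :=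
  ∃ t σ', Exec A f p σ t σ' ∧ t ≤ T ∧ Q σ'

namespace Runs
variable {p q : Cmd} {σ : Mem} {T T' : ℕ} {Q Q' : Mem → Prop}

theorem mono (h : Runs A f p σ T Q) (hT : T ≤ T') (hQ : ∀ σ', Q σ' → Q' σ') :
    Runs A f p σ T' Q' := by
  obtain ⟨t, σ', h1, h2, h3⟩ := h
  exact ⟨t, σ', h1, h2.trans hT, hQ _ h3⟩

theorem frame (h : Runs A f p σ T Q) : Runs A f p σ T fun σ' => Q σ' ∧ Eqv p.wn p.wr σ σ' := by
  obtain ⟨t, σ', h1, h2, h3⟩ := h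
  exact ⟨t, σ', h1, h2, h3, h1.eqv⟩

/-- Weaken the postcondition, knowing which arrays were not written to. -/
theorem imp (h : Runs A f p σ T Q) (hT : T ≤ T') (hQ : ∀ σ', Eqv p.wn p.wr σ σ' → Q σ' → Q' σ') :
    Runs A f p σ T' Q' :=
  h.frame.mono hT fun σ' h => hQ σ' h.2 h.1

theorem seq (T₁ T₂ : ℕ) (hT : T₁ + T₂ ≤ T) (h : Runs A f p σ T₁ fun σ' => Runs A f q σ' T₂ Q) :
    Runs A f (.seq p q) σ T Q := by
  obtain ⟨t, σ', h1, h2, u, σ'', h3, h4, h5⟩ := h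
  exact ⟨t + u, σ'', .seq h1 h3, by omega, h5⟩

theorem skip (hT : 1 ≤ T) (hQ : Q σ) : Runs A f .skip σ T Q := ⟨1, σ, .skip σ, hT, hQ⟩

theorem setNat {B : ℕ} {i e : NExp} (hT : i.time + e.time + 1 ≤ T)
    (hQ : Q (σ.setNat B (i.val σ) (e.val σ))) : Runs A f (.setNat B i e) σ T Q :=
  ⟨_, _, .setNat σ B i e, hT, hQ⟩

theorem setReal {B : ℕ} {i : NExp} {e : RExp} (hT : i.time + e.time + 1 ≤ T)
    (hQ : Q (σ.setReal B (i.val σ) (e.val σ))) : Runs A f (.setReal B i e) σ T Q :=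
  ⟨_, _, .setReal σ B i e, hT, hQ⟩

theorem ite {b : Test} (T₁ : ℕ) (hT : b.time + T₁ + 1 ≤ T) (h1 : b.Holds σ → Runs A f p σ T₁ Q)
    (h2 : ¬ b.Holds σ → Runs A f q σ T₁ Q) : Runs A f (.ite b p q) σ T Q := by
  by_cases hb : b.Holds σ
  · obtain ⟨t, σ', h3, h4, h5⟩ := h1 hb
    exact ⟨_, σ', .iteTrue hb h3, by omega, h5⟩
  · obtain ⟨t, σ', h3, h4, h5⟩ := h2 hb
    exact ⟨_, σ', .iteFalse hb h3, by omega, h5⟩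

/-- Loops with an invariant that mentions the remaining time. -/
theorem loopTime {b : Test} (Inv : ℕ → Mem → Prop) (N : ℕ) (hT : N + b.time + 1 ≤ T) (h0 : Inv N σ)
    (hstep : ∀ φ σ', Eqv p.wn p.wr σ σ' → Inv φ σ' → b.Holds σ' →
      ∃ T₁ φ', T₁ + b.time + 1 + φ' ≤ φ ∧ Runs A f p σ' T₁ (Inv φ'))
    (hQ : ∀ φ σ', Eqv p.wn p.wr σ σ' → Inv φ σ' → ¬ b.Holds σ' → Q σ') :
    Runs A f (.loop b p) σ T Q := by
  suffices ∀ N σ', Eqv p.wn p.wr σ σ' → Inv N σ' → Runs A f (.loop b p) σ' (N + b.time + 1) Q from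
    (this N σ (Eqv.refl _ _ _) h0).mono hT fun _ h => h
  intro N
  induction N using Nat.strong_induction_on with
  | _ N ih =>
    intro σ' he hI
    by_cases hb : b.Holds σ'
    · obtain ⟨T₁, φ', h4, t, σ₁, h1, h2, h3⟩ := hstep N σ' he hI hb
      obtain ⟨u, σ₂, h5, h6, h7⟩ := ih φ' (by omega) σ₁ (he.trans h1.eqv) h3
      exact ⟨_, σ₂, .loopStep hb h1 h5, by omega, h7⟩
    · exact ⟨_, σ', .loopDone hb, by omega, hQ N σ' he hI hb⟩

end Runs

/-- The natural number variable `i`. -/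
abbrev nv (i : ℕ) : NExp := .get i (.lit 0)

/-- The real variable `x`. -/
abbrev rv (x : ℕ) : RExp := .get x (.lit 0)

/-- `for i < N`. -/
def forCmd (i : ℕ) (N : NExp) (p : Cmd) : Cmd :=
  .seq (.setNat i (.lit 0) (.lit 0))
    (.loop (.natLt (nv i) N) (.seq p (.setNat i (.lit 0) (.add (nv i) (.lit 1)))))

/-- The counter is assigned between the rounds, so the invariant has to survive assignments to it
(`hJ`). The `10` covers the test and the increment. -/
theorem Runs.forLoop {i : ℕ} {N : NExp} {p : Cmd} {σ : Mem} {T : ℕ} {Q : Mem → Prop} (N₀ T₁ : ℕ)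
    (J : ℕ → Mem → Prop) (hT : 3 + (N₀ + 1) * (T₁ + N.time + 10) ≤ T) (hi : i ∉ p.wn)
    (hN : ∀ σ', Eqv (i :: p.wn) p.wr σ σ' → N.val σ' = N₀) (h0 : J 0 σ)
    (hJ : ∀ k σ' v, J k σ' → J k (σ'.setNat i 0 v))
    (hstep : ∀ k < N₀, ∀ σ', Eqv (i :: p.wn) p.wr σ σ' → J k σ' → σ'.nat i 0 = k →
      Runs A f p σ' T₁ (J (k + 1)))
    (hQ : ∀ σ', Eqv (i :: p.wn) p.wr σ σ' → J N₀ σ' → Q σ') :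
    Runs A f (forCmd i N p) σ T Q := by
  have hset : ∀ σ' v, Eqv (i :: p.wn) p.wr σ' (σ'.setNat i 0 v) := fun σ' v =>
    ⟨fun B hB => Mem.setNat_nat_of_ne _ _ _ (by simp at hB; exact hB.1), fun _ _ => rfl⟩
  have hT' : (N₀ + 1) * (T₁ + N.time + 10) = N₀ * (T₁ + N.time + 10) + (T₁ + N.time + 10) := by ring
  refine .seq 3 (N₀ * (T₁ + N.time + 10) + N.time + 4) (by omega) (.setNat (by simp [NExp.time]) ?_)
  refine .loopTime (fun φ σ' => Eqv (i :: p.wn) p.wr σ σ' ∧ J (σ'.nat i 0) σ' ∧ σ'.nat i 0 ≤ N₀ ∧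
    φ = (N₀ - σ'.nat i 0) * (T₁ + N.time + 10)) (N₀ * (T₁ + N.time + 10)) ?_ ?_ ?_ ?_
  · simp [NExp.time, Test.time]; omega
  · refine ⟨hset _ _, ?_, by simp [NExp.val], by simp [NExp.val]⟩
    have := hJ 0 σ 0 h0
    simpa [NExp.val] using this
  · rintro φ σ' - ⟨he, hj, hle, rfl⟩ hb
    have hN' := hN σ' he
    simp only [Test.Holds, NExp.val, hN'] at hb
    obtain ⟨t, σ₁, h1, h2, h3⟩ := hstep _ hb σ' he hj rfl
    have hσ₁ : σ₁.nat i 0 = σ'.nat i 0 := by rw [h1.eqv.1 i hi]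
    refine ⟨T₁ + 6, (N₀ - (σ'.nat i 0 + 1)) * (T₁ + N.time + 10), ?_,
      .seq T₁ 6 le_rfl ⟨t, σ₁, h1, h2, .setNat (by simp [NExp.time]) ?_⟩⟩
    · have : N₀ - σ'.nat i 0 = (N₀ - (σ'.nat i 0 + 1)) + 1 := by omega
      rw [this, add_mul]
      simp [Test.time, NExp.time]; omega
    have hnew : (σ₁.setNat i 0 (σ₁.nat i 0 + 1)).nat i 0 = σ'.nat i 0 + 1 := by simp [hσ₁]
    simp only [NExp.val]
    refine ⟨?_, ?_, by omega, by rw [hnew]⟩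
    · exact (he.trans (h1.eqv.mono (List.subset_cons_self _ _) (List.Subset.refl _))).trans
        (hset _ _)
    · rw [hnew]; exact hJ _ _ _ h3
  · rintro φ σ' - ⟨he, hj, hle, -⟩ hb
    have hN' := hN σ' he
    simp only [Test.Holds, NExp.val, hN'] at hb
    have : σ'.nat i 0 = N₀ := by omega
    rw [this] at hj
    exact hQ σ' he hj

/-- A bound on the running time if no loop makes more than `K` rounds. -/
def Cmd.bnd (K : ℕ) : Cmd → ℕ
  | .skip => 1
  | .setNat _ i e => i.time + e.time + 1
  | .setReal _ i e => i.time + e.time + 1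
  | .seq p q => p.bnd K + q.bnd K
  | .ite b p q => b.time + (p.bnd K + q.bnd K) + 1
  | .loop b p => (K + 1) * (p.bnd K + b.time + 1)
  | .solve _ _ _ _ _ _ _ _ _ _ => 0

/-- For a fixed program the bound is polynomial in `K`. Hence it is exponential in `d` whenever `K`
is. -/
theorem Cmd.bnd_le (p : Cmd) : ∃ c k : ℕ, ∀ K, 0 < K → p.bnd K ≤ c * K ^ k := by
  have up : ∀ {c k c' k' K : ℕ}, 0 < K → c * K ^ k + c' * K ^ k' ≤ (c + c') * K ^ (k + k') := by
    intro c k c' k' K hK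
    have h1 : K ^ k ≤ K ^ (k + k') := Nat.pow_le_pow_right hK (by omega)
    have h2 : K ^ k' ≤ K ^ (k + k') := Nat.pow_le_pow_right hK (by omega)
    nlinarith [Nat.mul_le_mul_left c h1, Nat.mul_le_mul_left c' h2]
  induction p with
  | skip => exact ⟨1, 0, fun K _ => by simp [bnd]⟩
  | setNat A i e => exact ⟨i.time + e.time + 1, 0, fun K _ => by simp [bnd]⟩
  | setReal A i e => exact ⟨i.time + e.time + 1, 0, fun K _ => by simp [bnd]⟩
  | seq p q hp hq =>
    obtain ⟨c, k, h⟩ := hp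
    obtain ⟨c', k', h'⟩ := hq
    exact ⟨c + c', k + k', fun K hK => (add_le_add (h K hK) (h' K hK)).trans (up hK)⟩
  | ite b p q hp hq =>
    obtain ⟨c, k, h⟩ := hp
    obtain ⟨c', k', h'⟩ := hq
    refine ⟨c + c' + (b.time + 1), k + k', fun K hK => ?_⟩
    have h1 := (add_le_add (h K hK) (h' K hK)).trans (up hK)
    have h2 := Nat.mul_le_mul_left (b.time + 1) (Nat.pow_pos hK : 0 < K ^ (k + k'))
    simp only [bnd, add_mul] at h1 h2 ⊢
    omega
  | loop b p hp =>
    obtain ⟨c, k, h⟩ := hp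
    refine ⟨2 * (c + b.time + 1), k + 1, fun K hK => ?_⟩
    have h2 := Nat.mul_le_mul_left (b.time + 1) (Nat.pow_pos hK : 0 < K ^ k)
    have h3 : p.bnd K + b.time + 1 ≤ (c + b.time + 1) * K ^ k := by
      have := h K hK
      simp only [add_mul] at h2 ⊢
      omega
    calc (K + 1) * (p.bnd K + b.time + 1) ≤ (2 * K) * ((c + b.time + 1) * K ^ k) :=
          Nat.mul_le_mul (by omega) h3
      _ = _ := by ring
  | solve => exact ⟨0, 0, fun K _ => by simp [bnd]⟩

/-- Started in `σ`, the program halts in a memory satisfying `Q`, within the time allowed by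
`Cmd.bnd`. -/
def Within (A : Solver d) (f : ℕ → ℕ) (K : ℕ) (p : Cmd) (σ : Mem) (Q : Mem → Prop) : Prop :=
  Runs A f p σ (p.bnd K) Q

namespace Within
variable {K : ℕ} {p q : Cmd} {σ : Mem} {Q Q' : Mem → Prop}

theorem imp (h : Within A f K p σ Q) (hQ : ∀ σ', Eqv p.wn p.wr σ σ' → Q σ' → Q' σ') :
    Within A f K p σ Q' := Runs.imp h le_rfl hQ

theorem seq (h : Within A f K p σ fun σ' => Within A f K q σ' Q) : Within A f K (.seq p q) σ Q :=
  Runs.seq _ _ le_rfl h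

theorem skip (hQ : Q σ) : Within A f K .skip σ Q := Runs.skip le_rfl hQ

theorem setNat {B : ℕ} {i e : NExp} (hQ : Q (σ.setNat B (i.val σ) (e.val σ))) :
    Within A f K (.setNat B i e) σ Q := Runs.setNat le_rfl hQ

theorem setReal {B : ℕ} {i : NExp} {e : RExp} (hQ : Q (σ.setReal B (i.val σ) (e.val σ))) :
    Within A f K (.setReal B i e) σ Q := Runs.setReal le_rfl hQ

theorem ite {b : Test} (h1 : b.Holds σ → Within A f K p σ Q)
    (h2 : ¬ b.Holds σ → Within A f K q σ Q) : Within A f K (.ite b p q) σ Q :=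
  Runs.ite _ le_rfl (fun h => (h1 h).mono (Nat.le_add_right _ _) fun _ h => h)
    (fun h => (h2 h).mono (Nat.le_add_left _ _) fun _ h => h)

theorem forLoop {i : ℕ} {N : NExp} (N₀ : ℕ) (J : ℕ → Mem → Prop) (hK : N₀ ≤ K) (hi : i ∉ p.wn)
    (hN : ∀ σ', Eqv (i :: p.wn) p.wr σ σ' → N.val σ' = N₀) (h0 : J 0 σ)
    (hJ : ∀ k σ' v, J k σ' → J k (σ'.setNat i 0 v))
    (hstep : ∀ k < N₀, ∀ σ', Eqv (i :: p.wn) p.wr σ σ' → J k σ' → σ'.nat i 0 = k →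
      Within A f K p σ' (J (k + 1)))
    (hQ : ∀ σ', Eqv (i :: p.wn) p.wr σ σ' → J N₀ σ' → Q σ') :
    Within A f K (forCmd i N p) σ Q :=
  Runs.forLoop N₀ (p.bnd K) J (by
    have := Nat.mul_le_mul_right (p.bnd K + N.time + 10) (Nat.succ_le_succ hK)
    simp only [forCmd, Cmd.bnd, NExp.time, Test.time]
    calc _ ≤ _ := Nat.add_le_add_left this 3
      _ ≤ _ := Nat.add_le_add (by omega) (Nat.mul_le_mul_left _ (by omega)))
    hi hN h0 hJ hstep hQ

end Within

/-- `x := ∑ i < N, e`. -/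
def sumCmd (x i : ℕ) (N : NExp) (e : RExp) : Cmd :=
  .seq (.setReal x (.lit 0) (.lit 0)) (forCmd i N (.setReal x (.lit 0) (.add (rv x) e)))

/-- `for i < N do p; B[a] := e`. -/
def fillCmd (p : Cmd) (B i : ℕ) (N a : NExp) (e : RExp) : Cmd :=
  forCmd i N (.seq p (.setReal B a e))

/-- `for i < N, j < M do p; B[i * M + j] := e`. -/
def fill2Cmd (p : Cmd) (B i j : ℕ) (N M : NExp) (e : RExp) : Cmd :=
  forCmd i N (fillCmd p B j M (.add (.mul (nv i) M) (nv j)) e)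

theorem index_inj {M a b a' b' : ℕ} (hb : b < M) (hb' : b' < M) (h : a * M + b = a' * M + b') :
    a = a' ∧ b = b' := by
  have hM : 0 < M := by omega
  have h1 := congrArg (· / M) h
  simp only [Nat.mul_comm _ M, Nat.mul_add_div hM, Nat.div_eq_of_lt hb, Nat.div_eq_of_lt hb'] at h1
  have : a = a' := by omega
  subst this
  exact ⟨rfl, by omega⟩

namespace Within
variable {K : ℕ} {p q : Cmd} {σ : Mem} {Q Q' : Mem → Prop}

theorem sum {x i : ℕ} {N : NExp} {e : RExp} (N₀ : ℕ) (g : Fin N₀ → ℝ) (hK : N₀ ≤ K)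
    (hN : ∀ σ', Eqv [i] [x] σ σ' → N.val σ' = N₀)
    (hg : ∀ k : Fin N₀, ∀ σ', Eqv [i] [x] σ σ' → σ'.nat i 0 = k → e.val σ' = g k)
    (hQ : ∀ σ', Eqv [i] [x] σ σ' → σ'.real x 0 = ∑ k, g k → Q σ') :
    Within A f K (sumCmd x i N e) σ Q := by
  have hx : Eqv [i] [x] σ (σ.setReal x 0 0) :=
    ⟨fun _ _ => rfl, fun B hB => Mem.setReal_real_of_ne _ _ _ (by simpa using hB)⟩
  refine .seq (.setReal ?_)
  simp only [NExp.val, RExp.val, Nat.cast_zero]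
  refine .forLoop N₀ (fun k σ' => σ'.real x 0 =
    ∑ j ∈ Finset.range k, if h : j < N₀ then g ⟨j, h⟩ else 0) hK (by simp [Cmd.wn]) ?_ (by simp)
    (by intros; simpa) ?_ ?_
  · intro σ' h
    exact hN _ (hx.trans (h.mono (by simp [Cmd.wn]) (by simp [Cmd.wr])))
  · intro k hk σ' h hj hi
    refine .setReal ?_
    have := hg ⟨k, hk⟩ σ' (hx.trans (h.mono (by simp [Cmd.wn]) (by simp [Cmd.wr]))) hi
    simp [NExp.val, RExp.val, hj, this, Finset.sum_range_succ, hk]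
  · intro σ' h hj
    refine hQ _ (hx.trans (h.mono (by simp [Cmd.wn]) (by simp [Cmd.wr]))) ?_
    rw [hj, Finset.sum_range]
    simp

theorem fill {B i : ℕ} {N a : NExp} {e : RExp} (N₀ : ℕ) (ix : Fin N₀ → ℕ) (g : Fin N₀ → ℝ)
    (hK : N₀ ≤ K) (hi : i ∉ p.wn) (hB : B ∉ p.wr)
    (hN : ∀ σ', Eqv (i :: p.wn) (B :: p.wr) σ σ' → N.val σ' = N₀)
    (hix : Function.Injective ix)
    (hp : ∀ k : Fin N₀, ∀ σ', Eqv (i :: p.wn) (B :: p.wr) σ σ' → σ'.nat i 0 = k →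
      Within A f K p σ' fun σ'' => a.val σ'' = ix k ∧ e.val σ'' = g k)
    (hQ : ∀ σ', Eqv (i :: p.wn) (B :: p.wr) σ σ' → (∀ k, σ'.real B (ix k) = g k) →
      (∀ b, (∀ k, ix k ≠ b) → σ'.real B b = σ.real B b) → Q σ') :
    Within A f K (fillCmd p B i N a e) σ Q := by
  have hmono : ∀ {σ'}, Eqv (i :: (Cmd.seq p (.setReal B a e)).wn) (Cmd.seq p (.setReal B a e)).wr
      σ σ' → Eqv (i :: p.wn) (B :: p.wr) σ σ' := fun h =>
    h.mono (by simp [Cmd.wn]) (by intro x; simp [Cmd.wr]; tauto)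
  refine .forLoop N₀ (fun k σ' => (∀ j : Fin N₀, j < k → σ'.real B (ix j) = g j) ∧
      (∀ b, (∀ j : Fin N₀, j < k → ix j ≠ b) → σ'.real B b = σ.real B b))
    hK (by simpa [Cmd.wn] using hi) ?_ (by simp) (by intros; simpa) ?_ ?_
  · exact fun σ' h => hN σ' (hmono h)
  · rintro k hk σ' h ⟨h1, h2⟩ hik
    refine .seq ((hp ⟨k, hk⟩ σ' (hmono h) hik).imp ?_)
    rintro σ'' he ⟨ha, hv⟩
    refine .setReal ?_
    rw [ha, hv]
    refine ⟨fun j hj => ?_, fun b hb => ?_⟩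
    · rw [Mem.setReal_real]
      by_cases hjk : j = ⟨k, hk⟩
      · subst hjk; simp
      · rw [if_neg fun h => hjk (hix h.2), he.2 B hB]
        have : (j : ℕ) ≠ k := fun h => hjk (Fin.ext h)
        exact h1 j (by omega)
    · rw [Mem.setReal_real, if_neg fun h => hb ⟨k, hk⟩ (by simp) h.2.symm, he.2 B hB]
      exact h2 b fun j hj => hb j (by omega)
  · exact fun σ' h hj => hQ σ' (hmono h) (fun k => hj.1 k k.2) fun b hb => hj.2 b fun j _ => hb j

theorem fill2 {B i j : ℕ} {N M : NExp} {e : RExp} (N₀ M₀ : ℕ) (g : Fin N₀ → Fin M₀ → ℝ)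
    (hK : N₀ ≤ K) (hK' : M₀ ≤ K) (hi : i ∉ p.wn) (hj : j ∉ p.wn) (hij : i ≠ j) (hB : B ∉ p.wr)
    (hN : ∀ σ', Eqv (i :: j :: p.wn) (B :: p.wr) σ σ' → N.val σ' = N₀)
    (hM : ∀ σ', Eqv (i :: j :: p.wn) (B :: p.wr) σ σ' → M.val σ' = M₀)
    (hp : ∀ (k : Fin N₀) (l : Fin M₀), ∀ σ', Eqv (i :: j :: p.wn) (B :: p.wr) σ σ' →
      σ'.nat i 0 = k → σ'.nat j 0 = l → Within A f K p σ' fun σ'' => e.val σ'' = g k l)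
    (hQ : ∀ σ', Eqv (i :: j :: p.wn) (B :: p.wr) σ σ' →
      (∀ (k : Fin N₀) (l : Fin M₀), σ'.real B (k * M₀ + l) = g k l) → Q σ') :
    Within A f K (fill2Cmd p B i j N M e) σ Q := by
  have hmono : ∀ {σ'}, Eqv (i :: (fillCmd p B j M (.add (.mul (nv i) M) (nv j)) e).wn)
      (fillCmd p B j M (.add (.mul (nv i) M) (nv j)) e).wr σ σ' →
      Eqv (i :: j :: p.wn) (B :: p.wr) σ σ' := fun h =>
    h.mono (by intro x; simp [Cmd.wn, fillCmd, forCmd]; tauto)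
      (by intro x; simp [Cmd.wr, fillCmd, forCmd]; tauto)
  refine .forLoop N₀ (fun k σ' => ∀ a : Fin N₀, a < k → ∀ l : Fin M₀, σ'.real B (a * M₀ + l) = g a l)
    hK (by simp [Cmd.wn, fillCmd, forCmd, hi, hij]) (fun σ' h => hN σ' (hmono h)) (by simp)
    (fun k σ' v h => by simpa using h) ?_ (fun σ' h h' => hQ σ' (hmono h) fun k => h' k k.2)
  intro k hk σ' h hJ hik
  have he := hmono h
  have hsub : ∀ {σ''}, Eqv (j :: p.wn) (B :: p.wr) σ' σ'' →
      Eqv (i :: j :: p.wn) (B :: p.wr) σ σ'' := fun h =>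
    he.trans (h.mono (by simp) (by simp))
  refine .fill M₀ (fun l => k * M₀ + l) (g ⟨k, hk⟩) hK' hj hB ?_ ?_ ?_ ?_
  · exact fun σ'' h'' => hM σ'' (hsub h'')
  · exact fun a b hab => Fin.ext (index_inj a.2 b.2 hab).2
  · intro l σ'' h'' hjl
    have hi'' : σ''.nat i 0 = k := by
      rw [h''.1 i (by simp [hi, hij]), hik]
    refine (hp ⟨k, hk⟩ l σ'' (hsub h'') hi'' hjl).imp ?_
    intro σ₃ h₃ hv
    refine ⟨?_, hv⟩
    have h4 : Eqv (i :: j :: p.wn) (B :: p.wr) σ σ₃ :=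
      (hsub h'').trans (h₃.mono (by intro x; simp; tauto) (by intro x; simp; tauto))
    simp [NExp.val, hM σ₃ h4, h₃.1 i hi, h₃.1 j hj, hi'', hjl]
  · intro σ'' h'' h1 h2 a ha l
    rcases Nat.lt_succ_iff_lt_or_eq.1 ha with hak | hak
    · rw [h2 _ fun b hab => ?_]
      · exact hJ a hak l
      · have := (index_inj b.2 l.2 hab).1
        omega
    · obtain rfl : a = ⟨k, hk⟩ := Fin.ext hak
      exact h1 l

end Within

end PointSimplex

namespace PointSimplex

/-! ## Volume of a polytope on the RAM -/

/-- The array holds the matrix `M` row by row. -/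
def MatAt {n m : ℕ} (ρ : ℕ → ℝ) (M : Fin n → Fin m → ℝ) : Prop :=
  ∀ (i : Fin n) (j : Fin m), ρ (i * m + j) = M i j

/-- The array holds the vector `v`. -/
def VecAt {n : ℕ} (ρ : ℕ → ℝ) (v : Fin n → ℝ) : Prop := ∀ i : Fin n, ρ i = v i

/-- The dimension. -/
abbrev dimE : NExp := .get 0 (.lit 2)

/-- Entry `(i, j)` of the matrix with `d` columns in array `B`. -/
abbrev entryE (B i j : ℕ) : RExp := .get B (.add (.mul (nv i) dimE) (nv j))

/-- Kronecker's delta. -/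
abbrev deltaE (i j : ℕ) : RExp :=
  -- Subtraction is truncated, so the sum of the two differences vanishes exactly for equal indices.
  .ofNat (.sub (.lit 1) (.add (.sub (nv i) (nv j)) (.sub (nv j) (nv i))))

/-- Faddeev–LeVerrier for the matrix in array 10. -/
def flCmd : Cmd :=
  .seq (fill2Cmd .skip 11 13 14 dimE dimE (deltaE 13 14)) <|
  forCmd 16 dimE <|
  .seq (fill2Cmd (sumCmd 23 15 dimE (.mul (entryE 10 13 15) (entryE 11 15 14))) 12 13 14 dimE dimE
    (rv 23)) <|
  .seq (sumCmd 24 13 dimE (entryE 12 13 13)) <|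
  .seq (.setReal 22 (.lit 0) (.div (.sub (.lit 0) (rv 24)) (.ofNat (.add (nv 16) (.lit 1))))) <|
  .seq (fill2Cmd .skip 13 13 14 dimE dimE (entryE 11 13 14)) <|
  fill2Cmd .skip 11 13 14 dimE dimE (.add (entryE 12 13 14) (.mul (rv 22) (deltaE 13 14)))

variable {d : ℕ} {S : Solver d} {f : ℕ → ℕ} {K : ℕ} {σ : Mem}

theorem deltaE_val {i j : ℕ} {a b : Fin d} (hi : σ.nat i 0 = a) (hj : σ.nat j 0 = b) :
    (deltaE i j).val σ = (1 : Matrix (Fin d) (Fin d) ℝ) a b := by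
  simp only [RExp.val, NExp.val, hi, hj, Matrix.one_apply]
  by_cases h : a = b
  · simp [h]
  · have : (a : ℕ) ≠ b := fun h' => h (Fin.ext h')
    rw [if_neg h, show 1 - ((a : ℕ) - (b : ℕ) + ((b : ℕ) - (a : ℕ))) = 0 by omega, Nat.cast_zero]

theorem entryE_val {B i j e : ℕ} {M : Fin e → Fin d → ℝ} {a : Fin e} {b : Fin d}
    (hd : σ.nat 0 2 = d) (hM : MatAt (σ.real B) M) (hi : σ.nat i 0 = a) (hj : σ.nat j 0 = b) :
    (entryE B i j).val σ = M a b := by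
  simp only [RExp.val, NExp.val, hi, hj, hd, hM a b]

theorem within_flCmd (hd0 : 0 < d) (hK : d ≤ K) (hd : σ.nat 0 2 = d) {M : Matrix (Fin d) (Fin d) ℝ}
    (hM : MatAt (σ.real 10) M) : Within S f K flCmd σ fun σ' =>
      MatAt (σ'.real 13) (flX M (d - 1)) ∧ σ'.real 22 0 = flq M (d - 1) := by
  refine .seq (.fill2 d d (1 : Matrix (Fin d) (Fin d) ℝ) hK hK (by decide) (by decide) (by decide)
    (by decide) ?_ ?_ ?_ ?_)
  · intro σ' h; simpa [NExp.val, h.n 0] using hd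
  · intro σ' h; simpa [NExp.val, h.n 0] using hd
  · intro k l σ' h hk hl
    exact .skip (deltaE_val hk hl)
  intro σ₁ h₁ hX
  -- After `d` rounds array 11 has gone one step too far, to `flX M d`. Array 13 keeps the preceding
  -- matrix, which is the one proportional to the inverse.
  refine .forLoop d (fun k σ' => MatAt (σ'.real 11) (flX M k) ∧
    (0 < k → MatAt (σ'.real 13) (flX M (k - 1)) ∧ σ'.real 22 0 = flq M (k - 1))) hK (by decide)
    (fun σ' h => by simpa [NExp.val, h.n 0, h₁.n 0] using hd) ⟨hX, by simp⟩ (by simp) ?_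
    (fun σ' h h' => h'.2 hd0)
  rintro k hk σ₂ h₂ ⟨hX, -⟩ hi
  have hd₂ : σ₂.nat 0 2 = d := by rw [h₂.n 0, h₁.n 0, hd]
  have hM₂ : MatAt (σ₂.real 10) M := by rw [h₂.r 10, h₁.r 10]; exact hM
  clear h₂ h₁
  refine .seq (.fill2 d d (M * flX M k) hK hK (by decide) (by decide) (by decide)
    (by decide) ?_ ?_ ?_ ?_)
  · intro σ' h; simpa [NExp.val, h.n 0] using hd₂
  · intro σ' h; simpa [NExp.val, h.n 0] using hd₂
  · intro a b σ' h ha hb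
    refine .sum d (fun l => M a l * flX M k l b) hK ?_ ?_ ?_
    · intro σ'' h'; simpa [NExp.val, h'.n 0, h.n 0] using hd₂
    · intro l σ'' h' hl
      have e1 : σ''.nat 0 2 = d := by rw [h'.n 0, h.n 0, hd₂]
      have e2 : σ''.nat 13 0 = a := by rw [h'.n 13, ha]
      have e3 : σ''.nat 14 0 = b := by rw [h'.n 14, hb]
      have e4 : MatAt (σ''.real 10) M := by rw [h'.r 10, h.r 10]; exact hM₂
      have e5 : MatAt (σ''.real 11) (flX M k) := by rw [h'.r 11, h.r 11]; exact hX
      change (entryE 10 13 15).val σ'' * (entryE 11 15 14).val σ'' = _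
      rw [entryE_val e1 e4 e2 hl, entryE_val e1 e5 hl e3]
    · intro σ'' h' hs
      simpa [RExp.val, NExp.val, Matrix.mul_apply] using hs
  intro σ₃ h₃ hY
  replace hY : MatAt (σ₃.real 12) (M * flX M k) := hY
  refine .seq (.sum d (fun l => (M * flX M k) l l) hK ?_ ?_ ?_)
  · intro σ' h; simpa [NExp.val, h.n 0, h₃.n 0] using hd₂
  · intro l σ' h hl
    exact entryE_val (by rw [h.n 0, h₃.n 0, hd₂]) (by rw [h.r 12]; exact hY) hl hl
  intro σ₄ h₄ htr
  refine .seq (.setReal ?_)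
  have hq : RExp.val σ₄ (.div (.sub (.lit 0) (rv 24)) (.ofNat (.add (nv 16) (.lit 1)))) =
      flq M k := by
    simp [RExp.val, NExp.val, htr, h₄.n 16, h₃.n 16, hi, flq, Matrix.trace]
  rw [hq]
  simp only [NExp.val]
  generalize hσ₅ : σ₄.setReal 22 0 (flq M k) = σ₅
  have h₅ : Eqv [] [22] σ₄ σ₅ := hσ₅ ▸ ⟨fun _ _ => rfl, fun B hB =>
    Mem.setReal_real_of_ne _ _ _ (by simpa using hB)⟩
  have hq₅ : σ₅.real 22 0 = flq M k := by simp [← hσ₅]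
  have hd₅ : σ₅.nat 0 2 = d := by rw [h₅.n 0, h₄.n 0, h₃.n 0, hd₂]
  have hX₅ : MatAt (σ₅.real 11) (flX M k) := by rw [h₅.r 11, h₄.r 11, h₃.r 11]; exact hX
  have hY₅ : MatAt (σ₅.real 12) (M * flX M k) := by rw [h₅.r 12, h₄.r 12]; exact hY
  refine .seq (.fill2 d d (flX M k) hK hK (by decide) (by decide) (by decide) (by decide) ?_ ?_ ?_ ?_)
  · intro σ' h; simpa [NExp.val, h.n 0] using hd₅
  · intro σ' h; simpa [NExp.val, h.n 0] using hd₅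
  · intro a b σ' h ha hb
    exact .skip (entryE_val (by rw [h.n 0, hd₅]) (by rw [h.r 11]; exact hX₅) ha hb)
  intro σ₆ h₆ hXp
  refine .fill2 d d (flX M (k + 1)) hK hK (by decide) (by decide) (by decide) (by decide) ?_ ?_ ?_ ?_
  · intro σ' h; simpa [NExp.val, h.n 0, h₆.n 0] using hd₅
  · intro σ' h; simpa [NExp.val, h.n 0, h₆.n 0] using hd₅
  · intro a b σ' h ha hb
    refine .skip ?_
    change (entryE 12 13 14).val σ' + (rv 22).val σ' * (deltaE 13 14).val σ' = _
    rw [entryE_val (by rw [h.n 0, h₆.n 0, hd₅]) (by rw [h.r 12, h₆.r 12]; exact hY₅) ha hb,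
      deltaE_val ha hb]
    simp only [RExp.val, NExp.val, h.r 22, h₆.r 22, hq₅]
    rfl
  intro σ₇ h₇ hX₇
  refine ⟨hX₇, fun _ => ⟨?_, ?_⟩⟩
  · rw [h₇.r 13]; exact hXp
  · rw [h₇.r 22, h₆.r 22, hq₅]; rfl

end PointSimplex

namespace PointSimplex

open Matrix

/-! ### Decoding of subsets -/

/-- The binary digits of `code` at the positions `R - i, …, R - 1` that are set, in decreasing
order. -/
def bitList (R code : ℕ) : ℕ → List ℕ
  | 0 => []
  | i + 1 => if code.testBit (R - 1 - i) then bitList R code i ++ [R - 1 - i] else bitList R code i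

theorem mem_bitList {R code i r : ℕ} (hi : i ≤ R) :
    r ∈ bitList R code i ↔ r < R ∧ R - i ≤ r ∧ code.testBit r := by
  induction i with
  | zero => simp [bitList]; omega
  | succ i ih =>
    have key : (R - (i + 1) ≤ r ∧ r < R) ↔ ((R - i ≤ r ∧ r < R) ∨ r = R - 1 - i) := by omega
    by_cases h : code.testBit (R - 1 - i)
    · rw [bitList, if_pos h, List.mem_append, ih (by omega), List.mem_singleton]
      constructor
      · rintro (⟨h1, h2, h3⟩ | rfl)
        · exact ⟨h1, by omega, h3⟩
        · exact ⟨by omega, by omega, h⟩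
      · rintro ⟨h1, h2, h3⟩
        by_cases h4 : r = R - 1 - i
        · exact .inr h4
        · exact .inl ⟨h1, by omega, h3⟩
    · rw [bitList, if_neg h, ih (by omega)]
      constructor
      · rintro ⟨h1, h2, h3⟩
        exact ⟨h1, by omega, h3⟩
      · rintro ⟨h1, h2, h3⟩
        have h4 : r ≠ R - 1 - i := by rintro rfl; exact h h3
        exact ⟨h1, by omega, h3⟩

theorem nodup_bitList {R code i : ℕ} (hi : i ≤ R) : (bitList R code i).Nodup := by
  induction i with
  | zero => simp [bitList]
  | succ i ih =>
    rw [bitList]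
    split_ifs with h
    · refine List.Nodup.append (ih (by omega)) (List.nodup_singleton _) ?_
      intro r hr hr'
      rw [mem_bitList (by omega)] at hr
      rw [List.mem_singleton] at hr'
      omega
    · exact ih (by omega)

/-- The members of `codeSet R code`, if there are `d` of them. -/
def codeMap {R : ℕ} (hR : 0 < R) (d code : ℕ) (p : Fin d) : Fin R :=
  -- The default `0` and the reduction modulo `R` only make the map total; they have no effect when
  -- the subset has `d` members.
  ⟨(bitList R code R).getD p 0 % R, Nat.mod_lt _ hR⟩

section codeMap
variable {R : ℕ} (hR : 0 < R) {d code : ℕ}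

theorem card_codeSet : (codeSet R code).card = (bitList R code R).length := by
  rw [← List.toFinset_card_of_nodup (nodup_bitList le_rfl),
    ← Finset.card_map Fin.valEmbedding]
  congr 1
  ext r
  simp only [codeSet, Finset.mem_map, Finset.mem_filter, Finset.mem_univ, true_and,
    Fin.valEmbedding_apply, List.mem_toFinset, mem_bitList le_rfl]
  constructor
  · rintro ⟨a, h, rfl⟩
    exact ⟨a.2, by omega, h⟩
  · rintro ⟨h1, -, h3⟩
    exact ⟨⟨r, h1⟩, h3, rfl⟩

theorem codeMap_val (h : (codeSet R code).card = d) (p : Fin d) :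
    ∃ hp : p < (bitList R code R).length, (codeMap hR d code p : ℕ) = (bitList R code R)[(p : ℕ)] := by
  rw [card_codeSet] at h
  have hp : p < (bitList R code R).length := by rw [h]; exact p.2
  refine ⟨hp, ?_⟩
  have := ((mem_bitList le_rfl).1 (List.getElem_mem hp)).1
  simp [codeMap, List.getD_eq_getElem?_getD, hp, Nat.mod_eq_of_lt this]

theorem codeMap_injective (h : (codeSet R code).card = d) : Function.Injective (codeMap hR d code) := by
  intro p q hpq
  obtain ⟨hp, ep⟩ := codeMap_val hR h p
  obtain ⟨hq, eq⟩ := codeMap_val hR h q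
  rw [hpq, eq] at ep
  exact Fin.ext ((nodup_bitList le_rfl).getElem_inj_iff.1 ep).symm

theorem mem_range_codeMap (h : (codeSet R code).card = d) (r : Fin R) :
    r ∈ Set.range (codeMap hR d code) ↔ code.testBit r := by
  constructor
  · rintro ⟨p, rfl⟩
    obtain ⟨hp, ep⟩ := codeMap_val hR h p
    rw [ep]
    exact ((mem_bitList le_rfl).1 (List.getElem_mem hp)).2.2
  · intro hr
    have : (r : ℕ) ∈ bitList R code R := (mem_bitList le_rfl).2 ⟨r.2, by omega, hr⟩
    obtain ⟨p, hp, e⟩ := List.getElem_of_mem this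
    have hpd : p < d := by rw [← h, card_codeSet]; exact hp
    obtain ⟨_, ep⟩ := codeMap_val hR h ⟨p, hpd⟩
    exact ⟨⟨p, hpd⟩, Fin.ext (ep.trans e)⟩

theorem image_codeMap (h : (codeSet R code).card = d) :
    Finset.univ.image (codeMap hR d code) = codeSet R code := by
  ext r
  have := mem_range_codeMap hR h r
  simpa [codeSet] using this

end codeMap

/-- Decode the subset `nv 17` of the `nv 12` constraints: indicator in array 6, members in
array 7. -/
def decodeCmd : Cmd :=
  .seq (.setNat 18 (.lit 0) (nv 17)) <|
  .seq (.setNat 20 (.lit 0) (.lit 0)) <|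
  forCmd 13 (nv 12) <|
  .seq (.setNat 14 (.lit 0) (.sub (.sub (nv 12) (.lit 1)) (nv 13))) <|
  .ite (.natLt (nv 18) (.get 5 (nv 14)))
    (.setNat 6 (nv 14) (.lit 0))
    (.seq (.setNat 6 (nv 14) (.lit 1)) <|
    .seq (.setNat 7 (nv 20) (nv 14)) <|
    .seq (.setNat 20 (.lit 0) (.add (nv 20) (.lit 1))) <|
    .setNat 18 (.lit 0) (.sub (nv 18) (.get 5 (nv 14))))

variable {d : ℕ} {S : Solver d} {f : ℕ → ℕ} {K : ℕ} {σ : Mem}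

/-- Naturals cannot be divided, so the digits are found from the top, by comparing the remainder
with a power of two and subtracting it if possible. -/
theorem within_decodeCmd {R code : ℕ} (hK : R ≤ K) (hR : σ.nat 12 0 = R) (hc : σ.nat 17 0 = code)
    (hcode : code < 2 ^ R) (hpow : ∀ r ≤ R, σ.nat 5 r = 2 ^ r) :
    Within S f K decodeCmd σ fun σ' =>
      σ'.nat 20 0 = (bitList R code R).length ∧
      (∀ q, ∀ h : q < (bitList R code R).length, σ'.nat 7 q = (bitList R code R)[q]) ∧
      ∀ r < R, σ'.nat 6 r = if code.testBit r then 1 else 0 := by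
  refine .seq (.setNat (.seq (.setNat ?_)))
  simp only [NExp.val]
  refine .forLoop R (fun i σ' => σ'.nat 18 0 = code % 2 ^ (R - i) ∧
      σ'.nat 20 0 = (bitList R code i).length ∧
      (∀ q, ∀ h : q < (bitList R code i).length, σ'.nat 7 q = (bitList R code i)[q]) ∧
      ∀ r < R, R - i ≤ r → σ'.nat 6 r = if code.testBit r then 1 else 0) hK (by decide) ?_ ?_ ?_ ?_ ?_
  · intro σ' h; simp [NExp.val, h.n 12, hR]
  · refine ⟨by simp [hc, Nat.mod_eq_of_lt hcode], by simp [bitList], by simp [bitList], ?_⟩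
    intro r h1 h2; omega
  · intro k σ' v h
    simpa using h
  · rintro i hi σ' h ⟨h1, h2, h3, h4⟩ hv
    have hR' : σ'.nat 12 0 = R := by simp [h.n 12, hR]
    have hp' : σ'.nat 5 (R - 1 - i) = 2 ^ (R - 1 - i) := by
      simp [h.n 5, hpow (R - 1 - i) (by omega)]
    have hmod : code % 2 ^ (R - 1 - i + 1) =
        code % 2 ^ (R - 1 - i) + 2 ^ (R - 1 - i) * (code.testBit (R - 1 - i)).toNat := by
      rw [Nat.mod_pow_succ, Nat.toNat_testBit]
    rw [show R - 1 - i + 1 = R - i by omega] at hmod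
    have hlt : code % 2 ^ (R - 1 - i) < 2 ^ (R - 1 - i) := Nat.mod_lt _ (by positivity)
    refine .seq (.setNat ?_)
    simp only [NExp.val, hR', hv]
    refine .ite (fun hb => .setNat ?_) (fun hb => .seq (.setNat (.seq (.setNat
      (.seq (.setNat (.setNat ?_)))))))
    · simp [Test.Holds, NExp.val, h1, hp'] at hb
      have hbit : code.testBit (R - 1 - i) = false := by
        by_contra hne
        simp only [Bool.not_eq_false] at hne
        rw [hmod, hne] at hb
        simp at hb
      have e1 : bitList R code (i + 1) = bitList R code i := by simp [bitList, hbit]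
      refine ⟨?_, ?_, ?_, ?_⟩
      · simp [NExp.val, h1, hmod, hbit, show R - (i + 1) = R - 1 - i by omega]
      · simp [NExp.val, e1, h2]
      · intro q hq
        simp only [e1] at hq ⊢
        simp [NExp.val, h3 q hq]
      · intro r hr hir
        by_cases hri : r = R - 1 - i
        · simp [NExp.val, hri, hbit]
        · simp [NExp.val, hri, h4 r hr (by omega)]
    · simp [Test.Holds, NExp.val, h1, hp'] at hb
      have hbit : code.testBit (R - 1 - i) = true := by
        by_contra hne
        simp only [Bool.not_eq_true] at hne
        rw [hmod, hne] at hb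
        simp at hb
        omega
      have e1 : bitList R code (i + 1) = bitList R code i ++ [R - 1 - i] := by simp [bitList, hbit]
      refine ⟨?_, ?_, ?_, ?_⟩
      · simp [NExp.val, h1, hp', hmod, hbit, show R - (i + 1) = R - 1 - i by omega]
      · simp [NExp.val, e1, h2]
      · intro q hq
        simp only [e1] at hq ⊢
        simp only [List.length_append, List.length_singleton] at hq
        by_cases hq' : q = (bitList R code i).length
        · simp [NExp.val, hq', h2]
        · have hlt : q < (bitList R code i).length := by omega
          simp [NExp.val, h2, hq', List.getElem_append_left hlt, h3 q hlt]
      · intro r hr hir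
        by_cases hri : r = R - 1 - i
        · simp [NExp.val, hri, hbit]
        · simp [NExp.val, hri, h4 r hr (by omega)]
  · rintro σ' - ⟨-, h2, h3, h4⟩
    exact ⟨h2, h3, fun r hr => h4 r hr (by omega)⟩

end PointSimplex

namespace PointSimplex

open Matrix

/-! ### Contribution of a vertex -/

/-- The memory holds the polytope `A x ≤ b`, and powers of two. -/
structure PolyIn {R d : ℕ} (σ : Mem) (A : Fin R → Fin d → ℝ) (b : Fin R → ℝ) : Prop where
  dim : σ.nat 0 2 = d
  num : σ.nat 12 0 = R
  pow : ∀ r ≤ R, σ.nat 5 r = 2 ^ r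
  lhs : MatAt (σ.real 8) A
  rhs : VecAt (σ.real 9) b

theorem PolyIn.eqv {R d : ℕ} {σ σ' : Mem} {A : Fin R → Fin d → ℝ} {b : Fin R → ℝ} {ln lr : List ℕ}
    (h : PolyIn σ A b) (e : Eqv ln lr σ σ') (hn : 0 ∉ ln ∧ 5 ∉ ln ∧ 12 ∉ ln := by decide)
    (hr : 8 ∉ lr ∧ 9 ∉ lr := by decide) : PolyIn σ' A b where
  dim := by rw [e.n 0 hn.1]; exact h.dim
  num := by rw [e.n 12 hn.2.2]; exact h.num
  pow := by rw [e.n 5 hn.2.1]; exact h.pow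
  lhs := by rw [e.r 8 hr.1]; exact h.lhs
  rhs := by rw [e.r 9 hr.2]; exact h.rhs

/-- `real 27` and `real 28` get the slacks of constraint `nv 13` at the vertex. -/
def slackCmd : Cmd :=
  .seq (sumCmd 23 14 dimE (.mul (entryE 8 13 14) (.get 16 (nv 14)))) <|
  .seq (.setReal 27 (.lit 0) (.sub (.get 9 (nv 13)) (rv 23))) <|
  .seq (sumCmd 23 14 dimE (.mul (entryE 8 13 14) (.get 17 (nv 14)))) <|
  .setReal 28 (.lit 0) (.sub (.get 18 (nv 13)) (rv 23))

/-- The lexicographic sign test for the perturbed slack. `nat 21` is cleared if the constraint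
fails, and `nat 22` is set if both slacks vanish, so that the sign is undecided. -/
def checkCmd : Cmd :=
  .seq slackCmd <|
  .ite (.realLe (rv 27) (.lit 0))
    (.ite (.realLe (.lit 0) (rv 27))
      (.ite (.realLe (rv 28) (.lit 0))
        (.seq (.setNat 21 (.lit 0) (.lit 0))
          (.ite (.realLe (.lit 0) (rv 28)) (.setNat 22 (.lit 0) (.lit 1)) .skip))
        .skip)
      (.setNat 21 (.lit 0) (.lit 0)))
    .skip

/-- Add the contribution of the vertex with inverse matrix `-X / q`. -/
def vertexCmd : Cmd :=
  .seq (fillCmd (sumCmd 23 13 dimE (.mul (.get 18 (nv 13)) (entryE 13 13 14))) 15 14 dimE (nv 14)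
    (.div (.sub (.lit 0) (rv 23)) (rv 22))) <|
  .seq (fillCmd (sumCmd 23 14 dimE (.mul (entryE 13 13 14) (.get 9 (.get 7 (nv 14))))) 16 13 dimE
    (nv 13) (.div (.sub (.lit 0) (rv 23)) (rv 22))) <|
  .seq (fillCmd (sumCmd 23 14 dimE (.mul (entryE 13 13 14) (.get 18 (.get 7 (nv 14))))) 17 13 dimE
    (nv 13) (.div (.sub (.lit 0) (rv 23)) (rv 22))) <|
  .seq (sumCmd 25 13 dimE (.mul (.get 18 (nv 13)) (.get 16 (nv 13)))) <|
  .seq (.setReal 26 (.lit 0) (.lit 1)) <|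
  .seq (forCmd 13 dimE <|
    .seq (.setReal 26 (.lit 0) (.mul (rv 26)
      (.div (rv 25) (.mul (.ofNat (.add (nv 13) (.lit 1))) (.get 15 (nv 13))))))
    (.ite (.and (.realLe (.get 15 (nv 13)) (.lit 0)) (.realLe (.lit 0) (.get 15 (nv 13))))
      (.setNat 22 (.lit 0) (.lit 1)) .skip)) <|
  .seq (.setNat 21 (.lit 0) (.lit 1)) <|
  .seq (forCmd 13 (nv 12) (.ite (.natLt (.get 6 (nv 13)) (.lit 1)) checkCmd .skip)) <|
  .ite (.natLt (.lit 0) (nv 21))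
    (.ite (.realLe (rv 22) (.lit 0))
      (.setReal 21 (.lit 0) (.add (rv 21) (.div (rv 26) (.sub (.lit 0) (rv 22)))))
      (.setReal 21 (.lit 0) (.add (rv 21) (.div (rv 26) (rv 22)))))
    .skip

variable {d R : ℕ} {S : Solver d} {f : ℕ → ℕ} {K : ℕ} {σ : Mem} {A : Fin R → Fin d → ℝ}
  {b g : Fin R → ℝ}

theorem within_slackCmd (hd : d ≤ K) (hP : PolyIn σ A b) (hg : VecAt (σ.real 18) g)
    {v0 v1 : Fin d → ℝ} (h0 : VecAt (σ.real 16) v0) (h1 : VecAt (σ.real 17) v1) {r : Fin R}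
    (hr : σ.nat 13 0 = r) : Within S f K slackCmd σ fun σ' =>
      σ'.real 27 0 = b r - A r ⬝ᵥ v0 ∧ σ'.real 28 0 = g r - A r ⬝ᵥ v1 := by
  refine .seq (.sum d (fun k => A r k * v0 k) hd ?_ ?_ ?_)
  · intro σ' h; simp [NExp.val, (hP.eqv h).dim]
  · intro k σ' h hk
    change (entryE 8 13 14).val σ' * (RExp.get 16 (nv 14)).val σ' = _
    rw [entryE_val (hP.eqv h).dim (hP.eqv h).lhs (by rw [h.n 13, hr]) hk]
    simp only [RExp.val, NExp.val, hk, h.r 16, h0 k]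
  intro σ₁ e₁ hs
  refine .seq (.setReal (.seq (.sum d (fun k => A r k * v1 k) hd ?_ ?_ ?_)))
  · intro σ' h; simp [NExp.val, h.n 0, (hP.eqv e₁).dim]
  · intro k σ' h hk
    have hP' := (hP.eqv e₁)
    change (entryE 8 13 14).val σ' * (RExp.get 17 (nv 14)).val σ' = _
    rw [entryE_val (e := R) (M := A) (a := r) (b := k) (by simp [h.n 0, hP'.dim])
      (by simpa [MatAt, h.r 8] using hP'.lhs) (by simp [h.n 13, e₁.n 13, hr]) hk]
    simp [RExp.val, NExp.val, hk, h.r 17, e₁.r 17, h1 k]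
  intro σ₂ e₂ hs'
  refine .setReal ⟨?_, ?_⟩
  · simp [NExp.val, RExp.val, e₂.r 27, e₁.r 9, e₁.n 13, hr, hP.rhs r, hs, dotProduct]
  · simp [NExp.val, RExp.val, e₂.r 18, e₁.r 18, e₁.n 13, e₂.n 13, hr, hg r, hs', dotProduct]

open Classical in
theorem within_checkCmd (hd : d ≤ K) (hP : PolyIn σ A b) (hg : VecAt (σ.real 18) g)
    {v0 v1 : Fin d → ℝ} (h0 : VecAt (σ.real 16) v0) (h1 : VecAt (σ.real 17) v1) {r : Fin R}
    (hr : σ.nat 13 0 = r) : Within S f K checkCmd σ fun σ' =>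
      σ'.nat 21 0 = (if 0 < b r - A r ⬝ᵥ v0 ∨ (b r - A r ⬝ᵥ v0 = 0 ∧ 0 < g r - A r ⬝ᵥ v1)
        then σ.nat 21 0 else 0) ∧
      σ'.nat 22 0 = if b r - A r ⬝ᵥ v0 ≠ 0 ∨ g r - A r ⬝ᵥ v1 ≠ 0 then σ.nat 22 0 else 1 := by
  refine .seq ((within_slackCmd hd hP hg h0 h1 hr).imp ?_)
  rintro σ₁ e₁ ⟨hs0, hs1⟩
  generalize b r - A r ⬝ᵥ v0 = s0 at *
  generalize g r - A r ⬝ᵥ v1 = s1 at *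
  have a1 : σ₁.nat 21 = σ.nat 21 := e₁.n 21
  have a2 : σ₁.nat 22 = σ.nat 22 := e₁.n 22
  refine .ite (fun hb => .ite (fun hb2 => .ite (fun hb3 => .seq (.setNat (.ite (fun hb4 =>
    .setNat ?_) (fun hb4 => .skip ?_)))) (fun hb3 => .skip ?_)) (fun hb2 => .setNat ?_))
    (fun hb => .skip ?_) <;> simp [Test.Holds, RExp.val, NExp.val, hs0, hs1, a1, a2] at *
  · obtain rfl : s0 = 0 := le_antisymm hb hb2
    obtain rfl : s1 = 0 := le_antisymm hb3 hb4
    simp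
  · obtain rfl : s0 = 0 := le_antisymm hb hb2
    simp [hb4.ne, hb4.not_gt]
  · obtain rfl : s0 = 0 := le_antisymm hb hb2
    simp [hb3, hb3.ne']
  · simp [hb2.ne, hb2.not_gt]
  · simp [hb, hb.ne']

-- Array 18 serves as `g` and as `c` at once, since both consist of powers of the same number. A
-- vanishing coefficient causes a division by zero; then the flag `nat 22` is raised and nothing is
-- claimed about the accumulated sum.
open Classical in
theorem within_vertexCmd (hd0 : 0 < d) (hd : d ≤ K) (hR : R ≤ K) (hdR : d ≤ R) (hP : PolyIn σ A b)
    (hg : VecAt (σ.real 18) g) {c : Fin d → ℝ} (hc : VecAt (σ.real 18) c) {β : Fin d → Fin R}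
    (hβ : ∀ p : Fin d, σ.nat 7 p = β p)
    (hbit : ∀ r : Fin R, σ.nat 6 r = if r ∈ Set.range β then 1 else 0)
    (hX : MatAt (σ.real 13) (flX (rows A β) (d - 1))) (hq : σ.real 22 0 = flq (rows A β) (d - 1))
    (hq0 : flq (rows A β) (d - 1) ≠ 0) :
    Within S f K vertexCmd σ fun σ' =>
      σ'.nat 22 0 = (if Good A b c g β then σ.nat 22 0 else 1) ∧
      (Good A b c g β → σ'.real 21 0 = σ.real 21 0 + subsetTerm A b c g β) := by
  obtain ⟨d, rfl⟩ : ∃ e, d = e + 1 := ⟨d - 1, by omega⟩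
  rw [Nat.add_sub_cancel] at hX hq hq0
  have hinv := flX_inv _ hq0
  have hdet := (flX_last (rows A β)).2
  have hdet0 : (rows A β).det ≠ 0 := by rwa [ne_eq, ← flq_eq_zero_iff]
  have hXe : ∀ i j, flX (rows A β) d i j = -(flq (rows A β) d) * (rows A β)⁻¹ i j := by
    intro i j
    rw [hinv, Matrix.smul_apply, smul_eq_mul]
    field_simp
  generalize flq (rows A β) d = q at *
  generalize flX (rows A β) d = X at *
  set y := c ᵥ* (rows A β)⁻¹ with hy
  set v0 := (rows A β)⁻¹ *ᵥ (b ∘ β) with hv0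
  set v1 := (rows A β)⁻¹ *ᵥ (g ∘ β) with hv1
  -- the vectors `y`, `v0`, `v1`
  refine .seq (.fill (d + 1) (fun p => p) y hd (by decide) (by decide) ?_ Fin.val_injective ?_ ?_)
  · intro σ' h; simp [NExp.val, (hP.eqv h).dim]
  · intro p σ' h hp
    refine .sum (d + 1) (fun k => c k * X k p) hd ?_ ?_ ?_
    · intro σ'' h'; simp [NExp.val, ((hP.eqv h).eqv h').dim]
    · intro k σ'' h' hk
      change (RExp.get 18 (nv 13)).val σ'' * (entryE 13 13 14).val σ'' = _
      rw [entryE_val ((hP.eqv h).eqv h').dim (by rw [h'.r 13, h.r 13]; exact hX) hk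
        (by rw [h'.n 14, hp])]
      simp only [RExp.val, NExp.val, hk, h'.r 18, h.r 18, hc k]
    · intro σ'' h' hs
      refine ⟨by simp [NExp.val, h'.n 14, hp], ?_⟩
      simp only [RExp.val, NExp.val, hs, h'.r 22, h.r 22, hq, Nat.cast_zero, zero_sub, hy, vecMul,
        dotProduct, hXe]
      rw [← Finset.sum_neg_distrib, Finset.sum_div]
      exact Finset.sum_congr rfl fun k _ => by field_simp
  intro σ₁ e₁ hy₁ _
  have hP₁ := hP.eqv e₁
  refine .seq (.fill (d + 1) (fun p => p) v0 hd (by decide) (by decide) ?_ Fin.val_injective ?_ ?_)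
  · intro σ' h; simp [NExp.val, (hP₁.eqv h).dim]
  · intro p σ' h hp
    refine .sum (d + 1) (fun k => X p k * b (β k)) hd ?_ ?_ ?_
    · intro σ'' h'; simp [NExp.val, ((hP₁.eqv h).eqv h').dim]
    · intro k σ'' h' hk
      change (entryE 13 13 14).val σ'' * (RExp.get 9 (.get 7 (nv 14))).val σ'' = _
      rw [entryE_val ((hP₁.eqv h).eqv h').dim (by rw [h'.r 13, h.r 13, e₁.r 13]; exact hX)
        (by rw [h'.n 13, hp]) hk]
      simp only [RExp.val, NExp.val, hk, h'.n 7, h.n 7, e₁.n 7, hβ,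
        ((hP₁.eqv h).eqv h').rhs (β k)]
    · intro σ'' h' hs
      refine ⟨by simp [NExp.val, h'.n 13, hp], ?_⟩
      simp only [RExp.val, NExp.val, hs, h'.r 22, h.r 22, e₁.r 22, hq, Nat.cast_zero, zero_sub, hv0,
        mulVec, dotProduct, hXe, Function.comp_apply]
      rw [← Finset.sum_neg_distrib, Finset.sum_div]
      exact Finset.sum_congr rfl fun k _ => by field_simp
  intro σ₂ e₂ hv0₂ _
  have hP₂ := hP₁.eqv e₂
  refine .seq (.fill (d + 1) (fun p => p) v1 hd (by decide) (by decide) ?_ Fin.val_injective ?_ ?_)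
  · intro σ' h; simp [NExp.val, (hP₂.eqv h).dim]
  · intro p σ' h hp
    refine .sum (d + 1) (fun k => X p k * g (β k)) hd ?_ ?_ ?_
    · intro σ'' h'; simp [NExp.val, ((hP₂.eqv h).eqv h').dim]
    · intro k σ'' h' hk
      change (entryE 13 13 14).val σ'' * (RExp.get 18 (.get 7 (nv 14))).val σ'' = _
      rw [entryE_val ((hP₂.eqv h).eqv h').dim (by rw [h'.r 13, h.r 13, e₂.r 13, e₁.r 13]; exact hX)
        (by rw [h'.n 13, hp]) hk]
      simp only [RExp.val, NExp.val, hk, h'.n 7, h.n 7, e₂.n 7, e₁.n 7, hβ, h'.r 18, h.r 18,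
        e₂.r 18, e₁.r 18, hg (β k)]
    · intro σ'' h' hs
      refine ⟨by simp [NExp.val, h'.n 13, hp], ?_⟩
      simp only [RExp.val, NExp.val, hs, h'.r 22, h.r 22, e₂.r 22, e₁.r 22, hq, Nat.cast_zero,
        zero_sub, hv1, mulVec, dotProduct, hXe, Function.comp_apply]
      rw [← Finset.sum_neg_distrib, Finset.sum_div]
      exact Finset.sum_congr rfl fun k _ => by field_simp
  intro σ₃ e₃ hv1₃ _
  have hP₃ := hP₂.eqv e₃
  have hy₃ : VecAt (σ₃.real 15) y := by rw [e₃.r 15, e₂.r 15]; exact hy₁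
  have hv0₃ : VecAt (σ₃.real 16) v0 := by rw [e₃.r 16]; exact hv0₂
  replace hv1₃ : VecAt (σ₃.real 17) v1 := hv1₃
  have hg₃ : VecAt (σ₃.real 18) g := by rw [e₃.r 18, e₂.r 18, e₁.r 18]; exact hg
  have hc₃ : VecAt (σ₃.real 18) c := by rw [e₃.r 18, e₂.r 18, e₁.r 18]; exact hc
  have hb₃ : ∀ r : Fin R, σ₃.nat 6 r = if r ∈ Set.range β then 1 else 0 := by
    rw [e₃.n 6, e₂.n 6, e₁.n 6]; exact hbit
  have hq₃ : σ₃.real 22 0 = q := by rw [e₃.r 22, e₂.r 22, e₁.r 22, hq]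
  have hacc₃ : σ₃.real 21 = σ.real 21 := by rw [e₃.r 21, e₂.r 21, e₁.r 21]
  have hbad₃ : σ₃.nat 22 = σ.nat 22 := by rw [e₃.n 22, e₂.n 22, e₁.n 22]
  clear e₁ e₂ e₃ hP₁ hP₂ hP hy₁ hv0₂ hX hXe hinv hq hg hc hbit hβ
  -- the product
  refine .seq (.sum (d + 1) (fun k => c k * v0 k) hd ?_ ?_ ?_)
  · intro σ' h; simp [NExp.val, (hP₃.eqv h).dim]
  · intro k σ' h hk
    simp only [RExp.val, NExp.val, hk, h.r 18, h.r 16, hc₃ k, hv0₃ k]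
  intro σ₄ e₄ hcv
  refine .seq (.setReal (.seq ?_))
  -- The factors `(c ⬝ᵥ v0) / ((p + 1) * y p)` together produce the power, the factorial and the
  -- product of coefficients.
  refine .forLoop (d + 1) (fun k σ' =>
    σ'.real 26 0 = ∏ p : Fin (d + 1), (if (p : ℕ) < k then (c ⬝ᵥ v0) / ((p + 1 : ℝ) * y p) else 1) ∧
    σ'.nat 22 0 = if ∀ p : Fin (d + 1), (p : ℕ) < k → y p ≠ 0 then σ.nat 22 0 else 1)
    hd (by decide) ?_ ?_ (by simp) ?_ ?_
  · intro σ' h; simp [NExp.val, h.n 0, e₄.n 0, hP₃.dim]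
  · simp [RExp.val, NExp.val, e₄.n 22, hbad₃]
  · rintro k hk σ' h ⟨h1, h2⟩ hi
    have hyk : σ'.real 15 k = y ⟨k, hk⟩ := by
      simp only [h.r 15, Mem.setReal_real, e₄.r 15]
      simpa using hy₃ ⟨k, hk⟩
    have hcv' : σ'.real 25 0 = c ⬝ᵥ v0 := by simp [h.r 25, hcv, dotProduct, NExp.val]
    have hprod : (∏ p : Fin (d + 1), (if (p : ℕ) < k + 1 then (c ⬝ᵥ v0) / ((p + 1 : ℝ) * y p) else 1))
        = (∏ p : Fin (d + 1), (if (p : ℕ) < k then (c ⬝ᵥ v0) / ((p + 1 : ℝ) * y p) else 1)) *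
          ((c ⬝ᵥ v0) / ((k + 1 : ℝ) * y ⟨k, hk⟩)) := by
      have : ∀ p : Fin (d + 1), (if (p : ℕ) < k + 1 then (c ⬝ᵥ v0) / ((p + 1 : ℝ) * y p) else 1) =
          (if (p : ℕ) < k then (c ⬝ᵥ v0) / ((p + 1 : ℝ) * y p) else 1) *
          (if p = ⟨k, hk⟩ then (c ⬝ᵥ v0) / ((p + 1 : ℝ) * y p) else 1) := by
        intro p
        rcases lt_trichotomy (p : ℕ) k with hp | hp | hp
        · rw [if_pos (by omega), if_pos hp, if_neg (by rintro rfl; simp at hp), mul_one]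
        · obtain rfl : p = ⟨k, hk⟩ := Fin.ext hp
          simp
        · rw [if_neg (by omega), if_neg (by omega), if_neg (by rintro rfl; simp at hp), mul_one]
      rw [Finset.prod_congr rfl fun p _ => this p, Finset.prod_mul_distrib]
      simp
    have hcond : (∀ p : Fin (d + 1), (p : ℕ) < k + 1 → y p ≠ 0) ↔
        (∀ p : Fin (d + 1), (p : ℕ) < k → y p ≠ 0) ∧ y ⟨k, hk⟩ ≠ 0 := by
      constructor
      · exact fun h => ⟨fun p hp => h p (by omega), h _ (by simp)⟩
      · rintro ⟨h1, h2⟩ p hp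
        rcases Nat.lt_succ_iff_lt_or_eq.1 hp with hp | hp
        · exact h1 p hp
        · obtain rfl : p = ⟨k, hk⟩ := Fin.ext hp
          exact h2
    have hval : RExp.val σ' (.mul (rv 26) (.div (rv 25)
        (.mul (.ofNat (.add (nv 13) (.lit 1))) (.get 15 (nv 13))))) =
        ∏ p : Fin (d + 1), (if (p : ℕ) < k + 1 then (c ⬝ᵥ v0) / ((p + 1 : ℝ) * y p) else 1) := by
      rw [hprod]
      simp [RExp.val, NExp.val, h1, hi, hyk, hcv']
    refine .seq (.setReal ?_)
    rw [hval]
    refine .ite (fun hb => .setNat ?_) (fun hb => .skip ?_)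
    · simp [Test.Holds, RExp.val, NExp.val, hi, hyk] at hb
      refine ⟨by simp [NExp.val], ?_⟩
      have : ¬ ∀ p : Fin (d + 1), (p : ℕ) < k + 1 → y p ≠ 0 := fun h =>
        (hcond.1 h).2 (le_antisymm hb.1 hb.2)
      rw [if_neg this]
      simp [NExp.val]
    · simp [Test.Holds, RExp.val, NExp.val, hi, hyk] at hb
      refine ⟨by simp [NExp.val], ?_⟩
      have hne : y ⟨k, hk⟩ ≠ 0 := fun h => by rw [h] at hb; simp at hb
      simp only [Mem.setReal_nat, h2, hcond, hne, ne_eq, not_false_iff, and_true]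
  rintro σ₅ e₅ ⟨hprod, hbad⟩
  simp only [Fin.is_lt, if_true, forall_const] at hprod hbad
  have e₅' := (eqv_setReal σ₄ 26 (NExp.val σ₄ (.lit 0)) (RExp.val σ₄ (.lit 1)))
  have hP₅ := ((hP₃.eqv e₄).eqv e₅').eqv e₅
  have hv0₅ : VecAt (σ₅.real 16) v0 := by rw [e₅.r 16, e₅'.r 16, e₄.r 16]; exact hv0₃
  have hv1₅ : VecAt (σ₅.real 17) v1 := by rw [e₅.r 17, e₅'.r 17, e₄.r 17]; exact hv1₃
  have hg₅ : VecAt (σ₅.real 18) g := by rw [e₅.r 18, e₅'.r 18, e₄.r 18]; exact hg₃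
  have hb₅ : ∀ r : Fin R, σ₅.nat 6 r = if r ∈ Set.range β then 1 else 0 := by
    rw [e₅.n 6, e₅'.n 6, e₄.n 6]; exact hb₃
  have hq₅ : σ₅.real 22 0 = q := by rw [e₅.r 22, e₅'.r 22, e₄.r 22, hq₃]
  have hacc₅ : σ₅.real 21 = σ.real 21 := by rw [e₅.r 21, e₅'.r 21, e₄.r 21, hacc₃]
  clear e₅ e₅' e₄ hP₃ hv0₃ hv1₃ hg₃ hb₃ hq₃ hacc₃ hbad₃ hy₃ hc₃
  refine .seq (.setNat (.seq ?_))
  have e₆ := eqv_setNat σ₅ 21 (NExp.val σ₅ (.lit 0)) (NExp.val σ₅ (.lit 1))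
  have hfeas₆ : (σ₅.setNat 21 (NExp.val σ₅ (.lit 0)) (NExp.val σ₅ (.lit 1))).nat 21 0 = 1 := by
    simp [NExp.val]
  generalize σ₅.setNat 21 (NExp.val σ₅ (.lit 0)) (NExp.val σ₅ (.lit 1)) = σ₆ at *
  have hs0 : ∀ r, slack A b β r = b r - A r ⬝ᵥ v0 := fun r => rfl
  have hs1 : ∀ r, slack A g β r = g r - A r ⬝ᵥ v1 := fun r => rfl
  have step : ∀ (P : Fin R → Prop) (k : ℕ) (hk : k < R), (∀ r : Fin R, (r : ℕ) < k + 1 → P r) ↔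
      (∀ r : Fin R, (r : ℕ) < k → P r) ∧ P ⟨k, hk⟩ := by
    intro P k hk
    constructor
    · exact fun h => ⟨fun p hp => h p (by omega), h _ (by simp)⟩
    · rintro ⟨h1, h2⟩ p hp
      rcases Nat.lt_succ_iff_lt_or_eq.1 hp with hp | hp
      · exact h1 p hp
      · obtain rfl : p = ⟨k, hk⟩ := Fin.ext hp
        exact h2
  refine .forLoop R (fun k σ' =>
    σ'.nat 21 0 = (if ∀ r : Fin R, (r : ℕ) < k → r ∉ Set.range β →
      0 < slack A b β r ∨ (slack A b β r = 0 ∧ 0 < slack A g β r) then 1 else 0) ∧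
    σ'.nat 22 0 = if ∀ r : Fin R, (r : ℕ) < k → r ∉ Set.range β →
      slack A b β r ≠ 0 ∨ slack A g β r ≠ 0 then σ₆.nat 22 0 else 1) hR (by decide) ?_ ?_
      (by simp) ?_ ?_
  · intro σ' h; simp [NExp.val, h.n 12, e₆.n 12, hP₅.num]
  · simp [hfeas₆]
  · rintro k hk σ' h ⟨h1, h2⟩ hi
    have hbk : σ'.nat 6 k = if (⟨k, hk⟩ : Fin R) ∈ Set.range β then 1 else 0 := by
      rw [h.n 6, e₆.n 6]; exact hb₅ ⟨k, hk⟩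
    simp only [step _ k hk]
    refine .ite (fun hb => ?_) (fun hb => .skip ?_)
    · refine (within_checkCmd (A := A) (b := b) (g := g) (r := ⟨k, hk⟩) hd ((hP₅.eqv e₆).eqv h)
        (by rw [h.r 18, e₆.r 18]; exact hg₅) (by rw [h.r 16, e₆.r 16]; exact hv0₅)
        (by rw [h.r 17, e₆.r 17]; exact hv1₅) hi).imp ?_
      rintro σ'' - ⟨h3, h4⟩
      have hr : (⟨k, hk⟩ : Fin R) ∉ Set.range β := by
        intro hr
        simp only [Test.Holds, NExp.val, hi, hbk, if_pos hr] at hb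
        omega
      simp only [← hs0, ← hs1] at h3 h4
      simp only [h3, h4, h1, h2, hr, not_false_iff, forall_true_left]
      constructor
      · split_ifs <;> first | rfl | tauto
      · split_ifs <;> first | rfl | tauto
    · have hr : (⟨k, hk⟩ : Fin R) ∈ Set.range β := by
        by_contra hr
        simp only [Test.Holds, NExp.val, hi, hbk, if_neg hr] at hb
        omega
      simp only [h1, h2, hr, not_true_eq_false, false_imp_iff, and_true, and_self]
  rintro σ₇ e₇ ⟨hfeas, hbad₇⟩
  simp only [Fin.is_lt, forall_true_left] at hfeas hbad₇
  rw [e₆.n 22, hbad] at hbad₇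
  have hbad' : σ₇.nat 22 0 = if Good A b c g β then σ.nat 22 0 else 1 := by
    rw [hbad₇]
    simp only [Good, ← hy]
    split_ifs <;> first | rfl | tauto
  have hprod₇ : σ₇.real 26 0 = (c ⬝ᵥ v0) ^ (d + 1) / ((d + 1).factorial * ∏ p, y p) := by
    rw [e₇.r 26, e₆.r 26, hprod, Finset.prod_div_distrib, Finset.prod_mul_distrib,
      Finset.prod_const, Finset.card_univ, Fintype.card_fin, ← Finset.prod_range_add_one_eq_factorial,
      Finset.prod_range]
    push_cast
    rfl
  have hacc₇ : σ₇.real 21 0 = σ.real 21 0 := by rw [e₇.r 21, e₆.r 21, hacc₅]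
  have hq₇ : σ₇.real 22 0 = q := by rw [e₇.r 22, e₆.r 22, hq₅]
  have hterm : Feasible A b g β → subsetTerm A b c g β =
      (c ⬝ᵥ v0) ^ (d + 1) / ((d + 1).factorial * ∏ p, y p) / |q| := by
    intro hF
    rw [subsetTerm, if_pos ⟨hdet0, hF⟩, hdet, ← hv0, ← hy, div_div]
    congr 1
    ring
  have hterm' : ¬ Feasible A b g β → subsetTerm A b c g β = 0 := fun hF =>
    if_neg fun h => hF h.2
  refine .ite (fun hb => ?_) (fun hb => .skip ⟨hbad', fun _ => ?_⟩)
  · have hF : Feasible A b g β := by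
      by_contra hF
      rw [Feasible] at hF
      simp only [Test.Holds, NExp.val, hfeas, if_neg hF] at hb
      omega
    refine .ite (fun hq => .setReal ⟨by simpa using hbad', fun _ => ?_⟩)
      (fun hq => .setReal ⟨by simpa using hbad', fun _ => ?_⟩)
    · simp only [Test.Holds, RExp.val, NExp.val, hq₇, Nat.cast_zero] at hq
      simp [RExp.val, NExp.val, hacc₇, hprod₇, hq₇, hterm hF, abs_of_nonpos hq]
    · simp only [Test.Holds, RExp.val, NExp.val, hq₇, Nat.cast_zero, not_le] at hq
      simp [RExp.val, NExp.val, hacc₇, hprod₇, hq₇, hterm hF, abs_of_pos hq]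
  · have hF : ¬ Feasible A b g β := by
      intro hF
      rw [Feasible] at hF
      simp only [Test.Holds, NExp.val, hfeas, if_pos hF] at hb
      omega
    rw [hacc₇, hterm' hF, add_zero]

end PointSimplex

namespace PointSimplex

open Matrix

/-! ### Summation over the vertices -/

/-- Contribution of the subset of constraints listed in array 7. -/
def subsetCmd : Cmd :=
  .seq (fill2Cmd .skip 10 13 14 dimE dimE (.get 8 (.add (.mul (.get 7 (nv 13)) dimE) (nv 14)))) <|
  .seq flCmd <|
  .ite (.and (.realLe (rv 22) (.lit 0)) (.realLe (.lit 0) (rv 22))) .skip vertexCmd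

def codeCmd : Cmd :=
  .seq decodeCmd <|
  .ite (.and (.neg (.natLt (nv 20) dimE)) (.neg (.natLt dimE (nv 20)))) subsetCmd .skip

/-- Array 18 gets the powers of `nv 19`. -/
def powersCmd : Cmd :=
  .seq (.setReal 23 (.lit 0) (.lit 1)) <|
  forCmd 13 (nv 12) <|
  .seq (.setReal 18 (nv 13) (rv 23)) (.setReal 23 (.lit 0) (.mul (rv 23) (.ofNat (nv 19))))

/-- Volume of the polytope, using the moment curve at `nv 19`; `nv 22` tells whether it was
degenerate. -/
def tryCmd : Cmd :=
  .seq powersCmd <|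
  .seq (.setReal 21 (.lit 0) (.lit 0)) <|
  .seq (.setNat 22 (.lit 0) (.lit 0)) <|
  forCmd 17 (.get 5 (nv 12)) codeCmd

/-- `real 21` gets the volume of the polytope in arrays 8 and 9. -/
def polyVolCmd : Cmd :=
  .seq (.setNat 22 (.lit 0) (.lit 1)) <|
  forCmd 19 (.add (.mul (.get 5 (nv 12)) (.add (.mul dimE dimE) (.mul (nv 12) (nv 12)))) (.lit 1)) <|
  .ite (.natLt (.lit 0) (nv 22)) tryCmd .skip

variable {d R : ℕ} {S : Solver d} {f : ℕ → ℕ} {K : ℕ} {σ : Mem} {A : Fin R → Fin d → ℝ}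
  {b g : Fin R → ℝ}

open Classical in
theorem within_subsetCmd (hd0 : 0 < d) (hd : d ≤ K) (hR : R ≤ K) (hdR : d ≤ R) (hP : PolyIn σ A b)
    (hg : VecAt (σ.real 18) g) {c : Fin d → ℝ} (hc : VecAt (σ.real 18) c) {β : Fin d → Fin R}
    (hβ : ∀ p : Fin d, σ.nat 7 p = β p)
    (hbit : ∀ r : Fin R, σ.nat 6 r = if r ∈ Set.range β then 1 else 0) :
    Within S f K subsetCmd σ fun σ' =>
      σ'.nat 22 0 = (if (rows A β).det ≠ 0 → Good A b c g β then σ.nat 22 0 else 1) ∧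
      (((rows A β).det ≠ 0 → Good A b c g β) →
        σ'.real 21 0 = σ.real 21 0 + subsetTerm A b c g β) := by
  refine .seq (.fill2 d d (rows A β) hd hd (by decide) (by decide) (by decide) (by decide)
    ?_ ?_ ?_ ?_)
  · intro σ' h; simp [NExp.val, (hP.eqv h).dim]
  · intro σ' h; simp [NExp.val, (hP.eqv h).dim]
  · intro i j σ' h hi hj
    refine .skip ?_
    simp only [RExp.val, NExp.val, hi, hj, (hP.eqv h).dim, h.n 7, hβ, (hP.eqv h).lhs (β i) j]
    rfl
  intro σ₁ e₁ hM
  have hP₁ := hP.eqv e₁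
  refine .seq ((within_flCmd hd0 hd hP₁.dim hM).imp ?_)
  rintro σ₂ e₂ ⟨hX, hq⟩
  have hbad₂ : σ₂.nat 22 = σ.nat 22 := by rw [e₂.n 22, e₁.n 22]
  have hacc₂ : σ₂.real 21 = σ.real 21 := by rw [e₂.r 21, e₁.r 21]
  have hdet : flq (rows A β) (d - 1) = 0 ↔ (rows A β).det = 0 := by
    obtain ⟨e, rfl⟩ : ∃ e, d = e + 1 := ⟨d - 1, by omega⟩
    exact flq_eq_zero_iff _
  refine .ite (fun hb => .skip ?_) (fun hb => ?_) <;>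
    simp only [Test.Holds, RExp.val, NExp.val, hq, Nat.cast_zero, ← le_antisymm_iff, hdet] at hb
  · refine ⟨by rw [if_pos fun h => absurd hb h, hbad₂], fun _ => ?_⟩
    rw [subsetTerm, if_neg fun h => h.1 hb, add_zero, hacc₂]
  · refine (within_vertexCmd (g := g) (c := c) (β := β) hd0 hd hR hdR (hP₁.eqv e₂)
      (by rw [e₂.r 18, e₁.r 18]; exact hg) (by rw [e₂.r 18, e₁.r 18]; exact hc)
      (by rw [e₂.n 7, e₁.n 7]; exact hβ) (by rw [e₂.n 6, e₁.n 6]; exact hbit) hX hq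
      (by rwa [ne_eq, hdet])).imp ?_
    rintro σ₃ - ⟨h1, h2⟩
    rw [hbad₂] at h1
    rw [hacc₂] at h2
    simp only [ne_eq, hb, not_false_iff, forall_true_left]
    exact ⟨h1, h2⟩

/-- The subset `code` is not degenerate. -/
def CodeGood (hR0 : 0 < R) (A : Fin R → Fin d → ℝ) (b : Fin R → ℝ) (c : Fin d → ℝ) (g : Fin R → ℝ)
    (code : ℕ) : Prop :=
  (codeSet R code).card = d → (rows A (codeMap hR0 d code)).det ≠ 0 →
    Good A b c g (codeMap hR0 d code)

open Classical in
theorem within_codeCmd (hd0 : 0 < d) (hd : d ≤ K) (hR : R ≤ K) (hR0 : 0 < R) (hdR : d ≤ R)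
    (hP : PolyIn σ A b) (hg : VecAt (σ.real 18) g) {c : Fin d → ℝ} (hc : VecAt (σ.real 18) c)
    {code : ℕ} (hcode : code < 2 ^ R) (hn : σ.nat 17 0 = code) :
    Within S f K codeCmd σ fun σ' =>
      σ'.nat 22 0 = (if CodeGood hR0 A b c g code then σ.nat 22 0 else 1) ∧
      (CodeGood hR0 A b c g code → σ'.real 21 0 = σ.real 21 0 +
        if (codeSet R code).card = d then subsetTerm A b c g (codeMap hR0 d code) else 0) := by
  refine .seq ((within_decodeCmd hR hP.num hn hcode hP.pow).imp ?_)
  rintro σ₁ e₁ ⟨h1, h2, h3⟩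
  have hbad₁ : σ₁.nat 22 = σ.nat 22 := e₁.n 22
  have hacc₁ : σ₁.real 21 = σ.real 21 := e₁.r 21
  have hP₁ := hP.eqv e₁
  refine .ite (fun hb => ?_) (fun hb => .skip ?_)
  · have hcard : (codeSet R code).card = d := by
      simp only [Test.Holds, NExp.val, h1, hP₁.dim] at hb
      rw [card_codeSet]
      omega
    refine (within_subsetCmd (g := g) (c := c) (β := codeMap hR0 d code) hd0 hd hR hdR hP₁
      (by rw [e₁.r 18]; exact hg) (by rw [e₁.r 18]; exact hc) ?_ ?_).imp ?_
    · intro p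
      obtain ⟨hp, ep⟩ := codeMap_val hR0 hcard p
      rw [ep, h2 p hp]
    · intro r
      simp only [h3 r r.2, mem_range_codeMap hR0 hcard]
    · rintro σ₂ - ⟨h4, h5⟩
      simp only [CodeGood, hcard, forall_true_left, if_true]
      rw [hbad₁] at h4
      rw [hacc₁] at h5
      exact ⟨h4, h5⟩
  · have hcard : (codeSet R code).card ≠ d := by
      intro h
      rw [card_codeSet] at h
      simp only [Test.Holds, NExp.val, h1, hP₁.dim, h] at hb
      omega
    simp [CodeGood, hcard, hbad₁, hacc₁]

theorem within_powersCmd {t : ℕ} (hR : R ≤ K) (hP : PolyIn σ A b) (ht : σ.nat 19 0 = t) :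
    Within S f K powersCmd σ fun σ' => ∀ r < R, σ'.real 18 r = (t : ℝ) ^ r := by
  refine .seq (.setReal ?_)
  refine .forLoop R (fun k σ' => σ'.real 23 0 = (t : ℝ) ^ k ∧ ∀ r < k, σ'.real 18 r = (t : ℝ) ^ r)
    hR (by decide) ?_ (by simp [NExp.val, RExp.val]) (by simp) ?_ (fun σ' _ h => h.2)
  · intro σ' h; simp [NExp.val, h.n 12, hP.num]
  · rintro k hk σ' h ⟨h1, h2⟩ hi
    refine .seq (.setReal (.setReal ⟨?_, ?_⟩))
    · simp [NExp.val, RExp.val, h1, h.n 19, ht, pow_succ]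
    · intro r hr
      by_cases hrk : r = k
      · subst hrk; simp [NExp.val, RExp.val, hi, h1]
      · simp [NExp.val, hi, hrk, h2 r (by omega)]

/-- No subset is degenerate. -/
def TryGood (hR0 : 0 < R) (A : Fin R → Fin d → ℝ) (b : Fin R → ℝ) (t : ℕ) : Prop :=
  ∀ code < 2 ^ R,
    CodeGood hR0 A b (fun k => (t : ℝ) ^ (k : ℕ)) (fun r => (t : ℝ) ^ (r : ℕ)) code

open Classical in
theorem within_tryCmd (hd0 : 0 < d) (hR : 2 ^ R ≤ K) (hR0 : 0 < R) (hdR : d ≤ R)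
    (hP : PolyIn σ A b) (hb : ∀ b, Bornology.IsBounded (polytope A b)) (hA : HasAxes A) {t : ℕ}
    (ht : σ.nat 19 0 = t) : Within S f K tryCmd σ fun σ' =>
      σ'.nat 22 0 = (if TryGood hR0 A b t then 0 else 1) ∧
      (TryGood hR0 A b t → σ'.real 21 0 = volume.real (polytope A b)) := by
  have hRK : R ≤ K := R.lt_two_pow_self.le.trans hR
  refine .seq ((within_powersCmd hRK hP ht).imp ?_)
  intro σ₁ e₁ hpw
  refine .seq (.setReal (.seq (.setNat ?_)))
  have e₂ := (eqv_setReal σ₁ 21 0 0)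
  have e₃ := (eqv_setNat (σ₁.setReal 21 0 0) 22 0 0)
  have hacc : ((σ₁.setReal 21 0 0).setNat 22 0 0).real 21 0 = 0 := by simp
  have hbad : ((σ₁.setReal 21 0 0).setNat 22 0 0).nat 22 0 = 0 := by simp
  simp only [NExp.val, RExp.val, Nat.cast_zero]
  generalize (σ₁.setReal 21 0 0).setNat 22 0 0 = σ₃ at *
  have hP₃ := ((hP.eqv e₁).eqv e₂).eqv e₃
  have hpw₃ : ∀ r < R, σ₃.real 18 r = (t : ℝ) ^ r := by rw [e₃.r 18, e₂.r 18]; exact hpw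
  set g : Fin R → ℝ := fun r => (t : ℝ) ^ (r : ℕ) with hg
  set c : Fin d → ℝ := fun r => (t : ℝ) ^ (r : ℕ) with hc
  refine .forLoop (2 ^ R) (fun k σ' =>
    σ'.nat 22 0 = (if ∀ code < k, CodeGood hR0 A b c g code then 0 else 1) ∧
    ((∀ code < k, CodeGood hR0 A b c g code) → σ'.real 21 0 = ∑ code ∈ Finset.range k,
      if (codeSet R code).card = d then subsetTerm A b c g (codeMap hR0 d code) else 0))
    hR (by decide) ?_ (by simp [hacc, hbad]) (by simp) ?_ ?_
  · intro σ' h; simp [NExp.val, (hP₃.eqv h).num, (hP₃.eqv h).pow R le_rfl]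
  · rintro k hk σ' h ⟨h1, h2⟩ hi
    refine (within_codeCmd (g := g) (c := c) hd0 (hdR.trans hRK) hRK hR0 hdR (hP₃.eqv h) ?_ ?_ hk hi).imp ?_
    · intro r; rw [h.r 18]; exact hpw₃ r r.2
    · intro r; rw [h.r 18]; exact hpw₃ r (r.2.trans_le hdR)
    rintro σ'' - ⟨h3, h4⟩
    have hsplit : (∀ code < k + 1, CodeGood hR0 A b c g code) ↔
        (∀ code < k, CodeGood hR0 A b c g code) ∧ CodeGood hR0 A b c g k := by
      constructor
      · exact fun h => ⟨fun i hi => h i (by omega), h k (by omega)⟩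
      · rintro ⟨h1, h2⟩ i hi
        rcases Nat.lt_succ_iff_lt_or_eq.1 hi with hi | rfl
        · exact h1 i hi
        · exact h2
    simp only [hsplit]
    refine ⟨?_, ?_⟩
    · rw [h3, h1]
      split_ifs <;> first | rfl | tauto
    · rintro ⟨h5, h6⟩
      rw [h4 h6, h2 h5, Finset.sum_range_succ]
  · rintro σ' - ⟨h1, h2⟩
    refine ⟨h1.trans ?_, fun hT => ?_⟩
    · by_cases hT : TryGood hR0 A b t
      · exact (if_pos hT).trans (if_pos hT).symm
      · exact (if_neg hT).trans (if_neg hT).symm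
    rw [h2 hT, volume_polytope_code A b c g hb hA (fun r => by positivity) (codeMap hR0 d)
      (fun code h => ⟨codeMap_injective hR0 h, image_codeMap hR0 h⟩)
      (fun code h h' h'' => hT code h h' h'')]

/-- After the first success the remaining rounds do nothing. Failure in all rounds would give one
more degenerate parameter than `card_bad_le` allows. -/
theorem within_polyVolCmd (hd0 : 0 < d) (hdR : d ≤ R) (hR : 2 ^ R * (d * d + R * R) + 1 ≤ K)
    (hP : PolyIn σ A b) (hb : ∀ b, Bornology.IsBounded (polytope A b)) (hA : HasAxes A) :
    Within S f K polyVolCmd σ fun σ' => σ'.real 21 0 = volume.real (polytope A b) := by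
  classical
  have hR0 : 0 < R := hd0.trans_le hdR
  have hRK : 2 ^ R ≤ K := le_trans (by nlinarith [Nat.one_le_two_pow (n := R), Nat.mul_pos hR0 hR0]) hR
  refine .seq (.setNat ?_)
  have e₁ := eqv_setNat σ 22 (NExp.val σ (.lit 0)) (NExp.val σ (.lit 1))
  have hbad : (σ.setNat 22 (NExp.val σ (.lit 0)) (NExp.val σ (.lit 1))).nat 22 0 = 1 := by
    simp [NExp.val]
  generalize σ.setNat 22 (NExp.val σ (.lit 0)) (NExp.val σ (.lit 1)) = σ₁ at *
  have hP₁ := hP.eqv e₁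
  refine .forLoop (2 ^ R * (d * d + R * R) + 1) (fun k σ' =>
    (σ'.nat 22 0 = 0 ∧ σ'.real 21 0 = volume.real (polytope A b)) ∨
    (σ'.nat 22 0 = 1 ∧ ∀ t < k, ¬ TryGood hR0 A b t)) hR (by decide) ?_ (.inr ⟨hbad, by simp⟩)
    (by simp) ?_ ?_
  · intro σ' h
    simp [NExp.val, (hP₁.eqv h).num, (hP₁.eqv h).dim, (hP₁.eqv h).pow R le_rfl]
  · rintro k hk σ' h hJ hi
    refine .ite (fun hb' => ?_) (fun hb' => .skip ?_)
    · rcases hJ with hJ | ⟨-, hJ⟩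
      · simp [Test.Holds, NExp.val, hJ.1] at hb'
      refine (within_tryCmd hd0 hRK hR0 hdR (hP₁.eqv h) hb hA hi).imp ?_
      rintro σ'' - ⟨h1, h2⟩
      by_cases hg : TryGood hR0 A b k
      · rw [if_pos hg] at h1
        exact .inl ⟨h1, h2 hg⟩
      · rw [if_neg hg] at h1
        refine .inr ⟨h1, fun t ht => ?_⟩
        rcases Nat.lt_succ_iff_lt_or_eq.1 ht with ht | rfl
        · exact hJ t ht
        · exact hg
    · rcases hJ with hJ | ⟨hJ, -⟩
      · exact .inl hJ
      · simp [Test.Holds, NExp.val, hJ] at hb'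
  · rintro σ' - (h | ⟨-, h⟩)
    · exact h.2
    · exfalso
      have := card_bad_le A b (codeMap hR0 d) (Finset.range (2 ^ R * (d * d + R * R) + 1)) (by
        intro t ht
        have := h t (Finset.mem_range.1 ht)
        simp only [TryGood, CodeGood, not_forall] at this
        obtain ⟨code, h1, -, h3, h4⟩ := this
        exact ⟨code, h1, h3, h4⟩)
      rw [Finset.card_range] at this
      omega

end PointSimplex

namespace PointSimplex

open Matrix

/-! ## Volume of the part of a simplex inside a cube -/

section geometry
variable (d : ℕ) (V : ℕ → ℕ → ℝ) (a : ℕ → ℝ) (s : ℝ)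

/-- Coefficients of the constraints, in barycentric coordinates, for the intersection of a cube
with the simplex whose vertices are the rows of `V`. -/
def cellLhs (r : Fin (3 * d + 1)) (k : Fin d) : ℝ :=
  if (r : ℕ) < d then (if (r : ℕ) = k then -1 else 0)
  else if (r : ℕ) < d + 1 then 1
  else if (r : ℕ) < 2 * d + 1 then V (k + 1) (r - (d + 1)) - V 0 (r - (d + 1))
  else V 0 (r - (2 * d + 1)) - V (k + 1) (r - (2 * d + 1))

/-- Right hand sides of the constraints. -/
def cellRhs (r : Fin (3 * d + 1)) : ℝ :=
  if (r : ℕ) < d then 0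
  else if (r : ℕ) < d + 1 then 1
  else if (r : ℕ) < 2 * d + 1 then a (r - (d + 1)) + s - V 0 (r - (d + 1))
  else V 0 (r - (2 * d + 1)) - a (r - (2 * d + 1))

/-- Edge vectors from the first vertex, as columns. -/
def edgeMat : Matrix (Fin d) (Fin d) ℝ := Matrix.of fun c k => V (k + 1) c - V 0 c

theorem hasAxes_cellLhs : HasAxes (cellLhs d V) := by
  intro k
  refine ⟨⟨k, by omega⟩, -1, by norm_num, ?_⟩
  ext l
  simp only [cellLhs, k.2, if_true, Pi.single_apply]
  by_cases h : l = k
  · simp [h]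
  · have : (k : ℕ) ≠ l := fun h' => h (Fin.ext h'.symm)
    simp [h, this]

variable {d V a s}

theorem sum_ite_val (k : ℕ) (hk : k < d) (y : Fin d → ℝ) :
    ∑ l : Fin d, (if k = (l : ℕ) then -1 else 0) * y l = - y ⟨k, hk⟩ := by
  rw [Finset.sum_eq_single ⟨k, hk⟩]
  · simp
  · intro l _ hl
    rw [if_neg fun h => hl (Fin.ext h.symm), zero_mul]
  · simp

/-- Needed for every right-hand side because of the perturbation. The coordinates are bounded below
one by one, and their sum is bounded above. -/
theorem isBounded_cell (b : Fin (3 * d + 1) → ℝ) :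
    Bornology.IsBounded (polytope (cellLhs d V) b) := by
  refine (Metric.isBounded_Icc (fun k : Fin d => -b ⟨k, by omega⟩)
    (fun _ : Fin d => b ⟨d, by omega⟩ + ∑ l : Fin d, |b ⟨l, by omega⟩|)).subset fun y hy => ?_
  have h1 : ∀ k : Fin d, - b ⟨k, by omega⟩ ≤ y k := by
    intro k
    have := hy ⟨k, by omega⟩
    simp only [cellLhs, dotProduct, k.2, if_true, sum_ite_val k k.2] at this
    linarith
  have h2 : ∑ k, y k ≤ b ⟨d, by omega⟩ := by
    have := hy ⟨d, by omega⟩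
    simpa [cellLhs, dotProduct] using this
  refine ⟨fun k => h1 k, fun k => ?_⟩
  have h3 : y k ≤ ∑ l, (y l + |b ⟨l, by omega⟩|) - |b ⟨k, by omega⟩| := by
    have := Finset.single_le_sum (f := fun l : Fin d => y l + |b ⟨l, by omega⟩|)
      (fun l _ => by have := h1 l; have := le_abs_self (b ⟨l, by omega⟩); linarith) (Finset.mem_univ k)
    linarith
  rw [Finset.sum_add_distrib] at h3
  have := abs_nonneg (b ⟨k, by omega⟩)
  linarith

/-- The constraints describe the cube and the simplex. -/
theorem mem_cell_polytope {y : Fin d → ℝ} : y ∈ polytope (cellLhs d V) (cellRhs d V a s) ↔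
    ((∀ k, 0 ≤ y k) ∧ ∑ k, y k ≤ 1) ∧
      ∀ c : Fin d, a c ≤ V 0 c + (edgeMat d V *ᵥ y) c ∧ V 0 c + (edgeMat d V *ᵥ y) c ≤ a c + s := by
  have hW : ∀ c : Fin d, (edgeMat d V *ᵥ y) c = ∑ k : Fin d, (V (k + 1) c - V 0 c) * y k :=
    fun c => rfl
  have hW' : ∀ c : Fin d, ∑ k : Fin d, (V 0 c - V (k + 1) c) * y k = -(edgeMat d V *ᵥ y) c := by
    intro c
    rw [hW, ← Finset.sum_neg_distrib]
    exact Finset.sum_congr rfl fun k _ => by ring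
  constructor
  · intro hy
    refine ⟨⟨fun k => ?_, ?_⟩, fun c => ⟨?_, ?_⟩⟩
    · have := hy ⟨k, by omega⟩
      simp only [cellLhs, cellRhs, dotProduct, k.2, if_true, sum_ite_val k k.2] at this
      linarith
    · have := hy ⟨d, by omega⟩
      simpa [cellLhs, cellRhs, dotProduct] using this
    · have := hy ⟨2 * d + 1 + c, by omega⟩
      simp only [cellLhs, cellRhs, dotProduct, show ¬ (2 * d + 1 + (c : ℕ) < d) by omega,
        show ¬ (2 * d + 1 + (c : ℕ) < d + 1) by omega,
        show ¬ (2 * d + 1 + (c : ℕ) < 2 * d + 1) by omega, if_false, Nat.add_sub_cancel_left, hW'] at this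
      linarith
    · have := hy ⟨d + 1 + c, by omega⟩
      simp only [cellLhs, cellRhs, dotProduct, show ¬ (d + 1 + (c : ℕ) < d) by omega,
        show ¬ (d + 1 + (c : ℕ) < d + 1) by omega,
        show (d + 1 + (c : ℕ) < 2 * d + 1) by omega, if_false, if_true, Nat.add_sub_cancel_left, ← hW] at this
      linarith
  · rintro ⟨⟨h1, h2⟩, h3⟩ r
    by_cases hr1 : (r : ℕ) < d
    · simp only [cellLhs, cellRhs, dotProduct, hr1, if_true, sum_ite_val r hr1]
      linarith [h1 ⟨r, hr1⟩]
    by_cases hr2 : (r : ℕ) < d + 1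
    · simpa [cellLhs, cellRhs, dotProduct, hr1, hr2] using h2
    by_cases hr3 : (r : ℕ) < 2 * d + 1
    · have := (h3 ⟨r - (d + 1), by omega⟩).2
      rw [hW] at this
      simp only [cellLhs, cellRhs, dotProduct, hr1, hr2, hr3, if_true, if_false]
      simp only at this
      linarith
    · have := (h3 ⟨r - (2 * d + 1), by omega⟩).1
      have hc := hW' ⟨r - (2 * d + 1), by omega⟩
      simp only [cellLhs, cellRhs, dotProduct, hr1, hr2, hr3, if_false]
      simp only at this hc
      rw [hc]
      linarith

theorem mem_solid_iff {S : Affine.Simplex ℝ (E d) d}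
    (hV : ∀ (i : Fin (d + 1)) (c : Fin d), V i c = S.points i c) (x : E d) :
    x ∈ solid S ↔ ∃ y : Fin d → ℝ, ((∀ k, 0 ≤ y k) ∧ ∑ k, y k ≤ 1) ∧
      ∀ c, x c = V 0 c + (edgeMat d V *ᵥ y) c := by
  have hsolid : x ∈ solid S ↔ ∃ w : Fin (d + 1) → ℝ, (∀ i, 0 ≤ w i) ∧ ∑ i, w i = 1 ∧
      x = ∑ i, w i • S.points i := by
    rw [solid, convexHull_range_eq_exists_affineCombination]
    constructor
    · rintro ⟨s, w, hw0, hw1, rfl⟩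
      refine ⟨fun i => if i ∈ s then w i else 0, fun i => ?_, by simpa using hw1, ?_⟩
      · dsimp only; split_ifs with h
        · exact hw0 i h
        · exact le_rfl
      · rw [Finset.affineCombination_eq_linear_combination _ _ _ hw1]
        simp [ite_smul]
    · rintro ⟨w, hw0, hw1, rfl⟩
      exact ⟨Finset.univ, w, fun i _ => hw0 i, hw1,
        Finset.affineCombination_eq_linear_combination _ _ _ hw1⟩
  have hval : ∀ (w : Fin (d + 1) → ℝ) (c : Fin d), (∑ i, w i • S.points i) c =
      ∑ i : Fin (d + 1), w i * V i c := by
    intro w c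
    simp [hV]
  have hedge : ∀ (y : Fin d → ℝ) (c : Fin d), (edgeMat d V *ᵥ y) c =
      ∑ k : Fin d, (V (k + 1) c - V 0 c) * y k := fun y c => rfl
  rw [hsolid]
  constructor
  · rintro ⟨w, hw0, hw1, rfl⟩
    rw [Fin.sum_univ_succ] at hw1
    refine ⟨fun k => w k.succ, ⟨fun k => hw0 _, by linarith [hw0 0]⟩, fun c => ?_⟩
    rw [hval, hedge, Fin.sum_univ_succ]
    have : w 0 = 1 - ∑ k : Fin d, w k.succ := by linarith
    rw [this]
    simp only [sub_mul, Finset.sum_sub_distrib, Finset.sum_mul, Fin.val_zero, Fin.val_succ, one_mul,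
      mul_comm (w _)]
    simp only [← Finset.mul_sum]
    ring
  · rintro ⟨y, ⟨hy0, hy1⟩, hx⟩
    refine ⟨Fin.cons (1 - ∑ k, y k) y, fun i => ?_, by simp [Fin.sum_univ_succ], ?_⟩
    · refine Fin.cases ?_ (fun k => ?_) i
      · simpa using hy1
      · simpa using hy0 k
    · ext c
      rw [hval, hx, hedge, Fin.sum_univ_succ]
      simp only [Fin.cons_zero, Fin.cons_succ, Fin.val_zero, Fin.val_succ, sub_mul,
        Finset.sum_sub_distrib, Finset.sum_mul, one_mul, mul_comm (y _)]
      simp only [← Finset.mul_sum]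
      ring

/-- Barycentric coordinates are an affine change of variables whose linear part is the matrix of
edge vectors. The half-open cube may be closed, at the price of a null set. -/
theorem volume_solid_inter_cube {S : Affine.Simplex ℝ (E d) d}
    (hV : ∀ (i : Fin (d + 1)) (c : Fin d), V i c = S.points i c) :
    volume.real (solid S ∩ cube (WithLp.toLp 2 fun c : Fin d => a c) s) =
      |(edgeMat d V).det| * volume.real (polytope (cellLhs d V) (cellRhs d V a s)) := by
  set Sf : Set (Fin d → ℝ) := (WithLp.toLp 2) ⁻¹' solid S with hSf
  have hSm : MeasurableSet Sf := (measurableSet_solid S).preimage (by fun_prop)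
  have h1 : solid S ∩ cube (WithLp.toLp 2 fun c : Fin d => a c) s =
      {x : E d | (fun c => x c) ∈ Sf ∩ Set.univ.pi fun c : Fin d => Set.Ico (a c) (a c + s)} := by
    ext x
    simp [Sf, cube]
  have h2 : (Sf ∩ Set.univ.pi fun c : Fin d => Set.Ico (a c) (a c + s) : Set (Fin d → ℝ)) =ᵐ[volume]
      (Sf ∩ Set.Icc (fun c : Fin d => a c) (fun c : Fin d => a c + s) : Set (Fin d → ℝ)) :=
    (Filter.EventuallyEq.refl _ _).inter Measure.univ_pi_Ico_ae_eq_Icc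
  have h3 : Sf ∩ Set.Icc (fun c : Fin d => a c) (fun c : Fin d => a c + s) =
      (fun x => (fun c : Fin d => V 0 c) + x) ''
        (Matrix.toLin' (edgeMat d V) '' polytope (cellLhs d V) (cellRhs d V a s)) := by
    ext x
    simp only [Set.image_image, Set.mem_image, mem_cell_polytope, Set.mem_inter_iff, Sf,
      Set.mem_preimage, mem_solid_iff hV, Matrix.toLin'_apply]
    constructor
    · rintro ⟨⟨y, hy, hx⟩, hc⟩
      refine ⟨y, ⟨hy, fun c => ?_⟩, funext fun c => (hx c).symm⟩
      rw [← hx]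
      exact ⟨hc.1 c, hc.2 c⟩
    · rintro ⟨y, ⟨hy, hc⟩, rfl⟩
      exact ⟨⟨y, hy, fun c => rfl⟩, fun c => (hc c).1, fun c => (hc c).2⟩
  rw [Measure.real, h1, volume_ofLp_preimage (hSm.inter (MeasurableSet.univ_pi fun c => measurableSet_Ico)),
    measure_congr h2, h3, Set.image_add_left, measure_preimage_add, Measure.addHaar_image_linearMap, LinearMap.det_toLin',
    ENNReal.toReal_mul, ENNReal.toReal_ofReal (abs_nonneg _)]
  rfl

end geometry

/-- Coordinate `c` of vertex `a` of simplex `nv 24`. -/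
abbrev vtxE (a c : NExp) : RExp :=
  .get 3 (.add (.mul (.add (.mul (nv 24) (.add dimE (.lit 1))) a) dimE) c)

def lhsEntryCmd : Cmd :=
  .ite (.natLt (nv 13) dimE) (.setReal 23 (.lit 0) (.sub (.lit 0) (deltaE 13 14))) <|
  .ite (.natLt (nv 13) (.add dimE (.lit 1))) (.setReal 23 (.lit 0) (.lit 1)) <|
  .ite (.natLt (nv 13) (.add (.mul (.lit 2) dimE) (.lit 1)))
    (.setReal 23 (.lit 0) (.sub (vtxE (.add (nv 14) (.lit 1)) (.sub (nv 13) (.add dimE (.lit 1))))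
      (vtxE (.lit 0) (.sub (nv 13) (.add dimE (.lit 1))))))
    (.setReal 23 (.lit 0) (.sub
      (vtxE (.lit 0) (.sub (nv 13) (.add (.mul (.lit 2) dimE) (.lit 1))))
      (vtxE (.add (nv 14) (.lit 1)) (.sub (nv 13) (.add (.mul (.lit 2) dimE) (.lit 1))))))

def rhsEntryCmd : Cmd :=
  .ite (.natLt (nv 13) dimE) (.setReal 23 (.lit 0) (.lit 0)) <|
  .ite (.natLt (nv 13) (.add dimE (.lit 1))) (.setReal 23 (.lit 0) (.lit 1)) <|
  .ite (.natLt (nv 13) (.add (.mul (.lit 2) dimE) (.lit 1)))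
    (.setReal 23 (.lit 0) (.sub (.add (.get 29 (.sub (nv 13) (.add dimE (.lit 1)))) (rv 30))
      (vtxE (.lit 0) (.sub (nv 13) (.add dimE (.lit 1))))))
    (.setReal 23 (.lit 0) (.sub
      (vtxE (.lit 0) (.sub (nv 13) (.add (.mul (.lit 2) dimE) (.lit 1))))
      (.get 29 (.sub (nv 13) (.add (.mul (.lit 2) dimE) (.lit 1))))))

/-- `real 32` gets the volume of the part of simplex `nv 24` in the cube with corner `real 29` and
edge length `rv 30`. -/
def cellVolCmd : Cmd :=
  .seq (.setNat 12 (.lit 0) (.add (.mul (.lit 3) dimE) (.lit 1))) <|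
  .seq (fill2Cmd lhsEntryCmd 8 13 14 (nv 12) dimE (rv 23)) <|
  .seq (fillCmd rhsEntryCmd 9 13 (nv 12) (nv 13) (rv 23)) <|
  .seq polyVolCmd <|
  .seq (fill2Cmd .skip 10 13 14 dimE dimE (.sub (vtxE (.add (nv 14) (.lit 1)) (nv 13))
    (vtxE (.lit 0) (nv 13)))) <|
  .seq flCmd <|
  .ite (.realLe (rv 22) (.lit 0))
    (.setReal 32 (.lit 0) (.mul (rv 21) (.sub (.lit 0) (rv 22))))
    (.setReal 32 (.lit 0) (.mul (rv 21) (rv 22)))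

/-- A bound on the number of rounds of the loops for cell volumes. -/
def loopBound (d : ℕ) : ℕ := 2 ^ (3 * d + 1) * (d * d + (3 * d + 1) * (3 * d + 1)) + 1

/-- The dimension, the table of powers of two, the index and the vertices of the simplex. -/
structure SimplexIn {d : ℕ} (σ : Mem) (j : ℕ) (T : Affine.Simplex ℝ (E d) d) : Prop where
  dim : σ.nat 0 2 = d
  pow : ∀ r ≤ 3 * d + 1, σ.nat 5 r = 2 ^ r
  idx : σ.nat 24 0 = j
  sx : ∀ (i : Fin (d + 1)) (c : Fin d), σ.real 3 ((j * (d + 1) + i) * d + c) = T.points i c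

theorem SimplexIn.eqv {d j : ℕ} {σ σ' : Mem} {T : Affine.Simplex ℝ (E d) d} {ln lr : List ℕ}
    (h : SimplexIn σ j T) (e : Eqv ln lr σ σ') (hn : 0 ∉ ln ∧ 5 ∉ ln ∧ 24 ∉ ln := by decide)
    (hr : 3 ∉ lr := by decide) : SimplexIn σ' j T where
  dim := by rw [e.n 0 hn.1]; exact h.dim
  pow := by rw [e.n 5 hn.2.1]; exact h.pow
  idx := by rw [e.n 24 hn.2.2]; exact h.idx
  sx := by rw [e.r 3 hr]; exact h.sx

variable {d : ℕ} {S : Solver d} {f : ℕ → ℕ} {σ : Mem}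

theorem within_cellVolCmd (hd : 0 < d) {j : ℕ} {T : Affine.Simplex ℝ (E d) d}
    (hT : SimplexIn σ j T) : Within S f (loopBound d) cellVolCmd σ fun σ' =>
      σ'.real 32 0 = volume.real
        (solid T ∩ cube (WithLp.toLp 2 fun c : Fin d => σ.real 29 c) (σ.real 30 0)) := by
  have hR : 3 * d + 1 ≤ loopBound d := by
    have h1 := (3 * d + 1).lt_two_pow_self
    rw [loopBound]
    nlinarith
  have hdK : d ≤ loopBound d := by omega
  set V : ℕ → ℕ → ℝ := fun i c => σ.real 3 ((j * (d + 1) + i) * d + c) with hV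
  set a : ℕ → ℝ := σ.real 29 with ha
  have hVT : ∀ (i : Fin (d + 1)) (c : Fin d), V i c = T.points i c := hT.sx
  rw [volume_solid_inter_cube hVT]
  refine .seq (.setNat ?_)
  have e₁ := eqv_setNat σ 12 0 (3 * d + 1)
  have hnum : (σ.setNat 12 0 (3 * d + 1)).nat 12 0 = 3 * d + 1 := by simp
  simp only [NExp.val, hT.dim]
  generalize σ.setNat 12 0 (3 * d + 1) = σ₁ at *
  have hT₁ := hT.eqv e₁
  refine .seq (.fill2 (3 * d + 1) d (cellLhs d V) hR hdK (by decide) (by decide) (by decide)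
    (by decide) ?_ ?_ ?_ ?_)
  · intro σ' h; simp [NExp.val, h.n 12, hnum]
  · intro σ' h; simp [NExp.val, (hT₁.eqv h).dim]
  · intro r k σ' h hr hk
    have h3 : σ'.real 3 = σ.real 3 := by rw [h.r 3, e₁.r 3]
    have hT' := hT₁.eqv h
    simp only [cellLhs]
    refine .ite (fun hb => .setReal ?_) (fun hb => .ite (fun hb2 => .setReal ?_) (fun hb2 =>
      .ite (fun hb3 => .setReal ?_) fun hb3 => .setReal ?_))
    · simp only [Test.Holds, NExp.val, hr, hT'.dim] at hb
      rw [if_pos hb]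
      have := deltaE_val (σ := σ') (i := 13) (j := 14) (a := ⟨r, hb⟩) hr hk
      change RExp.val _ (rv 23) = _
      simp only [RExp.val, NExp.val, Mem.setReal_real, and_self, if_true] at this ⊢
      rw [this, Matrix.one_apply]
      by_cases h : (r : ℕ) = k
      · rw [if_pos (Fin.ext h), if_pos h]; simp
      · rw [if_neg fun h' => h (congrArg Fin.val h'), if_neg h]; simp
    · simp only [Test.Holds, NExp.val, hr, hT'.dim] at hb hb2
      rw [if_neg hb, if_pos hb2]; simp [RExp.val, NExp.val]
    · simp only [Test.Holds, NExp.val, hr, hT'.dim] at hb hb2 hb3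
      rw [if_neg hb, if_neg hb2, if_pos hb3]
      simp [RExp.val, NExp.val, hr, hk, hT'.dim, hT'.idx, h3, hV]
    · simp only [Test.Holds, NExp.val, hr, hT'.dim] at hb hb2 hb3
      rw [if_neg hb, if_neg hb2, if_neg hb3]
      simp [RExp.val, NExp.val, hr, hk, hT'.dim, hT'.idx, h3, hV]
  intro σ₂ e₂ hA
  have hT₂ := hT₁.eqv e₂
  refine .seq (.fill (3 * d + 1) (fun r => r) (cellRhs d V a (σ.real 30 0)) hR (by decide)
    (by decide) ?_ Fin.val_injective ?_ ?_)
  · intro σ' h; simp [NExp.val, h.n 12, e₂.n 12, hnum]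
  · intro r σ' h hr
    have h3 : σ'.real 3 = σ.real 3 := by rw [h.r 3, e₂.r 3, e₁.r 3]
    have h29 : σ'.real 29 = σ.real 29 := by rw [h.r 29, e₂.r 29, e₁.r 29]
    have h30 : σ'.real 30 = σ.real 30 := by rw [h.r 30, e₂.r 30, e₁.r 30]
    have hT' := hT₂.eqv h
    simp only [cellRhs]
    refine .ite (fun hb => .setReal ⟨by simp [NExp.val, hr], ?_⟩) (fun hb => .ite
      (fun hb2 => .setReal ⟨by simp [NExp.val, hr], ?_⟩) (fun hb2 =>
      .ite (fun hb3 => .setReal ⟨by simp [NExp.val, hr], ?_⟩) fun hb3 =>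
        .setReal ⟨by simp [NExp.val, hr], ?_⟩))
    · simp only [Test.Holds, NExp.val, hr, hT'.dim] at hb
      rw [if_pos hb]; simp [RExp.val, NExp.val]
    · simp only [Test.Holds, NExp.val, hr, hT'.dim] at hb hb2
      rw [if_neg hb, if_pos hb2]; simp [RExp.val, NExp.val]
    · simp only [Test.Holds, NExp.val, hr, hT'.dim] at hb hb2 hb3
      rw [if_neg hb, if_neg hb2, if_pos hb3]
      simp [RExp.val, NExp.val, hr, hT'.dim, hT'.idx, h3, hV, h29, h30, ha]
    · simp only [Test.Holds, NExp.val, hr, hT'.dim] at hb hb2 hb3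
      rw [if_neg hb, if_neg hb2, if_neg hb3]
      simp [RExp.val, NExp.val, hr, hT'.dim, hT'.idx, h3, hV, h29, ha]
  intro σ₃ e₃ hb _
  have hT₃ := hT₂.eqv e₃
  have hP : PolyIn σ₃ (cellLhs d V) (cellRhs d V a (σ.real 30 0)) :=
    ⟨hT₃.dim, by rw [e₃.n 12, e₂.n 12, hnum], hT₃.pow, by rw [e₃.r 8]; exact hA, hb⟩
  refine .seq ((within_polyVolCmd hd (by omega) le_rfl hP (isBounded_cell) (hasAxes_cellLhs d V)).imp ?_)
  intro σ₄ e₄ hvol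
  have hT₄ := hT₃.eqv e₄
  have h3₄ : σ₄.real 3 = σ.real 3 := by rw [e₄.r 3, e₃.r 3, e₂.r 3, e₁.r 3]
  refine .seq (.fill2 d d (edgeMat d V) hdK hdK (by decide) (by decide) (by decide) (by decide)
    ?_ ?_ ?_ ?_)
  · intro σ' h; simp [NExp.val, (hT₄.eqv h).dim]
  · intro σ' h; simp [NExp.val, (hT₄.eqv h).dim]
  · intro i k σ' h hi hk
    refine .skip ?_
    have hT' := hT₄.eqv h
    have h3 : σ'.real 3 = σ.real 3 := by rw [h.r 3, h3₄]
    simp [RExp.val, NExp.val, hi, hk, hT'.dim, hT'.idx, h3, hV, edgeMat]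
  intro σ₅ e₅ hM
  refine .seq ((within_flCmd hd hdK (hT₄.eqv e₅).dim hM).imp ?_)
  rintro σ₆ e₆ ⟨-, hq⟩
  have hdet : |flq (edgeMat d V) (d - 1)| = |(edgeMat d V).det| := by
    obtain ⟨e, rfl⟩ : ∃ e, d = e + 1 := ⟨d - 1, by omega⟩
    exact (flX_last _).2
  have hv₆ : σ₆.real 21 0 = volume.real (polytope (cellLhs d V) (cellRhs d V a (σ.real 30 0))) := by
    rw [e₆.r 21, e₅.r 21, hvol]
  rw [← hdet]
  refine .ite (fun hb => .setReal ?_) (fun hb => .setReal ?_) <;>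
    simp only [Test.Holds, RExp.val, NExp.val, hq, Nat.cast_zero] at hb
  · simp [RExp.val, NExp.val, hv₆, hq, abs_of_nonpos hb, mul_comm]
  · simp [RExp.val, NExp.val, hv₆, hq, abs_of_pos (not_le.1 hb), mul_comm]

end PointSimplex

namespace PointSimplex

/-! ## Cells with lists of relevant points -/

/-- A cube that waits to be processed, with the number of levels below it and the points that are
not known to be far away. -/
structure Item (d n : ℕ) where
  corner : Fin d → ℝ
  size : ℝ
  depth : ℕ
  pts : List (Fin n)

/-- The point `p` is so near the cube that its distance may vary by more than a factor `1 + δ`. -/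
def Relevant {d : ℕ} (δ : ℝ) (p a : Fin d → ℝ) (s : ℝ) : Prop :=
  (∑ c, (p c - (a c + s / 2)) ^ 2) * δ ^ 2 < 4 * d * s ^ 2

/-- Corner of the child `h` of a cube of size `s`. -/
def childCorner {d : ℕ} (a : Fin d → ℝ) (s : ℝ) (h : ℕ) (c : Fin d) : ℝ :=
  a c + if h.testBit c then s / 2 else 0

open Classical in
/-- The child `h` of an item. -/
def Item.child {d n : ℕ} (δ : ℝ) (p : Fin n → E d) (it : Item d n) (h : ℕ) : Item d n where
  corner := childCorner it.corner it.size h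
  size := it.size / 2
  depth := it.depth - 1
  pts := it.pts.filter fun i => Relevant δ (p i) (childCorner it.corner it.size h) (it.size / 2)

section subdivision
variable {d n : ℕ}

/-- The cube with a corner given as a tuple. -/
def box (a : Fin d → ℝ) (s : ℝ) : Set (E d) := cube (WithLp.toLp 2 a) s

theorem measurableSet_box (a : Fin d → ℝ) (s : ℝ) : MeasurableSet (box a s) := measurableSet_cube _ _

/-- Bit `c` of the number of a child says in which half its coordinate `c` lies. A point of the cube
determines all these bits and so lies in exactly one child. -/
theorem sum_indicator_child (a : Fin d → ℝ) {s : ℝ} (hs : 0 < s) (x : E d) :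
    ∑ h ∈ Finset.range (2 ^ d), (box (childCorner a s h) (s / 2)).indicator (1 : E d → ℝ) x =
      (box a s).indicator 1 x := by
  classical
  set f : Finset (Fin d) → ℝ := fun B =>
    if ∀ c, a c + (if c ∈ B then s / 2 else 0) ≤ x c ∧
      x c < a c + (if c ∈ B then s / 2 else 0) + s / 2 then 1 else 0 with hf
  have h1 : ∀ h, (box (childCorner a s h) (s / 2)).indicator (1 : E d → ℝ) x = f (codeSet d h) := by
    intro h
    simp [Set.indicator_apply, box, cube, hf, childCorner, codeSet]
  simp only [h1]
  rw [sum_codeSet]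
  have key : ∀ B, (∀ c, a c + (if c ∈ B then s / 2 else 0) ≤ x c ∧
      x c < a c + (if c ∈ B then s / 2 else 0) + s / 2) ↔
      x ∈ box a s ∧ B = Finset.univ.filter fun c => a c + s / 2 ≤ x c := by
    intro B
    constructor
    · intro hB
      refine ⟨fun c => ?_, ?_⟩
      · have := hB c
        simp only
        split_ifs at this <;> constructor <;> linarith
      · ext c
        have := hB c
        simp only [Finset.mem_filter, Finset.mem_univ, true_and]
        split_ifs at this with hc
        · simp only [hc, true_iff]; exact this.1
        · simp only [hc, false_iff, not_le]; linarith
    · rintro ⟨hx, rfl⟩ c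
      have := hx c
      simp only at this
      simp only [Finset.mem_filter, Finset.mem_univ, true_and]
      split_ifs with hc <;> constructor <;> linarith
  rw [Finset.sum_eq_single (Finset.univ.filter fun c => a c + s / 2 ≤ x c)]
  · simp only [hf, key, and_true, Set.indicator_apply, Pi.one_apply]
  · intro B _ hB
    simp only [hf, key, hB, and_false, if_false]
  · simp

theorem sum_setIntegral_child (a : Fin d → ℝ) {s : ℝ} (hs : 0 < s) {g : E d → ℝ}
    (hg : Integrable g) :
    ∑ h ∈ Finset.range (2 ^ d), ∫ x in box (childCorner a s h) (s / 2), g x =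
      ∫ x in box a s, g x := by
  simp only [← integral_indicator (measurableSet_box _ _)]
  rw [← integral_finsetSum _ fun h _ => hg.indicator (measurableSet_box _ _)]
  congr 1
  ext x
  have h1 : ∀ S : Set (E d), S.indicator g x = S.indicator (1 : E d → ℝ) x * g x := by
    intro S
    by_cases hx : x ∈ S <;> simp [hx]
  simp only [h1 (box _ _)]
  rw [← Finset.sum_mul, sum_indicator_child a hs]

/-- Distances from points that are not relevant vary little. -/
theorem dist_le_of_not_relevant {δ : ℝ} (hδ : 0 < δ) (hδ1 : δ ≤ 1) {p x y : E d} {a : Fin d → ℝ}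
    {s : ℝ} (hs : 0 < s) (h : ¬ Relevant δ p a s) (hx : x ∈ box a s) (hy : y ∈ box a s) :
    dist p x ≤ (1 + δ) * dist p y := by
  set z : E d := WithLp.toLp 2 fun c => a c + s / 2 with hz
  -- Let `ρ = √d * s / 2` be the radius of the cube and `D` the distance from `p` to its centre. The
  -- claim follows from `D + ρ ≤ (1 + δ) * (D - ρ)`, that is `(2 + δ) * ρ ≤ δ * D`. Irrelevance
  -- gives `4 * ρ ≤ δ * D`, which is enough as `δ ≤ 1`.
  have hpz : 2 * (√d * s) ≤ δ * dist p z := by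
    have h1 : dist p z ^ 2 = ∑ c, (p c - (a c + s / 2)) ^ 2 := by
      rw [EuclideanSpace.dist_eq, Real.sq_sqrt (Finset.sum_nonneg fun _ _ => sq_nonneg _)]
      simp [hz, Real.dist_eq, sq_abs]
    rw [Relevant, not_lt, ← h1] at h
    refine abs_le_of_sq_le_sq' ?_ (by positivity) |>.2
    rw [mul_pow, mul_pow, Real.sq_sqrt (Nat.cast_nonneg d), mul_pow]
    linarith
  have hcen : ∀ w ∈ box a s, dist w z ≤ √d * s / 2 := by
    intro w hw
    rw [EuclideanSpace.dist_eq]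
    refine Real.sqrt_le_iff.2 ⟨by positivity, ?_⟩
    have : ∀ c, dist (w c) (z c) ^ 2 ≤ (s / 2) ^ 2 := by
      intro c
      have := hw c
      simp only at this
      rw [Real.dist_eq, sq_abs]
      exact sq_le_sq' (by simp only [hz]; linarith) (by simp only [hz]; linarith)
    refine (Finset.sum_le_sum fun c _ => this c).trans_eq ?_
    rw [Finset.sum_const, Finset.card_univ, Fintype.card_fin, nsmul_eq_mul, mul_div_assoc, mul_pow,
      Real.sq_sqrt (Nat.cast_nonneg d)]
  have h1 := dist_triangle p z x
  have h2 := dist_triangle p y z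
  have h3 := hcen x hx
  have h4 := hcen y hy
  rw [dist_comm] at h3
  have h5 : 0 ≤ √d * s := by positivity
  nlinarith [mul_nonneg hδ.le h5]

/-! ### Counting -/

open Classical in
/-- Number of cubes, among those `k` levels deep, at which the point `p` is relevant. -/
def treeCount (δ : ℝ) (p : Fin d → ℝ) : ℕ → (Fin d → ℝ) → ℝ → ℕ
  | 0, _, _ => 1
  | k + 1, a, s => 1 + ∑ h ∈ Finset.range (2 ^ d),
      if Relevant δ p (childCorner a s h) (s / 2) then
        treeCount δ p k (childCorner a s h) (s / 2) else 0

/-- The Gaussian of width `t / δ` around `p`. -/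
def bump (δ : ℝ) (p : E d) (t : ℝ) (x : E d) : ℝ := Real.exp (-(δ / t) ^ 2 * ‖x - p‖ ^ 2)

theorem integral_bump {δ : ℝ} (hδ : 0 < δ) (p : E d) {t : ℝ} (ht : 0 < t) :
    ∫ x, bump δ p t x = (√Real.pi * t / δ) ^ d := by
  have h1 := GaussianFourier.integral_rexp_neg_mul_sq_norm (V := E d) (b := (δ / t) ^ 2)
    (by positivity)
  have h2 : ∫ x, bump δ p t x = ∫ v : E d, Real.exp (-(δ / t) ^ 2 * ‖v‖ ^ 2) :=
    integral_sub_right_eq_self (fun v : E d => Real.exp (-(δ / t) ^ 2 * ‖v‖ ^ 2)) p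
  have h3 : Real.pi / (δ / t) ^ 2 = (√Real.pi * t / δ) ^ 2 := by
    rw [div_pow, div_pow, mul_pow, Real.sq_sqrt Real.pi_pos.le]
    field_simp
  rw [h2, h1, finrank_euclideanSpace, Fintype.card_fin, h3, ← Real.rpow_natCast _ 2,
    ← Real.rpow_mul (by positivity), ← Real.rpow_natCast _ d]
  congr 1
  push_cast
  ring

theorem integrable_bump {δ : ℝ} (hδ : 0 < δ) (p : E d) {t : ℝ} (ht : 0 < t) :
    Integrable (bump δ p t) := by
  by_contra h
  have h1 := integral_bump hδ p ht
  rw [integral_undef h] at h1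
  have : 0 < (√Real.pi * t / δ) ^ d := by positivity
  exact this.ne h1

/-- For relevant `p` and any `x` in the cube, the exponent `(δ / t) ^ 2 * ‖x - p‖ ^ 2` is at most `8
d + d / 2`. Here `8 d` is twice the relevance bound for the centre, and `d / 2` comes from the
offset of `x` from the centre. -/
theorem one_le_bump {δ : ℝ} (hδ : 0 < δ) (hδ1 : δ ≤ 1) {p : E d} {a : Fin d → ℝ} {t : ℝ} (ht : 0 < t)
    (h : Relevant δ p a t) : 1 ≤ Real.exp (9 * d) / t ^ d * ∫ x in box a t, bump δ p t x := by
  have hlow : ∀ x ∈ box a t, Real.exp (-(9 * d)) ≤ bump δ p t x := by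
    intro x hx
    rw [bump, Real.exp_le_exp]
    have h1 : ‖x - p‖ ^ 2 ≤ 2 * ∑ c, (p c - (a c + t / 2)) ^ 2 + d * t ^ 2 / 2 := by
      rw [EuclideanSpace.norm_eq, Real.sq_sqrt (Finset.sum_nonneg fun _ _ => sq_nonneg _)]
      have : ∀ c, ‖(x - p) c‖ ^ 2 ≤ 2 * (p c - (a c + t / 2)) ^ 2 + t ^ 2 / 2 := by
        intro c
        have hc := hx c
        simp only at hc
        rw [Real.norm_eq_abs, sq_abs, PiLp.sub_apply]
        have h2 : (x c - (a c + t / 2)) ^ 2 ≤ (t / 2) ^ 2 :=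
          sq_le_sq' (by linarith) (by linarith)
        nlinarith [sq_nonneg ((x c - (a c + t / 2)) + (p c - (a c + t / 2)))]
      refine (Finset.sum_le_sum fun c _ => this c).trans_eq ?_
      rw [Finset.sum_add_distrib, ← Finset.mul_sum]
      simp
      ring
    rw [Relevant] at h
    have h2 : (δ / t) ^ 2 * ‖x - p‖ ^ 2 ≤ 9 * d := by
      rw [div_pow, div_mul_eq_mul_div, div_le_iff₀ (by positivity)]
      have h3 : δ ^ 2 * (d * t ^ 2 / 2) ≤ d * t ^ 2 / 2 :=
        mul_le_of_le_one_left (by positivity) (by nlinarith)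
      have h4 := mul_le_mul_of_nonneg_left h1 (sq_nonneg δ)
      have h5 : (0 : ℝ) ≤ d * t ^ 2 := by positivity
      nlinarith
    linarith
  have hvol : volume.real (box a t) = t ^ d := volume_cube _ ht.le
  have hfin : volume (box a t) ≠ ⊤ := by
    intro h
    have : volume.real (box a t) = 0 := by simp [Measure.real, h]
    rw [hvol] at this
    exact absurd this (by positivity)
  have h1 : Real.exp (-(9 * d)) * t ^ d ≤ ∫ x in box a t, bump δ p t x := by
    rw [← hvol]
    exact setIntegral_ge_of_const_le_real (measurableSet_box _ _) hfin hlow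
      (integrable_bump hδ p ht).integrableOn
  calc (1 : ℝ) = Real.exp (9 * d) / t ^ d * (Real.exp (-(9 * d)) * t ^ d) := by
        rw [Real.exp_neg]; field_simp
    _ ≤ _ := mul_le_mul_of_nonneg_left h1 (by positivity)

-- Each cube counted below the root is charged to a Gaussian of its own scale, integrated over that
-- cube. The cubes of one level are disjoint, so the charges of a level add up to at most one
-- integral over the root.
open Classical in
theorem treeCount_le {δ : ℝ} (hδ : 0 < δ) (hδ1 : δ ≤ 1) (p : E d) (k : ℕ) (a : Fin d → ℝ) {s : ℝ}
    (hs : 0 < s) : (treeCount δ p k a s : ℝ) ≤ 1 + ∑ l ∈ Finset.range k,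
      Real.exp (9 * d) / (s / 2 ^ (l + 1)) ^ d * ∫ x in box a s, bump δ p (s / 2 ^ (l + 1)) x := by
  induction k generalizing a s with
  | zero => simp [treeCount]
  | succ k ih =>
    simp only [treeCount]
    push_cast
    refine add_le_add le_rfl ?_
    set F : ℝ → Set (E d) → ℝ := fun t S => Real.exp (9 * d) / t ^ d * ∫ x in S, bump δ p t x with hF
    have hFsum : ∀ t, 0 < t → ∑ h ∈ Finset.range (2 ^ d), F t (box (childCorner a s h) (s / 2)) =
        F t (box a s) := by
      intro t ht
      simp only [hF, ← Finset.mul_sum]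
      rw [sum_setIntegral_child a hs (integrable_bump hδ p ht)]
    have hF0 : ∀ t S, 0 < t → 0 ≤ F t S := fun t S ht =>
      mul_nonneg (by positivity) (integral_nonneg fun x => (Real.exp_pos _).le)
    have hs2 : ∀ l : ℕ, s / 2 / 2 ^ (l + 1) = s / 2 ^ (l + 1 + 1) := by
      intro l
      rw [div_div, ← pow_succ']
    have hterm : ∀ h ∈ Finset.range (2 ^ d),
        ((if Relevant δ p (childCorner a s h) (s / 2) then
          (treeCount δ p k (childCorner a s h) (s / 2) : ℝ) else 0)) ≤
        F (s / 2) (box (childCorner a s h) (s / 2)) +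
          ∑ l ∈ Finset.range k, F (s / 2 ^ (l + 1 + 1)) (box (childCorner a s h) (s / 2)) := by
      intro h _
      split_ifs with hr
      · have h1 := ih (childCorner a s h) (half_pos hs)
        simp only [hs2] at h1
        exact h1.trans (add_le_add (one_le_bump hδ hδ1 (half_pos hs) hr) le_rfl)
      · exact add_nonneg (hF0 _ _ (half_pos hs)) (Finset.sum_nonneg fun l _ => hF0 _ _ (by positivity))
    refine (Finset.sum_le_sum hterm).trans_eq ?_
    rw [Finset.sum_add_distrib, hFsum _ (half_pos hs), Finset.sum_comm, Finset.sum_range_succ', add_comm]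
    congr 1
    · exact Finset.sum_congr rfl fun l _ => hFsum _ (by positivity)
    · simp [hF]

/-- Once the integrals are extended to the whole space, the volume of the cubes cancels the scale of
the Gaussian, and every level contributes the same bound. -/
theorem treeCount_le_mul {δ : ℝ} (hδ : 0 < δ) (hδ1 : δ ≤ 1) (p : E d) (k : ℕ) (a : Fin d → ℝ) {s : ℝ}
    (hs : 0 < s) : (treeCount δ p k a s : ℝ) ≤ 1 + k * (Real.exp 9 * √Real.pi / δ) ^ d := by
  refine (treeCount_le hδ hδ1 p k a hs).trans (add_le_add le_rfl ?_)
  have : ∀ l ∈ Finset.range k, Real.exp (9 * d) / (s / 2 ^ (l + 1)) ^ d *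
      ∫ x in box a s, bump δ p (s / 2 ^ (l + 1)) x ≤ (Real.exp 9 * √Real.pi / δ) ^ d := by
    intro l _
    have ht : 0 < s / 2 ^ (l + 1) := by positivity
    have h1 := setIntegral_le_integral (s := box a s) (integrable_bump hδ p ht)
      (Filter.Eventually.of_forall fun x => (Real.exp_pos _).le)
    rw [integral_bump hδ p ht] at h1
    refine (mul_le_mul_of_nonneg_left h1 (by positivity)).trans_eq ?_
    rw [show Real.exp (9 * d) = Real.exp 9 ^ d by rw [← Real.exp_nat_mul]; ring_nf,
      ← div_pow, ← mul_pow]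
    congr 1
    field_simp
  refine (Finset.sum_le_sum this).trans_eq ?_
  simp

end subdivision

end PointSimplex

namespace PointSimplex

/-! ## The queue of cells on the RAM -/

/-- Dimension, powers of two, points and approximation parameter. -/
structure PointsIn {d n : ℕ} (σ : Mem) (p : Fin n → E d) (δ : ℝ) : Prop where
  dim : σ.nat 0 2 = d
  pow : ∀ r ≤ 3 * d + 1, σ.nat 5 r = 2 ^ r
  pt : ∀ (i : Fin n) (c : Fin d), σ.real 1 (i * d + c) = p i c
  param : σ.real 33 0 = δ

theorem PointsIn.eqv {d n : ℕ} {σ σ' : Mem} {p : Fin n → E d} {δ : ℝ} {ln lr : List ℕ}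
    (h : PointsIn σ p δ) (e : Eqv ln lr σ σ') (hn : 0 ∉ ln ∧ 5 ∉ ln := by decide)
    (hr : 1 ∉ lr ∧ 33 ∉ lr := by decide) : PointsIn σ' p δ where
  dim := by rw [e.n 0 hn.1]; exact h.dim
  pow := by rw [e.n 5 hn.2]; exact h.pow
  pt := by rw [e.r 1 hr.1]; exact h.pt
  param := by rw [e.r 33 hr.2]; exact h.param

/-- Place `q` of the queue holds the item `it`. -/
structure Stored {d n : ℕ} (σ : Mem) (q : ℕ) (it : Item d n) : Prop where
  corner : ∀ c : Fin d, σ.real 19 (q * d + c) = it.corner c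
  size : σ.real 20 q = it.size
  depth : σ.nat 11 q = it.depth
  cnt : σ.nat 10 q = it.pts.length
  pts : ∀ l, ∀ hl : l < it.pts.length, σ.nat 8 (σ.nat 9 q + l) = it.pts[l]
  top : σ.nat 9 q + it.pts.length ≤ σ.nat 27 0

/-- The first `t` places of the queue are unchanged. -/
structure Keeps (d t : ℕ) (σ σ' : Mem) : Prop where
  corner : ∀ i < t * d, σ'.real 19 i = σ.real 19 i
  size : ∀ q < t, σ'.real 20 q = σ.real 20 q
  start : ∀ q < t, σ'.nat 9 q = σ.nat 9 q
  cnt : ∀ q < t, σ'.nat 10 q = σ.nat 10 q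
  depth : ∀ q < t, σ'.nat 11 q = σ.nat 11 q
  list : ∀ i < σ.nat 27 0, σ'.nat 8 i = σ.nat 8 i
  top : σ.nat 27 0 ≤ σ'.nat 27 0

theorem Keeps.of_eqv {d t : ℕ} {σ σ' : Mem} {ln lr : List ℕ} (e : Eqv ln lr σ σ')
    (hn : 8 ∉ ln ∧ 9 ∉ ln ∧ 10 ∉ ln ∧ 11 ∉ ln ∧ 27 ∉ ln := by decide)
    (hr : 19 ∉ lr ∧ 20 ∉ lr := by decide) : Keeps d t σ σ' where
  corner _ _ := by rw [e.r 19 hr.1]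
  size _ _ := by rw [e.r 20 hr.2]
  start _ _ := by rw [e.n 9 hn.2.1]
  cnt _ _ := by rw [e.n 10 hn.2.2.1]
  depth _ _ := by rw [e.n 11 hn.2.2.2.1]
  list _ _ := by rw [e.n 8 hn.1]
  top := by rw [e.n 27 hn.2.2.2.2]

theorem Keeps.trans {d t : ℕ} {σ σ' σ'' : Mem} (h : Keeps d t σ σ') (h' : Keeps d t σ' σ'') :
    Keeps d t σ σ'' where
  corner i hi := (h'.corner i hi).trans (h.corner i hi)
  size i hi := (h'.size i hi).trans (h.size i hi)
  start i hi := (h'.start i hi).trans (h.start i hi)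
  cnt i hi := (h'.cnt i hi).trans (h.cnt i hi)
  depth i hi := (h'.depth i hi).trans (h.depth i hi)
  list i hi := (h'.list i (hi.trans_le h.top)).trans (h.list i hi)
  top := h.top.trans h'.top

theorem Keeps.mono {d t t' : ℕ} {σ σ' : Mem} (h : Keeps d t' σ σ') (ht : t ≤ t') :
    Keeps d t σ σ' where
  corner i hi := h.corner i (hi.trans_le (Nat.mul_le_mul_right d ht))
  size i hi := h.size i (by omega)
  start i hi := h.start i (by omega)
  cnt i hi := h.cnt i (by omega)
  depth i hi := h.depth i (by omega)
  list := h.list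
  top := h.top

theorem Keeps.stored {d t n q : ℕ} {σ σ' : Mem} (h : Keeps d t σ σ') {it : Item d n} (hq : q < t)
    (hs : Stored σ q it) : Stored σ' q it where
  corner c := by
    have : q * d + c < t * d := by
      calc q * d + c < q * d + d := by omega
        _ = (q + 1) * d := by ring
        _ ≤ t * d := Nat.mul_le_mul_right d hq
    rw [h.corner _ this]; exact hs.corner c
  size := by rw [h.size q hq]; exact hs.size
  depth := by rw [h.depth q hq]; exact hs.depth
  cnt := by rw [h.cnt q hq]; exact hs.cnt
  pts l hl := by
    rw [h.start q hq, h.list _ (lt_of_lt_of_le (by omega) hs.top)]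
    exact hs.pts l hl
  top := by rw [h.start q hq]; exact hs.top.trans h.top

/-- Difference of coordinate `nv 13` of the point `nv 33` and the centre of the last cell. -/
abbrev offsetE : RExp :=
  .sub (.get 1 (.add (.mul (nv 33) dimE) (nv 13)))
    (.add (.get 19 (.add (.mul (nv 26) dimE) (nv 13))) (.div (rv 34) (.lit 2)))

/-- Append point `nv 30` of the list of cell `nv 25` to the list of cell `nv 26` if it is
relevant. -/
def filterCmd : Cmd :=
  .seq (.setNat 33 (.lit 0) (.get 8 (.add (.get 9 (nv 25)) (nv 30)))) <|
  .seq (sumCmd 23 13 dimE (.mul offsetE offsetE)) <|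
  .ite (.realLe (.mul (.mul (.lit 4) (.ofNat dimE)) (.mul (rv 34) (rv 34)))
      (.mul (rv 23) (.mul (rv 33) (rv 33))))
    .skip
    (.seq (.setNat 8 (.add (nv 27) (nv 32)) (nv 33)) (.setNat 32 (.lit 0) (.add (nv 32) (.lit 1))))

def childHeadCmd : Cmd :=
  .seq decodeCmd <|
  .seq (fillCmd .skip 19 13 dimE (.add (.mul (nv 26) dimE) (nv 13))
    (.add (.get 29 (nv 13)) (.mul (.ofNat (.get 6 (nv 13))) (rv 34)))) <|
  .seq (.setReal 20 (nv 26) (rv 34)) <|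
  .seq (.setNat 11 (nv 26) (.sub (.get 11 (nv 25)) (.lit 1))) <|
  .seq (.setNat 9 (nv 26) (nv 27)) (.setNat 32 (.lit 0) (.lit 0))

def childTailCmd : Cmd :=
  .seq (.setNat 10 (nv 26) (nv 32)) <|
  .seq (.setNat 27 (.lit 0) (.add (nv 27) (nv 32))) (.setNat 26 (.lit 0) (.add (nv 26) (.lit 1)))

/-- Append child `nv 17` of cell `nv 25` to the queue. -/
def childCmd : Cmd :=
  .seq childHeadCmd (.seq (forCmd 30 (.get 10 (nv 25)) filterCmd) childTailCmd)

/-- The length of a list is not bounded by a function of `d`. The filtering loop is therefore timed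
apart from the rest, linearly in `cnt`. -/
def childTime (K cnt : ℕ) : ℕ :=
  childHeadCmd.bnd K + childTailCmd.bnd K + 3 + (cnt + 1) * (filterCmd.bnd K + 13)

variable {d n : ℕ} {S : Solver d} {f : ℕ → ℕ} {K : ℕ} {σ : Mem} {p : Fin n → E d} {δ : ℝ}

open Classical in
theorem within_filterCmd (hK : d ≤ K) (hP : PointsIn σ p δ) {i : Fin n} {a : Fin d → ℝ} {s : ℝ}
    (hi : σ.nat 8 (σ.nat 9 (σ.nat 25 0) + σ.nat 30 0) = i)
    (ha : ∀ c : Fin d, σ.real 19 (σ.nat 26 0 * d + c) = a c) (hs : σ.real 34 0 = s) :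
    Within S f K filterCmd σ fun σ' =>
      σ'.nat 32 0 = σ.nat 32 0 + (if Relevant δ (p i) a s then 1 else 0) ∧
      (∀ b, b ≠ σ.nat 27 0 + σ.nat 32 0 → σ'.nat 8 b = σ.nat 8 b) ∧
      (Relevant δ (p i) a s → σ'.nat 8 (σ.nat 27 0 + σ.nat 32 0) = i) := by
  refine .seq (.setNat (.seq ?_))
  have e₁ := eqv_setNat σ 33 0 i
  have h33 : (σ.setNat 33 0 i).nat 33 0 = i := by simp
  simp only [NExp.val, hi]
  generalize σ.setNat 33 0 i = σ₁ at *
  refine .sum d (fun c => (p i c - (a c + s / 2)) ^ 2) hK ?_ ?_ ?_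
  · intro σ' h; simp [NExp.val, ((hP.eqv e₁).eqv h).dim]
  · intro c σ' h hc
    have hP' := (hP.eqv e₁).eqv h
    simp only [RExp.val, NExp.val, hc, hP'.dim, h.n 33, h33, hP'.pt, h.r 19, e₁.r 19, h.n 26,
      e₁.n 26, ha, h.r 34, e₁.r 34, hs]
    push_cast
    ring
  intro σ₂ e₂ hsum
  have hP₂ := (hP.eqv e₁).eqv e₂
  have a32 : σ₂.nat 32 = σ.nat 32 := by rw [e₂.n 32, e₁.n 32]
  have a27 : σ₂.nat 27 = σ.nat 27 := by rw [e₂.n 27, e₁.n 27]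
  have a8 : σ₂.nat 8 = σ.nat 8 := by rw [e₂.n 8, e₁.n 8]
  have a33 : σ₂.nat 33 0 = i := by rw [e₂.n 33, h33]
  have a34 : σ₂.real 34 0 = s := by rw [e₂.r 34, e₁.r 34, hs]
  have hrel : Relevant δ (p i) a s ↔ ¬ (4 * (d : ℝ) * (s * s) ≤
      (∑ c, (p i c - (a c + s / 2)) ^ 2) * (δ * δ)) := by
    rw [not_le, Relevant, sq s, sq δ]
  refine .ite (fun hb => .skip ?_) (fun hb => .seq (.setNat (.setNat ?_))) <;>
    simp only [Test.Holds, RExp.val, NExp.val, hP₂.dim, hP₂.param, hsum, a34, Nat.cast_ofNat] at hb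
  · have hr : ¬ Relevant δ (p i) a s := by rw [hrel, not_not]; exact hb
    simp [hr, a32, a8]
  · have hr : Relevant δ (p i) a s := hrel.2 hb
    refine ⟨by simp [hr, NExp.val, a32], fun b hb => ?_, fun _ => ?_⟩
    · simp [NExp.val, a27, a32, hb, a8]
    · simp [NExp.val, a27, a32, a33]

theorem runs_childCmd (hK : d ≤ K) (hP : PointsIn σ p δ) {it : Item d n}
    (hit : Stored σ (σ.nat 25 0) it) (hlt : σ.nat 25 0 < σ.nat 26 0)
    (hc : ∀ c : Fin d, σ.real 29 c = it.corner c) (hs : σ.real 34 0 = it.size / 2)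
    (hd : σ.nat 12 0 = d) {h : ℕ} (hh : σ.nat 17 0 = h) (hh2 : h < 2 ^ d) :
    Runs S f childCmd σ (childTime K it.pts.length) fun σ' =>
      Stored σ' (σ.nat 26 0) (it.child δ p h) ∧ σ'.nat 26 0 = σ.nat 26 0 + 1 ∧
      Keeps d (σ.nat 26 0) σ σ' := by
  classical
  set t := σ.nat 26 0 with ht
  set it' := it.child δ p h with hit'
  refine .seq (childHeadCmd.bnd K) (childTailCmd.bnd K + 3 +
    (it.pts.length + 1) * (filterCmd.bnd K + 13)) (by rw [childTime]; omega) ?_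
  change Within S f K childHeadCmd σ _
  refine .seq ((within_decodeCmd hK hd hh hh2 fun r hr => hP.pow r (by omega)).imp ?_)
  rintro σ₁ e₁ ⟨-, -, hbit⟩
  have hP₁ := hP.eqv e₁
  refine .seq (.fill d (fun c => t * d + c) it'.corner hK (by decide) (by decide) ?_ ?_ ?_ ?_)
  · intro σ' h; simp [NExp.val, (hP₁.eqv h).dim]
  · intro a b hab; exact Fin.ext (by simpa using hab)
  · intro c σ' h' hc'
    refine .skip ⟨?_, ?_⟩
    · simp [NExp.val, hc', (hP₁.eqv h').dim, h'.n 26, e₁.n 26, ht]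
    · simp only [RExp.val, NExp.val, hc', h'.n 6, hbit c c.2, h'.r 29, e₁.r 29, hc, h'.r 34,
        e₁.r 34, hs]
      change _ = childCorner it.corner it.size h c
      rw [childCorner]
      split_ifs <;> simp
  intro σ₂ e₂ hcor hcor'
  refine .seq (.setReal (.seq (.setNat (.seq (.setNat (.setNat ?_))))))
  have b26 : σ₂.nat 26 = σ.nat 26 := by rw [e₂.n 26, e₁.n 26]
  have b25 : σ₂.nat 25 = σ.nat 25 := by rw [e₂.n 25, e₁.n 25]
  have b27 : σ₂.nat 27 = σ.nat 27 := by rw [e₂.n 27, e₁.n 27]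
  have b34 : σ₂.real 34 0 = it.size / 2 := by rw [e₂.r 34, e₁.r 34, hs]
  have b11 : σ₂.nat 11 = σ.nat 11 := by rw [e₂.n 11, e₁.n 11]
  have hk₂ : Keeps d t σ σ₂ := by
    have k2 : Keeps d t σ₁ σ₂ :=
      ⟨fun i hi => hcor' i fun k => by omega, fun q _ => by rw [e₂.r 20], fun q _ => by rw [e₂.n 9],
        fun q _ => by rw [e₂.n 10], fun q _ => by rw [e₂.n 11], fun q _ => by rw [e₂.n 8],
        by rw [e₂.n 27]⟩
    exact (Keeps.of_eqv e₁).trans k2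
  have hP₂ := hP₁.eqv e₂
  simp only [NExp.val, RExp.val]
  set σ₃ := (((σ₂.setReal 20 (σ₂.nat 26 0) (σ₂.real 34 0)).setNat 11 _ _).setNat 9 _ _).setNat 32 0 0
    with hσ₃
  have e₃ : Eqv [11, 9, 32] [20] σ₂ σ₃ := by
    refine (((eqv_setReal _ _ _ _).mono ?_ ?_).trans ((eqv_setNat _ _ _ _).mono ?_ ?_)).trans
      (((eqv_setNat _ _ _ _).mono ?_ ?_).trans ((eqv_setNat _ _ _ _).mono ?_ ?_)) <;> simp
  have hk₃ : Keeps d t σ σ₃ := by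
    refine hk₂.trans ⟨?_, ?_, ?_, ?_, ?_, ?_, ?_⟩
    · intro i _; rw [e₃.r 19]
    · intro q hq; simp [hσ₃, b26, ← ht, hq.ne]
    · intro q hq; simp [hσ₃, b26, ← ht, hq.ne]
    · intro q hq; rw [e₃.n 10]
    · intro q hq; simp [hσ₃, b26, ← ht, hq.ne]
    · intro q hq; rw [e₃.n 8]
    · rw [e₃.n 27]
  have hP₃ := hP₂.eqv e₃
  have hcor₃ : ∀ c : Fin d, σ₃.real 19 (t * d + c) = it'.corner c := by rw [e₃.r 19]; exact hcor
  have hsize₃ : σ₃.real 20 t = it'.size := by simp [hσ₃, b26, ← ht, b34, hit', Item.child]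
  have hdep₃ : σ₃.nat 11 t = it'.depth := by
    simp [hσ₃, b26, ← ht, b11, b25, hit.depth, hit', Item.child]
  have hst₃ : σ₃.nat 9 t = σ.nat 27 0 := by simp [hσ₃, b26, ← ht, b27]
  have c25 : σ₃.nat 25 = σ.nat 25 := by rw [e₃.n 25, b25]
  have c26 : σ₃.nat 26 = σ.nat 26 := by rw [e₃.n 26, b26]
  have c27 : σ₃.nat 27 = σ.nat 27 := by rw [e₃.n 27, b27]
  have c32 : σ₃.nat 32 0 = 0 := by simp [hσ₃]
  have c34 : σ₃.real 34 0 = it.size / 2 := by rw [e₃.r 34, b34]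
  have hit₃ : Stored σ₃ (σ.nat 25 0) it := hk₃.stored hlt hit
  clear hσ₃
  clear_value σ₃
  clear e₁ e₂ e₃ hbit hP₁ hP₂ hcor hcor' hk₂
  -- the filter
  set P : Fin n → Bool := fun i => decide (Relevant δ (p i) it'.corner (it.size / 2)) with hPdef
  have hpts : it'.pts = it.pts.filter P := rfl
  refine .seq (3 + (it.pts.length + 1) * (filterCmd.bnd K + 13)) (childTailCmd.bnd K) (by omega) ?_
  refine .forLoop it.pts.length (filterCmd.bnd K) (fun k σ' =>
    σ'.nat 32 0 = ((it.pts.take k).filter P).length ∧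
    (∀ l, ∀ hl : l < ((it.pts.take k).filter P).length,
      σ'.nat 8 (σ.nat 27 0 + l) = ((it.pts.take k).filter P)[l]) ∧
    (∀ i < σ.nat 27 0, σ'.nat 8 i = σ₃.nat 8 i)) (by simp [NExp.time]) (by decide) ?_ (by simp [c32])
    (by simp) ?_ ?_
  · intro σ' h'
    simp [NExp.val, h'.n 25, c25, h'.n 10, hit₃.cnt]
  · rintro k hk σ' h' ⟨h1, h2, h3⟩ hi
    have hP' := hP₃.eqv h'
    refine (within_filterCmd (i := it.pts[k]) (a := it'.corner) (s := it.size / 2) hK hP'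
      ?_ ?_ ?_).imp ?_
    · rw [h'.n 9, h'.n 25, c25, hi, h3 _ ?_, hit₃.pts k hk]
      have := hit₃.top
      rw [c27] at this
      omega
    · rw [h'.r 19, h'.n 26, c26, ← ht]; exact hcor₃
    · rw [h'.r 34, c34]
    rintro σ'' e'' ⟨h4, h5, h6⟩
    rw [h'.n 27, c27, h1] at h5 h6
    have htake : (it.pts.take (k + 1)).filter P =
        (it.pts.take k).filter P ++ if P it.pts[k] then [it.pts[k]] else [] := by
      rw [List.take_add_one, List.getElem?_eq_getElem hk, List.filter_append]
      simp [List.filter_cons]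
    rw [htake]
    by_cases hr : Relevant δ (p it.pts[k]) it'.corner (it.size / 2)
    · have hP1 : P it.pts[k] = true := by simpa [P] using hr
      simp only [hP1, if_true]
      refine ⟨?_, ?_, ?_⟩
      · rw [h4, h1, if_pos hr, List.length_append, List.length_singleton]
      · intro l hl
        rw [List.length_append, List.length_singleton] at hl
        by_cases hl' : l = ((it.pts.take k).filter P).length
        · subst hl'
          rw [h6 hr]; simp
        · have hlt' : l < ((it.pts.take k).filter P).length := by omega
          rw [h5 _ (by omega), h2 l hlt', List.getElem_append_left hlt']
      · intro i hi'
        rw [h5 _ (by omega), h3 i hi']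
    · have hP1 : P it.pts[k] = false := by simpa [P] using hr
      simp only [hP1, Bool.false_eq_true, if_false, List.append_nil]
      rw [if_neg hr, h1] at h4
      refine ⟨h4, ?_, ?_⟩
      · intro l hl
        rw [h5 _ (by omega), h2 l hl]
      · intro i hi'
        rw [h5 _ (by omega), h3 i hi']
  rintro σ₄ e₄ ⟨h1, h2, h3⟩
  rw [List.take_length, ← hpts] at h1 h2
  change Within S f K childTailCmd σ₄ _
  refine .seq (.setNat (.seq (.setNat (.setNat ?_))))
  simp only [NExp.val]
  set σ₅ := ((σ₄.setNat 10 (σ₄.nat 26 0) (σ₄.nat 32 0)).setNat 27 0 _).setNat 26 0 _ with hσ₅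
  have e₅ : Eqv [10, 27, 26] [] σ₄ σ₅ := by
    refine (((eqv_setNat _ _ _ _).mono ?_ ?_).trans ((eqv_setNat _ _ _ _).mono ?_ ?_)).trans
      ((eqv_setNat _ _ _ _).mono ?_ ?_) <;> simp
  have d26 : σ₄.nat 26 = σ.nat 26 := by rw [e₄.n 26, c26]
  have d27 : σ₄.nat 27 = σ.nat 27 := by rw [e₄.n 27, c27]
  have f27 : σ₅.nat 27 0 = σ.nat 27 0 + it'.pts.length := by simp [hσ₅, d27, h1]
  refine ⟨⟨?_, ?_, ?_, ?_, ?_, ?_⟩, by simp [hσ₅, d26, ht], hk₃.trans ⟨?_, ?_, ?_, ?_, ?_, ?_, ?_⟩⟩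
  · rw [e₅.r 19, e₄.r 19]; exact hcor₃
  · rw [e₅.r 20, e₄.r 20]; exact hsize₃
  · rw [e₅.n 11, e₄.n 11]; exact hdep₃
  · simp [hσ₅, d26, ← ht, h1]
  · rw [e₅.n 9, e₅.n 8, e₄.n 9, hst₃]; exact h2
  · rw [e₅.n 9, e₄.n 9, hst₃, f27]
  · intro i _; rw [e₅.r 19, e₄.r 19]
  · intro i _; rw [e₅.r 20, e₄.r 20]
  · intro i _; rw [e₅.n 9, e₄.n 9]
  · intro i hi; simp [hσ₅, d26, ← ht, hi.ne, e₄.n 10]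
  · intro i _; rw [e₅.n 11, e₄.n 11]
  · intro i hi; rw [e₅.n 8, h3 i (by rwa [c27] at hi)]
  · rw [f27, c27]; omega

end PointSimplex

namespace PointSimplex

/-! ## Subdivision of one simplex -/

/-- A part of a simplex: the index of the simplex, a cube, and the volume. -/
structure Piece (d : ℕ) where
  idx : ℕ
  corner : Fin d → ℝ
  size : ℝ
  weight : ℝ

section abstract
variable {d n : ℕ}

/-- The cube of an item. -/
def Item.box (it : Item d n) : Set (E d) := PointSimplex.box it.corner it.size

def Piece.box (e : Piece d) : Set (E d) := PointSimplex.box e.corner e.size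

/-- The cube is small, or distances from the points vary little on it. -/
def Fine (δ r : ℝ) (p : Fin n → E d) (a : Fin d → ℝ) (s : ℝ) : Prop :=
  0 < s ∧ (s ≤ r ∨ ∀ i, ∀ x ∈ box a s, ∀ y ∈ box a s, dist (p i) x ≤ (1 + δ) * dist (p i) y)

/-- The depth suffices to reach size `r`, and points that are not listed are far away. -/
structure Item.Sound (it : Item d n) (δ r : ℝ) (p : Fin n → E d) : Prop where
  pos : 0 < it.size
  size : it.size ≤ 2 ^ it.depth * r
  far : ∀ i ∉ it.pts, ∀ x ∈ it.box, ∀ y ∈ it.box, dist (p i) x ≤ (1 + δ) * dist (p i) y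

/-- Work needed for an item: `α` for each cell and `γ` for each listed point. -/
def Item.work (it : Item d n) (δ : ℝ) (p : Fin n → E d) (α γ : ℕ) : ℕ :=
  α + γ * (it.pts.map fun i => treeCount δ (p i) it.depth it.corner it.size).sum

open Classical in
/-- The pieces that come from a cell that is not subdivided. -/
def Item.emit (it : Item d n) (j : ℕ) (T : Set (E d)) : List (Piece d) :=
  if 0 < volume.real (T ∩ it.box) then [⟨j, it.corner, it.size, volume.real (T ∩ it.box)⟩] else []

/-- The items pending and the pieces produced cover the simplex `T`. -/
structure Covers (j : ℕ) (T : Set (E d)) (δ r : ℝ) (p : Fin n → E d) (qs : List (Item d n))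
    (es : List (Piece d)) : Prop where
  cover : ∀ᵐ x ∂volume.restrict T, (qs.map fun it => it.box.indicator (1 : E d → ℝ) x).sum +
    (es.map fun e => e.box.indicator (1 : E d → ℝ) x).sum = 1
  sound : ∀ it ∈ qs, it.Sound δ r p
  piece : ∀ e ∈ es, e.idx = j ∧ e.weight = volume.real (T ∩ e.box) ∧ 0 < e.weight ∧
    Fine δ r p e.corner e.size

theorem box_child_subset (a : Fin d → ℝ) {s : ℝ} (hs : 0 < s) (h : ℕ) :
    box (childCorner a s h) (s / 2) ⊆ box a s := by
  intro x hx c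
  have := hx c
  simp only [childCorner] at this
  simp only
  split_ifs at this <;> constructor <;> linarith

variable {j : ℕ} {T : Set (E d)} {δ r : ℝ} {p : Fin n → E d} {it : Item d n}
  {qs : List (Item d n)} {es : List (Piece d)}

theorem Item.Sound.child (h : it.Sound δ r p) (hδ : 0 < δ) (hδ1 : δ ≤ 1) (hd : 0 < it.depth)
    (k : ℕ) : (it.child δ p k).Sound δ r p where
  pos := half_pos h.pos
  size := by
    have h1 := h.size
    obtain ⟨e, he⟩ : ∃ e, it.depth = e + 1 := ⟨it.depth - 1, by omega⟩
    rw [he, pow_succ] at h1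
    simp only [Item.child, he, Nat.add_sub_cancel]
    linarith
  far := by
    intro i hi x hx y hy
    simp only [Item.child, List.mem_filter, decide_eq_true_eq, not_and] at hi
    by_cases hm : i ∈ it.pts
    · exact dist_le_of_not_relevant hδ hδ1 (half_pos h.pos) (hi hm) hx hy
    · exact h.far i hm x (box_child_subset _ h.pos _ hx) y (box_child_subset _ h.pos _ hy)

theorem sum_map_range (g : ℕ → ℝ) (N : ℕ) : ((List.range N).map g).sum = ∑ k ∈ Finset.range N, g k := by
  induction N with
  | zero => simp
  | succ N ih => rw [List.range_succ, List.map_append, List.sum_append, ih, Finset.sum_range_succ]; simp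

theorem Covers.expand (h : Covers j T δ r p (it :: qs) es) (hδ : 0 < δ) (hδ1 : δ ≤ 1)
    (hd : 0 < it.depth) :
    Covers j T δ r p (qs ++ (List.range (2 ^ d)).map (it.child δ p)) es where
  cover := by
    filter_upwards [h.cover] with x hx
    rw [List.map_append, List.sum_append, List.map_map, sum_map_range]
    have := sum_indicator_child it.corner (h.sound it (by simp)).pos x
    rw [List.map_cons, List.sum_cons] at hx
    change (qs.map _).sum + ∑ k ∈ Finset.range (2 ^ d),
      (box (childCorner it.corner it.size k) (it.size / 2)).indicator (1 : E d → ℝ) x + _ = 1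
    rw [this]
    rw [← hx, add_comm (List.sum _) (Set.indicator _ _ _)]
    rfl
  sound := by
    intro it' hit'
    rw [List.mem_append, List.mem_map] at hit'
    rcases hit' with h1 | ⟨k, -, rfl⟩
    · exact h.sound it' (by simp [h1])
    · exact (h.sound it (by simp)).child hδ hδ1 hd k
  piece := h.piece

/-- Depth zero means that the cube is small, and an empty list means that all points are far away;
either makes it fine. Cubes that meet the simplex in a null set are dropped, so all weights in the
table are positive. -/
theorem Covers.emit (h : Covers j T δ r p (it :: qs) es) (hT : volume T ≠ ⊤)
    (hd : it.depth = 0 ∨ it.pts = []) : Covers j T δ r p qs (es ++ it.emit j T) where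
  cover := by
    classical
    by_cases hv : 0 < volume.real (T ∩ it.box)
    · filter_upwards [h.cover] with x hx
      rw [Item.emit, if_pos hv, List.map_append, List.sum_append, ← hx, List.map_cons, List.sum_cons]
      simp only [List.map_cons, List.map_nil, List.sum_cons, List.sum_nil, add_zero]
      change _ + (_ + it.box.indicator 1 x) = _
      ring
    · have h0 : volume.restrict T it.box = 0 := by
        rw [Measure.restrict_apply (show MeasurableSet it.box from measurableSet_box _ _), Set.inter_comm]
        have : volume.real (T ∩ it.box) = 0 := le_antisymm (not_lt.1 hv) measureReal_nonneg
        rwa [measureReal_eq_zero_iff (measure_ne_top_of_subset Set.inter_subset_left hT)] at this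
      filter_upwards [h.cover, measure_eq_zero_iff_ae_notMem.1 h0] with x hx hx'
      rw [Item.emit, if_neg hv, List.append_nil, ← hx, List.map_cons, List.sum_cons,
        Set.indicator_of_notMem hx', zero_add]
  sound it' hit' := h.sound it' (by simp [hit'])
  piece := by
    intro e he
    rw [List.mem_append] at he
    rcases he with he | he
    · exact h.piece e he
    · rw [Item.emit] at he
      split_ifs at he with hv
      · rw [List.mem_singleton] at he
        subst he
        have hs := h.sound it (by simp)
        refine ⟨rfl, rfl, hv, hs.pos, ?_⟩
        rcases hd with hd | hd
        · left; simpa [hd] using hs.size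
        · right
          intro i x hx y hy
          exact hs.far i (by simp [hd]) x hx y hy
      · simp at he

/-- The balance of the amortised analysis. Of the tree count of a listed point, the root accounts
for the `γ` spent on it now, and the rest passes to the children where it stays relevant. The fixed
costs of the `2 ^ d` children are new and must be paid out of `γ`, which is possible when the list
is nonempty. -/
theorem work_expand (α γ : ℕ) (hd : 0 < it.depth) : it.work δ p α γ + 2 ^ d * α =
    α + γ * it.pts.length +
      (((List.range (2 ^ d)).map (it.child δ p)).map fun it' => it'.work δ p α γ).sum := by
  classical
  obtain ⟨e, he⟩ : ∃ e, it.depth = e + 1 := ⟨it.depth - 1, by omega⟩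
  have hfil : ∀ (q : Fin n → Prop) [DecidablePred q] (g : Fin n → ℕ) (l : List (Fin n)),
      ((l.filter fun i => decide (q i)).map g).sum = (l.map fun i => if q i then g i else 0).sum := by
    intro q _ g l
    induction l with
    | nil => rfl
    | cons a l ih =>
      by_cases ha : q a
      · simp [ha, ih]
      · simp [ha, ih]
  have hchild : ∀ k, (it.child δ p k).work δ p α γ = α + γ * (it.pts.map fun i =>
      if Relevant δ (p i) (childCorner it.corner it.size k) (it.size / 2) then
        treeCount δ (p i) e (childCorner it.corner it.size k) (it.size / 2) else 0).sum := by
    intro k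
    rw [Item.work]
    simp only [Item.child, he, Nat.add_sub_cancel]
    rw [hfil]
  have hrange : ∀ (g : ℕ → ℕ) N, ((List.range N).map g).sum = ∑ k ∈ Finset.range N, g k := by
    intro g N
    induction N with
    | zero => simp
    | succ N ih => rw [List.range_succ, List.map_append, List.sum_append, ih, Finset.sum_range_succ]; simp
  rw [List.map_map, hrange]
  simp only [Function.comp_apply, hchild]
  rw [Finset.sum_add_distrib, Finset.sum_const, Finset.card_range, smul_eq_mul, ← Finset.mul_sum]
  rw [Item.work, he]
  simp only [treeCount]
  have hswap : ∀ (l : List (Fin n)) (F : Fin n → ℕ → ℕ),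
      (l.map fun i => 1 + ∑ k ∈ Finset.range (2 ^ d), F i k).sum =
        l.length + ∑ k ∈ Finset.range (2 ^ d), (l.map fun i => F i k).sum := by
    intro l F
    induction l with
    | nil => simp
    | cons a l ih =>
      simp only [List.map_cons, List.sum_cons, ih, List.length_cons, Finset.sum_add_distrib]
      ring
  rw [hswap]
  ring

end abstract

end PointSimplex

namespace PointSimplex

/-! ### Processing the queue on the RAM -/

/-- The output tables hold the pieces `es`. -/
structure PiecesIn {d : ℕ} (σ : Mem) (es : List (Piece d)) : Prop where
  num : σ.nat 28 0 = es.length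
  idx : ∀ q, ∀ h : q < es.length, σ.nat 2 q = es[q].idx
  corner : ∀ q, ∀ h : q < es.length, ∀ c : Fin d, σ.real 4 (q * d + c) = es[q].corner c
  size : ∀ q, ∀ h : q < es.length, σ.real 5 q = es[q].size
  weight : ∀ q, ∀ h : q < es.length, σ.real 7 q = es[q].weight

theorem PiecesIn.eqv {d : ℕ} {σ σ' : Mem} {es : List (Piece d)} {ln lr : List ℕ}
    (h : PiecesIn σ es) (e : Eqv ln lr σ σ') (hn : 28 ∉ ln ∧ 2 ∉ ln := by decide)
    (hr : 4 ∉ lr ∧ 5 ∉ lr ∧ 7 ∉ lr := by decide) : PiecesIn σ' es where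
  num := by rw [e.n 28 hn.1]; exact h.num
  idx := by rw [e.n 2 hn.2]; exact h.idx
  corner := by rw [e.r 4 hr.1]; exact h.corner
  size := by rw [e.r 5 hr.2.1]; exact h.size
  weight := by rw [e.r 7 hr.2.2]; exact h.weight

/-- The queue holds the items `qs`. -/
structure QueueIn {d n : ℕ} (σ : Mem) (qs : List (Item d n)) : Prop where
  tail : σ.nat 26 0 = σ.nat 25 0 + qs.length
  item : ∀ i, ∀ h : i < qs.length, Stored σ (σ.nat 25 0 + i) qs[i]

/-- Append the part of simplex `nv 24` in the cube `real 29`, `rv 30` to the table of pieces. -/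
def emitCmd : Cmd :=
  .seq cellVolCmd <|
  .ite (.realLe (rv 32) (.lit 0)) .skip <|
  .seq (fillCmd .skip 4 13 dimE (.add (.mul (nv 28) dimE) (nv 13)) (.get 29 (nv 13))) <|
  .seq (.setReal 5 (nv 28) (rv 30)) <|
  .seq (.setReal 7 (nv 28) (rv 32)) <|
  .seq (.setNat 2 (nv 28) (nv 24)) (.setNat 28 (.lit 0) (.add (nv 28) (.lit 1)))

def expandCmd : Cmd :=
  .seq (.setNat 12 (.lit 0) dimE) <|
  .seq (.setReal 34 (.lit 0) (.div (rv 30) (.lit 2))) (forCmd 17 (.get 5 dimE) childCmd)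

def loadCmd : Cmd :=
  .seq (fillCmd .skip 29 13 dimE (nv 13) (.get 19 (.add (.mul (nv 25) dimE) (nv 13))))
    (.setReal 30 (.lit 0) (.get 20 (nv 25)))

/-- Process the first cell of the queue. -/
def visitCmd : Cmd :=
  .seq loadCmd <|
  .seq (.ite (.and (.natLt (.lit 0) (.get 11 (nv 25))) (.natLt (.lit 0) (.get 10 (nv 25))))
    expandCmd emitCmd) (.setNat 25 (.lit 0) (.add (nv 25) (.lit 1)))

/-- Process the queue. -/
def queueCmd : Cmd := .loop (.natLt (nv 25) (nv 26)) visitCmd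

def expandTime (K cnt d : ℕ) : ℕ := 20 + (2 ^ d + 1) * (childTime K cnt + 14)

variable {d n : ℕ} {S : Solver d} {f : ℕ → ℕ} {σ : Mem} {p : Fin n → E d} {δ : ℝ}
  {j : ℕ} {T : Affine.Simplex ℝ (E d) d}

theorem le_loopBound (d : ℕ) : d ≤ loopBound d ∧ 3 * d + 1 ≤ loopBound d ∧ 2 ^ d ≤ loopBound d := by
  have h1 := (3 * d + 1).lt_two_pow_self
  have h2 : 2 ^ d ≤ 2 ^ (3 * d + 1) := Nat.pow_le_pow_right two_pos (by omega)
  have h3 : 2 ^ (3 * d + 1) * 1 ≤ 2 ^ (3 * d + 1) * (d * d + (3 * d + 1) * (3 * d + 1)) :=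
    Nat.mul_le_mul_left _ (by nlinarith)
  rw [loopBound]
  omega

theorem within_emitCmd (hd : 0 < d) (hT : SimplexIn σ j T) {it : Item d n}
    (hc : ∀ c : Fin d, σ.real 29 c = it.corner c) (hs : σ.real 30 0 = it.size)
    {es : List (Piece d)} (hes : PiecesIn σ es) :
    Within S f (loopBound d) emitCmd σ fun σ' => PiecesIn σ' (es ++ it.emit j (solid T)) := by
  refine .seq ((within_cellVolCmd hd hT).imp ?_)
  intro σ₁ e₁ hv
  have hbox : cube (WithLp.toLp 2 fun c : Fin d => σ.real 29 c) (σ.real 30 0) = it.box := by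
    rw [Item.box, box, hs]
    congr 2
    exact funext hc
  rw [hbox] at hv
  have hes₁ := hes.eqv e₁
  refine .ite (fun hb => .skip ?_) (fun hb => ?_) <;>
    simp only [Test.Holds, RExp.val, NExp.val, hv, Nat.cast_zero, not_le] at hb
  · rwa [Item.emit, if_neg (not_lt.2 hb), List.append_nil]
  rw [Item.emit, if_pos hb]
  have hT₁ := hT.eqv e₁
  have h28 := hes₁.num
  refine .seq (.fill d (fun c => es.length * d + c) it.corner (le_loopBound d).1 (by decide)
    (by decide) ?_ ?_ ?_ ?_)
  · intro σ' h; simp [NExp.val, (hT₁.eqv h).dim]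
  · intro a b hab; exact Fin.ext (by simpa using hab)
  · intro c σ' h' hc'
    refine .skip ⟨?_, ?_⟩
    · simp [NExp.val, hc', (hT₁.eqv h').dim, h'.n 28, h28]
    · simp only [RExp.val, NExp.val, hc', h'.r 29, e₁.r 29, hc]
  intro σ₂ e₂ hcor hcor'
  refine .seq (.setReal (.seq (.setReal (.seq (.setNat (.setNat ?_))))))
  have a28 : σ₂.nat 28 0 = es.length := by rw [e₂.n 28, h28]
  have a30 : σ₂.real 30 0 = it.size := by rw [e₂.r 30, e₁.r 30, hs]
  have a32 : σ₂.real 32 0 = volume.real (solid T ∩ it.box) := by rw [e₂.r 32, hv]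
  have a24 : σ₂.nat 24 0 = j := by rw [e₂.n 24, hT₁.idx]
  have hsplit : ∀ {q}, q < (es ++ [(⟨j, it.corner, it.size, volume.real (solid T ∩ it.box)⟩ : Piece d)]).length →
      q = es.length ∨ ∃ h : q < es.length, True := by
    intro q hq
    rw [List.length_append, List.length_singleton] at hq
    rcases Nat.lt_succ_iff_lt_or_eq.1 hq with h | h
    · exact .inr ⟨h, trivial⟩
    · exact .inl h
  refine ⟨?_, ?_, ?_, ?_, ?_⟩
  · simp [NExp.val, a28]
  · intro q hq
    rcases hsplit hq with rfl | ⟨h, -⟩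
    · simp [NExp.val, a28, a24]
    · simp [NExp.val, a28, h.ne, List.getElem_append_left h, e₂.n 2, hes₁.idx q h]
  · intro q hq c
    rcases hsplit hq with rfl | ⟨h, -⟩
    · simp [hcor c]
    · have hne : ∀ k : Fin d, es.length * d + k ≠ q * d + c := fun k hk => by
        have := (index_inj k.2 c.2 hk).1
        omega
      simp [List.getElem_append_left h, hcor' _ hne, hes₁.corner q h c]
  · intro q hq
    rcases hsplit hq with rfl | ⟨h, -⟩
    · simp [NExp.val, RExp.val, a28, a30]
    · simp [NExp.val, RExp.val, a28, h.ne, List.getElem_append_left h, e₂.r 5, hes₁.size q h]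
  · intro q hq
    rcases hsplit hq with rfl | ⟨h, -⟩
    · simp [NExp.val, RExp.val, a28, a32]
    · simp [NExp.val, RExp.val, a28, h.ne, List.getElem_append_left h, e₂.r 7, hes₁.weight q h]

theorem runs_expandCmd (hP : PointsIn σ p δ) {it : Item d n} {qs : List (Item d n)}
    (hq : QueueIn σ (it :: qs))
    (hc : ∀ c : Fin d, σ.real 29 c = it.corner c) (hs : σ.real 30 0 = it.size) :
    Runs S f expandCmd σ (expandTime (loopBound d) it.pts.length d) fun σ' =>
      QueueIn σ' ((it :: qs) ++ (List.range (2 ^ d)).map (it.child δ p)) ∧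
      σ'.nat 25 = σ.nat 25 := by
  obtain ⟨hK, -, hK2⟩ := le_loopBound d
  refine .seq 5 (15 + (2 ^ d + 1) * (childTime (loopBound d) it.pts.length + 14))
    (by rw [expandTime]; omega) (.setNat (by simp [NExp.time]) ?_)
  have e₁ := eqv_setNat σ 12 0 d
  have h12 : (σ.setNat 12 0 d).nat 12 0 = d := by simp
  simp only [NExp.val, hP.dim]
  generalize σ.setNat 12 0 d = σ₁ at *
  refine .seq 6 (3 + (2 ^ d + 1) * (childTime (loopBound d) it.pts.length + 14))
    (by omega) (.setReal (by simp [NExp.time, RExp.time]) ?_)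
  have e₂ := eqv_setReal σ₁ 34 0 (it.size / 2)
  have h34 : (σ₁.setReal 34 0 (it.size / 2)).real 34 0 = it.size / 2 := by simp
  simp only [NExp.val, RExp.val, e₁.r 30, hs, Nat.cast_ofNat]
  generalize σ₁.setReal 34 0 (it.size / 2) = σ₂ at *
  have hP₂ := (hP.eqv e₁).eqv e₂
  have hk₂ : Keeps d (σ.nat 26 0) σ σ₂ := (Keeps.of_eqv e₁).trans (Keeps.of_eqv e₂)
  have h25 : σ₂.nat 25 = σ.nat 25 := by rw [e₂.n 25, e₁.n 25]
  have h26 : σ₂.nat 26 = σ.nat 26 := by rw [e₂.n 26, e₁.n 26]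
  have htail := hq.tail
  rw [List.length_cons] at htail
  set t := σ.nat 26 0 with ht
  refine .forLoop (2 ^ d) (childTime (loopBound d) it.pts.length) (fun k σ' =>
    Keeps d t σ σ' ∧ σ'.nat 26 0 = t + k ∧
    ∀ i < k, Stored σ' (t + i) (it.child δ p i)) (by simp [NExp.time]) (by decide) ?_
    ⟨hk₂, by simp [h26, ht], by simp⟩ ?_ ?_ ?_
  · intro σ' h; simp [NExp.val, (hP₂.eqv h).dim, (hP₂.eqv h).pow d (by omega)]
  · rintro k σ' v ⟨h1, h2, h3⟩
    have hk : ∀ t, Keeps d t σ' (σ'.setNat 17 0 v) := fun t => Keeps.of_eqv (eqv_setNat _ _ _ _)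
    exact ⟨h1.trans (hk _), by simpa using h2, fun i hi =>
      (hk (t + i + 1)).stored (by omega) (h3 i hi)⟩
  · rintro k hk σ' h ⟨h1, h2, h3⟩ hi
    have hP' := hP₂.eqv h
    have g25 : σ'.nat 25 = σ.nat 25 := by rw [h.n 25, h25]
    have hit : Stored σ' (σ'.nat 25 0) it := by
      rw [g25]
      exact h1.stored (by omega) (hq.item 0 (by simp))
    refine (runs_childCmd (it := it) (h := k) hK hP' hit (by rw [g25, h2]; omega) ?_ ?_ ?_ hi hk).mono
      le_rfl ?_
    · rw [h.r 29, e₂.r 29, e₁.r 29]; exact hc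
    · rw [h.r 34, h34]
    · rw [h.n 12, e₂.n 12, h12]
    rintro σ'' ⟨g1, g2, g3⟩
    rw [h2] at g1 g2 g3
    refine ⟨h1.trans (g3.mono (by omega)), by omega, fun i hi' => ?_⟩
    rcases Nat.lt_succ_iff_lt_or_eq.1 hi' with hi' | rfl
    · exact g3.stored (by omega) (h3 i hi')
    · exact g1
  · rintro σ' h ⟨h1, h2, h3⟩
    have g25 : σ'.nat 25 = σ.nat 25 := by rw [h.n 25, h25]
    refine ⟨⟨?_, ?_⟩, g25⟩
    · rw [h2, g25, htail]; simp; omega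
    · intro i hi
      rw [List.length_append, List.length_map, List.length_range] at hi
      rw [g25]
      by_cases hi' : i < (it :: qs).length
      · rw [List.getElem_append_left hi']
        rw [List.length_cons] at hi'
        exact h1.stored (by omega) (hq.item i (by simpa using hi'))
      · rw [List.getElem_append_right (by omega), List.getElem_map, List.getElem_range]
        have := h3 (i - (it :: qs).length) (by omega)
        rw [htail] at this
        rw [List.length_cons] at this hi' ⊢
        rwa [show σ.nat 25 0 + (qs.length + 1) + (i - (qs.length + 1)) = σ.nat 25 0 + i by omega] at this

/-- Time for a cell that is not subdivided. -/
def emitTime (d : ℕ) : ℕ := loadCmd.bnd (loopBound d) + emitCmd.bnd (loopBound d) + 30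

/-- Time per listed point for a cell that is subdivided. -/
def listTime (d : ℕ) : ℕ :=
  2 ^ d * emitTime d + loadCmd.bnd (loopBound d) + 2 * expandTime (loopBound d) 1 d + 30

/-- The total work of the queued items is the remaining time. The same potential with `α = 1` and `γ
= 2 ^ d` bounds the number of pieces, since an item emits at most one piece and an expansion creates
`2 ^ d` items. -/
theorem runs_queueCmd (hd : 0 < d) (hδ : 0 < δ) (hδ1 : δ ≤ 1) (hP : PointsIn σ p δ)
    (hT : SimplexIn σ j T) {r : ℝ} {it₀ : Item d n} {es₀ : List (Piece d)} (hq : QueueIn σ [it₀])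
    (hes : PiecesIn σ es₀) (hcov : Covers j (solid T) δ r p [it₀] []) :
    Runs S f queueCmd σ (it₀.work δ p (emitTime d) (listTime d) + 10) fun σ' =>
      ∃ es, PiecesIn σ' (es₀ ++ es) ∧ Covers j (solid T) δ r p ([] : List (Item d n)) es ∧
        es.length ≤ it₀.work δ p 1 (2 ^ d) := by
  obtain ⟨hK, -, hK2⟩ := le_loopBound d
  refine .loopTime (fun φ σ' => ∃ (qs : List (Item d n)) (es : List (Piece d)), QueueIn σ' qs ∧
    PiecesIn σ' (es₀ ++ es) ∧ Covers j (solid T) δ r p qs es ∧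
    es.length + (qs.map fun it => it.work δ p 1 (2 ^ d)).sum ≤ it₀.work δ p 1 (2 ^ d) ∧
    (qs.map fun it => it.work δ p (emitTime d) (listTime d)).sum = φ)
    (it₀.work δ p (emitTime d) (listTime d)) (by simp [Test.time, NExp.time])
    ⟨[it₀], [], hq, by simpa using hes, hcov, by simp, by simp⟩ ?_ ?_
  · rintro φ σ' h ⟨qs, es, hq, hes, hcov, hcnt, hφ⟩ hb
    simp only [Test.Holds, NExp.val] at hb
    have hP' := hP.eqv h
    have hT' := hT.eqv h
    obtain ⟨it, qs, rfl⟩ : ∃ it qs', qs = it :: qs' := by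
      cases qs with
      | nil => have := hq.tail; simp at this; omega
      | cons it qs => exact ⟨it, qs, rfl⟩
    have hit : Stored σ' (σ'.nat 25 0) it := hq.item 0 (by simp)
    have hload : Within S f (loopBound d) loadCmd σ' fun σ'' =>
        (∀ c : Fin d, σ''.real 29 c = it.corner c) ∧ σ''.real 30 0 = it.size := by
      refine .seq (.fill d (fun c => c) it.corner hK (by decide) (by decide) ?_ Fin.val_injective ?_ ?_)
      · intro σ'' h; simp [NExp.val, (hP'.eqv h).dim]
      · intro c σ'' h' hc
        refine .skip ⟨by simp [NExp.val, hc], ?_⟩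
        simp only [RExp.val, NExp.val, hc, h'.r 19, h'.n 25, (hP'.eqv h').dim, hit.corner]
      intro σ₁ e₁ hc _
      refine .setReal ⟨by simpa using hc, ?_⟩
      simp [NExp.val, RExp.val, e₁.n 25, e₁.r 20, hit.size]
    rw [List.map_cons, List.sum_cons] at hcnt hφ
    by_cases hex : 0 < it.depth ∧ it.pts ≠ []
    · have hlen : 1 ≤ it.pts.length := List.length_pos_of_ne_nil hex.2
      set chs := (List.range (2 ^ d)).map (it.child δ p) with hchs
      have hlch : chs.length = 2 ^ d := by simp [hchs]
      refine ⟨loadCmd.bnd (loopBound d) + (expandTime (loopBound d) it.pts.length d + 18),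
        ((qs ++ chs).map fun it => it.work δ p (emitTime d) (listTime d)).sum, ?_, ?_⟩
      · have hw := work_expand (δ := δ) (p := p) (emitTime d) (listTime d) hex.1
        rw [← hchs] at hw
        rw [List.map_append, List.sum_append, ← hφ]
        -- The time is affine in the length of the list, and the length is at least one, so it is at
        -- most proportional to the length. This is why `listTime` contains `2 * expandTime
        -- (loopBound d) 1 d`.
        have h1 : expandTime (loopBound d) it.pts.length d ≤ 2 * expandTime (loopBound d) 1 d * it.pts.length := by
          have hc : childTime (loopBound d) it.pts.length + 14 ≤
              2 * it.pts.length * (childTime (loopBound d) 1 + 14) := by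
            simp only [childTime]
            nlinarith [Nat.zero_le (filterCmd.bnd (loopBound d)), Nat.zero_le (childHeadCmd.bnd (loopBound d)),
              Nat.zero_le (childTailCmd.bnd (loopBound d)),
              Nat.mul_le_mul_left (childHeadCmd.bnd (loopBound d) + childTailCmd.bnd (loopBound d)) hlen,
              Nat.mul_le_mul_left (filterCmd.bnd (loopBound d) ) hlen]
          have := Nat.mul_le_mul_left (2 ^ d + 1) hc
          simp only [expandTime]
          nlinarith
        have h2 : 2 ^ d * emitTime d ≤ 2 ^ d * emitTime d * it.pts.length := Nat.le_mul_of_pos_right _ hlen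
        have h3 : loadCmd.bnd (loopBound d) ≤ loadCmd.bnd (loopBound d) * it.pts.length :=
          Nat.le_mul_of_pos_right _ hlen
        have h4 : listTime d * it.pts.length = 2 ^ d * emitTime d * it.pts.length +
          loadCmd.bnd (loopBound d) * it.pts.length +
          2 * expandTime (loopBound d) 1 d * it.pts.length + 30 * it.pts.length := by
          rw [listTime]; ring
        simp only [Test.time, NExp.time]
        omega
      · refine .seq _ (expandTime (loopBound d) it.pts.length d + 18) le_rfl (Runs.imp hload le_rfl ?_)
        rintro σ₁ e₁ ⟨hc, hs⟩
        have hk₁ : ∀ t, Keeps d t σ' σ₁ := fun t => Keeps.of_eqv e₁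
        have hq₁ : QueueIn σ₁ (it :: qs) := ⟨by rw [e₁.n 26, e₁.n 25]; exact hq.tail, fun i hi => by
          rw [e₁.n 25]; exact (hk₁ (σ'.nat 25 0 + i + 1)).stored (by omega) (hq.item i hi)⟩
        have hit₁ : Stored σ₁ (σ₁.nat 25 0) it := hq₁.item 0 (by simp)
        refine .seq (expandTime (loopBound d) it.pts.length d + 12) 6 (by omega)
          (.ite (expandTime (loopBound d) it.pts.length d) (by simp [Test.time, NExp.time]; omega) (fun _ => ?_) (fun hb => ?_))
        · refine (runs_expandCmd (hP'.eqv e₁) hq₁ hc hs).imp le_rfl ?_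
          rintro σ₂ e₂ ⟨hq₂, h25⟩
          refine .setNat (by simp [NExp.time]) ?_
          have hk₃ : ∀ t, Keeps d t σ₂ (σ₂.setNat 25 0 (σ₂.nat 25 0 + 1)) := fun t =>
            Keeps.of_eqv (eqv_setNat _ _ _ _)
          refine ⟨qs ++ chs, es, ⟨?_, ?_⟩, ?_, hcov.expand hδ hδ1 hex.1, ?_, rfl⟩
          · have := hq₂.tail
            simp only [NExp.val, Mem.setNat_nat] at this ⊢
            simp only [List.cons_append, List.length_cons, ← hchs] at this
            simp
            rw [List.length_append] at this
            omega
          · intro i hi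
            have := hq₂.item (i + 1) (by simpa [hlch] using hi)
            simp only [List.cons_append, List.getElem_cons_succ] at this
            have h3 := (hk₃ (σ₂.nat 25 0 + (i + 1) + 1)).stored (by omega) this
            simp only [NExp.val, Mem.setNat_nat, and_self, if_true]
            rwa [show σ₂.nat 25 0 + 1 + i = σ₂.nat 25 0 + (i + 1) by omega]
          · exact ((hes.eqv e₁).eqv e₂).eqv (eqv_setNat _ _ _ _)
          · have hw := work_expand (δ := δ) (p := p) 1 (2 ^ d) hex.1
            rw [← hchs] at hw
            rw [List.map_append, List.sum_append]
            have : 2 ^ d * 1 ≤ 2 ^ d * it.pts.length := Nat.mul_le_mul_left _ hlen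
            omega
        · exfalso
          apply hb
          simp only [Test.Holds, NExp.val, hit₁.depth, hit₁.cnt]
          exact ⟨hex.1, hlen⟩
    · have hex' : it.depth = 0 ∨ it.pts = [] := by
        rw [not_and_or, not_not] at hex
        exact hex.imp (by omega) id
      refine ⟨loadCmd.bnd (loopBound d) + (emitCmd.bnd (loopBound d) + 18),
        (qs.map fun it => it.work δ p (emitTime d) (listTime d)).sum, ?_, ?_⟩
      · rw [← hφ, Item.work, emitTime]
        simp only [Test.time, NExp.time]
        omega
      · refine .seq _ (emitCmd.bnd (loopBound d) + 18) le_rfl (Runs.imp hload le_rfl ?_)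
        rintro σ₁ e₁ ⟨hc, hs⟩
        have hk₁ : ∀ t, Keeps d t σ' σ₁ := fun t => Keeps.of_eqv e₁
        have hq₁ : QueueIn σ₁ (it :: qs) := ⟨by rw [e₁.n 26, e₁.n 25]; exact hq.tail, fun i hi => by
          rw [e₁.n 25]; exact (hk₁ (σ'.nat 25 0 + i + 1)).stored (by omega) (hq.item i hi)⟩
        have hit₁ : Stored σ₁ (σ₁.nat 25 0) it := hq₁.item 0 (by simp)
        refine .seq (emitCmd.bnd (loopBound d) + 12) 6 (by omega)
          (.ite (emitCmd.bnd (loopBound d)) (by simp [Test.time, NExp.time]; omega) (fun hb => ?_) (fun _ => ?_))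
        · exfalso
          simp only [Test.Holds, NExp.val, hit₁.depth, hit₁.cnt] at hb
          rcases hex' with h0 | h0
          · omega
          · rw [h0] at hb; simp at hb
        · refine Runs.imp (within_emitCmd hd (hT'.eqv e₁) hc hs (hes.eqv e₁)) le_rfl ?_
          intro σ₂ e₂ hes₂
          refine .setNat (by simp [NExp.time]) ?_
          have e₃ := eqv_setNat σ₂ 25 0 (σ₂.nat 25 0 + 1)
          have hk₃ : ∀ t, Keeps d t σ₁ (σ₂.setNat 25 0 (σ₂.nat 25 0 + 1)) := fun t =>
            (Keeps.of_eqv e₂).trans (Keeps.of_eqv e₃)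
          refine ⟨qs, es ++ it.emit j (solid T), ⟨?_, ?_⟩, ?_,
            hcov.emit (isCompact_solid T).measure_lt_top.ne hex', ?_, rfl⟩
          · have := hq₁.tail
            simp only [NExp.val, Mem.setNat_nat] at this ⊢
            simp only [List.length_cons] at this
            simp [e₂.n 25, e₂.n 26]
            omega
          · intro i hi
            have := hq₁.item (i + 1) (by simpa using hi)
            simp only [List.getElem_cons_succ] at this
            have h3 := (hk₃ (σ₁.nat 25 0 + (i + 1) + 1)).stored (by omega) this
            simp only [NExp.val, Mem.setNat_nat, and_self, if_true]
            rw [e₂.n 25] at h3 ⊢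
            rwa [show σ₁.nat 25 0 + 1 + i = σ₁.nat 25 0 + (i + 1) by omega]
          · rw [← List.append_assoc]
            exact hes₂.eqv e₃
          · have h1 : (it.emit j (solid T)).length ≤ 1 := by
              rw [Item.emit]; split_ifs <;> simp
            have h2 : 1 ≤ it.work δ p 1 (2 ^ d) := by rw [Item.work]; omega
            rw [List.length_append]
            omega
  · rintro φ σ' h ⟨qs, es, hq, hes, hcov, hcnt, -⟩ hb
    simp only [Test.Holds, NExp.val] at hb
    have : qs = [] := by
      have := hq.tail
      exact List.length_eq_zero_iff.1 (by omega)
    subst this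
    exact ⟨es, hes, hcov, by simpa using hcnt⟩

end PointSimplex

namespace PointSimplex

/-! ### All simplices -/

/-- Start the queue with a cube around simplex `nv 24`, with all points in its list. -/
def rootCmd : Cmd :=
  .seq (fillCmd .skip 19 13 dimE (nv 13) (.sub (vtxE (.lit 0) (nv 13)) (rv 35))) <|
  .seq (.setReal 20 (.lit 0) (.mul (.lit 3) (rv 35))) <|
  .seq (.setNat 11 (.lit 0) (nv 34)) <|
  .seq (.setNat 9 (.lit 0) (.lit 0)) <|
  .seq (.setNat 10 (.lit 0) (nv 0)) <|
  .seq (.setNat 25 (.lit 0) (.lit 0)) <|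
  .seq (.setNat 26 (.lit 0) (.lit 1)) (.setNat 27 (.lit 0) (nv 0))

/-- Array 8 gets the list of all points. -/
def allPointsCmd : Cmd := forCmd 13 (nv 0) (.setNat 8 (nv 13) (nv 13))

def simplexCmd : Cmd := .seq rootCmd (.seq allPointsCmd queueCmd)

/-- Cubes are half-open, so edge length `2 * R` would miss points whose coordinate exceeds that of
`v` by exactly `R`; hence `3 * R`. -/
def rootItem {d : ℕ} (n : ℕ) (v : Fin d → ℝ) (R : ℝ) (L : ℕ) : Item d n where
  corner c := v c - R
  size := 3 * R
  depth := L
  pts := List.finRange n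

/-- Bound on the time for a simplex if each point is relevant at most `N` times. -/
def simplexTime (d n N : ℕ) : ℕ :=
  rootCmd.bnd (loopBound d) + allPointsCmd.bnd n + emitTime d + listTime d * (n * N) + 10

variable {d n : ℕ} {S : Solver d} {f : ℕ → ℕ} {σ : Mem} {p : Fin n → E d} {δ : ℝ}
  {j : ℕ} {T : Affine.Simplex ℝ (E d) d} {R : ℝ} {L N : ℕ}

theorem work_rootItem_le (hR : 0 < R) (hN : ∀ i a s, 0 < s → treeCount δ (p i) L a s ≤ N)
    (v : Fin d → ℝ) (α γ : ℕ) : (rootItem n v R L).work δ p α γ ≤ α + γ * (n * N) := by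
  rw [Item.work]
  refine Nat.add_le_add_left (Nat.mul_le_mul_left _ ?_) _
  have := List.sum_le_card_nsmul ((rootItem n v R L).pts.map fun i =>
    treeCount δ (p i) (rootItem n v R L).depth (rootItem n v R L).corner (rootItem n v R L).size) N (by
      intro x hx
      obtain ⟨i, -, rfl⟩ := List.mem_map.1 hx
      exact hN _ _ _ (by simp only [rootItem]; positivity))
  simpa [rootItem] using this

theorem solid_subset_rootItem (hR : 0 < R) (hv : ∀ (a : Fin (d + 1)) (c : Fin d),
    |T.points a c - T.points 0 c| ≤ R) (n L : ℕ) :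
    solid T ⊆ (rootItem n (fun c => T.points 0 c) R L).box := by
  have h1 : solid T ⊆ {x : E d | ∀ c, |x c - T.points 0 c| ≤ R} := by
    refine convexHull_min ?_ ?_
    · rintro _ ⟨a, rfl⟩ c
      exact hv a c
    · intro x hx y hy a b ha hb hab c
      have e : (a • x + b • y) c - T.points 0 c =
          a * (x c - T.points 0 c) + b * (y c - T.points 0 c) := by
        simp only [PiLp.add_apply, PiLp.smul_apply, smul_eq_mul]
        linear_combination (T.points 0 c) * hab
      rw [e]
      refine (abs_add_le _ _).trans ?_
      rw [abs_mul, abs_mul, abs_of_nonneg ha, abs_of_nonneg hb]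
      have := mul_le_mul_of_nonneg_left (hx c) ha
      have := mul_le_mul_of_nonneg_left (hy c) hb
      nlinarith
  intro x hx c
  have := abs_le.1 (h1 hx c)
  simp only [rootItem]
  constructor <;> linarith

theorem runs_simplexCmd (hd : 0 < d) (hδ : 0 < δ) (hδ1 : δ ≤ 1) (hP : PointsIn σ p δ)
    (hT : SimplexIn σ j T) (hn : σ.nat 0 0 = n) (hR0 : 0 < R) (hR : σ.real 35 0 = R)
    (hv : ∀ (a : Fin (d + 1)) (c : Fin d), |T.points a c - T.points 0 c| ≤ R)
    (hL : σ.nat 34 0 = L) (hN : ∀ i a s, 0 < s → treeCount δ (p i) L a s ≤ N)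
    {es₀ : List (Piece d)} (hes : PiecesIn σ es₀) :
    Runs S f simplexCmd σ (simplexTime d n N) fun σ' =>
      ∃ es, PiecesIn σ' (es₀ ++ es) ∧
        Covers j (solid T) δ (3 * R / 2 ^ L) p ([] : List (Item d n)) es ∧
        es.length ≤ 1 + 2 ^ d * (n * N) := by
  obtain ⟨hK, -, -⟩ := le_loopBound d
  set it := rootItem n (fun c => T.points 0 c) R L with hit
  have hw := work_rootItem_le (n := n) (p := p) hR0 hN (fun c => T.points 0 c)
  refine .seq (rootCmd.bnd (loopBound d)) (allPointsCmd.bnd n +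
    (it.work δ p (emitTime d) (listTime d) + 10)) ?_ ?_
  · have := hw (emitTime d) (listTime d)
    rw [← hit] at this
    rw [simplexTime]
    omega
  change Within S f (loopBound d) rootCmd σ _
  refine .seq (.fill d (fun c => c) it.corner hK (by decide) (by decide) ?_ Fin.val_injective ?_ ?_)
  · intro σ' h; simp [NExp.val, (hP.eqv h).dim]
  · intro c σ' h hc
    have hT' := hT.eqv h
    have := hT'.sx 0 c
    simp only [Fin.val_zero, add_zero] at this
    refine .skip ⟨by simp [NExp.val, hc], ?_⟩
    simp only [RExp.val, NExp.val, hc, hT'.idx, hT'.dim, add_zero, this, h.r 35, hR]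
    rfl
  intro σ₁ e₁ hc _
  refine .seq (.setReal (.seq (.setNat (.seq (.setNat (.seq (.setNat (.seq (.setNat (.seq (.setNat
    (.setNat ?_))))))))))))
  simp only [NExp.val, RExp.val]
  have b34 : σ₁.nat 34 0 = L := by rw [e₁.n 34, hL]
  have b35 : σ₁.real 35 0 = R := by rw [e₁.r 35, hR]
  have b0 : σ₁.nat 0 0 = n := by rw [e₁.n 0, hn]
  set σ₂ := (((((((σ₁.setReal 20 0 _).setNat 11 0 _).setNat 9 0 _).setNat 10 0 _).setNat 25 0 _).setNat
    26 0 _).setNat 27 0 _) with hσ₂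
  have e₂ : Eqv [11, 9, 10, 25, 26, 27] [20] σ₁ σ₂ := by
    refine ((((((((eqv_setReal _ _ _ _).mono ?_ ?_).trans ((eqv_setNat _ _ _ _).mono ?_ ?_)).trans
      ((eqv_setNat _ _ _ _).mono ?_ ?_)).trans ((eqv_setNat _ _ _ _).mono ?_ ?_)).trans
      ((eqv_setNat _ _ _ _).mono ?_ ?_)).trans ((eqv_setNat _ _ _ _).mono ?_ ?_)).trans
      ((eqv_setNat _ _ _ _).mono ?_ ?_)) <;> simp
  have c20 : σ₂.real 20 0 = it.size := by simp [hσ₂, b35, hit, rootItem]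
  have c11 : σ₂.nat 11 0 = it.depth := by simp [hσ₂, b34, hit, rootItem]
  have c9 : σ₂.nat 9 0 = 0 := by simp [hσ₂]
  have c10 : σ₂.nat 10 0 = n := by simp [hσ₂, b0]
  have c25 : σ₂.nat 25 0 = 0 := by simp [hσ₂]
  have c26 : σ₂.nat 26 0 = 1 := by simp [hσ₂]
  have c27 : σ₂.nat 27 0 = n := by simp [hσ₂, b0]
  clear hσ₂
  clear_value σ₂
  refine .seq (allPointsCmd.bnd n) _ le_rfl ?_
  change Within S f n allPointsCmd σ₂ _
  refine .forLoop n (fun k σ' => ∀ i < k, σ'.nat 8 i = i) le_rfl (by decide) ?_ (by simp) (by simp)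
    ?_ ?_
  · intro σ' h; simp [NExp.val, h.n 0, e₂.n 0, b0]
  · intro k hk σ' h hJ hi
    refine .setNat fun i hi' => ?_
    by_cases hik : i = k
    · subst hik; simp [NExp.val, hi]
    · simp [NExp.val, hi, hik, hJ i (by omega)]
  intro σ₃ e₃ hlist
  have hP₃ := ((hP.eqv e₁).eqv e₂).eqv e₃
  have hT₃ := ((hT.eqv e₁).eqv e₂).eqv e₃
  have hlen : it.pts.length = n := by simp [hit, rootItem]
  have hst : Stored σ₃ 0 it := by
    refine ⟨?_, ?_, ?_, ?_, ?_, ?_⟩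
    · rw [e₃.r 19, e₂.r 19]; simpa using hc
    · rw [e₃.r 20, c20]
    · rw [e₃.n 11, c11]
    · rw [e₃.n 10, c10, hlen]
    · intro l hl
      rw [e₃.n 9, c9, zero_add, hlist l (by omega)]
      simp [hit, rootItem]
    · rw [e₃.n 9, e₃.n 27, c9, c27, hlen, zero_add]
  have hq : QueueIn σ₃ [it] := by
    refine ⟨by rw [e₃.n 26, e₃.n 25, c26, c25]; rfl, fun i hi => ?_⟩
    simp only [List.length_singleton] at hi
    obtain rfl : i = 0 := by omega
    rw [e₃.n 25, c25]
    exact hst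
  have hcov : Covers j (solid T) δ (3 * R / 2 ^ L) p [it] [] := by
    refine ⟨?_, ?_, by simp⟩
    · filter_upwards [ae_restrict_mem (measurableSet_solid T)] with x hx
      have : x ∈ it.box := solid_subset_rootItem hR0 hv n L hx
      simp [Set.indicator_of_mem this]
    · intro it' hit'
      rw [List.mem_singleton] at hit'
      subst hit'
      refine ⟨by simp only [hit, rootItem]; positivity, ?_, ?_⟩
      · simp only [hit, rootItem]
        rw [mul_div_cancel₀ _ (by positivity)]
      · intro i hi
        exact absurd (by simp [hit, rootItem]) hi
  refine (runs_queueCmd hd hδ hδ1 hP₃ hT₃ hq (((hes.eqv e₁).eqv e₂).eqv e₃) hcov).mono le_rfl ?_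
  rintro σ' ⟨es, h1, h2, h3⟩
  exact ⟨es, h1, h2, h3.trans (hw 1 (2 ^ d))⟩

/-- The pieces of all simplices. -/
structure Table {m : ℕ} (sx : Fin m → Affine.Simplex ℝ (E d) d) (δ r : ℝ) (p : Fin n → E d)
    (es : List (Piece d)) : Prop where
  idx : ∀ e ∈ es, ∃ j : Fin m, e.idx = (j : ℕ) ∧ e.weight = volume.real (solid (sx j) ∩ e.box)
  fine : ∀ e ∈ es, Fine δ r p e.corner e.size
  cover : ∀ j : Fin m, ∀ᵐ x ∂volume.restrict (solid (sx j)),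
    (es.map fun e => if e.idx = (j : ℕ) then e.box.indicator (1 : E d → ℝ) x else 0).sum = 1

theorem Table.of_covers {m : ℕ} {sx : Fin m → Affine.Simplex ℝ (E d) d} {r : ℝ}
    {F : ℕ → List (Piece d)} (h : ∀ j : Fin m,
      Covers j (solid (sx j)) δ r p ([] : List (Item d n)) (F j)) :
    Table sx δ r p ((List.range m).flatMap F) := by
  have hmem : ∀ {e}, e ∈ (List.range m).flatMap F → ∃ j : Fin m, e ∈ F j := by
    intro e he
    obtain ⟨j, hj, he⟩ := List.mem_flatMap.1 he
    exact ⟨⟨j, List.mem_range.1 hj⟩, he⟩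
  refine ⟨?_, ?_, ?_⟩
  · intro e he
    obtain ⟨j, hj⟩ := hmem he
    exact ⟨j, ((h j).piece e hj).1, ((h j).piece e hj).2.1⟩
  · intro e he
    obtain ⟨j, hj⟩ := hmem he
    exact ((h j).piece e hj).2.2.2
  · intro j
    filter_upwards [(h j).cover] with x hx
    simp only [List.map_nil, List.sum_nil, zero_add] at hx
    rw [← hx]
    have key : ∀ k : Fin m, ((F k).map fun e => if e.idx = (j : ℕ) then e.box.indicator (1 : E d → ℝ) x else 0).sum =
        if (k : ℕ) = j then ((F j).map fun e => e.box.indicator (1 : E d → ℝ) x).sum else 0 := by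
      intro k
      split_ifs with hkj
      · rw [hkj]
        congr 1
        refine List.map_congr_left fun e he => ?_
        rw [if_pos ((h j).piece e he).1]
      · refine List.sum_eq_zero fun y hy => ?_
        obtain ⟨e, he, rfl⟩ := List.mem_map.1 hy
        rw [if_neg]
        rw [((h k).piece e he).1]
        exact hkj
    have hflat : ∀ (g : Piece d → ℝ) (M : ℕ), (((List.range M).flatMap F).map g).sum =
        ∑ k ∈ Finset.range M, ((F k).map g).sum := by
      intro g M
      induction M with
      | zero => simp
      | succ M ih =>
        rw [List.range_succ, List.flatMap_append, List.map_append, List.sum_append, ih,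
          Finset.sum_range_succ]
        simp
    rw [hflat, Finset.sum_range]
    simp only [key]
    rw [Finset.sum_eq_single j]
    · simp
    · intro k _ hk
      rw [if_neg fun h => hk (Fin.ext h)]
    · simp

/-- Process all simplices. -/
def subdivideCmd : Cmd := .seq (.setNat 28 (.lit 0) (.lit 0)) (forCmd 24 (.get 0 (.lit 1)) simplexCmd)

theorem runs_subdivideCmd {m : ℕ} {sx : Fin m → Affine.Simplex ℝ (E d) d}
    (hd : 0 < d) (hδ : 0 < δ) (hδ1 : δ ≤ 1) (hP : PointsIn σ p δ)
    (hsx : ∀ (j : Fin m) (a : Fin (d + 1)) (c : Fin d),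
      σ.real 3 ((j * (d + 1) + a) * d + c) = (sx j).points a c)
    (hn : σ.nat 0 0 = n) (hm : σ.nat 0 1 = m) (hR0 : 0 < R) (hR : σ.real 35 0 = R)
    (hv : ∀ (j : Fin m) (a : Fin (d + 1)) (c : Fin d), |(sx j).points a c - (sx j).points 0 c| ≤ R)
    (hL : σ.nat 34 0 = L) (hN : ∀ i a s, 0 < s → treeCount δ (p i) L a s ≤ N) :
    Runs S f subdivideCmd σ (6 + (m + 1) * (simplexTime d n N + 12)) fun σ' =>
      ∃ es : List (Piece d), PiecesIn σ' es ∧ Table sx δ (3 * R / 2 ^ L) p es ∧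
        es.length ≤ m * (1 + 2 ^ d * (n * N)) := by
  refine .seq 3 (3 + (m + 1) * (simplexTime d n N + 12)) (by omega) (.setNat (by simp [NExp.time]) ?_)
  have e₁ := eqv_setNat σ 28 0 0
  have h28 : (σ.setNat 28 0 0).nat 28 0 = 0 := by simp
  simp only [NExp.val]
  generalize σ.setNat 28 0 0 = σ₁ at *
  refine .forLoop m (simplexTime d n N) (fun k σ' => ∃ F : ℕ → List (Piece d),
    PiecesIn σ' ((List.range k).flatMap F) ∧ ∀ j : Fin m, (j : ℕ) < k →
      Covers j (solid (sx j)) δ (3 * R / 2 ^ L) p ([] : List (Item d n)) (F j) ∧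
      (F j).length ≤ 1 + 2 ^ d * (n * N)) (by simp [NExp.time]) (by decide) ?_ ?_ ?_ ?_ ?_
  · intro σ' h; simp [NExp.val, h.n 0, e₁.n 0, hm]
  · exact ⟨fun _ => [], ⟨by simpa using h28, by simp, by simp, by simp, by simp⟩, by simp⟩
  · rintro k σ' v ⟨F, h1, h2⟩
    exact ⟨F, h1.eqv (eqv_setNat _ _ _ _), h2⟩
  · rintro k hk σ' h ⟨F, h1, h2⟩ hi
    have hP' := (hP.eqv e₁).eqv h
    have hT' : SimplexIn σ' k (sx ⟨k, hk⟩) := ⟨hP'.dim, hP'.pow, hi, by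
      rw [h.r 3, e₁.r 3]; exact hsx ⟨k, hk⟩⟩
    refine (runs_simplexCmd hd hδ hδ1 hP' hT' (by rw [h.n 0, e₁.n 0, hn]) hR0
      (by rw [h.r 35, e₁.r 35, hR]) (hv ⟨k, hk⟩) (by rw [h.n 34, e₁.n 34, hL]) hN h1).mono le_rfl ?_
    rintro σ'' ⟨es, h3, h4, h5⟩
    have hF : ∀ i < k, Function.update F k es i = F i := fun i hi =>
      Function.update_of_ne (by omega) _ _
    have hflat : (List.range (k + 1)).flatMap (Function.update F k es) = (List.range k).flatMap F ++ es := by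
      rw [List.range_succ, List.flatMap_append, List.flatMap_singleton, Function.update_self]
      congr 1
      exact List.flatMap_congr fun i hi => hF i (List.mem_range.1 hi)
    refine ⟨Function.update F k es, by rw [hflat]; exact h3, fun i hik => ?_⟩
    rcases Nat.lt_succ_iff_lt_or_eq.1 hik with hik | hik
    · rw [hF i hik]; exact h2 i hik
    · obtain rfl : i = ⟨k, hk⟩ := Fin.ext hik
      simp only [Function.update_self]
      exact ⟨h4, h5⟩
  · rintro σ' - ⟨F, h1, h2⟩
    refine ⟨_, h1, Table.of_covers fun j => (h2 j j.2).1, ?_⟩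
    have : ∀ k ≤ m, ((List.range k).flatMap F).length ≤ k * (1 + 2 ^ d * (n * N)) := by
      intro k
      induction k with
      | zero => simp
      | succ k ih =>
        intro hk
        rw [List.range_succ, List.flatMap_append, List.length_append, List.flatMap_singleton,
          Nat.succ_mul]
        exact Nat.add_le_add (ih (by omega)) (h2 ⟨k, by omega⟩ hk).2
    exact this m le_rfl

end PointSimplex

namespace PointSimplex

/-! ### Initialisation -/

/-- `rv 33 := min δ (1/5)`. -/
def paramCmd : Cmd :=
  .ite (.realLe (rv 0) (.div (.lit 1) (.lit 5))) (.setReal 33 (.lit 0) (rv 0))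
    (.setReal 33 (.lit 0) (.div (.lit 1) (.lit 5)))

/-- Array 5 gets the powers of two. -/
def powCmd : Cmd :=
  .seq (.setNat 5 (.lit 0) (.lit 1)) <|
  .seq (forCmd 13 (.add (.mul (.lit 3) dimE) (.lit 1))
    (.setNat 5 (.add (nv 13) (.lit 1)) (.mul (.lit 2) (.get 5 (nv 13)))))
    (.setReal 38 (.lit 0) (.ofNat (.get 5 dimE)))

/-- `rv 36` gets the total weight. -/
def weightCmd : Cmd := sumCmd 36 13 (nv 0) (.get 2 (nv 13))

/-- `rv 35 := max (rv 35) |c - c₀|`, where `c` is coordinate `nv 14` of vertex `nv 13` of simplex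
`nv 24`, and `c₀` the same coordinate of its first vertex. -/
def maxCmd : Cmd :=
  .seq (.setReal 23 (.lit 0) (.sub (vtxE (nv 13) (nv 14)) (vtxE (.lit 0) (nv 14)))) <|
  .seq (.ite (.realLe (.lit 0) (rv 23)) .skip (.setReal 23 (.lit 0) (.sub (.lit 0) (rv 23)))) <|
  .ite (.realLe (rv 23) (rv 35)) .skip (.setReal 35 (.lit 0) (rv 23))

def reachBodyCmd : Cmd := forCmd 13 (.add dimE (.lit 1)) (forCmd 14 dimE maxCmd)

/-- `rv 35` gets the largest coordinate difference from the first vertex of a simplex. -/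
def reachCmd : Cmd :=
  .seq (.setReal 35 (.lit 0) (.lit 0)) (forCmd 24 (.get 0 (.lit 1)) reachBodyCmd)

/-- `rv 37` gets the volume of cubes around all points that the depth is based on. -/
def spreadCmd : Cmd :=
  .seq (.setReal 37 (.lit 0) (.mul (.ofNat (nv 0)) (.ofNat (.get 0 (.lit 1))))) <|
  forCmd 13 dimE (.setReal 37 (.lit 0)
    (.mul (rv 37) (.div (.mul (.mul (.lit 24) (.ofNat dimE)) (rv 35)) (rv 33))))

/-- `nv 34` gets the depth of the subdivision. -/
def depthCmd : Cmd :=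
  .seq (.setNat 34 (.lit 0) (.lit 0)) <|
  .loop (.neg (.realLe (rv 37) (rv 36))) <|
    .seq (.setReal 37 (.lit 0) (.div (rv 37) (rv 38)))
      (.setNat 34 (.lit 0) (.add (nv 34) (.lit 1)))

def initCmd : Cmd :=
  .seq paramCmd <| .seq powCmd <| .seq weightCmd <| .seq reachCmd <| .seq spreadCmd depthCmd

def initTime (d n m L : ℕ) : ℕ :=
  paramCmd.bnd (loopBound d) + (powCmd.bnd (loopBound d) + (weightCmd.bnd n +
    (6 + (m + 1) * (reachBodyCmd.bnd (loopBound d + 1) + 12) + (spreadCmd.bnd (loopBound d) +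
      (20 + 30 * L)))))

variable {d n m : ℕ} {S : Solver d} {f : ℕ → ℕ} {σ : Mem} {K : ℕ}

theorem within_paramCmd {δ : ℝ} (h : σ.real 0 0 = δ) : Within S f K paramCmd σ fun σ' =>
    σ'.real 33 0 = min δ (1 / 5) := by
  refine .ite (fun hb => .setReal ?_) (fun hb => .setReal ?_) <;>
    simp only [Test.Holds, RExp.val, NExp.val, h, Nat.cast_one, Nat.cast_ofNat, not_le] at hb
  · simpa [RExp.val, NExp.val, h] using hb
  · simpa [RExp.val, NExp.val] using hb.le

theorem within_powCmd (h : σ.nat 0 2 = d) (hK : 3 * d + 1 ≤ K) : Within S f K powCmd σ fun σ' =>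
    (∀ r ≤ 3 * d + 1, σ'.nat 5 r = 2 ^ r) ∧ σ'.real 38 0 = 2 ^ d := by
  refine .seq (.setNat ?_)
  have e₁ := eqv_setNat σ 5 0 1
  have h5 : (σ.setNat 5 0 1).nat 5 0 = 1 := by simp
  simp only [NExp.val]
  generalize σ.setNat 5 0 1 = σ₁ at *
  refine .seq (.forLoop (3 * d + 1) (fun k σ' => ∀ r ≤ k, σ'.nat 5 r = 2 ^ r) hK (by decide) ?_
    (by simpa using h5) (by simp) ?_ ?_)
  · intro σ' h'; simp [NExp.val, h'.n 0, e₁.n 0, h]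
  · intro k hk σ' h' hJ hi
    refine .setNat fun r hr => ?_
    by_cases hrk : r = k + 1
    · subst hrk; simp [NExp.val, hi, hJ k le_rfl, pow_succ, mul_comm]
    · simp [NExp.val, hi, hrk, hJ r (by omega)]
  · intro σ' h' hJ
    refine .setReal ⟨by simpa using hJ, ?_⟩
    simp [NExp.val, RExp.val, h'.n 0, e₁.n 0, h, hJ d (by omega)]

/-- Coordinate `c` of the edge from vertex `0` to vertex `a` of simplex `j`, in absolute value. -/
def Input.reach (I : Input d n m) (j : Fin m) (a : Fin (d + 1)) (c : Fin d) : ℝ :=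
  |(I.sx j).points a c - (I.sx j).points 0 c|

theorem Input.reach_le (I : Input d n m) (j : Fin m) (a : Fin (d + 1)) (c : Fin d) :
    I.reach j a c ≤ I.longestEdge := by
  have := PiLp.norm_apply_le ((I.sx j).points a - (I.sx j).points 0) c
  rw [← dist_eq_norm] at this
  exact this.trans (I.le_longestEdge j a 0)

/-- `rv 35` bounds the reaches that satisfy `P`. -/
def ReachIn (I : Input d n m) (P : ℕ → ℕ → ℕ → Prop) (σ : Mem) : Prop :=
  0 ≤ σ.real 35 0 ∧ σ.real 35 0 ≤ I.longestEdge ∧ 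
    ∀ (j : Fin m) (a : Fin (d + 1)) (c : Fin d), P j a c → I.reach j a c ≤ σ.real 35 0

/-- The memory holds the data of `I`. -/
structure DataIn (I : Input d n m) (σ : Mem) : Prop where
  points : σ.nat 0 0 = n
  simplices : σ.nat 0 1 = m
  dim : σ.nat 0 2 = d
  pt : ∀ (i : Fin n) (c : Fin d), σ.real 1 (i * d + c) = I.pt i c
  wt : ∀ i : Fin n, σ.real 2 i = I.wt i
  sx : ∀ (j : Fin m) (a : Fin (d + 1)) (c : Fin d),
    σ.real 3 ((j * (d + 1) + a) * d + c) = (I.sx j).points a c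

theorem DataIn.eqv {I : Input d n m} {σ σ' : Mem} {ln lr : List ℕ} (h : DataIn I σ)
    (e : Eqv ln lr σ σ') (hn : 0 ∉ ln := by decide) (hr : 1 ∉ lr ∧ 2 ∉ lr ∧ 3 ∉ lr := by decide) :
    DataIn I σ' where
  points := by rw [e.n 0 hn]; exact h.points
  simplices := by rw [e.n 0 hn]; exact h.simplices
  dim := by rw [e.n 0 hn]; exact h.dim
  pt := by rw [e.r 1 hr.1]; exact h.pt
  wt := by rw [e.r 2 hr.2.1]; exact h.wt
  sx := by rw [e.r 3 hr.2.2]; exact h.sx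

variable {I : Input d n m}

theorem within_weightCmd (h : DataIn I σ) : Within S f n weightCmd σ fun σ' =>
    σ'.real 36 0 = I.mass := by
  refine .sum n I.wt le_rfl ?_ ?_ ?_
  · intro σ' h'; simp [NExp.val, (h.eqv h').points]
  · intro k σ' h' hk; simp [RExp.val, NExp.val, hk, (h.eqv h').wt]
  · intro σ' _ h'; rw [h', I.balanced]; rfl

theorem within_maxCmd (h : DataIn I σ) {P : ℕ → ℕ → ℕ → Prop} (hR : ReachIn I P σ)
    {j : Fin m} {a : Fin (d + 1)} {c : Fin d} (hj : σ.nat 24 0 = j) (ha : σ.nat 13 0 = a)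
    (hc : σ.nat 14 0 = c) : Within S f K maxCmd σ fun σ' =>
      ReachIn I (fun j' a' c' => P j' a' c' ∨ (j' = j ∧ a' = a ∧ c' = c)) σ' := by
  have hend : ∀ {x y : ℝ}, x = max y (I.reach j a c) → 0 ≤ y ∧ y ≤ I.longestEdge ∧
      (∀ (j : Fin m) (a : Fin (d + 1)) (c : Fin d), P j a c → I.reach j a c ≤ y) → 0 ≤ x ∧ x ≤ I.longestEdge ∧
      ∀ (j' : Fin m) (a' : Fin (d + 1)) (c' : Fin d), (P j' a' c' ∨ ((j' : ℕ) = j ∧ (a' : ℕ) = a ∧ (c' : ℕ) = c)) →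
        I.reach j' a' c' ≤ x := by
    rintro x y rfl ⟨h1, h2, h3⟩
    refine ⟨le_max_of_le_left h1, max_le h2 (I.reach_le _ _ _), ?_⟩
    rintro j' a' c' (h | ⟨h4, h5, h6⟩)
    · exact le_max_of_le_left (h3 _ _ _ h)
    · rw [Fin.ext h4, Fin.ext h5, Fin.ext h6]; exact le_max_right _ _
  refine .seq (.setReal (.seq ?_))
  have e₁ := eqv_setReal σ 23 0 ((I.sx j).points a c - (I.sx j).points 0 c)
  have h23 : (σ.setReal 23 0 ((I.sx j).points a c - (I.sx j).points 0 c)).real 23 0 =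
    (I.sx j).points a c - (I.sx j).points 0 c := by simp
  have h0 := h.sx j 0 c
  simp only [Fin.val_zero, add_zero] at h0
  simp only [NExp.val, RExp.val, hj, ha, hc, h.dim, add_zero, h.sx j a c, h0]
  generalize σ.setReal 23 0 ((I.sx j).points a c - (I.sx j).points 0 c) = σ₁ at *
  have key : Within S f K (.ite (.realLe (.lit 0) (rv 23)) .skip
      (.setReal 23 (.lit 0) (.sub (.lit 0) (rv 23)))) σ₁ fun σ' => σ'.real 23 0 = I.reach j a c := by
    refine .ite (fun hb => .skip ?_) (fun hb => .setReal ?_) <;>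
      simp only [Test.Holds, RExp.val, NExp.val, h23, Nat.cast_zero, not_le] at hb
    · rw [h23, Input.reach, abs_of_nonneg hb]
    · simp only [RExp.val, NExp.val, h23, Nat.cast_zero, Mem.setReal_real, and_self, if_true, Input.reach,
        abs_of_neg hb, zero_sub]
  refine key.imp fun σ₂ e₂ h2 => ?_
  have h35 : σ₂.real 35 0 = σ.real 35 0 := by rw [e₂.r 35, e₁.r 35]
  refine .ite (fun hb => .skip ?_) (fun hb => .setReal ?_) <;>
    simp only [Test.Holds, RExp.val, NExp.val, h2, h35, not_le] at hb
  · exact hend (h35.trans (max_eq_left hb).symm) hR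
  · refine hend ?_ hR
    simp [RExp.val, NExp.val, h2, hb.le]

theorem ReachIn.mono {P Q : ℕ → ℕ → ℕ → Prop} (h : ReachIn I P σ)
    (hQ : ∀ j a c, a ≤ d → c < d → Q j a c → P j a c) : ReachIn I Q σ :=
  ⟨h.1, h.2.1, fun j a c hq => h.2.2 j a c (hQ _ _ _ (by omega) c.2 hq)⟩

theorem within_reachBodyCmd (hK : d + 1 ≤ K) (h : DataIn I σ) {k : ℕ} (hk : k < m)
    (hR : ReachIn I (fun j _ _ => j < k) σ) (hj : σ.nat 24 0 = k) :
    Within S f K reachBodyCmd σ (ReachIn I fun j _ _ => j < k + 1) := by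
  refine .forLoop (d + 1) (fun a => ReachIn I fun j a' _ => j < k ∨ (j = k ∧ a' < a)) hK (by decide)
    ?_ (hR.mono fun j a c _ _ h => ?_) (fun _ _ _ h => h) ?_ (fun σ' _ h => h.mono fun j a c _ _ h => ?_)
  · intro σ' h'; simp [NExp.val, (h.eqv h').dim]
  · omega
  · intro a ha σ₁ e₁ h1 hi
    refine .forLoop d (fun c => ReachIn I fun j a' c' => j < k ∨ (j = k ∧ (a' < a ∨ (a' = a ∧ c' < c))))
      (by omega) (by decide) ?_ (h1.mono fun j a c _ _ h => ?_) (fun _ _ _ h => h) ?_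
      (fun σ' _ h => h.mono fun j a c _ _ h => ?_)
    · intro σ' h'; simp [NExp.val, ((h.eqv e₁).eqv h').dim]
    · omega
    · intro c hc σ₂ e₂ h2 hi2
      refine (within_maxCmd (j := ⟨k, hk⟩) (a := ⟨a, ha⟩) (c := ⟨c, hc⟩) ((h.eqv e₁).eqv e₂) h2
        (by rw [e₂.n 24, e₁.n 24, hj]) (by rw [e₂.n 13, hi]) hi2).imp fun σ₃ _ h3 => ?_
      refine h3.mono fun j a c _ _ h => ?_
      simp only
      omega
    · omega
  · omega

theorem runs_reachCmd (hd : 0 < d) (hm : 0 < m) (h : DataIn I σ) : Runs S f reachCmd σ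
    (6 + (m + 1) * (reachBodyCmd.bnd (loopBound d + 1) + 12)) fun σ' =>
      0 < σ'.real 35 0 ∧ σ'.real 35 0 ≤ I.longestEdge ∧ ∀ j a c, I.reach j a c ≤ σ'.real 35 0 := by
  refine .seq 3 (3 + (m + 1) * (reachBodyCmd.bnd (loopBound d + 1) + 12)) (by omega)
    (.setReal (by simp [NExp.time, RExp.time]) ?_)
  simp only [NExp.val, RExp.val, Nat.cast_zero]
  have e₁ := eqv_setReal σ 35 0 0
  have h35 : (σ.setReal 35 0 0).real 35 0 = 0 := by simp
  generalize σ.setReal 35 0 0 = σ₁ at *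
  have h₁ := h.eqv e₁
  refine .forLoop m (reachBodyCmd.bnd (loopBound d + 1)) (fun k => ReachIn I fun j _ _ => j < k)
    (by simp [NExp.time]) (by decide) ?_ ⟨h35.ge, ?_, by simp⟩ (fun _ _ _ h => h) ?_ ?_
  · intro σ' h'; simp [NExp.val, (h₁.eqv h').simplices]
  · rw [h35]; exact (I.longestEdge_pos hd hm).le
  · intro k hk σ' h' hJ hi
    exact within_reachBodyCmd (by have := (le_loopBound d).1; omega) (h₁.eqv h') hk hJ hi
  · intro σ' _ hJ
    have hall : ∀ j a c, I.reach j a c ≤ σ'.real 35 0 := fun j a c => hJ.2.2 j a c j.2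
    -- If all coordinate differences vanished, two vertices of a nondegenerate simplex would
    -- coincide.
    refine ⟨lt_of_le_of_ne hJ.1 fun h0 => ?_, hJ.2.1, hall⟩
    have heq : (I.sx ⟨0, hm⟩).points ⟨1, by omega⟩ = (I.sx ⟨0, hm⟩).points 0 := by
      ext c
      have := hall ⟨0, hm⟩ ⟨1, by omega⟩ c
      rw [← h0, Input.reach] at this
      exact sub_eq_zero.1 (abs_nonpos_iff.1 this)
    have := (I.sx ⟨0, hm⟩).independent.injective heq
    simp [Fin.ext_iff] at this

theorem within_spreadCmd (hK : d ≤ K) (h : DataIn I σ) {R δ : ℝ} (hR : σ.real 35 0 = R)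
    (hδ : σ.real 33 0 = δ) : Within S f K spreadCmd σ fun σ' =>
      σ'.real 37 0 = n * m * (24 * d * R / δ) ^ d := by
  refine .seq (.setReal ?_)
  simp only [NExp.val, RExp.val, h.points, h.simplices]
  have e₁ := eqv_setReal σ 37 0 (n * m)
  have h37 : (σ.setReal 37 0 (n * m)).real 37 0 = n * m := by simp
  generalize σ.setReal 37 0 (n * m) = σ₁ at *
  have h₁ := h.eqv e₁
  refine .forLoop d (fun k σ' => σ'.real 37 0 = n * m * (24 * d * R / δ) ^ k) hK (by decide) ?_
    (by simpa using h37) (by simp) ?_ (fun _ _ h => h)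
  · intro σ' h'; simp [NExp.val, (h₁.eqv h').dim]
  · intro k hk σ' h' hJ hi
    refine .setReal ?_
    simp [RExp.val, NExp.val, hJ, (h₁.eqv h').dim, h'.r 35, e₁.r 35, hR, h'.r 33, e₁.r 33, hδ, pow_succ,
      mul_assoc]

/-- Without roots and logarithms the depth is found by comparing `d`-th powers: halving the edge
divides the volume by `2 ^ d`. -/
theorem runs_depthCmd {u v : ℝ} {L₀ : ℕ} (hu : σ.real 37 0 = u) (hv : σ.real 36 0 = v)
    (h38 : σ.real 38 0 = 2 ^ d) (hL : u ≤ v * (2 ^ d) ^ L₀) :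
    Runs S f depthCmd σ (20 + 30 * L₀) fun σ' =>
      σ'.nat 34 0 ≤ L₀ ∧ u ≤ v * (2 ^ d) ^ σ'.nat 34 0 := by
  refine .seq 3 (16 + 30 * L₀) (by omega) (.setNat (by simp [NExp.time]) ?_)
  simp only [NExp.val]
  have e₁ := eqv_setNat σ 34 0 0
  have h34 : (σ.setNat 34 0 0).nat 34 0 = 0 := by simp
  generalize σ.setNat 34 0 0 = σ₁ at *
  refine .loopTime (fun φ σ' => σ'.nat 34 0 ≤ L₀ ∧ σ'.real 37 0 = u / (2 ^ d) ^ σ'.nat 34 0 ∧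
    φ = 30 * (L₀ - σ'.nat 34 0)) (30 * L₀) (by simp [Test.time, RExp.time, NExp.time]; omega)
    ⟨by omega, by rw [e₁.r 37, hu, h34]; simp, by rw [h34]; simp⟩ ?_ ?_
  · rintro φ σ' e ⟨h1, h2, rfl⟩ hb
    have h36 : σ'.real 36 0 = v := by rw [e.r 36, e₁.r 36, hv]
    have h38' : σ'.real 38 0 = 2 ^ d := by rw [e.r 38, e₁.r 38, h38]
    simp only [Test.Holds, RExp.val, NExp.val, h2, h36, not_le] at hb
    have hlt : σ'.nat 34 0 < L₀ := by
      refine lt_of_le_of_ne h1 fun h => ?_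
      rw [h, lt_div_iff₀ (by positivity)] at hb
      linarith
    refine ⟨20, 30 * (L₀ - (σ'.nat 34 0 + 1)), by simp [Test.time, RExp.time, NExp.time]; omega, ?_⟩
    refine .seq 10 10 le_rfl (.setReal (by simp [RExp.time, NExp.time]) (.setNat (by simp [NExp.time]) ?_))
    simp only [NExp.val, RExp.val, Mem.setReal_nat, Mem.setNat_nat, Mem.setNat_real, Mem.setReal_real,
      and_self, if_true, h2, h38']
    refine ⟨hlt, ?_⟩
    rw [pow_succ, div_div]; simp
  · rintro φ σ' e ⟨h1, h2, -⟩ hb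
    have h36 : σ'.real 36 0 = v := by rw [e.r 36, e₁.r 36, hv]
    simp only [Test.Holds, RExp.val, NExp.val, h2, h36, not_not] at hb
    rw [div_le_iff₀ (by positivity)] at hb
    exact ⟨h1, hb⟩

theorem runs_initCmd (hd : 0 < d) (hm : 0 < m) {δ : ℝ} (hδ : 0 < δ) (h : σ.HasInput δ I) {L₀ : ℕ}
    (hL : n * m * (24 * d * I.longestEdge / min δ (1 / 5)) ^ d ≤ I.mass * (2 ^ d) ^ L₀) :
    Runs S f initCmd σ (initTime d n m L₀) fun σ' =>
      DataIn I σ' ∧ PointsIn σ' I.pt (min δ (1 / 5)) ∧ 0 < σ'.real 35 0 ∧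
      (∀ j a c, I.reach j a c ≤ σ'.real 35 0) ∧ σ'.nat 34 0 ≤ L₀ ∧
      n * m * (24 * d * σ'.real 35 0 / min δ (1 / 5)) ^ d ≤ I.mass * (2 ^ d) ^ σ'.nat 34 0 := by
  obtain ⟨hK, hK3, -⟩ := le_loopBound d
  have hD : DataIn I σ := ⟨h.points, h.simplices, h.dim, h.pt, h.wt, h.sx⟩
  refine .seq _ _ le_rfl (Runs.imp (within_paramCmd h.param) le_rfl fun σ₁ e₁ h1 => ?_)
  have hD₁ := hD.eqv e₁
  refine .seq _ _ le_rfl (Runs.imp (within_powCmd hD₁.dim hK3) le_rfl fun σ₂ e₂ h2 => ?_)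
  have hD₂ := hD₁.eqv e₂
  refine .seq _ _ le_rfl (Runs.imp (within_weightCmd hD₂) le_rfl fun σ₃ e₃ h3 => ?_)
  have hD₃ := hD₂.eqv e₃
  refine .seq _ _ le_rfl (Runs.imp (runs_reachCmd hd hm hD₃) le_rfl fun σ₄ e₄ h4 => ?_)
  have hD₄ := hD₃.eqv e₄
  have hp₄ : σ₄.real 33 0 = min δ (1 / 5) := by rw [e₄.r 33, e₃.r 33, e₂.r 33, h1]
  refine .seq _ _ le_rfl (Runs.imp (within_spreadCmd hK hD₄ rfl hp₄) le_rfl fun σ₅ e₅ h5 => ?_)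
  have hD₅ := hD₄.eqv e₅
  have hδ0 : 0 < min δ (1 / 5) := lt_min hδ (by norm_num)
  refine Runs.imp (runs_depthCmd (d := d) (L₀ := L₀) h5 (v := I.mass) ?_ ?_ ?_) le_rfl fun σ₆ e₆ h6 => ?_
  · rw [e₅.r 36, e₄.r 36, h3]
  · rw [e₅.r 38, e₄.r 38, e₃.r 38, h2.2]
  · refine le_trans ?_ hL
    have := h4.1
    have := h4.2.1
    gcongr
  have h35 : σ₆.real 35 0 = σ₄.real 35 0 := by rw [e₆.r 35, e₅.r 35]
  have hD₆ := hD₅.eqv e₆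
  refine ⟨hD₆, ⟨hD₆.dim, ?_, hD₆.pt, ?_⟩, ?_, ?_, h6.1, ?_⟩
  · rw [e₆.n 5, e₅.n 5, e₄.n 5, e₃.n 5]; exact h2.1
  · rw [e₆.r 33, e₅.r 33, hp₄]
  · rw [h35]; exact h4.1
  · rw [h35]; exact h4.2.2
  · rw [h35]; exact h6.2

end PointSimplex

namespace PointSimplex

/-! ### The plan computed from a table of pieces -/

open Classical in
/-- The part of simplex `j` in piece `q`. -/
def pieceSet {d : ℕ} (m : ℕ) (es : List (Piece d)) (q : Fin es.length) (j : Fin m) : Set (E d) :=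
  if es[q].idx = (j : ℕ) then es[q].box else ∅

/-- The lower corner of piece `q`. -/
def pieceCorner {d : ℕ} (es : List (Piece d)) (q : Fin es.length) : E d := WithLp.toLp 2 es[q].corner

theorem Piece.measurableSet_box {d : ℕ} (e : Piece d) : MeasurableSet e.box :=
  PointSimplex.measurableSet_box _ _

namespace Table
variable {d n m : ℕ} {I : Input d n m} {δ r : ℝ} {es : List (Piece d)}

theorem isPartition (h : Table I.sx δ r I.pt es) : I.IsPartition (pieceSet m es) where
  meas q j := by
    rw [pieceSet]
    split_ifs
    exacts [es[q].measurableSet_box, MeasurableSet.empty]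
  ae_sum j := by
    filter_upwards [h.cover j] with x hx
    rw [← Fin.sum_univ_fun_getElem] at hx
    refine Eq.trans ?_ hx
    refine Finset.sum_congr rfl fun q _ => ?_
    simp only [pieceSet, Fin.getElem_fin]
    split_ifs
    · rfl
    · simp

theorem pieceWt_eq (h : Table I.sx δ r I.pt es) (q : Fin es.length) :
    I.pieceWt (pieceSet m es) q = es[q].weight := by
  obtain ⟨j, hj, hw⟩ := h.idx es[q] (List.getElem_mem _)
  rw [Input.pieceWt, Finset.sum_eq_single j]
  · rw [hw, pieceSet, if_pos hj, Input.vol, measureReal_restrict_apply es[q].measurableSet_box,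
      Set.inter_comm]
  · intro k _ hk
    rw [pieceSet, if_neg, measureReal_empty]
    rw [hj]
    exact fun h => hk (Fin.ext h.symm)
  · simp

theorem valid (h : Table I.sx δ r I.pt es) :
    (I.pieceProblem (pieceSet m es) (pieceCorner es)).Valid :=
  ⟨I.wt_nonneg, Input.pieceWt_nonneg, I.balanced.trans h.isPartition.sum_pieceWt.symm⟩

/-- Spreading an approximate plan for the pieces costs little more than the optimum. -/
theorem cost_le (hd : 0 < d) (hm : 0 < m) {ε : ℝ} (hε : 0 < ε) (hδ : δ = min ε (1 / 5))
    (h : Table I.sx δ r I.pt es) (hr : 8 * (√d * r) ≤ δ * I.scale)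
    {ν : Fin n → Fin es.length → ℝ}
    (hν : (I.pieceProblem (pieceSet m es) (pieceCorner es)).IsApprox ε ν) :
    I.cost (I.spreadOn (pieceSet m es) ν) ≤ (1 + 21 * ε) * I.emd := by
  classical
  have hpart := h.isPartition
  have hδ0 : 0 < δ := hδ ▸ lt_min hε (by norm_num)
  have hs := Input.scale_pos (I := I) hm
  refine Input.le_mul_emd (by positivity) ⟨_, Input.isPlan_spreadOn hpart hν.1⟩ fun τ hτ => ?_
  -- One error for all pieces suffices: `δ * scale / 8` times the total mass is at most `δ` times
  -- the cost, by `IsPlan.le_cost`.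
  have key := Input.cost_spreadOn_le hpart hε.le hδ0.le hν (err := fun _ => δ * I.scale / 8) (by
    intro q i j x hx
    rw [pieceSet] at hx
    split_ifs at hx
    swap
    · exact absurd hx (Set.notMem_empty _)
    obtain ⟨hs0, hfine⟩ := h.fine es[q] (List.getElem_mem _)
    have hc : pieceCorner es q ∈ es[q].box := fun c => ⟨le_rfl, by
      simp only [pieceCorner]; linarith⟩
    have hp : 0 ≤ δ * I.scale / 8 := by positivity
    rcases hfine with hle | hfine
    · have hdist : dist x (pieceCorner es q) ≤ δ * I.scale / 8 := by
        refine (dist_le_of_mem_cube hx hc hs0.le).trans ?_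
        have := mul_le_mul_of_nonneg_left hle (Real.sqrt_nonneg d)
        linarith
      have h1 := dist_triangle (I.pt i) (pieceCorner es q) x
      have h2 := dist_triangle (I.pt i) x (pieceCorner es q)
      rw [dist_comm (pieceCorner es q) x] at h1
      have h3 : 0 ≤ δ * dist (I.pt i) x := by positivity
      have h4 : 0 ≤ δ * dist (I.pt i) (pieceCorner es q) := by positivity
      constructor <;> linarith
    · exact ⟨(hfine i x hx _ hc).trans (by linarith), (hfine i _ hc x hx).trans (by linarith)⟩) hτ
  rw [← Finset.mul_sum, hpart.sum_pieceWt] at key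
  have h1 := hτ.le_cost hd hm
  have h2 := hτ.cost_nonneg
  have h3 : δ * I.scale / 8 * I.mass ≤ δ * I.cost τ := by nlinarith
  have h5 : δ ≤ 1 / 5 := hδ ▸ min_le_right _ _
  have h6 : δ ≤ ε := hδ ▸ min_le_left _ _
  -- Here `ε` may be large. The estimate is linear in `ε`, and products with `δ` are bounded through
  -- `δ ≤ 1 / 5`.
  have h7 : (1 + ε) * (1 + δ) ^ 2 + ((1 + ε) * (1 + δ) + 1) * δ ≤ 1 + 21 * ε := by
    nlinarith [mul_pos hε hδ0, mul_pos (mul_pos hε hδ0) hδ0, mul_nonneg hδ0.le (sub_nonneg.2 h5),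
      mul_nonneg hε.le (sub_nonneg.2 h5), mul_nonneg (mul_pos hε hδ0).le (sub_nonneg.2 h5)]
  calc _ ≤ _ := key
    _ ≤ (1 + ε) * (1 + δ) ^ 2 * I.cost τ + ((1 + ε) * (1 + δ) + 1) * (δ * I.cost τ) := by gcongr
    _ = ((1 + ε) * (1 + δ) ^ 2 + ((1 + ε) * (1 + δ) + 1) * δ) * I.cost τ := by ring
    _ ≤ _ := by gcongr

end Table

/-- The memory after solving the discrete problem for the pieces `es`, the solution being `L`. -/
structure OutputIn {d n : ℕ} (σ : Mem) (es : List (Piece d)) (L : List (Fin n × Fin es.length × ℝ)) :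
    Prop where
  num : σ.nat 1 0 = L.length
  src : ∀ l, ∀ h : l < L.length, σ.nat 3 l = L[l].1
  tgt : ∀ l, ∀ h : l < L.length, σ.nat 4 l = L[l].2.1
  idx : ∀ q : Fin es.length, σ.nat 2 q = es[q].idx
  corner : ∀ (q : Fin es.length) (c : Fin d), σ.real 4 (q * d + c) = es[q].corner c
  size : ∀ q : Fin es.length, σ.real 5 q = es[q].size
  density : ∀ l, ∀ h : l < L.length, σ.real 6 l = L[l].2.2 / es[L[l].2.1].weight

/-- The memory sums densities over transfers, the plan over pieces. Each transfer has a single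
target, so exchanging the sums identifies them, even if several transfers share source and target.
-/
theorem OutputIn.plan_eq {d n m : ℕ} {I : Input d n m} {δ r : ℝ} {σ : Mem} {es : List (Piece d)}
    {L : List (Fin n × Fin es.length × ℝ)} (h : OutputIn σ es L) (ht : Table I.sx δ r I.pt es) :
    σ.plan d n m = I.spreadOn (pieceSet m es) (listPlan L) := by
  classical
  ext i j x
  simp only [Mem.plan, Input.spreadOn, ht.pieceWt_eq, listPlan, h.num]
  rw [Finset.sum_range]
  have h1 : ∀ q : Fin es.length, (if x ∈ pieceSet m es q j then
      (L.map fun e => if e.1 = i ∧ e.2.1 = q then e.2.2 else 0).sum / es[q].weight else 0) =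
      ∑ l : Fin L.length, if L[l].1 = i ∧ L[l].2.1 = q ∧ x ∈ pieceSet m es q j then
        L[l].2.2 / es[q].weight else 0 := by
    intro q
    rw [← Fin.sum_univ_fun_getElem, Finset.sum_div]
    split_ifs with hx
    · refine Finset.sum_congr rfl fun l _ => ?_
      simp only [hx, and_true, ite_div, zero_div]
      rfl
    · simp [hx]
  simp only [h1]
  rw [Finset.sum_comm]
  refine Finset.sum_congr rfl fun l _ => ?_
  rw [Finset.sum_eq_single L[l].2.1]
  · rw [h.src l l.2, h.tgt l l.2, h.idx, h.size, h.density l l.2]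
    have hc : (fun c : Fin d => σ.real 4 ((L[l].2.1 : ℕ) * d + c)) = es[L[l].2.1].corner :=
      funext fun c => h.corner _ c
    simp only [Fin.getElem_fin] at hc ⊢
    rw [hc]
    refine if_congr ?_ rfl rfl
    rw [pieceSet]
    simp only [Fin.ext_iff, Fin.getElem_fin, true_and]
    refine and_congr_right fun _ => ?_
    split_ifs with hj
    · simp only [hj, true_and]; rfl
    · simp [hj]
  · intro q _ hq
    rw [if_neg fun h => hq h.2.1.symm]
  · simp

end PointSimplex

namespace PointSimplex

/-! ### The program -/

def solveCmd : Cmd := .solve (nv 0) (nv 28) 1 2 4 7 1 3 4 6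

/-- Divide the masses of the transfers by the volumes of the pieces. -/
def densityCmd : Cmd :=
  forCmd 13 (.get 1 (.lit 0)) (.setReal 6 (nv 13) (.div (.get 6 (nv 13)) (.get 7 (.get 4 (nv 13)))))

def transportCmd : Cmd := .seq initCmd <| .seq subdivideCmd <| .seq solveCmd densityCmd

variable {d n m : ℕ} {S : Solver d} {f : ℕ → ℕ} {σ : Mem} {I : Input d n m} {δ r : ℝ}
  {es : List (Piece d)}

theorem runs_solve {a b : NExp} {X U Y V K S' T' M N₁ N₂ : ℕ} (ha : a.val σ = N₁) (hb : b.val σ = N₂)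
    {D : Discrete d N₁ N₂} (hD : σ.instanceAt d N₁ N₂ X U Y V = D) {t : ℕ}
    (ht : a.time + b.time + f (N₁ + N₂) + 1 ≤ t) {Q : Mem → Prop}
    (hQ : Q (σ.storePlan (S N₁ N₂ D) K S' T' M)) :
    Runs S f (.solve a b X U Y V K S' T' M) σ t Q := by
  subst ha hb hD
  exact ⟨_, _, .solve σ a b X U Y V K S' T' M, ht, hQ⟩

theorem instanceAt_eq (hD : DataIn I σ) (hes : PiecesIn σ es) (ht : Table I.sx δ r I.pt es) :
    σ.instanceAt d n es.length 1 2 4 7 = I.pieceProblem (pieceSet m es) (pieceCorner es) := by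
  simp only [Mem.instanceAt, Input.pieceProblem, Discrete.mk.injEq]
  refine ⟨funext fun i => ?_, funext fun i => hD.wt i, funext fun q => ?_, funext fun q => ?_⟩
  · ext c; exact hD.pt i c
  · ext c; exact hes.corner q q.2 c
  · rw [ht.pieceWt_eq]; exact hes.weight q q.2

/-- Solving the discrete problem and dividing by the volumes. -/
theorem runs_solveCmd {ε : ℝ} (hS : S.Solves ε f) (hD : DataIn I σ) (hes : PiecesIn σ es)
    (ht : Table I.sx δ r I.pt es) :
    Runs S f (.seq solveCmd densityCmd) σ (8 + f (n + es.length) +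
        (f (n + es.length) + 1) * 30) fun σ' =>
      ∃ L : List (Fin n × Fin es.length × ℝ), OutputIn σ' es L ∧
        (I.pieceProblem (pieceSet m es) (pieceCorner es)).IsApprox ε (listPlan L) := by
  obtain ⟨hA, hlen⟩ := hS _ _ _ ht.valid
  set L := S n es.length (I.pieceProblem (pieceSet m es) (pieceCorner es)) with hL
  refine .seq (5 + f (n + es.length)) (3 + (f (n + es.length) + 1) * 30) (by omega)
    (runs_solve (by simpa [NExp.val] using hD.points) (by simpa [NExp.val] using hes.num)
      (instanceAt_eq hD hes ht) (by simp [NExp.time]) ?_)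
  rw [← hL]
  set σ₁ := σ.storePlan L 1 3 4 6 with hσ₁
  have k1 : σ₁.nat 1 0 = L.length := by simp [hσ₁, Mem.storePlan]
  have k3 : ∀ l, ∀ h : l < L.length, σ₁.nat 3 l = L[l].1 := fun l h => by
    simp [hσ₁, Mem.storePlan, h]
  have k4 : ∀ l, ∀ h : l < L.length, σ₁.nat 4 l = L[l].2.1 := fun l h => by
    simp [hσ₁, Mem.storePlan, h]
  have k6 : ∀ l, ∀ h : l < L.length, σ₁.real 6 l = L[l].2.2 := fun l h => by
    simp [hσ₁, Mem.storePlan, h]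
  have k2 : σ₁.nat 2 = σ.nat 2 := by ext l; simp [hσ₁, Mem.storePlan]
  have kr : ∀ B, B ≠ 6 → σ₁.real B = σ.real B := fun B hB => by
    ext l; simp [hσ₁, Mem.storePlan, hB]
  clear hσ₁
  clear_value σ₁
  -- The division is done in place: entries below `k` are densities already, the others are still
  -- masses.
  refine .forLoop L.length 11 (fun k σ' =>
      (∀ l, ∀ h : l < L.length, l < k → σ'.real 6 l = L[l].2.2 / es[L[l].2.1].weight) ∧
      ∀ l, ∀ h : l < L.length, k ≤ l → σ'.real 6 l = L[l].2.2) ?_ (by decide) ?_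
    ⟨by simp, fun l h _ => k6 l h⟩ (by intros; simpa) ?_ ?_
  · refine Nat.add_le_add_left (Nat.mul_le_mul (Nat.succ_le_succ hlen) ?_) _
    simp [NExp.time]
  · intro σ' h; simp [NExp.val, h.n 1, k1]
  · rintro k hk σ' h ⟨h1, h2⟩ hi
    refine .setReal (by simp [NExp.time, RExp.time]) ?_
    have hw : σ'.real 7 (σ'.nat 4 k) = es[L[k].2.1].weight := by
      rw [h.n 4, h.r 7, k4 k hk, kr 7 (by decide)]
      exact hes.weight _ L[k].2.1.2
    simp only [NExp.val, RExp.val, hi, hw, h2 k hk le_rfl, Mem.setReal_real, true_and]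
    refine ⟨fun l hl hlk => ?_, fun l hl hlk => ?_⟩
    · by_cases hlk' : l = k
      · subst hlk'; simp
      · rw [if_neg hlk']; exact h1 l hl (by omega)
    · rw [if_neg (by omega)]; exact h2 l hl (by omega)
  · rintro σ' h ⟨h1, -⟩
    refine ⟨L, ⟨?_, ?_, ?_, ?_, ?_, ?_, fun l hl => h1 l hl hl⟩, hA⟩
    · rw [h.n 1, k1]
    · rw [h.n 3]; exact k3
    · rw [h.n 4]; exact k4
    · intro q; rw [h.n 2, k2]; exact hes.idx q q.2
    · intro q c; rw [h.r 4, kr 4 (by decide)]; exact hes.corner q q.2 c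
    · intro q; rw [h.r 5, kr 5 (by decide)]; exact hes.size q q.2

/-- If `R` is the largest coordinate difference, cubes of size `3 R / 2 ^ L` are small. -/
theorem final_size_le (hd : 0 < d) (hm : 0 < m) (hδ : 0 < δ) {R : ℝ} (hR : 0 < R) {L : ℕ}
    (h : n * m * (24 * d * R / δ) ^ d ≤ I.mass * (2 ^ d) ^ L) :
    8 * (√d * (3 * R / 2 ^ L)) ≤ δ * I.scale := by
  have hs := Input.scale_pos (I := I) hm
  have hn := I.n_pos hm
  have h1 : (24 * d * R / δ / 2 ^ L) ^ d ≤ I.scale ^ d := by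
    rw [Input.scale_pow hd hm, div_pow, div_le_div_iff₀ (by positivity) (by positivity), ← pow_mul,
      mul_comm L d, pow_mul]
    linarith
  have h2 := (pow_le_pow_iff_left₀ (by positivity) hs.le hd.ne').1 h1
  -- This is why the depth is based on `24 * d` although `24 * √d` would do: the program cannot take
  -- roots.
  have h3 : √(d : ℝ) ≤ d := by
    have h1d : (1 : ℝ) ≤ d := by exact_mod_cast hd
    exact (Real.sqrt_le_left (by positivity)).2 (by nlinarith)
  have h4 : 24 * d * R / δ / 2 ^ L = 24 * d * (R / 2 ^ L) / δ := by ring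
  rw [h4, div_le_iff₀ hδ] at h2
  have h5 : √(d : ℝ) * (R / 2 ^ L) ≤ d * (R / 2 ^ L) := by gcongr
  calc 8 * (√d * (3 * R / 2 ^ L)) = 24 * (√d * (R / 2 ^ L)) := by ring
    _ ≤ δ * I.scale := by linarith

/-- Time and number of pieces, if the depth is at most `L` and each point is relevant at most `N`
times for each simplex. -/
def totalTime (d n m L N : ℕ) (f : ℕ → ℕ) : ℕ :=
  initTime d n m L + (6 + (m + 1) * (simplexTime d n N + 12) +
    (38 + 31 * f (n + m * (1 + 2 ^ d * (n * N)))))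

/-- `L` and `N` enter only the time bound. The program determines its own depth from the largest
coordinate difference, which is at most the longest edge, so this depth is at most `L`. -/
theorem runs_transportCmd (hd : 0 < d) (hm : 0 < m) {ε : ℝ} (hε : 0 < ε) (hf : Monotone f)
    (hS : S.Solves ε f) (h : σ.HasInput ε I) {L N : ℕ}
    (hL : n * m * (24 * d * I.longestEdge / min ε (1 / 5)) ^ d ≤ I.mass * (2 ^ d) ^ L)
    (hN : 1 + L * (Real.exp 9 * √Real.pi / min ε (1 / 5)) ^ d ≤ N) :
    Runs S f transportCmd σ (totalTime d n m L N f) fun σ' =>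
      I.IsPlan (σ'.plan d n m) ∧ I.cost (σ'.plan d n m) ≤ (1 + 21 * ε) * I.emd := by
  set δ := min ε (1 / 5) with hδ
  have hδ0 : 0 < δ := lt_min hε (by norm_num)
  have hδ1 : δ ≤ 1 := (min_le_right _ _).trans (by norm_num)
  refine .seq _ _ le_rfl (Runs.imp (runs_initCmd hd hm hε h hL) le_rfl ?_)
  rintro σ₁ e₁ ⟨hD, hP, hR0, hR, hLle, hLs⟩
  refine .seq _ _ le_rfl (Runs.imp (runs_subdivideCmd (N := N) hd hδ0 hδ1 hP hD.sx hD.points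
    hD.simplices hR0 rfl hR rfl ?_) le_rfl ?_)
  · intro i a s hs
    have h1 := treeCount_le_mul hδ0 hδ1 (I.pt i) (σ₁.nat 34 0) a hs
    have h2 : (σ₁.nat 34 0 : ℝ) ≤ L := by exact_mod_cast hLle
    have h3 : (0 : ℝ) ≤ (Real.exp 9 * √Real.pi / δ) ^ d := by positivity
    have h4 : (treeCount δ (I.pt i) (σ₁.nat 34 0) a s : ℝ) ≤ N := by
      refine h1.trans (le_trans ?_ hN)
      gcongr
    exact_mod_cast h4
  rintro σ₂ e₂ ⟨es, hes, ht, hlen⟩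
  refine (runs_solveCmd hS (hD.eqv e₂) hes ht).mono ?_ ?_
  · have := hf (Nat.add_le_add_left hlen n)
    omega
  rintro σ₃ ⟨T, hT, hA⟩
  rw [hT.plan_eq ht]
  exact ⟨Input.isPlan_spreadOn ht.isPartition hA.1,
    ht.cost_le hd hm hε hδ (final_size_le hd hm hδ0 hR0 hLs) hA⟩

end PointSimplex

namespace PointSimplex

/-! ### Running time -/

/-- At most exponential growth. -/
def ExpBdd (T : ℕ → ℕ) : Prop := ∃ A, ∀ d, 0 < d → T d ≤ A ^ d

namespace ExpBdd
variable {T U : ℕ → ℕ}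

theorem const (c : ℕ) : ExpBdd fun _ => c :=
  ⟨c + 1, fun _ hd => (Nat.le_succ c).trans (Nat.le_self_pow hd.ne' _)⟩

theorem two_pow : ExpBdd fun d => 2 ^ d := ⟨2, fun _ _ => le_rfl⟩

theorem mul (hT : ExpBdd T) (hU : ExpBdd U) : ExpBdd fun d => T d * U d := by
  obtain ⟨A, hA⟩ := hT
  obtain ⟨B, hB⟩ := hU
  exact ⟨A * B, fun d hd => (Nat.mul_le_mul (hA d hd) (hB d hd)).trans (mul_pow A B d).ge⟩

theorem add (hT : ExpBdd T) (hU : ExpBdd U) : ExpBdd fun d => T d + U d := by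
  obtain ⟨A, hA⟩ := hT
  obtain ⟨B, hB⟩ := hU
  refine ⟨2 * (A + B), fun d hd => ?_⟩
  have h1 : A ^ d ≤ (A + B) ^ d := Nat.pow_le_pow_left (by omega) d
  have h2 : B ^ d ≤ (A + B) ^ d := Nat.pow_le_pow_left (by omega) d
  have h3 : 2 * (A + B) ^ d ≤ 2 ^ d * (A + B) ^ d :=
    Nat.mul_le_mul_right _ (Nat.le_self_pow hd.ne' 2)
  have := hA d hd
  have := hB d hd
  beta_reduce
  rw [mul_pow]
  omega

theorem pow (hT : ExpBdd T) (k : ℕ) : ExpBdd fun d => T d ^ k := by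
  obtain ⟨A, hA⟩ := hT
  exact ⟨A ^ k, fun d hd => (Nat.pow_le_pow_left (hA d hd) k).trans (by rw [← pow_mul, ← pow_mul, mul_comm])⟩

theorem mono (hT : ExpBdd T) (h : ∀ d, U d ≤ T d) : ExpBdd U := by
  obtain ⟨A, hA⟩ := hT
  exact ⟨A, fun d hd => (h d).trans (hA d hd)⟩

theorem id : ExpBdd fun d => d := two_pow.mono fun d => d.lt_two_pow_self.le

theorem loopBound : ExpBdd fun d => PointSimplex.loopBound d + 1 := by
  have h : ExpBdd fun d => 3 * d + 1 := ((const 3).mul id).add (const 1)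
  refine ExpBdd.add (.add (.mul ?_ (.add (id.mul id) (h.mul h))) (const 1)) (const 1)
  refine (((two_pow.pow 3).mul (const 2))).mono fun d => ?_
  rw [pow_succ, ← pow_mul, mul_comm 3 d]

theorem bnd (p : Cmd) (hT : ExpBdd T) : ExpBdd fun d => p.bnd (T d + 1) := by
  obtain ⟨c, k, h⟩ := p.bnd_le
  exact ((const c).mul ((hT.add (const 1)).pow k)).mono fun d => h _ (Nat.succ_pos _)

theorem bnd_loopBound (p : Cmd) : ExpBdd fun d => p.bnd (PointSimplex.loopBound d) :=
  -- `loopBound d` is a successor by definition, so subtracting and adding one gives it back.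
  bnd p (T := fun d => PointSimplex.loopBound d - 1) (loopBound.mono fun d => by omega)

theorem emitTime : ExpBdd PointSimplex.emitTime :=
  ((bnd_loopBound _).add (bnd_loopBound _)).add (const _)

theorem listTime : ExpBdd PointSimplex.listTime := by
  refine (((two_pow.mul emitTime).add (bnd_loopBound _)).add ((const 2).mul
    ((const 20).add ((two_pow.add (const 1)).mul (.add ?_ (const 14)))))).add (const 30)
  exact (((bnd_loopBound _).add (bnd_loopBound _)).add (const 3)).add
    ((const (1 + 1)).mul ((bnd_loopBound _).add (const 13)))

end ExpBdd

theorem bnd_weightCmd_le (n : ℕ) : weightCmd.bnd n ≤ 40 * (n + 1) := by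
  simp only [weightCmd, sumCmd, forCmd, Cmd.bnd, NExp.time, RExp.time, Test.time]
  omega

theorem bnd_allPointsCmd_le (n : ℕ) : allPointsCmd.bnd n ≤ 40 * (n + 1) := by
  simp only [allPointsCmd, forCmd, Cmd.bnd, NExp.time, Test.time]
  omega

/-- All factors that depend on `d` alone are at most exponential. The other quantities appear only
as `n`, `m`, `L`, `m * n` and `m * n * N`, each at most `n * m * N`. -/
theorem totalTime_le : ∃ A, ∀ d n m L N : ℕ, 0 < d → 0 < n → 0 < m → L + 1 ≤ N →
    ∀ f : ℕ → ℕ, Monotone f →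
      totalTime d n m L N f ≤ A ^ d * (n * m * N) + 31 * f (A ^ d * (n * m * N)) := by
  obtain ⟨A, hA⟩ : ExpBdd fun d => paramCmd.bnd (loopBound d) + powCmd.bnd (loopBound d) +
      2 * reachBodyCmd.bnd (loopBound d + 1) + spreadCmd.bnd (loopBound d) +
      2 * rootCmd.bnd (loopBound d) + 2 * emitTime d + 2 * listTime d + 3 * 2 ^ d + 500 :=
    ((((((((ExpBdd.bnd_loopBound _).add (.bnd_loopBound _)).add ((ExpBdd.const 2).mul
      (.bnd _ (ExpBdd.loopBound.mono fun d => by omega)))).add (.bnd_loopBound _)).add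
      ((ExpBdd.const 2).mul (.bnd_loopBound _))).add ((ExpBdd.const 2).mul .emitTime)).add
      ((ExpBdd.const 2).mul .listTime)).add ((ExpBdd.const 3).mul .two_pow)).add (.const 500)
  refine ⟨A, fun d n m L N hd hn hm hL f hf => ?_⟩
  have hA' := hA d hd
  beta_reduce at hA'
  set Y := n * m * N with hY
  have hN : 1 ≤ N := by omega
  have y1 : 1 ≤ Y := Nat.mul_pos (Nat.mul_pos hn hm) hN
  have yn : n ≤ Y := by
    rw [hY, mul_assoc]; exact Nat.le_mul_of_pos_right _ (Nat.mul_pos hm hN)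
  have ym : m ≤ Y := by
    rw [hY, mul_comm n m, mul_assoc]; exact Nat.le_mul_of_pos_right _ (Nat.mul_pos hn hN)
  have yL : L + 1 ≤ Y := hL.trans (Nat.le_mul_of_pos_left _ (Nat.mul_pos hn hm))
  have ymn : m * n ≤ Y := by rw [hY, mul_comm n m]; exact Nat.le_mul_of_pos_right _ hN
  have yY : m * (n * N) = Y := by rw [hY]; ring
  have hAY := Nat.mul_le_mul_right Y hA'
  have hbig : n + m * (1 + 2 ^ d * (n * N)) ≤ A ^ d * Y := by
    have h1 : 2 ^ d * Y = m * (2 ^ d * (n * N)) := by rw [← yY]; ring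
    have h2 : Y ≤ 2 ^ d * Y := Nat.le_mul_of_pos_left _ (by positivity)
    refine le_trans ?_ hAY
    calc n + m * (1 + 2 ^ d * (n * N)) = n + m + 2 ^ d * Y := by rw [h1]; ring
      _ ≤ 3 * 2 ^ d * Y := by rw [mul_assoc]; omega
      _ ≤ _ := Nat.mul_le_mul_right _ (by omega)
  have hf' := hf hbig
  have w := bnd_weightCmd_le n
  have a := bnd_allPointsCmd_le n
  have hs : (m + 1) * (simplexTime d n N + 12) ≤
      (2 * rootCmd.bnd (loopBound d) + 2 * emitTime d + 2 * listTime d + 204) * Y := by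
    calc (m + 1) * (simplexTime d n N + 12)
        ≤ 2 * m * (rootCmd.bnd (loopBound d) + 40 * (n + 1) + emitTime d + listTime d * (n * N) + 22) := by
          refine Nat.mul_le_mul (by omega) ?_
          rw [simplexTime]; omega
      _ = (2 * rootCmd.bnd (loopBound d) + 2 * emitTime d + 124) * m + 80 * (m * n) +
          2 * listTime d * (m * (n * N)) := by ring
      _ ≤ (2 * rootCmd.bnd (loopBound d) + 2 * emitTime d + 124) * Y + 80 * Y + 2 * listTime d * Y := by
          rw [yY]; gcongr
      _ = _ := by ring
  have hr : (m + 1) * (reachBodyCmd.bnd (loopBound d + 1) + 12) ≤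
      (2 * reachBodyCmd.bnd (loopBound d + 1) + 24) * Y := by
    calc _ ≤ (2 * Y) * (reachBodyCmd.bnd (loopBound d + 1) + 12) := Nat.mul_le_mul_right _ (by omega)
      _ = _ := by ring
  have hc : ∀ c : ℕ, c ≤ c * Y := fun c => Nat.le_mul_of_pos_right _ y1
  have c1 := hc (paramCmd.bnd (loopBound d))
  have c2 := hc (powCmd.bnd (loopBound d))
  have c3 := hc (spreadCmd.bnd (loopBound d))
  rw [totalTime, initTime]
  simp only [add_mul] at hAY hs hr ⊢
  omega

/-- `d ^ (d / 2)` grows faster than any exponential. -/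
theorem exists_pow_le (H : ℝ) : ∃ C, 0 < C ∧ ∀ d : ℕ, 0 < d → H ^ d ≤ C * (d : ℝ) ^ ((d : ℝ) / 2) := by
  obtain ⟨M, hM1, hM⟩ : ∃ M : ℕ, 1 ≤ M ∧ |H| ≤ M := by
    obtain ⟨M, hM⟩ := exists_nat_ge |H|
    exact ⟨M + 1, by omega, hM.trans (by push_cast; linarith)⟩
  have hM1' : (1 : ℝ) ≤ M := by exact_mod_cast hM1
  refine ⟨(M : ℝ) ^ (M ^ 2), by positivity, fun d hd => ?_⟩
  have hd1 : (1 : ℝ) ≤ d := by exact_mod_cast hd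
  have h0 : H ^ d ≤ (M : ℝ) ^ d := by
    refine (le_abs_self _).trans ?_
    rw [abs_pow]
    exact pow_le_pow_left₀ (abs_nonneg _) hM d
  refine h0.trans ?_
  have h1 : (1 : ℝ) ≤ (d : ℝ) ^ ((d : ℝ) / 2) := Real.one_le_rpow hd1 (by positivity)
  have h2 : (1 : ℝ) ≤ (M : ℝ) ^ (M ^ 2) := one_le_pow₀ hM1'
  -- For `d ≥ M ^ 2` the power `M ^ d = (M ^ 2) ^ (d / 2)` is at most `d ^ (d / 2)`. Smaller `d` are
  -- covered by the constant.
  rcases le_total d (M ^ 2) with h | h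
  · have := pow_le_pow_right₀ hM1' h
    nlinarith
  · have h3 : (M : ℝ) ^ d ≤ (d : ℝ) ^ ((d : ℝ) / 2) := by
      have h4 : (M : ℝ) ^ d = ((M : ℝ) ^ 2) ^ ((d : ℝ) / 2) := by
        rw [← Real.rpow_natCast (M : ℝ) 2, ← Real.rpow_mul (by positivity), ← Real.rpow_natCast]
        congr 1; push_cast; ring
      rw [h4]
      exact Real.rpow_le_rpow (by positivity) (by exact_mod_cast h) (by positivity)
    nlinarith

variable {d n m : ℕ} {I : Input d n m}

theorem Input.mass_le (hd : 0 < d) (hm : 0 < m) : I.mass ≤ m * (2 * I.longestEdge) ^ d := by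
  have hl := (I.longestEdge_pos hd hm).le
  have h1 : ∀ j, volume.real (solid (I.sx j)) ≤ (2 * I.longestEdge) ^ d := by
    intro j
    have h2 : solid (I.sx j) ⊆ Metric.closedBall ((I.sx j).points 0) I.longestEdge :=
      convexHull_min (by rintro _ ⟨a, rfl⟩; exact I.le_longestEdge j a 0) (convex_closedBall _ _)
    exact ENNReal.toReal_le_of_le_ofReal (by positivity)
      ((measure_mono h2).trans (volume_closedBall_le _ hl))
  calc I.mass ≤ ∑ _j : Fin m, (2 * I.longestEdge) ^ d := Finset.sum_le_sum fun j _ => h1 j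
    _ = _ := by simp

/-- The argument of the logarithm in `cellBound`. -/
def Input.aspect (I : Input d n m) (δ : ℝ) : ℝ := ((n : ℝ) * m) ^ (1 / (d : ℝ)) * I.normEdge / δ

theorem Input.aspect_pow (hd : 0 < d) (hm : 0 < m) (δ : ℝ) :
    I.aspect δ ^ d * I.mass = n * m * (I.longestEdge / δ) ^ d := by
  have hV := I.mass_pos hm
  rw [aspect, normEdge, div_pow, mul_pow, div_pow, div_pow, one_div,
    Real.rpow_inv_natCast_pow (by positivity) hd.ne', Real.rpow_inv_natCast_pow hV.le hd.ne']
  field_simp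

/-- Keeps the logarithm in `cellBound` above `1 / 2`, so that it absorbs additive constants. It
follows from `V ≤ m (2ℓ)^d` and `1 / δ ≥ 5 > 4`. -/
theorem Input.two_le_aspect (hd : 0 < d) (hm : 0 < m) {δ : ℝ} (hδ : 0 < δ) (hδ5 : δ ≤ 1 / 5) :
    2 ≤ I.aspect δ := by
  have hV := I.mass_pos hm
  have hn := I.n_pos hm
  have hn1 : (1 : ℝ) ≤ n := by exact_mod_cast hn
  have hl := I.longestEdge_pos hd hm
  have h0 : 0 ≤ I.aspect δ := by
    rw [aspect, normEdge]; positivity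
  refine (pow_le_pow_iff_left₀ (by norm_num) h0 hd.ne').1 ?_
  refine le_of_mul_le_mul_right ?_ hV
  rw [I.aspect_pow hd hm]
  calc 2 ^ d * I.mass ≤ 2 ^ d * (m * (2 * I.longestEdge) ^ d) := by gcongr; exact I.mass_le hd hm
    _ = 1 * m * (2 * (2 * I.longestEdge)) ^ d := by rw [mul_pow 2 (2 * I.longestEdge)]; ring
    _ ≤ n * m * (I.longestEdge / δ) ^ d := by
        gcongr
        rw [le_div_iff₀ hδ]
        nlinarith

/-- A depth that suffices. -/
theorem exists_depth (hd : 0 < d) (hm : 0 < m) {δ : ℝ} (hδ : 0 < δ) (hδ5 : δ ≤ 1 / 5) :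
    ∃ L : ℕ, n * m * (24 * d * I.longestEdge / δ) ^ d ≤ I.mass * (2 ^ d) ^ L ∧
      (L : ℝ) ≤ 24 * d * Real.log (I.aspect δ) := by
  have hE := I.two_le_aspect hd hm hδ hδ5
  have hV := I.mass_pos hm
  set e := I.aspect δ with he
  have hd1 : (1 : ℝ) ≤ d := by exact_mod_cast hd
  have hl2 : (1 / 2 : ℝ) ≤ Real.log 2 := by linarith [Real.log_two_gt_d9]
  have hle : Real.log 2 ≤ Real.log e := Real.log_le_log (by norm_num) hE
  refine ⟨⌈Real.logb 2 (24 * d * e)⌉₊, ?_, ?_⟩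
  · have h1 : 24 * d * e ≤ 2 ^ ⌈Real.logb 2 (24 * d * e)⌉₊ := by
      rw [← Real.rpow_natCast, ← Real.logb_le_iff_le_rpow (by norm_num) (by positivity)]
      exact Nat.le_ceil _
    calc n * m * (24 * d * I.longestEdge / δ) ^ d
        = (24 * d) ^ d * (n * m * (I.longestEdge / δ) ^ d) := by
          rw [mul_div_assoc, mul_pow]; ring
      _ = I.mass * (24 * d * e) ^ d := by rw [← I.aspect_pow hd hm, mul_pow]; ring
      _ ≤ I.mass * (2 ^ ⌈Real.logb 2 (24 * d * e)⌉₊) ^ d := by gcongr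
      _ = _ := by rw [← pow_mul, ← pow_mul, mul_comm d]
  · have h2 : Real.log (24 * d * e) ≤ 4 + d + Real.log e := by
      rw [Real.log_mul (by positivity) (by positivity), Real.log_mul (by norm_num) (by positivity)]
      have h3 : Real.log 24 ≤ 4 := by
        have : Real.log 24 ≤ Real.log (2 ^ 5) := Real.log_le_log (by norm_num) (by norm_num)
        rw [Real.log_pow] at this
        push_cast at this
        linarith [Real.log_two_lt_d9]
      have h4 := Real.log_le_sub_one_of_pos (show (0 : ℝ) < d by positivity)
      linarith
    have h5 : 0 ≤ Real.log (24 * d * e) := Real.log_nonneg (by nlinarith)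
    have h6 : Real.logb 2 (24 * d * e) ≤ 2 * Real.log (24 * d * e) := by
      rw [Real.logb, div_le_iff₀ (by linarith)]
      nlinarith
    have h7 : 0 ≤ Real.logb 2 (24 * d * e) := div_nonneg h5 (by linarith)
    -- With `λ = log e ≥ 1 / 2` it remains that `2 * (4 + d + λ) + 1 ≤ 24 * d * λ`. Here `9 ≤ 18 d
    -- λ`, `2 d ≤ 4 d λ` and `2 λ ≤ 2 d λ`.
    have h8 := (Nat.ceil_lt_add_one h7).le
    nlinarith

/-- The program runs in the time claimed. -/
theorem exists_transport_time : ∃ C : ℝ, 0 < C ∧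
    ∀ (d n m : ℕ) (_ : 0 < d) (_ : 0 < m) (I : Input d n m) (δ : ℝ) (_ : 0 < δ) (_ : δ ≤ 1 / 5)
      (f : ℕ → ℕ) (_ : Monotone f) (_ : ∀ k, k ≤ f k), ∃ L N : ℕ,
        n * m * (24 * d * I.longestEdge / δ) ^ d ≤ I.mass * (2 ^ d) ^ L ∧
        1 + L * (Real.exp 9 * √Real.pi / δ) ^ d ≤ N ∧
        (totalTime d n m L N f : ℝ) ≤ C * f ⌈C * cellBound d n m I.normEdge δ⌉₊ := by
  obtain ⟨A, hA⟩ := totalTime_le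
  set g := Real.exp 9 * √Real.pi with hg
  have hg1 : 1 ≤ g := by
    have h1 : 1 ≤ Real.exp 9 := Real.one_le_exp (by norm_num)
    have h2 : 1 ≤ √Real.pi := Real.one_le_sqrt.2 (by linarith [Real.pi_gt_three])
    nlinarith
  obtain ⟨C₀, hC₀, hpow⟩ := exists_pow_le (A * g)
  -- `32 = 1 + 31` adds the program's own steps, which are at most `f` of their number, to the `31`
  -- calls of `f` in `totalTime_le`. In `28 = 24 + 4` the `24` is from the depth, and the `4`
  -- absorbs the leading `1` and the rounding in `N`.
  refine ⟨max 32 (28 * C₀), by positivity, fun d n m hd hm I δ hδ hδ5 f hf hfk => ?_⟩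
  set C := max 32 (28 * C₀) with hC
  obtain ⟨L, hL, hLe⟩ := exists_depth (I := I) hd hm hδ hδ5
  have hn := I.n_pos hm
  have hE := I.two_le_aspect hd hm hδ hδ5
  have hd1 : (1 : ℝ) ≤ d := by exact_mod_cast hd
  set lam := Real.log (I.aspect δ) with hlam
  have hlam2 : 1 / 2 ≤ lam := by
    have : Real.log 2 ≤ lam := Real.log_le_log (by norm_num) hE
    linarith [Real.log_two_gt_d9]
  have hgd : 1 ≤ (g / δ) ^ d := one_le_pow₀ (by rw [le_div_iff₀ hδ]; linarith)
  refine ⟨L, ⌈1 + L * (g / δ) ^ d⌉₊, hL, Nat.le_ceil _, ?_⟩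
  set N := ⌈1 + L * (g / δ) ^ d⌉₊ with hN
  have hLN : L + 1 ≤ N := by
    have : (L : ℝ) + 1 ≤ N := by
      refine le_trans ?_ (Nat.le_ceil _)
      nlinarith [(Nat.cast_nonneg L : (0 : ℝ) ≤ L)]
    exact_mod_cast this
  have hNle : (N : ℝ) ≤ 28 * (d * lam * (g / δ) ^ d) := by
    have h1 := (Nat.ceil_lt_add_one (show 0 ≤ 1 + L * (g / δ) ^ d by positivity)).le
    have h2 : L * (g / δ) ^ d ≤ 24 * d * lam * (g / δ) ^ d := by gcongr
    have h3 : 1 / 2 ≤ d * lam := by nlinarith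
    have h4 : 1 / 2 ≤ d * lam * (g / δ) ^ d := by nlinarith
    linarith
  have hX : ((A ^ d * (n * m * N) : ℕ) : ℝ) ≤ C * cellBound d n m I.normEdge δ := by
    have h5 : (1 : ℝ) ≤ 5 ^ d := one_le_pow₀ (by norm_num)
    push_cast
    calc (A : ℝ) ^ d * (n * m * N) ≤ A ^ d * (n * m * (28 * (d * lam * (g / δ) ^ d))) := by gcongr
      _ = 28 * (A * g) ^ d * (d * (n * m) / δ ^ d * lam) := by rw [mul_pow, div_pow]; ring
      _ ≤ 28 * (C₀ * (d : ℝ) ^ ((d : ℝ) / 2)) * (d * (n * m) / δ ^ d * lam) := by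
          gcongr
          exact hpow d hd
      _ = (28 * C₀) * (1 * d * (d : ℝ) ^ ((d : ℝ) / 2) * (n * m) / δ ^ d * lam) := by ring
      _ ≤ C * (5 ^ d * d * (d : ℝ) ^ ((d : ℝ) / 2) * (n * m) / δ ^ d * lam) := by
          gcongr
          exact le_max_right _ _
      _ = _ := by rw [cellBound, hlam, Input.aspect]
  have hk : A ^ d * (n * m * N) ≤ ⌈C * cellBound d n m I.normEdge δ⌉₊ := by
    have := hX.trans (Nat.le_ceil _)
    exact_mod_cast this
  have ht : totalTime d n m L N f ≤ 32 * f ⌈C * cellBound d n m I.normEdge δ⌉₊ := by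
    have h1 := hA d n m L N hd hn hm hLN f hf
    have h2 := hf hk
    have h3 := hk.trans (hfk _)
    omega
  calc (totalTime d n m L N f : ℝ) ≤ 32 * f ⌈C * cellBound d n m I.normEdge δ⌉₊ := by exact_mod_cast ht
    _ ≤ _ := by gcongr; exact le_max_left _ _

end PointSimplex

end

/-! ### The main theorem -/

theorem mainTheorem8 :
    -- approximation: the plan obtained from the subdivision
    (∀ (d n m : ℕ) (_ : 0 < d) (_ : 0 < m) (I : PointSimplex.Input d n m)
      (δ : ℝ) (_ : 0 < δ) (_ : δ ≤ 1 / 5) (o : PointSimplex.E d),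
      (I.cells δ o).Finite ∧
      ∀ (k : ℕ) (q : Fin k → ℕ × (Fin d → ℤ)), Function.Injective q →
        Set.range q = I.cells δ o →
      ∀ t : Fin k → PointSimplex.E d, (∀ c, t c ∈ I.cell o (q c)) →
      ∀ ν : Fin n → Fin k → ℝ, (I.discretize o q t).IsApprox δ ν →
        I.IsPlan (I.spread o q ν) ∧ I.cost (I.spread o q ν) ≤ (1 + 21 * δ) * I.emd) ∧
    -- algorithm: one program and one constant for all inputs
    (∃ (prog : PointSimplex.Cmd) (C : ℝ), 0 < C ∧
      ∀ (d n m : ℕ) (_ : 0 < d) (_ : 0 < m) (I : PointSimplex.Input d n m)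
        (δ : ℝ) (_ : 0 < δ)
        (f : ℕ → ℕ) (_ : Monotone f) (_ : ∀ k, k ≤ f k)
        (A : PointSimplex.Solver d) (_ : A.Solves δ f)
        (σ : PointSimplex.Mem) (_ : σ.HasInput δ I),
        ∃ (t : ℕ) (σ' : PointSimplex.Mem),
          PointSimplex.Exec A f prog σ t σ' ∧
          I.IsPlan (σ'.plan d n m) ∧
          I.cost (σ'.plan d n m) ≤ (1 + 21 * δ) * I.emd ∧
          (t : ℝ) ≤ C * (6 ^ d * d ^ 2 * d ^ d * m +
            f ⌈C * PointSimplex.cellBound d n m I.normEdge (min δ (1 / 5))⌉₊)) := by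
  open PointSimplex in
  refine ⟨fun d n m hd hm I δ hδ hδ5 o => ⟨I.finite_cells hd hm hδ o,
    fun k q hinj hq t ht ν hν => I.approximation hd hm hδ hδ5 o q hinj hq t ht ν hν⟩, ?_⟩
  obtain ⟨C, hC, h⟩ := PointSimplex.exists_transport_time
  refine ⟨PointSimplex.transportCmd, C, hC, fun d n m hd hm I δ hδ f hf hfk A hA σ hσ => ?_⟩
  obtain ⟨L, N, hL, hN, ht⟩ := h d n m hd hm I (min δ (1 / 5)) (lt_min hδ (by norm_num))
    (min_le_right _ _) f hf hfk
  obtain ⟨t, σ', hex, htle, hplan, hcost⟩ :=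
    PointSimplex.runs_transportCmd hd hm hδ hf hA hσ hL hN
  refine ⟨t, σ', hex, hplan, hcost, ?_⟩
  have h1 : (t : ℝ) ≤ PointSimplex.totalTime d n m L N f := by exact_mod_cast htle
  refine h1.trans (ht.trans (mul_le_mul_of_nonneg_left ?_ hC.le))
  -- The time is already bounded by the term with `f`; the other term is nonnegative and is simply
  -- added.
  have : (0 : ℝ) ≤ 6 ^ d * d ^ 2 * d ^ d * m := by positivity
  linarith
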